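/- **Setting.** Let $G$ be a compact topological group. Let $\mathcal A$ be the spin chain $C^*$-algebra over $\mathbb Z$ with site algebras $\mathcal A_j=M_{n_j}(\mathbb C)$, $n_j\ge 1$, i.e. the inductive limit of $\mathcal A_S=\bigotimes_{j\in S}\mathcal A_j$ over finite $S\subset\mathbb Z$. Let $g\mapsto\gamma(g)$ be a strongly continuous action of $G$ on $\mathcal A$ by $*$-automorphisms that preserve each $\mathcal A_j$. *Interactions and evolutions.* Let $\mathcal F$ be the set of non-increasing $f:\{1,2,\dots\}\to(0,\infty)$ with $r^pf(r)\to0$ for every $p>0$. An interaction is a family $H=(H_S)$ over finite $S\subset\mathbb Z$, $H_S=H_S^*\in\mathcal A_S$, with $\|H\|_f=\sup_j\sum_{S\ni j}\|H_S\|/f(1+\mathrm{diam}\,S)<\infty$ for some $f\in\mathcal F$. A TDI is a family $H(s)$, $s\in[0,1]$, of interactions which, for some $f\in\mathcal F$, is $\|\cdot\|_f$-strongly measurable with $|||H|||_f=\sup_s\|H(s)\|_f<\infty$. It generates the strongly continuous family $\alpha_H(s)$ of $*$-automorphisms of $\mathcal A$ which is the pointwise norm limit, as finite $\Lambda$ exhausts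 $\mathbb Z$, of the solutions of $\alpha(s)[A]=A+i\int_0^s\alpha(u)\{[\sum_{S\subset\Lambda}H_S(u),A]\}\,du$. A TDI is $G$-invariant if $\gamma(g)[H_S(s)]=H_S(s)$ for all $g,S,s$. *Loops and homotopies.* A loop is a family $\psi(s)$, $s\in[0,1]$, of pure states with $\psi(0)=\psi(1)$ and $\psi(s)=\psi(0)\circ\alpha_H(s)$ for some TDI $H$; one says that $H$ generates $\psi$. The loop is $G$-invariant if $\psi(s)\circ\gamma(g)=\psi(s)$ for all $s,g$. Two loops $\psi_0,\psi_1$ are $G$-homotopic if there is a family $\psi_\lambda(s)$, $(s,\lambda)\in[0,1]^2$, reducing to the given loops at $\lambda=0,1$, such that each $\psi_\lambda(\cdot)$ is a $G$-invariant loop, and there are TDIs $H_\lambda$, $F_s$ with $\psi_\lambda(s)=\psi_\lambda(0)\circ\alpha_{H_\lambda}(s)$ and $\psi_\lambda(s)=\psi_0(s)\circ\alpha_{F_s}(\lambda)$ for all $s,\lambda$, and $\sup_\lambda|||H_\lambda|||_f<\infty$, $\sup_s|||F_s|||_f<\infty$ for some $f\in\mathcal F$. (The basepoints $\psi_\lambda(0)$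 may vary with $\lambda$.) *Index.* Let $H$ be a $G$-invariant TDI generating a loop with basepoint $\phi$. Let $H'$ consist of the terms $H_S$ with $S\subset\{\dots,-1,0\}$, and let $\psi'=\phi\circ\alpha_{H'}(1)$ be the pumped state. Let $(\mathcal H,\Omega,\pi)$ be the GNS triple of $\phi$ and $U$ the strongly continuous unitary representation of $G$ on $\mathcal H$ with $U(g)\Omega=\Omega$ and $\pi\circ\gamma(g)=\mathrm{Ad}(U(g))\circ\pi$. If $\psi'$ is represented by a unit vector $v\in\mathcal H$ and $U(g)v=\chi(g)v$ for all $g$, with $\chi\in H^1(G)=\mathrm{Hom}(G,\mathbb S^1)$ (continuous homomorphisms), then $I(\phi,H):=\chi$. A loop $\psi$ has index $h(\psi)\in H^1(G)$ if it is generated by some $G$-invariant TDI and $I(\psi(0),H)=h(\psi)$ for every $G$-invariant TDI $H$ generating $\psi$. **Proposition.** Let $\phi$ be a pure, $G$-invariant product state on $\mathcal A$, that is, $\phi(AB)=\phi(A)\phi(B)$ whenever $A\in\mathcal A_S$, $B\in\mathcal A_T$ with $S,T$ finite and disjoint. Let $\psi_0$ and $\psi_1$ be $G$-invariant loops with common basepoint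 $\psi_0(0)=\psi_1(0)=\phi$. If $\psi_0$ and $\psi_1$ are $G$-homotopic, then both indices $h(\psi_0)$ and $h(\psi_1)$ are well defined, and $h(\psi_1)=h(\psi_0)$. -/

import Mathlib

open scoped ENNReal NNReal InnerProductSpace
open MeasureTheory Filter Topology

noncomputable section

namespace SpinChain

/-! ### The spin chain algebra -/

/-- Classical configurations: one basis label of `ℂ ^ (n j)` at every site `j ∈ ℤ`. -/
abbrev Config (n : ℤ → ℕ) : Type := ∀ j : ℤ, Fin (n j)

/-- The Hilbert space `ℓ²` over all configurations. Every algebra of observables on finitely many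
sites acts on it faithfully. -/
abbrev ConfigSpace (n : ℤ → ℕ) : Type := lp (fun _ : Config n => ℂ) 2

/-- Exchange the labels `a` and `b` at the site `j`. -/
def swapAt {n : ℤ → ℕ} (j : ℤ) (a b : Fin (n j)) : Equiv.Perm (Config n) :=
  Function.Involutive.toPerm (fun m => Function.update m j (Equiv.swap a b (m j))) (by
    intro m
    simp)

theorem swapAt_apply_of_eq {n : ℤ → ℕ} {j : ℤ} {a b : Fin (n j)} {m : Config n} (h : m j = a) :
    swapAt j a b m = Function.update m j b := by
  change Function.update m j (Equiv.swap a b (m j)) = _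
  rw [h, Equiv.swap_apply_left]

theorem unit_norm_le {n : ℤ → ℕ} (j : ℤ) (a b : Fin (n j)) (ξ : ConfigSpace n) (m : Config n) :
    ‖(if m j = a then ξ (Function.update m j b) else 0 : ℂ)‖ ^ (2 : ℝ≥0∞).toReal ≤
      ‖ξ (swapAt j a b m)‖ ^ (2 : ℝ≥0∞).toReal := by
  by_cases h : m j = a
  · rw [if_pos h, swapAt_apply_of_eq h]
  · rw [if_neg h]
    simp

theorem summable_swap {n : ℤ → ℕ} (j : ℤ) (a b : Fin (n j)) (ξ : ConfigSpace n) :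
    Summable fun m => ‖ξ (swapAt j a b m)‖ ^ (2 : ℝ≥0∞).toReal :=
  (swapAt j a b).summable_iff.mpr ((lp.memℓp ξ).summable (by simp))

theorem summable_unit {n : ℤ → ℕ} (j : ℤ) (a b : Fin (n j)) (ξ : ConfigSpace n) :
    Summable fun m : Config n =>
      ‖(if m j = a then ξ (Function.update m j b) else 0 : ℂ)‖ ^ (2 : ℝ≥0∞).toReal :=
  Summable.of_nonneg_of_le (fun _ => by positivity) (unit_norm_le j a b ξ) (summable_swap j a b ξ)

/-- The matrix unit `|a⟩⟨b|` at the site `j`, acting on the configuration space. -/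
def matrixUnit {n : ℤ → ℕ} (j : ℤ) (a b : Fin (n j)) : ConfigSpace n →L[ℂ] ConfigSpace n :=
  LinearMap.mkContinuous
    { toFun := fun ξ =>
        ⟨fun m => if m j = a then ξ (Function.update m j b) else 0,
          memℓp_gen (summable_unit j a b ξ)⟩
      map_add' := by
        intro ξ η
        ext m
        change (if m j = a then ξ (Function.update m j b) + η (Function.update m j b) else 0) =
          (if m j = a then ξ (Function.update m j b) else 0) +
            (if m j = a then η (Function.update m j b) else 0)
        split_ifs <;> simp
      map_smul' := by
        intro c ξ
        ext m
        by_cases h : m j = a <;> simp [h] }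
    1 (by
      intro ξ
      rw [one_mul]
      refine (Real.rpow_le_rpow_iff (z := (2 : ℝ≥0∞).toReal) (norm_nonneg _) (norm_nonneg _)
        (by simp)).mp ?_
      rw [lp.norm_rpow_eq_tsum (by simp) ξ, lp.norm_rpow_eq_tsum (by simp),
        ← (swapAt j a b).tsum_eq (fun m => ‖ξ m‖ ^ (2 : ℝ≥0∞).toReal)]
      exact Summable.tsum_le_tsum (unit_norm_le j a b ξ) (summable_unit j a b ξ)
        (summable_swap j a b ξ))

/-- The observable `M ∈ M_{n j}(ℂ)` at the site `j`, tensored with the identity elsewhere. -/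
def siteOp {n : ℤ → ℕ} (j : ℤ) (M : Matrix (Fin (n j)) (Fin (n j)) ℂ) :
    ConfigSpace n →L[ℂ] ConfigSpace n :=
  ∑ a, ∑ b, M a b • matrixUnit j a b

theorem siteOp_apply {n : ℤ → ℕ} (j : ℤ) (M : Matrix (Fin (n j)) (Fin (n j)) ℂ)
    (ξ : ConfigSpace n) (m : Config n) :
    siteOp j M ξ m = ∑ b, M (m j) b * ξ (Function.update m j b) := by
  have h : ∀ a b, (matrixUnit j a b ξ : ConfigSpace n) m =
      if m j = a then ξ (Function.update m j b) else 0 := fun _ _ => rfl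
  simp only [siteOp, sum_apply, lp.coeFn_sum, Finset.sum_apply,
    smul_apply, lp.coeFn_smul, Pi.smul_apply, h, smul_eq_mul]
  rw [Finset.sum_comm]
  simp

/-- The `⋆`-algebra generated by the observables at the sites of `X`. For finite `X` it is
`⨂ j ∈ X, M_{n j}(ℂ)`. -/
def localAlgebra (n : ℤ → ℕ) (X : Set ℤ) :
    StarSubalgebra ℂ (ConfigSpace n →L[ℂ] ConfigSpace n) :=
  StarAlgebra.adjoin ℂ {T | ∃ j ∈ X, ∃ M : Matrix (Fin (n j)) (Fin (n j)) ℂ, T = siteOp j M}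

/-- The spin chain algebra `𝒜` with site algebras `M_{n j}(ℂ)`: the norm completion of the union of
the algebras of finite sets of sites (the C⋆-norm on that union is unique, so that it may be
computed on the configuration space). -/
def ChainAlgebra (n : ℤ → ℕ) : Type :=
  (localAlgebra n Set.univ).topologicalClosure

/-- The C⋆-algebra structure is inherited from the bounded operators on the configuration space. -/
instance (n : ℤ → ℕ) : CStarAlgebra (ChainAlgebra n) :=
  haveI : IsClosed ((localAlgebra n Set.univ).topologicalClosure :
      Set (ConfigSpace n →L[ℂ] ConfigSpace n)) :=
    StarSubalgebra.isClosed_topologicalClosure _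
  StarSubalgebra.cstarAlgebra (localAlgebra n Set.univ).topologicalClosure

/-- The inclusion of the spin chain algebra into the bounded operators. -/
def toOp {n : ℤ → ℕ} : ChainAlgebra n →⋆ₐ[ℂ] (ConfigSpace n →L[ℂ] ConfigSpace n) where
  toFun := Subtype.val
  map_one' := rfl
  map_mul' _ _ := rfl
  map_zero' := rfl
  map_add' _ _ := rfl
  commutes' _ := rfl
  map_star' _ := rfl

theorem norm_toOp {n : ℤ → ℕ} (a : ChainAlgebra n) : ‖toOp a‖ = ‖a‖ := rfl

/-- `a` belongs to the subalgebra `𝒜_S` of the finite set of sites `S`. -/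
def IsSupportedOn {n : ℤ → ℕ} (a : ChainAlgebra n) (S : Finset ℤ) : Prop :=
  toOp a ∈ localAlgebra n (S : Set ℤ)

/-! ### Interactions, time-dependent interactions and almost local evolutions -/

/-- The class `ℱ` of decay functions. -/
structure IsDecayFunction (f : ℕ+ → ℝ) : Prop where
  pos : ∀ r, 0 < f r
  antitone : Antitone f
  fast : ∀ p : ℝ, 0 < p → Tendsto (fun r : ℕ+ => ((r : ℕ) : ℝ) ^ p * f r) atTop (𝓝 0)

/-- The diameter of a finite set of sites. -/
def diam (S : Finset ℤ) : ℕ := S.sup fun i => S.sup fun j => (i - j).natAbs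

/-- The quantity `‖H‖_f = sup_j ∑_{S ∋ j} ‖H_S‖ / f (1 + diam S)`, with values in `[0, ∞]`. -/
def fNorm {n : ℤ → ℕ} (f : ℕ+ → ℝ) (H : Finset ℤ → ChainAlgebra n) : ℝ≥0∞ :=
  ⨆ j : ℤ, ∑' S : {S : Finset ℤ // j ∈ S}, ‖H S‖ₑ / ENNReal.ofReal (f (diam S).succPNat)

/-- A family of self-adjoint local terms `H_S ∈ 𝒜_S`, indexed by the finite sets of sites. It is an
interaction if `‖H‖_f < ∞` for some `f ∈ ℱ`. -/
structure LocalTerms (n : ℤ → ℕ) where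
  term : Finset ℤ → ChainAlgebra n
  selfAdjoint : ∀ S, IsSelfAdjoint (term S)
  supported : ∀ S, IsSupportedOn (term S) S

/-- `|||H|||_f ≤ C`, where `|||H|||_f = sup_{s ∈ [0,1]} ‖H(s)‖_f`. -/
def UnifBound {n : ℤ → ℕ} (f : ℕ+ → ℝ) (H : ℝ → LocalTerms n) (C : ℝ≥0) : Prop :=
  ∀ s ∈ Set.Icc (0 : ℝ) 1, fNorm f (H s).term ≤ C

/-- `s ↦ H(s)` is strongly measurable in `‖·‖_f` on `[0,1]`: almost everywhere the `‖·‖_f`-limit of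
a sequence of simple functions. -/
def StronglyMeasurableFor {n : ℤ → ℕ} (f : ℕ+ → ℝ) (H : ℝ → LocalTerms n) : Prop :=
  ∃ K : ℕ → SimpleFunc ℝ (LocalTerms n),
    (∀ k s, fNorm f (K k s).term < ∞) ∧
    ∀ᵐ s ∂(volume.restrict (Set.Icc (0 : ℝ) 1)),
      Tendsto (fun k => fNorm f ((K k s).term - (H s).term)) atTop (𝓝 0)

/-- Time-dependent interactions. Only the times in `[0,1]` matter. -/
def IsTDI {n : ℤ → ℕ} (H : ℝ → LocalTerms n) : Prop :=
  ∃ f, IsDecayFunction f ∧ (∃ C, UnifBound f H C) ∧ StronglyMeasurableFor f H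

/-- The finite-volume Hamiltonian `ι_Λ(H) = ∑_{S ⊆ Λ} H_S`. -/
def hamiltonian {n : ℤ → ℕ} (Λ : Finset ℤ) (H : LocalTerms n) : ChainAlgebra n :=
  ∑ S ∈ Λ.powerset, H.term S

/-- `β` is a strongly continuous family of `⋆`-automorphisms which solves the Heisenberg equation
`β(s)[a] = a + i ∫₀ˢ β(u){[K(u), a]} du` for `s ∈ [0,1]`. -/
def SolvesHeisenberg {n : ℤ → ℕ} (K : ℝ → ChainAlgebra n)
    (β : ℝ → ChainAlgebra n ≃⋆ₐ[ℂ] ChainAlgebra n) : Prop :=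
  ∀ a : ChainAlgebra n,
    ContinuousOn (fun s => β s a) (Set.Icc 0 1) ∧
    IntervalIntegrable (fun u => β u (K u * a - a * K u)) volume 0 1 ∧
    ∀ s ∈ Set.Icc (0 : ℝ) 1,
      β s a = a + Complex.I • ∫ u in (0 : ℝ)..s, β u (K u * a - a * K u)

/-- `α` is the almost local evolution `α_H` generated by `H` on `[0,1]`: the strongly continuous
family of `⋆`-automorphisms which is the infinite-volume limit, as `Λ` exhausts `ℤ`, of the
solutions of the Heisenberg equation for the Hamiltonians `ι_Λ(H(s))`. -/
def IsEvolution {n : ℤ → ℕ} (H : ℝ → LocalTerms n)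
    (α : ℝ → ChainAlgebra n ≃⋆ₐ[ℂ] ChainAlgebra n) : Prop :=
  (∀ a, ContinuousOn (fun s => α s a) (Set.Icc 0 1)) ∧
  ∃ β : Finset ℤ → ℝ → ChainAlgebra n ≃⋆ₐ[ℂ] ChainAlgebra n,
    (∀ Λ, SolvesHeisenberg (fun u => hamiltonian Λ (H u)) (β Λ)) ∧
    ∀ s ∈ Set.Icc (0 : ℝ) 1, ∀ a, Tendsto (fun Λ => β Λ s a) atTop (𝓝 (α s a))

/-! ### States -/

/-- The set of states: normalized positive linear functionals. -/
def stateSet (n : ℤ → ℕ) : Set (ChainAlgebra n →L[ℂ] ℂ) :=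
  {ψ | ψ 1 = 1 ∧ ∀ a : ChainAlgebra n, ∃ r : ℝ, 0 ≤ r ∧ ψ (star a * a) = r}

/-- Pure states: extreme points of the set of states. -/
def IsPureState {n : ℤ → ℕ} (ψ : ChainAlgebra n →L[ℂ] ℂ) : Prop :=
  ψ ∈ (stateSet n).extremePoints ℝ

/-- `φ` factorizes over disjoint finite sets of sites. -/
def IsProduct {n : ℤ → ℕ} (φ : ChainAlgebra n →L[ℂ] ℂ) : Prop :=
  ∀ S T : Finset ℤ, Disjoint S T → ∀ a b : ChainAlgebra n, IsSupportedOn a S → IsSupportedOn b T →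
    φ (a * b) = φ a * φ b

/-! ### Symmetry -/

/-- A strongly continuous on-site action of `G` on the spin chain algebra by `⋆`-automorphisms:
each `γ(g)` preserves every site algebra `𝒜_j` (and is therefore the tensor product of its
restrictions `γ_j(g)`). -/
structure OnSiteAction (G : Type*) [Group G] [TopologicalSpace G] (n : ℤ → ℕ) where
  aut : G →* (ChainAlgebra n ≃⋆ₐ[ℂ] ChainAlgebra n)
  onSite : ∀ (g : G) (j : ℤ) (a : ChainAlgebra n),
    IsSupportedOn a {j} → IsSupportedOn (aut g a) {j}
  continuous : ∀ a : ChainAlgebra n, Continuous fun g => aut g a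

section Symmetry

variable {G : Type*} [Group G] [TopologicalSpace G] {n : ℤ → ℕ}

def IsInvariantState (γ : OnSiteAction G n) (ψ : ChainAlgebra n →L[ℂ] ℂ) : Prop :=
  ∀ g a, ψ (γ.aut g a) = ψ a

/-- All local terms at all times in `[0,1]` are `G`-invariant. -/
def IsInvariantTDI (γ : OnSiteAction G n) (H : ℝ → LocalTerms n) : Prop :=
  ∀ s ∈ Set.Icc (0 : ℝ) 1, ∀ S g, γ.aut g ((H s).term S) = (H s).term S

/-! ### Paths, loops and homotopies -/

/-- The TDI `H` generates the family of states `ψ`: `ψ(s) = ψ(0) ∘ α_H(s)` for `s ∈ [0,1]`. -/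
def Generates (H : ℝ → LocalTerms n) (ψ : ℝ → (ChainAlgebra n →L[ℂ] ℂ)) : Prop :=
  IsTDI H ∧ ∃ α, IsEvolution H α ∧ ∀ s ∈ Set.Icc (0 : ℝ) 1, ∀ a, ψ s a = ψ 0 (α s a)

/-- Paths of pure states. Only the parameters in `[0,1]` matter. -/
def IsPath (ψ : ℝ → (ChainAlgebra n →L[ℂ] ℂ)) : Prop :=
  (∀ s ∈ Set.Icc (0 : ℝ) 1, IsPureState (ψ s)) ∧ ∃ H, Generates H ψ

def IsLoop (ψ : ℝ → (ChainAlgebra n →L[ℂ] ℂ)) : Prop :=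
  IsPath ψ ∧ ψ 0 = ψ 1

/-- A loop through `G`-invariant states. -/
def IsInvariantLoop (γ : OnSiteAction G n) (ψ : ℝ → (ChainAlgebra n →L[ℂ] ℂ)) : Prop :=
  IsLoop ψ ∧ ∀ s ∈ Set.Icc (0 : ℝ) 1, IsInvariantState γ (ψ s)

/-- `G`-homotopy of loops. The two-parameter family is `Ψ l s`, where `l` is the homotopy
parameter; it is generated in the direction of `s` by the TDIs `H l`, in the direction of `l` by
the TDIs `F s`, with a bound on all of them in one common norm `|||·|||_f`. -/
def IsGHomotopic (γ : OnSiteAction G n) (ψ₀ ψ₁ : ℝ → (ChainAlgebra n →L[ℂ] ℂ)) : Prop :=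
  ∃ (Ψ : ℝ → ℝ → (ChainAlgebra n →L[ℂ] ℂ)) (H F : ℝ → ℝ → LocalTerms n) (f : ℕ+ → ℝ) (C : ℝ≥0),
    (∀ l ∈ Set.Icc (0 : ℝ) 1, IsInvariantLoop γ (Ψ l)) ∧
    (∀ l ∈ Set.Icc (0 : ℝ) 1, Generates (H l) (Ψ l)) ∧
    (∀ s ∈ Set.Icc (0 : ℝ) 1, Generates (F s) (fun l => Ψ l s)) ∧
    IsDecayFunction f ∧
    (∀ l ∈ Set.Icc (0 : ℝ) 1, UnifBound f (H l) C) ∧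
    (∀ s ∈ Set.Icc (0 : ℝ) 1, UnifBound f (F s) C) ∧
    ∀ s ∈ Set.Icc (0 : ℝ) 1, Ψ 0 s = ψ₀ s ∧ Ψ 1 s = ψ₁ s

/-! ### Relative charge and the index -/

/-- `(𝓗, Ω, π)` is a GNS triple of `φ`. -/
structure IsGNSTriple {𝓗 : Type*} [NormedAddCommGroup 𝓗] [InnerProductSpace ℂ 𝓗]
    [CompleteSpace 𝓗] (φ : ChainAlgebra n →L[ℂ] ℂ) (π : ChainAlgebra n →⋆ₐ[ℂ] (𝓗 →L[ℂ] 𝓗))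
    (Ω : 𝓗) : Prop where
  vector : ∀ a, φ a = ⟪Ω, π a Ω⟫_ℂ
  cyclic : Dense (Set.range fun a => π a Ω)

/-- `χ ∈ Hom(G, 𝕊¹)` is the relative charge `h_{ψ/φ}` of the state `ψ` with respect to the
`G`-invariant pure state `φ`. In the GNS representation of `φ`, with the strongly continuous unitary
representation `U` of `G` which implements the action and fixes `Ω`, the state `ψ` is represented by
a unit vector `v`, and `U(g) v = χ(g) v`. -/
def IsRelativeCharge (γ : OnSiteAction G n) (φ ψ : ChainAlgebra n →L[ℂ] ℂ)
    (χ : G →ₜ* Circle) : Prop :=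
  ∃ (𝓗 : Type) (_ : NormedAddCommGroup 𝓗) (_ : InnerProductSpace ℂ 𝓗) (_ : CompleteSpace 𝓗)
    (π : ChainAlgebra n →⋆ₐ[ℂ] (𝓗 →L[ℂ] 𝓗)) (Ω : 𝓗) (U : G →* unitary (𝓗 →L[ℂ] 𝓗)) (v : 𝓗),
    IsGNSTriple φ π Ω ∧
    (∀ x, Continuous fun g => (U g : 𝓗 →L[ℂ] 𝓗) x) ∧
    (∀ g, (U g : 𝓗 →L[ℂ] 𝓗) Ω = Ω) ∧
    (∀ g a, π (γ.aut g a) = (U g : 𝓗 →L[ℂ] 𝓗) * π a * star (U g : 𝓗 →L[ℂ] 𝓗)) ∧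
    ‖v‖ = 1 ∧ (∀ a, ψ a = ⟪v, π a v⟫_ℂ) ∧
    ∀ g, (U g : 𝓗 →L[ℂ] 𝓗) v = (χ g : ℂ) • v

open Classical in
/-- The truncation `H'` of `H` to the left half-line: only the terms with `S ⊆ {…, -1, 0}` are
kept. -/
def truncate (H : LocalTerms n) : LocalTerms n where
  term S := if ∀ j ∈ S, j ≤ 0 then H.term S else 0
  selfAdjoint S := by
    split_ifs
    · exact H.selfAdjoint S
    · exact IsSelfAdjoint.zero _
  supported S := by
    split_ifs
    · exact H.supported S
    · rw [IsSupportedOn, map_zero]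
      exact zero_mem _

/-- `I(φ, H) = χ`: the pumped state `φ ∘ α_{H'}(1)` has charge `χ` relative to `φ`. -/
def IsPumpedCharge (γ : OnSiteAction G n) (φ : ChainAlgebra n →L[ℂ] ℂ) (H : ℝ → LocalTerms n)
    (χ : G →ₜ* Circle) : Prop :=
  ∃ (α : ℝ → ChainAlgebra n ≃⋆ₐ[ℂ] ChainAlgebra n) (ψ' : ChainAlgebra n →L[ℂ] ℂ),
    IsEvolution (fun s => truncate (H s)) α ∧ (∀ a, ψ' a = φ (α 1 a)) ∧
    IsRelativeCharge γ φ ψ' χ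

/-- `χ` is the index of the loop `ψ`: some `G`-invariant TDI generates `ψ`, and every such TDI `H`
satisfies `I(ψ(0), H) = χ`. -/
def IsLoopIndex (γ : OnSiteAction G n) (ψ : ℝ → (ChainAlgebra n →L[ℂ] ℂ))
    (χ : G →ₜ* Circle) : Prop :=
  (∃ H, IsInvariantTDI γ H ∧ Generates H ψ) ∧
  ∀ H, IsInvariantTDI γ H → Generates H ψ → IsPumpedCharge γ (ψ 0) H χ

open Classical in
/-- The index `h(ψ) ∈ Hom(G, 𝕊¹)` of a loop (the trivial character if there is none). -/
def loopIndex (γ : OnSiteAction G n) (ψ : ℝ → (ChainAlgebra n →L[ℂ] ℂ)) : G →ₜ* Circle :=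
  if h : ∃ χ, IsLoopIndex γ ψ χ then h.choose else 1

end Symmetry

end SpinChain

end

/-!
The charge pumped by a loop at a cut is an invariant of the homotopy class of the loop.

*Charges.* Let `φ` be the invariant pure product state. An almost local evolution which preserves
`φ` is a product `θ' θ''` of evolutions of the two half-lines, followed by conjugation with an
invariant unitary `X` of the algebra (`IsRegular.isCut`), as the terms across the cut have a bounded
sum. Hence `φ ∘ θ' ∘ θ''` is a vector state in the GNS representation of `φ`, and, `φ` being a
product state, so is `φ ∘ θ'`: the projections onto `φ` in large parts of the right half-line turn
vectors of the former state into vectors of the latter one (`exists_vector_of_isCut`). Vectors of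
the same state are proportional, which makes the invariant state `φ ∘ θ'` a state of definite charge
(`exists_hasCharge_of_isCut`). Charges are multiplicative (`HasCharge.mul`), unchanged by invariant
inner automorphisms (`HasCharge.innerAut_mul`), and trivial if the pumped state has an overlap with
`φ` that is uniform in the volume (`HasCharge.eq_one`).

*Homotopies.* Subdivide the parameter square of a homotopy. The transport around a plaquette, based
at `φ`, is `T K T⁻¹` with a small `K` and a quasi-local `T`. The projection onto `φ` in a large
interval factorizes into projections on the left, in the middle and on the right. The cut
automorphism acts on the first one almost like `T K T⁻¹`, which preserves `φ`, and it hardly moves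
the other two, so that the overlap with `φ` stays close to one and a plaquette has trivial charge
(`hasCharge_one_of_near`). Multiplying the plaquettes of a strip, neighbouring loops have the same
charge (`IsFineGrid.exists_hasCharge`). The constant homotopy of a loop, with different interactions
at its two ends, shows that the charge does not depend on the interaction
(`exists_hasCharge_of_generates`).

*Invariant interactions.* A homotopy need not come with invariant interactions, but the average over
the group of an interaction generates the same invariant states. Indeed, averaging one factor of a
commutator in an invariant state amounts to averaging the other one, so that the states solve the
weak evolution equation of the averaged interaction as well (`Generates.average`), and its solution
is unique (`IsWeakSolution.eq_ev`).

*Analysis.* Propagators in finite volume are Dyson series `prop`, differentiable almost everywhere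
along absolutely continuous paths. Infinite-volume evolutions `ev`, their locality, and the locality
of everything above rest on the Lieb-Robinson bound (`IsRegular.lieb_robinson`) for interactions
which decay at least as fast as the kernel `(1 + |d|)⁻²`, and on its consequence that terms across
the boundary of a region have little effect inside of it (`IsRegular.finEv_cut`).
-/

open scoped ENNReal NNReal InnerProductSpace
open MeasureTheory Filter Topology

noncomputable section

namespace SpinChain

/-! ### Absolutely continuous paths and linear evolution equations -/

section LocBdd

variable {E : Type*} [NormedAddCommGroup E]

/-- Almost everywhere bounded on every bounded interval. -/
def IsLocBdd (x : ℝ → E) : Prop := ∀ R : ℝ, ∃ M : ℝ, ∀ᵐ u : ℝ, |u| ≤ R → ‖x u‖ ≤ M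

theorem IsLocBdd.of_le {x : ℝ → E} {M : ℝ} (h : ∀ u, ‖x u‖ ≤ M) : IsLocBdd x :=
  fun _ => ⟨M, .of_forall fun u _ => h u⟩

theorem IsLocBdd.locallyIntegrable {x : ℝ → E} (hx : AEStronglyMeasurable x)
    (hb : IsLocBdd x) : LocallyIntegrable x := by
  rw [locallyIntegrable_iff]
  intro k hk
  obtain ⟨R, hR⟩ := hk.isBounded.subset_closedBall (0 : ℝ)
  obtain ⟨M, hM⟩ := hb R
  refine IntegrableOn.mono_set (t := Metric.closedBall 0 R) ?_ hR
  refine IntegrableOn.of_bound (isCompact_closedBall _ _).measure_lt_top hx.restrict M ?_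
  rw [ae_restrict_iff' measurableSet_closedBall]
  filter_upwards [hM] with u hu h
  exact hu (by simpa using h)

theorem IsLocBdd.intervalIntegrable {x : ℝ → E} (hx : AEStronglyMeasurable x)
    (hb : IsLocBdd x) (a b : ℝ) : IntervalIntegrable x volume a b :=
  intervalIntegrable_iff.mpr (((IsLocBdd.locallyIntegrable hx hb).integrableOn_isCompact
    isCompact_uIcc).mono_set Set.uIoc_subset_uIcc)

end LocBdd

section ACPath

variable {E : Type*} [NormedAddCommGroup E] [NormedSpace ℝ E]

/-- `X` is absolutely continuous on every bounded interval and has the derivative `x` almost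
everywhere. -/
structure IsACPath (X x : ℝ → E) : Prop where
  ac : ∀ a b, AbsolutelyContinuousOnInterval X a b
  deriv : ∀ᵐ s, HasDerivAt X (x s) s

namespace IsACPath

variable {X Y x y : ℝ → E}

theorem congr (h : IsACPath X x) (hxy : ∀ s, x s = y s) : IsACPath X y :=
  (funext hxy : x = y) ▸ h

theorem const (c : E) : IsACPath (fun _ => c) (fun _ => 0) where
  ac _ _ := (LipschitzWith.const' c (K := 0)).lipschitzOnWith.absolutelyContinuousOnInterval
  deriv := .of_forall fun s => hasDerivAt_const s c

theorem add (hX : IsACPath X x) (hY : IsACPath Y y) :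
    IsACPath (fun s => X s + Y s) (fun s => x s + y s) where
  ac a b := (hX.ac a b).add (hY.ac a b)
  deriv := by filter_upwards [hX.deriv, hY.deriv] with s h₁ h₂ using h₁.add h₂

theorem sub (hX : IsACPath X x) (hY : IsACPath Y y) :
    IsACPath (fun s => X s - Y s) (fun s => x s - y s) where
  ac a b := (hX.ac a b).sub (hY.ac a b)
  deriv := by filter_upwards [hX.deriv, hY.deriv] with s h₁ h₂ using h₁.sub h₂

theorem clm {F : Type*} [NormedAddCommGroup F] [NormedSpace ℝ F] (T : E →L[ℝ] F)
    (hX : IsACPath X x) : IsACPath (fun s => T (X s)) (fun s => T (x s)) where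
  ac a b := by
    refine squeeze_zero (fun t => Finset.sum_nonneg fun i _ => dist_nonneg) (fun t => ?_)
      (by simpa using! Filter.Tendsto.const_mul ‖T‖ (hX.ac a b))
    rw [Finset.mul_sum]
    refine Finset.sum_le_sum fun i _ => ?_
    rw [dist_eq_norm, dist_eq_norm, ← map_sub]
    exact T.le_opNorm _
  deriv := by filter_upwards [hX.deriv] with s h using T.hasFDerivAt.comp_hasDerivAt s h

theorem eq_of_eq (hX : IsACPath X x) (hY : IsACPath Y x) {r : ℝ} (h : X r = Y r) (s : ℝ) :
    X s = Y s := by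
  obtain ⟨c, hc⟩ := ((hX.sub hY).ac r s).const_of_ae_hasDerivAt_zero (by
    filter_upwards [(hX.sub hY).deriv] with u hu _
    simpa using hu)
  have h₁ := hc r (by simp)
  have h₂ := hc s (by simp)
  rw [h, sub_self] at h₁
  exact sub_eq_zero.mp (h₂.trans h₁.symm)

theorem continuous (hX : IsACPath X x) : Continuous X := by
  rw [continuous_iff_continuousAt]
  intro s
  exact ((hX.ac (s - 1) (s + 1)).continuousOn).continuousAt (by
    rw [Set.uIcc_of_le (by linarith)]
    exact Icc_mem_nhds (by linarith) (by linarith))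

end IsACPath

variable [CompleteSpace E]

theorem IsACPath.primitive {x : ℝ → E} (hx : AEStronglyMeasurable x) (hb : IsLocBdd x)
    (r : ℝ) : IsACPath (fun s => ∫ u in r..s, x u) x where
  ac a b := by
    have hi := hb.intervalIntegrable hx
    obtain ⟨M, hM⟩ := hb (max |a| |b|)
    refine LipschitzOnWith.absolutelyContinuousOnInterval (K := M.toNNReal) ?_
    refine LipschitzOnWith.of_dist_le_mul fun s hs t ht => ?_
    rw [dist_eq_norm, intervalIntegral.integral_interval_sub_left (hi _ _) (hi _ _),
      Real.dist_eq]
    refine intervalIntegral.norm_integral_le_of_norm_le_const_ae ?_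
    filter_upwards [hM] with u hu h
    refine (hu ?_).trans (Real.le_coe_toNNReal M)
    have h4 : u ∈ Set.uIcc a b :=
      Set.uIcc_subset_uIcc ht hs (Set.uIoc_subset_uIcc h)
    rcases Set.mem_uIcc.mp h4 with h1 | h1
    · exact abs_le_max_abs_abs h1.1 h1.2
    · rw [max_comm]
      exact abs_le_max_abs_abs h1.1 h1.2
  deriv := by
    filter_upwards [LocallyIntegrable.ae_hasDerivAt_integral
      (IsLocBdd.locallyIntegrable hx hb)] with s h using h r

theorem IsACPath.eq_add_integral {X x : ℝ → E} (hX : IsACPath X x) (hb : IsLocBdd x)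
    (a b : ℝ) : X b = X a + ∫ u in a..b, x u := by
  have hx : AEStronglyMeasurable x := (aestronglyMeasurable_deriv X volume).congr (by
    filter_upwards [hX.deriv] with u hu using hu.deriv)
  have h := (IsACPath.const (X a)).add (IsACPath.primitive hx hb a)
  exact hX.eq_of_eq (h.congr fun s => zero_add _) (r := a) (by simp) b

theorem IsACPath.norm_sub_le {X x : ℝ → E} (hX : IsACPath X x) (hb : IsLocBdd x)
    {a b : ℝ} (hab : a ≤ b) {g : ℝ → ℝ} (hg : IntervalIntegrable g volume a b)
    (hxg : ∀ u ∈ Set.Icc a b, ‖x u‖ ≤ g u) : ‖X b - X a‖ ≤ ∫ u in a..b, g u := by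
  rw [hX.eq_add_integral hb a b, add_sub_cancel_left]
  exact intervalIntegral.norm_integral_le_of_norm_le hab
    (.of_forall fun t ht => hxg t (Set.Ioc_subset_Icc_self ht)) hg

/-- A closed real subspace contains the integrals of functions with values in it. -/
theorem intervalIntegral_mem {V : Submodule ℝ E} (hV : IsClosed (V : Set E)) {x : ℝ → E}
    (hx : ∀ u, x u ∈ V) (a b : ℝ) : ∫ u in a..b, x u ∈ V := by
  have key : ∀ s : Set ℝ, volume s ≠ ∞ → ∫ u in s, x u ∈ V := by
    intro s hs
    by_cases hi : IntegrableOn x s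
    · by_cases h0 : volume s = 0
      · rw [Measure.restrict_eq_zero.mpr h0]; simp
      · have h := V.convex.set_average_mem hV h0 hs (.of_forall hx) hi
        rw [setAverage_eq] at h
        have h2 := V.smul_mem (volume.real s) h
        rwa [smul_inv_smul₀] at h2
        exact (ENNReal.toReal_pos h0 hs).ne'
    · rw [integral_undef hi]; exact V.zero_mem
  rw [intervalIntegral]
  exact V.sub_mem (key _ (by simp)) (key _ (by simp))

end ACPath

section Algebra

variable {A : Type*} [CStarAlgebra A]

theorem IsACPath.mul {X Y x y : ℝ → A} (hX : IsACPath X x) (hY : IsACPath Y y) :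
    IsACPath (fun s => X s * Y s) (fun s => x s * Y s + X s * y s) where
  ac a b := by
    obtain ⟨C, hC⟩ := (hX.ac a b).exists_bound
    obtain ⟨D, hD⟩ := (hY.ac a b).exists_bound
    have hlim := (Filter.Tendsto.const_mul C (hY.ac a b)).add
      (Filter.Tendsto.const_mul D (hX.ac a b))
    rw [mul_zero, mul_zero, add_zero] at hlim
    refine squeeze_zero' (.of_forall fun t => Finset.sum_nonneg fun i _ => dist_nonneg) ?_ hlim
    rw [eventually_inf_principal]
    refine .of_forall fun t ht => ?_
    rw [Finset.mul_sum, Finset.mul_sum, ← Finset.sum_add_distrib]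
    refine Finset.sum_le_sum fun i hi => ?_
    have hm := ht.1 i hi
    have h : X (t.2 i).1 * Y (t.2 i).1 - X (t.2 i).2 * Y (t.2 i).2 =
        X (t.2 i).1 * (Y (t.2 i).1 - Y (t.2 i).2) +
          (X (t.2 i).1 - X (t.2 i).2) * Y (t.2 i).2 := by noncomm_ring
    rw [dist_eq_norm, dist_eq_norm, dist_eq_norm, h, mul_comm D]
    exact (norm_add_le _ _).trans (add_le_add
      ((norm_mul_le _ _).trans (mul_le_mul_of_nonneg_right (hC _ hm.1) (norm_nonneg _)))
      ((norm_mul_le _ _).trans (mul_le_mul_of_nonneg_left (hD _ hm.2) (norm_nonneg _))))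
  deriv := by filter_upwards [hX.deriv, hY.deriv] with s h₁ h₂ using h₁.mul h₂

theorem IsACPath.star {X x : ℝ → A} (hX : IsACPath X x) :
    IsACPath (fun s => star (X s)) (fun s => star (x s)) :=
  hX.clm ((starL' ℝ : A ≃L[ℝ] A) : A →L[ℝ] A)

/-- A time-dependent Hamiltonian: bounded, measurable and self-adjoint. -/
structure IsDriver (K : ℝ → A) (M : ℝ) : Prop where
  meas : AEStronglyMeasurable K
  bound : ∀ u, ‖K u‖ ≤ M
  sa : ∀ u, star (K u) = K u

/-- The terms of the Dyson series of the equation `U' = i U K`. -/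
def dyson (K : ℝ → A) : ℕ → ℝ → A
  | 0, _ => 1
  | k + 1, s => ∫ u in (0 : ℝ)..s, Complex.I • (dyson K k u * K u)

/-- The propagator of `K`: the solution of `U' = i U K`, `U(0) = 1`, as the sum of the Dyson
series. -/
def prop (K : ℝ → A) (s : ℝ) : A := ∑' k, dyson K k s

variable {K : ℝ → A} {M : ℝ}

theorem IsDriver.nonneg (hK : IsDriver K M) : 0 ≤ M := (norm_nonneg _).trans (hK.bound 0)

theorem dyson_spec (hK : IsDriver K M) (k : ℕ) : Continuous (dyson K k) ∧
    ∀ s, ‖dyson K k s‖ ≤ ‖(1 : A)‖ * ((M * |s|) ^ k / k.factorial) := by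
  have hM := hK.nonneg
  induction k with
  | zero => exact ⟨continuous_const, fun s => by simp [dyson]⟩
  | succ k ih =>
    obtain ⟨hc, hb⟩ := ih
    have hm : AEStronglyMeasurable fun u => Complex.I • (dyson K k u * K u) :=
      (hc.aestronglyMeasurable.mul hK.meas).const_smul Complex.I
    have hle : ∀ u, ‖Complex.I • (dyson K k u * K u)‖ ≤
        ‖(1 : A)‖ * ((M * |u|) ^ k / k.factorial) * M := fun u => by
      rw [norm_smul, Complex.norm_I, one_mul]
      exact (norm_mul_le _ _).trans
        (mul_le_mul (hb u) (hK.bound u) (norm_nonneg _) (by positivity))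
    have hl : IsLocBdd fun u => Complex.I • (dyson K k u * K u) := fun R =>
      ⟨‖(1 : A)‖ * ((M * R) ^ k / k.factorial) * M, .of_forall fun u hu =>
        (hle u).trans (by gcongr)⟩
    refine ⟨(IsACPath.primitive hm hl 0).continuous, fun s => ?_⟩
    have h := intervalIntegral.norm_integral_le_abs_of_norm_le (μ := volume) (a := 0) (b := s)
      (.of_forall hle) (by
        apply Continuous.intervalIntegrable; fun_prop)
    refine h.trans (le_of_eq ?_)
    have h2 := integral_pow_abs_sub_uIoc (a := 0) (b := s) k
    simp only [sub_zero] at h2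
    rw [intervalIntegral.abs_intervalIntegral_eq, abs_of_nonneg
      (integral_nonneg fun u => by positivity)]
    have h3 : ∀ u : ℝ, ‖(1 : A)‖ * ((M * |u|) ^ k / k.factorial) * M =
        (‖(1 : A)‖ * M ^ (k + 1) / k.factorial) * |u| ^ k := fun u => by ring
    simp_rw [h3]
    rw [integral_const_mul, h2, Nat.factorial_succ]
    push_cast
    rw [mul_pow]
    field_simp

theorem summable_dyson_bound (c r : ℝ) : Summable fun k : ℕ => c * (r ^ k / k.factorial) :=
  (Real.summable_pow_div_factorial r).mul_left c

theorem prop_eq (hK : IsDriver K M) (s : ℝ) :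
    prop K s = 1 + ∫ u in (0 : ℝ)..s, Complex.I • (prop K u * K u) := by
  have hM := hK.nonneg
  have hsum : ∀ s, Summable fun k => dyson K k s := fun s =>
    Summable.of_norm_bounded (summable_dyson_bound ‖(1 : A)‖ (M * |s|))
      fun k => (dyson_spec hK k).2 s
  rw [prop, (hsum s).tsum_eq_zero_add]
  congr 1
  refine HasSum.tsum_eq ?_
  refine intervalIntegral.hasSum_integral_of_dominated_convergence
    (bound := fun k _ => ‖(1 : A)‖ * ((M * |s|) ^ k / k.factorial) * M) ?_ ?_ ?_ ?_ ?_
  · intro k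
    exact (((dyson_spec hK k).1.aestronglyMeasurable.mul hK.meas).const_smul
      Complex.I).restrict
  · refine fun k => .of_forall fun u hu => ?_
    have hus : |u| ≤ |s| := by
      rcases Set.mem_uIoc.mp hu with h | h
      · rw [abs_of_nonneg h.1.le]; exact h.2.trans (le_abs_self s)
      · rw [abs_of_nonpos h.2, abs_of_neg (h.1.trans_le h.2)]; linarith [h.1]
    rw [norm_smul, Complex.norm_I, one_mul]
    refine (norm_mul_le _ _).trans
      (mul_le_mul (((dyson_spec hK k).2 u).trans ?_) (hK.bound u) (norm_nonneg _)
        (by positivity))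
    gcongr
  · exact .of_forall fun _ _ => (summable_dyson_bound _ _).mul_right M
  · exact intervalIntegrable_const
  · refine .of_forall fun u _ => ?_
    exact ((hsum u).hasSum.mul_right (K u)).const_smul Complex.I

theorem norm_prop_le (hK : IsDriver K M) (s : ℝ) :
    ‖prop K s‖ ≤ ‖(1 : A)‖ * Real.exp (M * |s|) := by
  refine tsum_of_norm_bounded ?_ fun k => (dyson_spec hK k).2 s
  rw [Real.exp_eq_exp_ℝ]
  exact (NormedSpace.expSeries_div_hasSum_exp (M * |s|)).mul_left _

theorem continuous_prop (hK : IsDriver K M) : Continuous (prop K) := by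
  have hM := hK.nonneg
  rw [continuous_iff_continuousAt]
  intro s
  have h : ContinuousOn (fun t => ∑' k, dyson K k t) (Metric.ball 0 (|s| + 1)) := by
    refine continuousOn_tsum (u := fun k : ℕ => ‖(1 : A)‖ *
      ((M * (|s| + 1)) ^ k / (k.factorial : ℝ)))
      (fun k => (dyson_spec hK k).1.continuousOn) (summable_dyson_bound _ _) fun k u hu => ?_
    refine ((dyson_spec hK k).2 u).trans ?_
    have : |u| ≤ |s| + 1 := by simpa using (Metric.mem_ball.mp hu).le
    gcongr
  exact h.continuousAt (Metric.isOpen_ball.mem_nhds (by simp))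

theorem isACPath_prop (hK : IsDriver K M) :
    IsACPath (prop K) fun s => Complex.I • (prop K s * K s) := by
  have hM := hK.nonneg
  have h := (IsACPath.const (1 : A)).add (IsACPath.primitive (x := fun s =>
    Complex.I • (prop K s * K s))
    (((continuous_prop hK).aestronglyMeasurable.mul hK.meas).const_smul _) (fun R =>
      ⟨‖(1 : A)‖ * Real.exp (M * R) * M, .of_forall fun u hu => by
        rw [norm_smul, Complex.norm_I, one_mul]
        refine (norm_mul_le _ _).trans (mul_le_mul ((norm_prop_le hK u).trans ?_)
          (hK.bound u) (norm_nonneg _) (by positivity))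
        gcongr⟩) 0)
  have he : (fun s => 1 + ∫ u in (0 : ℝ)..s, Complex.I • (prop K u * K u)) = prop K :=
    funext fun s => (prop_eq hK s).symm
  rw [he] at h
  exact h.congr fun s => zero_add _

theorem prop_zero (hK : IsDriver K M) : prop K 0 = 1 := by
  rw [prop_eq hK]; simp

theorem prop_mul_star (hK : IsDriver K M) (s : ℝ) : prop K s * star (prop K s) = 1 := by
  have h := (isACPath_prop hK).mul (isACPath_prop hK).star
  refine (h.congr fun s => ?_).eq_of_eq (IsACPath.const (1 : A)) (r := 0)
    (by simp [prop_zero hK]) s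
  simp [hK.sa, mul_assoc]

/-- The projections `U⋆U` depend continuously on the time and start at `1`, so that they never
jump. -/
theorem star_prop_mul (hK : IsDriver K M) (s : ℝ) : star (prop K s) * prop K s = 1 := by
  set q : ℝ → A := fun s => 1 - star (prop K s) * prop K s with hq
  have hqs : ∀ s, star (q s) = q s := fun s => by simp [hq]
  have hqq : ∀ s, q s * q s = q s := fun s => by
    have h := prop_mul_star hK s
    have h2 : star (prop K s) * prop K s * (star (prop K s) * prop K s) =
        star (prop K s) * prop K s := by
      rw [mul_assoc, ← mul_assoc (prop K s), h, one_mul]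
    simp only [hq, sub_mul, mul_sub, one_mul, mul_one, h2]
    abel
  have hc : Continuous fun s => ‖q s‖ := by
    have := continuous_prop hK
    fun_prop
  have h01 : ∀ s, ‖q s‖ = 0 ∨ ‖q s‖ = 1 := fun s => by
    have h := CStarRing.norm_star_mul_self (x := q s)
    rw [hqs, hqq] at h
    have h2 : ‖q s‖ * (‖q s‖ - 1) = 0 := by linarith
    rcases mul_eq_zero.mp h2 with h3 | h3
    · exact .inl h3
    · exact .inr (by linarith)
  rcases h01 s with h | h
  · rw [norm_eq_zero] at h
    exact (sub_eq_zero.mp h).symm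
  · obtain ⟨t, ht⟩ := mem_range_of_exists_le_of_exists_ge (c := (1 / 2 : ℝ)) hc
      ⟨0, by simp [hq, prop_zero hK]⟩ ⟨s, by rw [h]; norm_num⟩
    rcases h01 t with h' | h' <;> norm_num [h'] at ht

theorem prop_mem_unitary (hK : IsDriver K M) (s : ℝ) : prop K s ∈ unitary A :=
  ⟨star_prop_mul hK s, prop_mul_star hK s⟩

theorem norm_prop_le_one (hK : IsDriver K M) (s : ℝ) : ‖prop K s‖ ≤ 1 := by
  have h := CStarRing.norm_star_mul_self (x := prop K s)
  rw [star_prop_mul hK] at h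
  rcases subsingleton_or_nontrivial A with _ | _
  · simp [Subsingleton.elim (prop K s) 0]
  · rw [CStarRing.norm_one] at h
    nlinarith [norm_nonneg (prop K s)]

/-- Uniqueness of the solutions of `X' = i X K`. -/
theorem eq_mul_prop (hK : IsDriver K M) {X : ℝ → A}
    (hX : IsACPath X fun s => Complex.I • (X s * K s)) (s : ℝ) : X s = X 0 * prop K s := by
  have h := hX.mul (isACPath_prop hK).star
  have h2 := (h.congr fun s => ?_).eq_of_eq (IsACPath.const (X 0)) (r := 0)
    (by simp [prop_zero hK]) s
  · have h3 := congrArg (· * prop K s) h2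
    simpa [mul_assoc, star_prop_mul hK] using h3
  · simp [hK.sa, mul_assoc]

theorem prop_mem {B : Subalgebra ℂ A} (hB : IsClosed (B : Set A)) (hK : IsDriver K M)
    (h : ∀ u, K u ∈ B) (s : ℝ) : prop K s ∈ B := by
  have hd : ∀ k s, dyson K k s ∈ B := by
    intro k
    induction k with
    | zero => exact fun _ => B.one_mem
    | succ k ih =>
      intro s
      exact intervalIntegral_mem (V := B.toSubmodule.restrictScalars ℝ) hB
        (fun u => B.smul_mem (B.mul_mem (ih u) (h u)) _) 0 s
  have hM := hK.nonneg
  have hsum : Summable fun k => dyson K k s :=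
    Summable.of_norm_bounded (summable_dyson_bound ‖(1 : A)‖ (M * |s|))
      fun k => (dyson_spec hK k).2 s
  exact hB.mem_of_tendsto hsum.hasSum (.of_forall fun F => B.sum_mem fun k _ => hd k s)

/-- Propagators depend continuously on the Hamiltonian. -/
theorem norm_prop_sub_prop_le {K' : ℝ → A} {M' : ℝ} (hK : IsDriver K M) (hK' : IsDriver K' M')
    {s : ℝ} (hs : 0 ≤ s) : ‖prop K s - prop K' s‖ ≤ ∫ u in (0 : ℝ)..s, ‖K u - K' u‖ := by
  have h := (isACPath_prop hK).mul (isACPath_prop hK').star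
  have hb : ∀ u, ‖Complex.I • (prop K u * K u) * star (prop K' u) +
      prop K u * star (Complex.I • (prop K' u * K' u))‖ ≤ ‖K u - K' u‖ := fun u => by
    have : Complex.I • (prop K u * K u) * star (prop K' u) +
        prop K u * star (Complex.I • (prop K' u * K' u)) =
        Complex.I • (prop K u * (K u - K' u) * star (prop K' u)) := by
      simp only [star_smul, star_mul, hK'.sa, mul_sub, sub_mul, smul_sub, mul_assoc,
        smul_mul_assoc, mul_smul_comm, Complex.star_def, Complex.conj_I, neg_smul, mul_neg]
      abel
    rw [this, norm_smul, Complex.norm_I, one_mul]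
    refine (norm_mul_le _ _).trans ?_
    rw [norm_star]
    refine (mul_le_mul (norm_mul_le _ _) (norm_prop_le_one hK' u) (norm_nonneg _)
      (by positivity)).trans ?_
    rw [mul_one]
    exact mul_le_of_le_one_left (norm_nonneg _) (norm_prop_le_one hK u)
  have hd : ∀ u, ‖K u - K' u‖ ≤ M + M' := fun u =>
    (norm_sub_le _ _).trans (add_le_add (hK.bound u) (hK'.bound u))
  have h2 := h.norm_sub_le (.of_le fun u => (hb u).trans (hd u)) hs
    (IsLocBdd.intervalIntegrable (hK.meas.sub hK'.meas).norm
      (.of_le fun u => by rw [norm_norm]; exact hd u) 0 s) (fun u _ => hb u)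
  refine le_trans (le_of_eq_of_le ?_ (norm_mul_le_of_le h2 (norm_prop_le_one hK' s)))
    (mul_one _).le
  rw [prop_zero hK, prop_zero hK', star_one, mul_one, sub_mul, one_mul, mul_assoc,
    star_prop_mul hK', mul_one]

theorem norm_prop_sub_le (hK : IsDriver K M) {s t : ℝ} (hst : s ≤ t) :
    ‖prop K t - prop K s‖ ≤ M * (t - s) := by
  have hb : ∀ u, ‖Complex.I • (prop K u * K u)‖ ≤ M := fun u => by
    rw [norm_smul, Complex.norm_I, one_mul]
    refine (norm_mul_le _ _).trans ((mul_le_mul (norm_prop_le_one hK u) (hK.bound u)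
      (norm_nonneg _) zero_le_one).trans (one_mul M).le)
  have h := (isACPath_prop hK).norm_sub_le (.of_le hb) hst (g := fun _ => M)
    intervalIntegrable_const (fun u _ => hb u)
  refine h.trans (le_of_eq ?_)
  rw [intervalIntegral.integral_const, smul_eq_mul, mul_comm]

/-- The propagator of a sum of commuting Hamiltonians. -/
theorem prop_add {K' : ℝ → A} {M' : ℝ} (hK : IsDriver K M) (hK' : IsDriver K' M')
    (hc : ∀ s u, Commute (prop K' s) (K u)) (s : ℝ) :
    prop (fun u => K u + K' u) s = prop K s * prop K' s := by
  have hKK : IsDriver (fun u => K u + K' u) (M + M') :=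
    ⟨hK.meas.add hK'.meas, fun u => (norm_add_le _ _).trans
      (add_le_add (hK.bound u) (hK'.bound u)), fun u => by rw [star_add, hK.sa, hK'.sa]⟩
  have h := ((isACPath_prop hK).mul (isACPath_prop hK')).congr (y := fun s =>
    Complex.I • (prop K s * prop K' s * (K s + K' s))) fun s => by
      rw [smul_mul_assoc, mul_smul_comm, ← smul_add, mul_add, mul_assoc, mul_assoc, mul_assoc,
        (hc s s).eq]
  have h2 := eq_mul_prop hKK h s
  rw [prop_zero hK, prop_zero hK', one_mul, one_mul] at h2
  exact h2.symm

/-- The propagator of a time-shifted Hamiltonian. -/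
theorem prop_shift (hK : IsDriver K M) (r s : ℝ) :
    prop (fun u => K (r + u)) s = star (prop K r) * prop K (r + s) := by
  have hmp : MeasurePreserving (fun u : ℝ => r + u) := measurePreserving_add_left volume r
  have hKr : IsDriver (fun u => K (r + u)) M :=
    ⟨hK.meas.comp_measurePreserving hmp, fun u => hK.bound _, fun u => hK.sa _⟩
  have hsh : IsACPath (fun s => prop K (r + s)) fun s => Complex.I •
      (prop K (r + s) * K (r + s)) := by
    have h : IsACPath (fun s => prop K r + ∫ u in (0 : ℝ)..s, Complex.I •
        (prop K (r + u) * K (r + u))) fun s => 0 + Complex.I • (prop K (r + s) * K (r + s)) := by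
      refine (IsACPath.const _).add (IsACPath.primitive ?_ (.of_le (M := M) fun u => ?_) 0)
      · exact ((((continuous_prop hK).comp (continuous_const.add
          continuous_id)).aestronglyMeasurable).mul hKr.meas).const_smul _
      · rw [norm_smul, Complex.norm_I, one_mul]
        exact (norm_mul_le _ _).trans ((mul_le_mul (norm_prop_le_one hK _) (hK.bound _)
          (norm_nonneg _) zero_le_one).trans (one_mul M).le)
    have he : (fun s => prop K (r + s)) = fun s => prop K r + ∫ u in (0 : ℝ)..s, Complex.I •
        (prop K (r + u) * K (r + u)) := by
      funext s
      rw [intervalIntegral.integral_comp_add_left (fun u => Complex.I • (prop K u * K u)) r,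
        add_zero]
      refine (isACPath_prop hK).eq_add_integral (.of_le (M := M) fun u => ?_) r (r + s)
      rw [norm_smul, Complex.norm_I, one_mul]
      exact (norm_mul_le _ _).trans ((mul_le_mul (norm_prop_le_one hK _) (hK.bound _)
        (norm_nonneg _) zero_le_one).trans (one_mul M).le)
    rw [he]
    refine h.congr fun s => ?_
    rw [zero_add]
  have h := ((IsACPath.const (star (prop K r))).mul hsh).congr (y := fun s =>
    Complex.I • (star (prop K r) * prop K (r + s) * K (r + s))) fun s => by
      simp [mul_assoc]
  have h2 := eq_mul_prop hKr h s
  rw [add_zero, star_prop_mul hK, one_mul] at h2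
  exact h2.symm

end Algebra

/-! ### Local algebras -/

theorem isClosed_of_fg {A : Type*} [CStarAlgebra A] {V : Submodule ℂ A} (hV : V.FG) :
    IsClosed (V : Set A) :=
  haveI : FiniteDimensional ℂ V := Module.Finite.iff_fg.mpr hV
  Submodule.closed_of_finiteDimensional V

section LocalAlgebras

variable {n : ℤ → ℕ}

theorem siteOp_mul (j : ℤ) (M N : Matrix (Fin (n j)) (Fin (n j)) ℂ) :
    siteOp j M * siteOp j N = siteOp j (M * N) := by
  ext ξ m
  change siteOp j M (siteOp j N ξ) m = _
  simp only [siteOp_apply, Function.update_self, Function.update_idem, Matrix.mul_apply,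
    Finset.mul_sum, Finset.sum_mul]
  rw [Finset.sum_comm]
  simp only [mul_assoc]

theorem siteOp_one (j : ℤ) : siteOp (n := n) j 1 = 1 := by
  ext ξ m
  rw [siteOp_apply]
  simp [Matrix.one_apply]

theorem siteOp_add (j : ℤ) (M N : Matrix (Fin (n j)) (Fin (n j)) ℂ) :
    siteOp j (M + N) = siteOp j M + siteOp j N := by
  simp [siteOp, add_smul, Finset.sum_add_distrib]

theorem siteOp_smul (j : ℤ) (c : ℂ) (M : Matrix (Fin (n j)) (Fin (n j)) ℂ) :
    siteOp j (c • M) = c • siteOp j M := by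
  simp [siteOp, mul_smul, Finset.smul_sum]

theorem siteOp_comm {i j : ℤ} (hij : i ≠ j) (M : Matrix (Fin (n i)) (Fin (n i)) ℂ)
    (N : Matrix (Fin (n j)) (Fin (n j)) ℂ) : Commute (siteOp i M) (siteOp j N) := by
  ext ξ m
  change siteOp i M (siteOp j N ξ) m = siteOp j N (siteOp i M ξ) m
  simp only [siteOp_apply, Finset.mul_sum]
  rw [Finset.sum_comm]
  refine Finset.sum_congr rfl fun b _ => Finset.sum_congr rfl fun a _ => ?_
  rw [Function.update_of_ne hij.symm, Function.update_of_ne hij, Function.update_comm hij]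
  ring

theorem star_matrixUnit (j : ℤ) (a b : Fin (n j)) :
    star (matrixUnit (n := n) j a b) = matrixUnit j b a := by
  rw [ContinuousLinearMap.star_eq_adjoint]
  symm
  rw [ContinuousLinearMap.eq_adjoint_iff]
  intro ξ η
  rw [lp.inner_eq_tsum, lp.inner_eq_tsum, ← (swapAt j a b).tsum_eq]
  congr 1
  funext m
  have h : ∀ a b (ξ : ConfigSpace n) m, (matrixUnit j a b ξ : ConfigSpace n) m =
      if m j = a then ξ (Function.update m j b) else 0 := fun _ _ _ _ => rfl
  rw [h, h]
  by_cases hm : m j = a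
  · rw [swapAt_apply_of_eq hm, if_pos hm, if_pos (by simp)]
    simp [← hm]
  · rw [if_neg hm, if_neg]
    · simp
    · intro h2
      change Function.update m j (Equiv.swap a b (m j)) j = b at h2
      rw [Function.update_self] at h2
      apply hm
      exact (Equiv.swap a b).injective (h2.trans (Equiv.swap_apply_left a b).symm)

theorem star_siteOp (j : ℤ) (M : Matrix (Fin (n j)) (Fin (n j)) ℂ) :
    star (siteOp j M) = siteOp j M.conjTranspose := by
  simp only [siteOp, star_sum, star_smul, star_matrixUnit, Matrix.conjTranspose_apply]
  rw [Finset.sum_comm]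

/-- The observable `M` at the site `j`, as an element of the spin chain algebra. -/
def site (j : ℤ) (M : Matrix (Fin (n j)) (Fin (n j)) ℂ) : ChainAlgebra n :=
  ⟨siteOp j M, StarSubalgebra.le_topologicalClosure _
    (StarAlgebra.subset_adjoin ℂ _ ⟨j, Set.mem_univ j, M, rfl⟩)⟩

theorem toOp_injective : Function.Injective (toOp (n := n)) := Subtype.val_injective

theorem site_mul (j : ℤ) (M N : Matrix (Fin (n j)) (Fin (n j)) ℂ) :
    site j M * site j N = site j (M * N) :=
  toOp_injective (by rw [map_mul]; exact siteOp_mul j M N)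

theorem site_one (j : ℤ) : site (n := n) j 1 = 1 :=
  toOp_injective (by rw [map_one]; exact siteOp_one j)

theorem site_add (j : ℤ) (M N : Matrix (Fin (n j)) (Fin (n j)) ℂ) :
    site j (M + N) = site j M + site j N :=
  toOp_injective (by rw [map_add]; exact siteOp_add j M N)

theorem site_smul (j : ℤ) (c : ℂ) (M : Matrix (Fin (n j)) (Fin (n j)) ℂ) :
    site j (c • M) = c • site j M :=
  toOp_injective (by rw [map_smul]; exact siteOp_smul j c M)

theorem star_site (j : ℤ) (M : Matrix (Fin (n j)) (Fin (n j)) ℂ) :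
    star (site j M) = site j M.conjTranspose :=
  toOp_injective (by rw [map_star]; exact star_siteOp j M)

/-- The observables at the site `j` as a linear image of a matrix algebra. -/
def siteₗ (j : ℤ) : Matrix (Fin (n j)) (Fin (n j)) ℂ →ₗ[ℂ] ChainAlgebra n where
  toFun := site j
  map_add' := site_add j
  map_smul' := site_smul j

/-- The observables at the sites of `X`. -/
def siteSet (n : ℤ → ℕ) (X : Set ℤ) : Set (ChainAlgebra n) :=
  {a | ∃ j ∈ X, ∃ M : Matrix (Fin (n j)) (Fin (n j)) ℂ, a = site j M}

/-- The `⋆`-subalgebra of the spin chain algebra generated by the observables at the sites of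
`X`. -/
def supp (n : ℤ → ℕ) (X : Set ℤ) : StarSubalgebra ℂ (ChainAlgebra n) :=
  StarAlgebra.adjoin ℂ (siteSet n X)

theorem mem_supp_iff {X : Set ℤ} {a : ChainAlgebra n} :
    a ∈ supp n X ↔ toOp a ∈ localAlgebra n X := by
  have h : (supp n X).map toOp = localAlgebra n X := by
    rw [supp, StarAlgHom.map_adjoin, localAlgebra]
    congr 1
    ext T
    constructor
    · rintro ⟨_, ⟨j, hj, M, rfl⟩, rfl⟩
      exact ⟨j, hj, M, rfl⟩
    · rintro ⟨j, hj, M, rfl⟩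
      exact ⟨site j M, ⟨j, hj, M, rfl⟩, rfl⟩
  rw [← h, StarSubalgebra.mem_map]
  constructor
  · exact fun ha => ⟨a, ha, rfl⟩
  · rintro ⟨b, hb, hba⟩
    rwa [← toOp_injective hba]

theorem isSupportedOn_iff {S : Finset ℤ} {a : ChainAlgebra n} :
    IsSupportedOn a S ↔ a ∈ supp n (S : Set ℤ) := mem_supp_iff.symm

theorem supp_mono {X Y : Set ℤ} (h : X ⊆ Y) : supp n X ≤ supp n Y :=
  StarAlgebra.adjoin_mono fun _ ⟨j, hj, M, e⟩ => ⟨j, h hj, M, e⟩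

theorem site_mem_supp {X : Set ℤ} {j : ℤ} (hj : j ∈ X)
    (M : Matrix (Fin (n j)) (Fin (n j)) ℂ) : site j M ∈ supp n X :=
  StarAlgebra.subset_adjoin ℂ _ ⟨j, hj, M, rfl⟩

/-- The generators are closed under the involution, so that it suffices to check a property on
them and for sums and products. -/
theorem supp_induction {X : Set ℤ} {p : ChainAlgebra n → Prop}
    (hs : ∀ j ∈ X, ∀ M, p (site j M)) (hc : ∀ c : ℂ, p (algebraMap ℂ _ c))
    (ha : ∀ a b, a ∈ supp n X → b ∈ supp n X → p a → p b → p (a + b))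
    (hm : ∀ a b, a ∈ supp n X → b ∈ supp n X → p a → p b → p (a * b))
    {a : ChainAlgebra n} (h : a ∈ supp n X) : p a := by
  have e : siteSet n X ∪ star (siteSet n X) = siteSet n X := by
    refine Set.union_eq_left.mpr ?_
    rintro a ⟨j, hj, M, hM⟩
    exact ⟨j, hj, M.conjTranspose, by rw [← star_site, ← hM, star_star]⟩
  have e2 : ∀ a, a ∈ supp n X ↔ a ∈ Algebra.adjoin ℂ (siteSet n X) := fun a => by
    rw [← StarSubalgebra.mem_toSubalgebra, supp, StarAlgebra.adjoin_toSubalgebra, e]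
  rw [e2] at h
  induction h using Algebra.adjoin_induction with
  | mem x hx => obtain ⟨j, hj, M, rfl⟩ := hx; exact hs j hj M
  | algebraMap r => exact hc r
  | add x y hx hy px py => exact ha x y ((e2 x).mpr hx) ((e2 y).mpr hy) px py
  | mul x y hx hy px py => exact hm x y ((e2 x).mpr hx) ((e2 y).mpr hy) px py

theorem site_commute {i j : ℤ} (hij : i ≠ j) (M : Matrix (Fin (n i)) (Fin (n i)) ℂ)
    (N : Matrix (Fin (n j)) (Fin (n j)) ℂ) : Commute (site i M) (site j N) :=
  toOp_injective (by rw [map_mul, map_mul]; exact siteOp_comm hij M N)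

/-- Locality: observables of disjoint sets of sites commute. -/
theorem commute_of_disjoint {X Y : Set ℤ} (hXY : Disjoint X Y) {a b : ChainAlgebra n}
    (ha : a ∈ supp n X) (hb : b ∈ supp n Y) : Commute a b := by
  refine supp_induction (p := fun a => Commute a b) (fun i hi M => ?_)
    (fun c => Algebra.commutes c b) (fun _ _ _ _ h₁ h₂ => h₁.add_left h₂)
    (fun _ _ _ _ h₁ h₂ => h₁.mul_left h₂) ha
  refine supp_induction (p := fun b => Commute (site i M) b) (fun j hj N => ?_)
    (fun c => (Algebra.commutes c _).symm) (fun _ _ _ _ h₁ h₂ => h₁.add_right h₂)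
    (fun _ _ _ _ h₁ h₂ => h₁.mul_right h₂) hb
  exact site_commute (fun e => Set.disjoint_left.mp hXY hi (by rw [e]; exact hj)) M N

theorem exists_finset_of_mem_supp {X : Set ℤ} {a : ChainAlgebra n} (ha : a ∈ supp n X) :
    ∃ S : Finset ℤ, (S : Set ℤ) ⊆ X ∧ a ∈ supp n (S : Set ℤ) := by
  classical
  refine supp_induction (p := fun a => ∃ S : Finset ℤ, (S : Set ℤ) ⊆ X ∧ a ∈ supp n (S : Set ℤ))
    (fun j hj M => ⟨{j}, by simpa using hj, site_mem_supp (by simp) M⟩)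
    (fun c => ⟨∅, by simp, StarSubalgebra.algebraMap_mem _ c⟩) ?_ ?_ ha
  · rintro a b - - ⟨S, hS, ha⟩ ⟨T, hT, hb⟩
    refine ⟨S ∪ T, by simp [hS, hT], ?_⟩
    rw [Finset.coe_union]
    exact add_mem (supp_mono Set.subset_union_left ha) (supp_mono Set.subset_union_right hb)
  · rintro a b - - ⟨S, hS, ha⟩ ⟨T, hT, hb⟩
    refine ⟨S ∪ T, by simp [hS, hT], ?_⟩
    rw [Finset.coe_union]
    exact mul_mem (supp_mono Set.subset_union_left ha) (supp_mono Set.subset_union_right hb)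

/-- The observables on finitely many sites are dense. -/
theorem dense_supp (n : ℤ → ℕ) : Dense (supp n Set.univ : Set (ChainAlgebra n)) := by
  intro a
  have h : a.1 ∈ closure (localAlgebra n Set.univ : Set (ConfigSpace n →L[ℂ] ConfigSpace n)) :=
    a.2
  rw [Metric.mem_closure_iff] at h ⊢
  intro ε hε
  obtain ⟨T, hT, hd⟩ := h ε hε
  exact ⟨⟨T, StarSubalgebra.le_topologicalClosure _ hT⟩, mem_supp_iff.mpr hT, hd⟩

/-- The local algebra `supp n X` as a linear subspace. -/
def suppSubmodule (n : ℤ → ℕ) (X : Set ℤ) : Submodule ℂ (ChainAlgebra n) :=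
  Subalgebra.toSubmodule (supp n X).toSubalgebra

theorem mem_suppSubmodule {X : Set ℤ} {a : ChainAlgebra n} :
    a ∈ suppSubmodule n X ↔ a ∈ supp n X := Iff.rfl

theorem suppSubmodule_union (X Y : Set ℤ) (hXY : Disjoint X Y) :
    suppSubmodule n (X ∪ Y) = suppSubmodule n X * suppSubmodule n Y := by
  apply le_antisymm
  · intro a ha
    change a ∈ supp n (X ∪ Y) at ha
    refine supp_induction ?_ ?_ (fun _ _ _ _ => add_mem) ?_ ha
    · rintro j (hj | hj) M
      · rw [← mul_one (site j M)]
        exact Submodule.mul_mem_mul (site_mem_supp hj M) (one_mem (supp n Y))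
      · rw [← one_mul (site j M)]
        exact Submodule.mul_mem_mul (one_mem (supp n X)) (site_mem_supp hj M)
    · intro c
      rw [← mul_one (algebraMap ℂ (ChainAlgebra n) c)]
      exact Submodule.mul_mem_mul (StarSubalgebra.algebraMap_mem (supp n X) c)
        (one_mem (supp n Y))
    · intro a b _ _ ha hb
      refine Submodule.mul_induction_on ha ?_ ?_
      · intro x hx y hy
        refine Submodule.mul_induction_on hb ?_ ?_
        · intro z hz w hw
          rw [mul_assoc, ← mul_assoc y, ← (commute_of_disjoint hXY hz hy).eq, mul_assoc,
            ← mul_assoc]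
          exact Submodule.mul_mem_mul (mul_mem (S := StarSubalgebra ℂ (ChainAlgebra n)) hx hz)
            (mul_mem (S := StarSubalgebra ℂ (ChainAlgebra n)) hy hw)
        · intro z w hz hw
          rw [mul_add]
          exact add_mem hz hw
      · intro x y hx hy
        rw [add_mul]
        exact add_mem hx hy
  · rw [Submodule.mul_le]
    intro x hx y hy
    exact mul_mem (S := StarSubalgebra ℂ (ChainAlgebra n))
      (supp_mono Set.subset_union_left hx) (supp_mono Set.subset_union_right hy)

theorem exists_smul_one_of_mem_supp_empty {a : ChainAlgebra n} (ha : a ∈ supp n ∅) :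
    ∃ c : ℂ, a = c • 1 := by
  refine supp_induction (p := fun a => ∃ c : ℂ, a = c • 1) (fun j hj => (hj.elim))
    (fun c => ⟨c, Algebra.algebraMap_eq_smul_one c⟩) ?_ ?_ ha
  · rintro _ _ - - ⟨c, rfl⟩ ⟨d, rfl⟩
    exact ⟨c + d, (add_smul c d 1).symm⟩
  · rintro _ _ - - ⟨c, rfl⟩ ⟨d, rfl⟩
    exact ⟨d * c, by simp [mul_smul]⟩

theorem exists_site_of_mem_supp_singleton {j : ℤ} {a : ChainAlgebra n} (ha : a ∈ supp n {j}) :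
    ∃ M, a = site j M := by
  refine supp_induction (p := fun a => ∃ M, a = site j M) ?_ ?_ ?_ ?_ ha
  · rintro i rfl M
    exact ⟨M, rfl⟩
  · exact fun c => ⟨c • 1, by rw [site_smul, site_one, Algebra.algebraMap_eq_smul_one]⟩
  · rintro _ _ - - ⟨M, rfl⟩ ⟨N, rfl⟩
    exact ⟨M + N, (site_add j M N).symm⟩
  · rintro _ _ - - ⟨M, rfl⟩ ⟨N, rfl⟩
    exact ⟨M * N, site_mul j M N⟩

theorem fg_suppSubmodule (S : Finset ℤ) : (suppSubmodule n (S : Set ℤ)).FG := by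
  classical
  induction S using Finset.induction_on with
  | empty =>
    refine ⟨{1}, le_antisymm ?_ fun a ha => ?_⟩
    · rw [Submodule.span_le]
      rintro _ hx
      rw [Finset.coe_singleton, Set.mem_singleton_iff] at hx
      rw [hx]
      exact one_mem (supp n _)
    · change a ∈ supp n _ at ha
      rw [Finset.coe_empty] at ha
      obtain ⟨c, rfl⟩ := exists_smul_one_of_mem_supp_empty ha
      exact Submodule.smul_mem _ _ (Submodule.subset_span (by simp))
  | insert j S hj ih =>
    rw [Finset.coe_insert, Set.insert_eq, suppSubmodule_union _ _ (by simpa using hj)]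
    refine Submodule.FG.mul ?_ ih
    have : suppSubmodule n {j} = LinearMap.range (siteₗ (n := n) j) := by
      apply le_antisymm
      · intro a ha
        obtain ⟨M, rfl⟩ := exists_site_of_mem_supp_singleton ha
        exact ⟨M, rfl⟩
      · rintro _ ⟨M, rfl⟩
        exact site_mem_supp (by simp) M
    rw [this, LinearMap.range_eq_map]
    exact Submodule.FG.map _ Module.Finite.fg_top

theorem isClosed_supp (S : Finset ℤ) : IsClosed (supp n (S : Set ℤ) : Set (ChainAlgebra n)) :=
  isClosed_of_fg (fg_suppSubmodule S)

/-- Two continuous maps which agree on finite sets of sites are equal. -/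
theorem eq_of_eq_on_local {F : Type*} [TopologicalSpace F] [T2Space F]
    {f g : ChainAlgebra n → F} (hf : Continuous f) (hg : Continuous g)
    (h : ∀ S : Finset ℤ, ∀ a ∈ supp n (S : Set ℤ), f a = g a) : f = g :=
  hf.ext_on (dense_supp n) hg fun a ha => by
    obtain ⟨S, -, hS⟩ := exists_finset_of_mem_supp ha
    exact h S a hS

end LocalAlgebras

/-! ### The decay kernel -/

section Kernel

/-- The kernel `F(d) = (1 + |d|)⁻²`, which controls the decay of all interactions. -/
def decay (d : ℤ) : ℝ := ((1 + |(d : ℝ)|) ^ 2)⁻¹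

theorem decay_pos (d : ℤ) : 0 < decay d := by unfold decay; positivity

theorem decay_nonneg (d : ℤ) : 0 ≤ decay d := (decay_pos d).le

theorem decay_zero : decay 0 = 1 := by simp [decay]

theorem decay_neg (d : ℤ) : decay (-d) = decay d := by simp [decay]

theorem decay_sub_comm (x y : ℤ) : decay (x - y) = decay (y - x) := by
  rw [← decay_neg, neg_sub]

theorem decay_natAbs (d : ℤ) : decay (d.natAbs : ℤ) = decay d := by
  unfold decay
  rw [← Int.cast_abs, ← Int.cast_abs, Int.natCast_natAbs, abs_abs]

theorem summable_decay : Summable decay := by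
  rw [summable_int_iff_summable_nat_and_neg]
  have h : Summable fun k : ℕ => decay (k : ℤ) := by
    have h1 := (summable_nat_add_iff 1).mpr (Real.summable_nat_pow_inv.mpr one_lt_two)
    refine h1.congr fun k => ?_
    simp [decay, add_comm]
  exact ⟨h, by simpa only [decay_neg] using h⟩

/-- The `ℓ¹`-norm of the decay kernel. -/
def decaySum : ℝ := ∑' d, decay d

theorem sum_decay_le (B : Finset ℤ) (x : ℤ) : ∑ z ∈ B, decay (x - z) ≤ decaySum := by
  have h : Summable fun z => decay (x - z) := (Equiv.subLeft x).summable_iff.mpr summable_decay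
  refine (h.sum_le_tsum B fun z _ => decay_nonneg _).trans (le_of_eq ?_)
  exact (Equiv.subLeft x).tsum_eq decay

theorem decaySum_nonneg : 0 ≤ decaySum := tsum_nonneg decay_nonneg

theorem one_le_decaySum : 1 ≤ decaySum := by
  simpa [decay_zero] using sum_decay_le {0} 0

/-- `F(x-z) F(z-y) ≤ 2 F(x-y) (F(x-z) + F(z-y))`, since one of the two distances is at least half of
`|x-y|`. -/
theorem decay_mul_decay_le (x y z : ℤ) :
    decay (x - z) * decay (z - y) ≤ 2 * decay (x - y) * (decay (x - z) + decay (z - y)) := by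
  unfold decay
  push_cast
  set a := |(x : ℝ) - z|
  set b := |(z : ℝ) - y|
  have hab : |(x : ℝ) - y| ≤ a + b := abs_sub_le _ _ _
  have ha : 0 ≤ a := abs_nonneg _
  have hb : 0 ≤ b := abs_nonneg _
  have hc : 0 ≤ |(x : ℝ) - y| := abs_nonneg _
  have h1 : (1 + |(x : ℝ) - y|) ^ 2 ≤ 2 * ((1 + a) ^ 2 + (1 + b) ^ 2) := by
    nlinarith [sq_nonneg (a - b)]
  have h2 : ((1 + a) ^ 2)⁻¹ * ((1 + b) ^ 2)⁻¹ = (((1 + a) ^ 2)⁻¹ + ((1 + b) ^ 2)⁻¹) *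
      ((1 + a) ^ 2 + (1 + b) ^ 2)⁻¹ := by field_simp; ring
  rw [h2, mul_comm]
  refine mul_le_mul_of_nonneg_right ?_ (by positivity)
  rw [← div_eq_mul_inv, inv_le_comm₀ (by positivity) (by positivity), inv_div]
  linarith

/-- The decay kernel reproduces itself under convolution. -/
theorem sum_decay_mul_decay_le (B : Finset ℤ) (x y : ℤ) :
    ∑ z ∈ B, decay (x - z) * decay (z - y) ≤ 4 * decaySum * decay (x - y) := by
  have h : ∑ z ∈ B, decay (x - z) * decay (z - y) ≤
      ∑ z ∈ B, 2 * decay (x - y) * (decay (x - z) + decay (z - y)) :=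
    Finset.sum_le_sum fun z _ => decay_mul_decay_le x y z
  rw [← Finset.mul_sum, Finset.sum_add_distrib] at h
  have h1 := sum_decay_le B x
  have h2 := sum_decay_le B y
  simp_rw [decay_sub_comm y] at h2
  have h3 := decay_pos (x - y)
  nlinarith

end Kernel

/-! ### Comparison of propagators -/

section Comparison

variable {A : Type*} [CStarAlgebra A]

theorem norm_unitary_conj {u : A} (hu : u ∈ unitary A) (x : A) : ‖u * x * star u‖ = ‖x‖ := by
  rw [CStarRing.norm_mul_mem_unitary _ (Unitary.star_mem hu), CStarRing.norm_mem_unitary_mul _ hu]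

theorem norm_star_unitary_conj {u : A} (hu : u ∈ unitary A) (x : A) :
    ‖star u * x * u‖ = ‖x‖ := by
  have := norm_unitary_conj (Unitary.star_mem hu) x
  rwa [star_star] at this

theorem norm_commutator_le (a b : A) : ‖a * b - b * a‖ ≤ 2 * ‖a‖ * ‖b‖ := by
  refine (norm_sub_le _ _).trans ?_
  have h1 := norm_mul_le a b
  have h2 := norm_mul_le b a
  nlinarith

variable {K K₀ : ℝ → A} {M M₀ : ℝ}

/-- If `a` commutes with the part `K₀` of the Hamiltonian `K`, then only `K - K₀` contributes to the
growth of the commutator of the evolved observable `a` with `b`. -/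
theorem norm_commutator_evolved_le (hK : IsDriver K M) (hK₀ : IsDriver K₀ M₀) {a b : A}
    (ha : ∀ u, Commute (prop K₀ u) a) {t : ℝ} (ht : 0 ≤ t) {g : ℝ → ℝ} (hg : Continuous g)
    (hb : ∀ u ∈ Set.Icc 0 t, ‖prop K u * (K u - K₀ u) * star (prop K u) * b -
      b * (prop K u * (K u - K₀ u) * star (prop K u))‖ ≤ g u) :
    ‖prop K t * a * star (prop K t) * b - b * (prop K t * a * star (prop K t))‖ ≤
      ‖a * b - b * a‖ + 2 * ‖a‖ * ∫ u in (0 : ℝ)..t, g u := by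
  set U := prop K with hU
  set W := prop K₀ with hW
  have hUu : ∀ s, U s ∈ unitary A := prop_mem_unitary hK
  have hWu : ∀ s, W s ∈ unitary A := prop_mem_unitary hK₀
  have hU2 : ∀ s, U s * star (U s) = 1 := prop_mul_star hK
  have hW1 : ∀ s, star (W s) * W s = 1 := star_prop_mul hK₀
  -- in the interaction picture only `K - K₀` moves `Q`, and since `W` commutes with `a`, the
  -- commutator of `a` with `Q t` has the norm which is to be estimated
  set Q : ℝ → A := fun s => W s * (star (U s) * b * U s) * star (W s) with hQ
  have hac : IsACPath Q fun s => -(Complex.I • (W s * ((K s - K₀ s) * (star (U s) * b * U s) -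
      star (U s) * b * U s * (K s - K₀ s)) * star (W s))) := by
    refine (((isACPath_prop hK₀).mul (((isACPath_prop hK).star.mul (IsACPath.const b)).mul
      (isACPath_prop hK))).mul (isACPath_prop hK₀).star).congr fun s => ?_
    simp only [star_smul, star_mul, hK.sa, hK₀.sa, Complex.star_def, Complex.conj_I, ← hU, ← hW,
      mul_zero, add_zero]
    simp only [smul_mul_assoc, mul_smul_comm, neg_smul, neg_mul, mul_neg, mul_add, add_mul,
      mul_sub, sub_mul, mul_assoc, smul_sub]
    abel
  have hnorm : ∀ u, ‖-(Complex.I • (W u * ((K u - K₀ u) * (star (U u) * b * U u) -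
      star (U u) * b * U u * (K u - K₀ u)) * star (W u)))‖ =
      ‖U u * (K u - K₀ u) * star (U u) * b - b * (U u * (K u - K₀ u) * star (U u))‖ := fun u => by
    rw [norm_neg, norm_smul, Complex.norm_I, one_mul, norm_unitary_conj (hWu u),
      ← norm_unitary_conj (hUu u)]
    congr 1
    have h1 : ∀ x, U u * (star (U u) * x) = x := fun x => by rw [← mul_assoc, hU2, one_mul]
    simp only [mul_sub, sub_mul, mul_assoc, h1, hU2, mul_one]
  have hlb : IsLocBdd fun s => -(Complex.I • (W s * ((K s - K₀ s) * (star (U s) * b * U s) -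
      star (U s) * b * U s * (K s - K₀ s)) * star (W s))) := by
    refine .of_le (M := 2 * (M + M₀) * ‖b‖) fun u => ?_
    rw [hnorm]
    refine (norm_commutator_le _ _).trans ?_
    rw [norm_unitary_conj (hUu u)]
    have := (norm_sub_le (K u) (K₀ u)).trans (add_le_add (hK.bound u) (hK₀.bound u))
    gcongr
  have hmain := hac.norm_sub_le hlb ht (hg.intervalIntegrable 0 t)
    (fun u hu => (hnorm u).le.trans (hb u hu))
  have hQ0 : Q 0 = b := by simp [hQ, hU, hW, prop_zero hK, prop_zero hK₀]
  have haW : Commute a (W t) := (ha t).symm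
  have haW' : Commute a (star (W t)) := by
    have h := congrArg (fun x => star (W t) * x * star (W t)) haW.eq
    simp only [mul_assoc] at h
    rw [show W t * star (W t) = 1 from prop_mul_star hK₀ t, mul_one,
      ← mul_assoc (star (W t)) (W t), hW1, one_mul] at h
    exact h.symm
  have hl : ‖U t * a * star (U t) * b - b * (U t * a * star (U t))‖ = ‖a * Q t - Q t * a‖ := by
    have h1 : ∀ x, U t * (star (U t) * x) = x := fun x => by rw [← mul_assoc, hU2, one_mul]
    have e1 : a * Q t - Q t * a = W t * (a * (star (U t) * b * U t) -
        star (U t) * b * U t * a) * star (W t) := by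
      have e2 : a * Q t = W t * (a * (star (U t) * b * U t)) * star (W t) := by
        rw [hQ]; simp only [← mul_assoc]; rw [haW.eq]
      have e3 : Q t * a = W t * (star (U t) * b * U t * a) * star (W t) := by
        rw [hQ]; simp only [mul_assoc]; rw [haW'.eq]
      rw [e2, e3, mul_sub, sub_mul]
    rw [e1, norm_unitary_conj (hWu t), ← norm_unitary_conj (hUu t)
      (a * (star (U t) * b * U t) - _)]
    congr 1
    simp only [mul_sub, sub_mul, mul_assoc, h1, hU2, mul_one]
  rw [hl]
  have e4 : a * Q t - Q t * a = (a * b - b * a) + (a * (Q t - Q 0) - (Q t - Q 0) * a) := by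
    rw [hQ0]; noncomm_ring
  rw [e4]
  refine (norm_add_le _ _).trans (add_le_add_right ?_ _)
  exact (norm_commutator_le _ _).trans (mul_le_mul_of_nonneg_left hmain (by positivity))

/-- The unitary `Y = U U₀⋆` of the interaction picture almost commutes with `b` if the evolved
perturbation does. -/
theorem norm_interaction_conj_sub_le (hK : IsDriver K M) (hK₀ : IsDriver K₀ M₀) {b : A} {t : ℝ}
    (ht : 0 ≤ t) {g : ℝ} (hb : ∀ u ∈ Set.Icc 0 t,
      ‖prop K₀ u * (K u - K₀ u) * star (prop K₀ u) * b -
        b * (prop K₀ u * (K u - K₀ u) * star (prop K₀ u))‖ ≤ g) :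
    ‖prop K t * star (prop K₀ t) * b * star (prop K t * star (prop K₀ t)) - b‖ ≤ g * t := by
  set U := prop K with hU
  set W := prop K₀ with hW
  have hW1 : ∀ s, star (W s) * W s = 1 := star_prop_mul hK₀
  have hYu : ∀ u, U u * star (W u) ∈ unitary A := fun u =>
    mul_mem (prop_mem_unitary hK u) (Unitary.star_mem (prop_mem_unitary hK₀ u))
  have hac : IsACPath (fun s => U s * star (W s) * b * star (U s * star (W s))) fun s =>
      Complex.I • (U s * star (W s) * (W s * (K s - K₀ s) * star (W s) * b -
        b * (W s * (K s - K₀ s) * star (W s))) * star (U s * star (W s))) := by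
    have hY := (isACPath_prop hK).mul (isACPath_prop hK₀).star
    refine ((hY.mul (IsACPath.const b)).mul hY.star).congr fun s => ?_
    have h1 : ∀ x, star (W s) * (W s * x) = x := fun x => by rw [← mul_assoc, hW1, one_mul]
    simp only [star_smul, star_mul, star_add, star_star, hK.sa, hK₀.sa, Complex.star_def,
      Complex.conj_I, map_neg, neg_neg, ← hU, ← hW, mul_zero, add_zero]
    simp only [smul_mul_assoc, mul_smul_comm, neg_smul, neg_mul, mul_neg, mul_add, add_mul,
      mul_sub, sub_mul, mul_assoc, smul_sub, h1]
    abel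
  have hnorm : ∀ u, ‖Complex.I • (U u * star (W u) * (W u * (K u - K₀ u) * star (W u) * b -
        b * (W u * (K u - K₀ u) * star (W u))) * star (U u * star (W u)))‖ =
      ‖W u * (K u - K₀ u) * star (W u) * b - b * (W u * (K u - K₀ u) * star (W u))‖ :=
    fun u => by
      rw [norm_smul, Complex.norm_I, one_mul, norm_unitary_conj (hYu u)]
  have h := hac.norm_sub_le (.of_le (M := 2 * (M + M₀) * ‖b‖) fun u => by
    rw [hnorm]
    refine (norm_commutator_le _ _).trans ?_
    rw [norm_unitary_conj (prop_mem_unitary hK₀ u)]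
    have := (norm_sub_le (K u) (K₀ u)).trans (add_le_add (hK.bound u) (hK₀.bound u))
    gcongr) ht (g := fun _ => g) intervalIntegrable_const
    (fun u hu => (hnorm u).le.trans (hb u hu))
  rw [intervalIntegral.integral_const, smul_eq_mul, sub_zero, mul_comm] at h
  simpa [hU, hW, prop_zero hK, prop_zero hK₀] using h

end Comparison

/-! ### The Lieb-Robinson bound -/

section LiebRobinson

attribute [local irreducible] instCStarAlgebraChainAlgebra

variable {n : ℤ → ℕ}

/-- A time-dependent family of local terms with the decay needed for a Lieb-Robinson bound,
uniformly in time. The bound is stated for finite families of sets. -/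
structure IsRegular (C : ℝ) (Φ : Finset ℤ → ℝ → ChainAlgebra n) : Prop where
  sa : ∀ Z u, star (Φ Z u) = Φ Z u
  mem : ∀ (Z : Finset ℤ) u, Φ Z u ∈ supp n (Z : Set ℤ)
  meas : ∀ Z, AEStronglyMeasurable (Φ Z)
  empty : ∀ u, Φ ∅ u = 0
  bound : ∀ (u : ℝ) (x : ℤ) (d : ℕ) (𝒵 : Finset (Finset ℤ)),
    (∀ Z ∈ 𝒵, x ∈ Z ∧ d ≤ diam Z) → ∑ Z ∈ 𝒵, ‖Φ Z u‖ ≤ C * decay d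

/-- The Hamiltonian with the terms of a finite family of sets. -/
def ham (Φ : Finset ℤ → ℝ → ChainAlgebra n) (𝒵 : Finset (Finset ℤ)) (u : ℝ) : ChainAlgebra n :=
  ∑ Z ∈ 𝒵, Φ Z u

theorem natAbs_sub_le_diam {Z : Finset ℤ} {x y : ℤ} (hx : x ∈ Z) (hy : y ∈ Z) :
    (x - y).natAbs ≤ diam Z :=
  (Finset.le_sup (f := fun j => (x - j).natAbs) hy).trans
    (Finset.le_sup (f := fun i => Z.sup fun j => (i - j).natAbs) hx)

namespace IsRegular

variable {C : ℝ} {Φ : Finset ℤ → ℝ → ChainAlgebra n}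

theorem shift (h : IsRegular C Φ) (r : ℝ) : IsRegular C fun Z u => Φ Z (r + u) where
  sa Z _ := h.sa Z _
  mem Z _ := h.mem Z _
  meas Z := (h.meas Z).comp_measurePreserving (measurePreserving_add_left volume r)
  empty _ := h.empty _
  bound u := h.bound (r + u)

theorem nonneg (h : IsRegular C Φ) : 0 ≤ C := by
  have := h.bound 0 0 0 ∅ (by simp)
  simpa [decay_zero] using this

theorem sum_le (h : IsRegular C Φ) (u : ℝ) (x : ℤ) (𝒵 : Finset (Finset ℤ))
    (hx : ∀ Z ∈ 𝒵, x ∈ Z) : ∑ Z ∈ 𝒵, ‖Φ Z u‖ ≤ C := by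
  have := h.bound u x 0 𝒵 fun Z hZ => ⟨hx Z hZ, Nat.zero_le _⟩
  simpa [decay_zero] using this

theorem norm_le (h : IsRegular C Φ) (Z : Finset ℤ) (u : ℝ) : ‖Φ Z u‖ ≤ C := by
  rcases Z.eq_empty_or_nonempty with rfl | ⟨x, hx⟩
  · rw [h.empty, norm_zero]; exact h.nonneg
  · simpa using h.sum_le u x {Z} (by simpa using hx)

theorem isDriver (h : IsRegular C Φ) (𝒵 : Finset (Finset ℤ)) :
    IsDriver (ham Φ 𝒵) (∑ _Z ∈ 𝒵, C) where
  meas := by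
    have := Finset.aestronglyMeasurable_sum 𝒵 fun Z _ => h.meas Z
    refine this.congr (.of_forall fun u => ?_)
    simp [ham]
  bound u := (norm_sum_le _ _).trans (Finset.sum_le_sum fun Z _ => h.norm_le Z u)
  sa u := by simp [ham, star_sum, h.sa]

theorem sum_decay_le (h : IsRegular C Φ) (u : ℝ) (x z : ℤ) (𝒵 : Finset (Finset ℤ))
    (hx : ∀ Z ∈ 𝒵, x ∈ Z ∧ z ∈ Z) : ∑ Z ∈ 𝒵, ‖Φ Z u‖ ≤ C * decay (x - z) := by
  rw [← decay_natAbs]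
  exact h.bound u x _ 𝒵 fun Z hZ => ⟨(hx Z hZ).1,
    natAbs_sub_le_diam (hx Z hZ).1 (hx Z hZ).2⟩

end IsRegular

theorem sum_mul_sum_comm (𝒵 : Finset (Finset ℤ)) (v : Finset ℤ → ℝ) (w : ℤ → ℝ) :
    ∑ Z ∈ 𝒵, v Z * ∑ x ∈ Z, w x =
      ∑ x ∈ 𝒵.sup id, w x * ∑ Z ∈ 𝒵 with x ∈ Z, v Z := by
  simp_rw [Finset.mul_sum]
  rw [Finset.sum_comm' (t' := 𝒵.sup id) (s' := fun x => 𝒵.filter (x ∈ ·))]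
  · exact Finset.sum_congr rfl fun x _ => Finset.sum_congr rfl fun Z _ => mul_comm _ _
  · intro Z x
    simp only [Finset.mem_filter, Finset.mem_sup, id]
    exact ⟨fun h => ⟨⟨h.1, h.2⟩, Z, h.1, h.2⟩, fun h => h.1⟩

/-- The rate of growth in the Lieb-Robinson bound. -/
def lrRate (C : ℝ) : ℝ := 4 * decaySum * C

/-- The sum of the kernel over two sets of sites. -/
def decayPair (X Y : Finset ℤ) : ℝ := ∑ x ∈ X, ∑ y ∈ Y, decay (x - y)

theorem decayPair_comm (X Y : Finset ℤ) : decayPair X Y = decayPair Y X := by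
  unfold decayPair
  rw [Finset.sum_comm]
  simp_rw [decay_sub_comm]

theorem decayPair_nonneg (X Y : Finset ℤ) : 0 ≤ decayPair X Y :=
  Finset.sum_nonneg fun _ _ => Finset.sum_nonneg fun _ _ => decay_nonneg _

variable {C : ℝ} {Φ : Finset ℤ → ℝ → ChainAlgebra n}

/-- One step of the iteration of the Lieb-Robinson bound: sum over the terms which meet `X`. -/
theorem IsRegular.sum_weight_le (h : IsRegular C Φ) (u : ℝ) (𝒵 : Finset (Finset ℤ))
    (X : Finset ℤ) (w : ℤ → ℝ) (hw : ∀ x, 0 ≤ w x) :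
    ∑ Z ∈ 𝒵 with ¬Disjoint Z X, ‖Φ Z u‖ * ∑ z ∈ Z, w z ≤
      ∑ x ∈ X, C * ∑ z ∈ 𝒵.sup id, decay (x - z) * w z := by
  have hC := h.nonneg
  calc ∑ Z ∈ 𝒵 with ¬Disjoint Z X, ‖Φ Z u‖ * ∑ z ∈ Z, w z
      ≤ ∑ Z ∈ 𝒵 with ¬Disjoint Z X, ∑ x ∈ X with x ∈ Z, ‖Φ Z u‖ * ∑ z ∈ Z, w z := by
        refine Finset.sum_le_sum fun Z hZ => ?_
        obtain ⟨x, hxZ, hxX⟩ := Finset.not_disjoint_iff.mp (Finset.mem_filter.mp hZ).2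
        exact Finset.single_le_sum (f := fun _ => ‖Φ Z u‖ * ∑ z ∈ Z, w z)
          (fun _ _ => mul_nonneg (norm_nonneg _) (Finset.sum_nonneg fun z _ => hw z))
          (Finset.mem_filter.mpr ⟨hxX, hxZ⟩)
    _ ≤ ∑ x ∈ X, ∑ Z ∈ 𝒵 with x ∈ Z, ‖Φ Z u‖ * ∑ z ∈ Z, w z := by
        rw [Finset.sum_comm' (t' := X) (s' := fun x => 𝒵.filter (x ∈ ·))]
        intro Z x
        simp only [Finset.mem_filter]
        refine ⟨fun h => ⟨⟨h.1.1, h.2.2⟩, h.2.1⟩, fun h => ⟨⟨h.1.1, ?_⟩, h.2, h.1.2⟩⟩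
        exact Finset.not_disjoint_iff.mpr ⟨x, h.1.2, h.2⟩
    _ ≤ ∑ x ∈ X, C * ∑ z ∈ 𝒵.sup id, decay (x - z) * w z := by
        refine Finset.sum_le_sum fun x _ => ?_
        rw [sum_mul_sum_comm, Finset.mul_sum]
        refine (Finset.sum_le_sum_of_subset_of_nonneg (t := 𝒵.sup id) ?_ ?_).trans ?_
        · exact Finset.sup_mono (Finset.filter_subset _ _)
        · exact fun z _ _ => mul_nonneg (hw z) (Finset.sum_nonneg fun _ _ => norm_nonneg _)
        · refine Finset.sum_le_sum fun z _ => ?_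
          rw [mul_comm (decay _), mul_left_comm]
          refine mul_le_mul_of_nonneg_left ?_ (hw z)
          refine h.sum_decay_le u x z _ fun Z hZ => ?_
          simp only [Finset.mem_filter] at hZ
          exact ⟨hZ.1.2, hZ.2⟩

theorem prop_ham_mem (h : IsRegular C Φ) {Γ : Set ℤ} (𝒵 : Finset (Finset ℤ))
    (hΓ : ∀ Z ∈ 𝒵, (Z : Set ℤ) ⊆ Γ) (s : ℝ) : prop (ham Φ 𝒵) s ∈ supp n Γ := by
  have hs : ((𝒵.sup id : Finset ℤ) : Set ℤ) ⊆ Γ := by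
    intro x hx
    obtain ⟨Z, hZ, hxZ⟩ := Finset.mem_sup.mp (Finset.mem_coe.mp hx)
    exact hΓ Z hZ hxZ
  refine supp_mono hs ?_
  refine prop_mem (B := (supp n _).toSubalgebra) (isClosed_supp _) (h.isDriver 𝒵) (fun u => ?_) s
  refine sum_mem fun Z hZ => supp_mono ?_ (h.mem Z u)
  exact Finset.coe_subset.mpr (Finset.le_sup (f := id) hZ)

/-- The bound after `k` steps of the iteration, by induction on `k`. The first summand reproduces
itself, because the convolution of the kernel with itself is dominated by the kernel; the second
one is what is left of the trivial bound `2 ‖a‖ ‖b‖`, and it vanishes as `k → ∞`. -/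
theorem IsRegular.lieb_robinson_aux (h : IsRegular C Φ) (𝒵 : Finset (Finset ℤ)) {Y : Finset ℤ}
    {b : ChainAlgebra n} (hb : b ∈ supp n (Y : Set ℤ)) (k : ℕ) :
    ∀ t ∈ Set.Icc (0 : ℝ) 1, ∀ (X : Finset ℤ), ∀ a ∈ supp n (X : Set ℤ),
      ‖prop (ham Φ 𝒵) t * a * star (prop (ham Φ 𝒵) t) * b -
        b * (prop (ham Φ 𝒵) t * a * star (prop (ham Φ 𝒵) t))‖ ≤
      ‖a‖ * ‖b‖ * ∑ x ∈ X, (2 * Real.exp (2 * lrRate C * t) * ∑ y ∈ Y, decay (x - y) +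
        2 * ((2 * lrRate C * t) ^ k / k.factorial)) := by
  have hC := h.nonneg
  have hS := one_le_decaySum
  have hc : 0 ≤ lrRate C := by unfold lrRate; positivity
  have hU := h.isDriver 𝒵
  induction k with
  | zero =>
    intro t ht X a ha
    rcases X.eq_empty_or_nonempty with rfl | ⟨x, hx⟩
    · rw [Finset.coe_empty] at ha
      obtain ⟨c, rfl⟩ := exists_smul_one_of_mem_supp_empty ha
      simp [prop_mul_star hU]
    · refine (norm_commutator_le _ _).trans ?_
      rw [norm_unitary_conj (prop_mem_unitary hU t)]
      have hg : ∀ x, 0 ≤ 2 * Real.exp (2 * lrRate C * t) * ∑ y ∈ Y, decay (x - y) := fun x =>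
        mul_nonneg (by positivity) (Finset.sum_nonneg fun y _ => decay_nonneg _)
      have h1 := Finset.single_le_sum (f := fun x => 2 * Real.exp (2 * lrRate C * t) *
        ∑ y ∈ Y, decay (x - y) + 2 * ((2 * lrRate C * t) ^ 0 / (Nat.factorial 0 : ℝ)))
        (fun x _ => add_nonneg (hg x) (by simp)) hx
      have h2 : (2 : ℝ) ≤ ∑ x ∈ X, (2 * Real.exp (2 * lrRate C * t) * ∑ y ∈ Y, decay (x - y) +
          2 * ((2 * lrRate C * t) ^ 0 / (Nat.factorial 0 : ℝ))) :=
        le_trans (by simpa using hg x) h1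
      calc 2 * ‖a‖ * ‖b‖ = ‖a‖ * ‖b‖ * 2 := by ring
        _ ≤ _ := mul_le_mul_of_nonneg_left h2 (by positivity)
  | succ k ih =>
    intro t ht X a ha
    set c := lrRate C with hcdef
    set w : ℝ → ℤ → ℝ := fun u x => 2 * Real.exp (2 * c * u) * ∑ y ∈ Y, decay (x - y) +
        2 * ((2 * c * u) ^ k / (k.factorial : ℝ)) with hw
    set G : ℝ → ℝ := fun u => ‖b‖ * ∑ x ∈ X, (c * (2 * Real.exp (2 * c * u)) *
      ∑ y ∈ Y, decay (x - y) + c * (2 * ((2 * c * u) ^ k / (k.factorial : ℝ)))) with hG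
    -- the terms of the Hamiltonian disjoint from `X` commute with `a`
    set 𝒵₀ := 𝒵.filter fun Z => Disjoint Z X with h𝒵₀
    have hcomm : ∀ u, Commute (prop (ham Φ 𝒵₀) u) a := fun u => by
      refine commute_of_disjoint (X := (X : Set ℤ)ᶜ) disjoint_compl_left
        (prop_ham_mem h _ (fun Z hZ => ?_) u) ha
      exact Set.subset_compl_iff_disjoint_right.mpr
        (Finset.disjoint_coe.mpr (Finset.mem_filter.mp hZ).2)
    have hdiff : ∀ u, ham Φ 𝒵 u - ham Φ 𝒵₀ u = ∑ Z ∈ 𝒵 with ¬Disjoint Z X, Φ Z u := fun u => by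
      rw [ham, ham, ← Finset.sum_filter_add_sum_filter_not 𝒵 fun Z => Disjoint Z X]
      abel
    have hwn : ∀ u, 0 ≤ u → ∀ x, 0 ≤ w u x := fun u hu x => by
      have := Finset.sum_nonneg (s := Y) fun y _ => decay_nonneg (x - y)
      simp only [hw]; positivity
    have hstep : ∀ u ∈ Set.Icc 0 t, ‖prop (ham Φ 𝒵) u * (ham Φ 𝒵 u - ham Φ 𝒵₀ u) *
        star (prop (ham Φ 𝒵) u) * b - b * (prop (ham Φ 𝒵) u * (ham Φ 𝒵 u - ham Φ 𝒵₀ u) *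
          star (prop (ham Φ 𝒵) u))‖ ≤ G u := by
      intro u hu
      rw [hdiff, Finset.mul_sum, Finset.sum_mul, Finset.sum_mul, Finset.mul_sum,
        ← Finset.sum_sub_distrib]
      refine (norm_sum_le_of_le _ fun Z _ => ih u ⟨hu.1, hu.2.trans ht.2⟩ Z _
        (h.mem Z u)).trans ?_
      have h1 := h.sum_weight_le u 𝒵 X (w u) (hwn u hu.1)
      have h2 : ∀ x ∈ X, C * ∑ z ∈ 𝒵.sup id, decay (x - z) * w u z ≤
          c * (2 * Real.exp (2 * c * u)) * ∑ y ∈ Y, decay (x - y) +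
            c * (2 * ((2 * c * u) ^ k / (k.factorial : ℝ))) := by
        intro x _
        have h3 : ∑ z ∈ 𝒵.sup id, decay (x - z) * ∑ y ∈ Y, decay (z - y) ≤
            4 * decaySum * ∑ y ∈ Y, decay (x - y) := by
          simp_rw [Finset.mul_sum]
          rw [Finset.sum_comm]
          exact Finset.sum_le_sum fun y _ => sum_decay_mul_decay_le _ x y
        have h4 : ∑ z ∈ 𝒵.sup id, decay (x - z) ≤ 4 * decaySum := by
          linarith [SpinChain.sum_decay_le (𝒵.sup id) x]
        have h5 : ∑ z ∈ 𝒵.sup id, decay (x - z) * w u z = 2 * Real.exp (2 * c * u) *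
            (∑ z ∈ 𝒵.sup id, decay (x - z) * ∑ y ∈ Y, decay (z - y)) +
            2 * ((2 * c * u) ^ k / (k.factorial : ℝ)) * ∑ z ∈ 𝒵.sup id, decay (x - z) := by
          simp only [hw]
          rw [Finset.mul_sum, Finset.mul_sum, ← Finset.sum_add_distrib]
          exact Finset.sum_congr rfl fun z _ => by ring
        have hu0 := hu.1
        rw [h5, mul_add]
        refine add_le_add ?_ ?_
        · calc _ ≤ C * (2 * Real.exp (2 * c * u) *
                (4 * decaySum * ∑ y ∈ Y, decay (x - y))) := by gcongr
            _ = _ := by rw [hcdef, lrRate]; ring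
        · calc _ ≤ C * (2 * ((2 * c * u) ^ k / (k.factorial : ℝ)) * (4 * decaySum)) := by gcongr
            _ = _ := by rw [hcdef, lrRate]; ring
      calc _ = ‖b‖ * ∑ Z ∈ 𝒵 with ¬Disjoint Z X, ‖Φ Z u‖ * ∑ z ∈ Z, w u z := by
            rw [Finset.mul_sum]
            exact Finset.sum_congr rfl fun Z _ => by simp only [hw]; ring
        _ ≤ _ := mul_le_mul_of_nonneg_left (h1.trans (Finset.sum_le_sum h2)) (norm_nonneg _)
    have hGc : Continuous G := by fun_prop
    have hmain := norm_commutator_evolved_le hU (h.isDriver 𝒵₀) hcomm ht.1 hGc hstep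
    refine hmain.trans ?_
    -- an antiderivative of `G`
    set P : ℝ → ℝ := fun u => ‖b‖ * ∑ x ∈ X, (Real.exp (2 * c * u) *
      ∑ y ∈ Y, decay (x - y) + (2 * c * u) ^ (k + 1) / ((k + 1).factorial : ℝ)) with hP
    have hPd : ∀ u, HasDerivAt P (G u) u := by
      intro u
      refine HasDerivAt.const_mul _ (HasDerivAt.fun_sum fun x _ => ?_)
      have hl : HasDerivAt (fun u : ℝ => 2 * c * u) (2 * c) u := by
        simpa using (hasDerivAt_id u).const_mul (2 * c)
      have e1 := (hl.exp.mul_const (∑ y ∈ Y, decay (x - y))).add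
        ((hl.pow (k + 1)).div_const ((k + 1).factorial : ℝ))
      refine e1.congr_deriv ?_
      rw [Nat.factorial_succ]
      push_cast
      field_simp
    rw [intervalIntegral.integral_eq_sub_of_hasDerivAt (fun u _ => hPd u)
      (hGc.intervalIntegrable 0 t)]
    have hP0 : P 0 = ‖b‖ * ∑ x ∈ X, ∑ y ∈ Y, decay (x - y) := by
      simp [hP]
    -- `a` and `b` commute if `X` and `Y` are disjoint, and otherwise the sum is at least
    -- `decay 0 = 1`
    have hab : ‖a * b - b * a‖ ≤ 2 * ‖a‖ * ‖b‖ * ∑ x ∈ X, ∑ y ∈ Y, decay (x - y) := by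
      by_cases hXY : Disjoint X Y
      · rw [(commute_of_disjoint (Finset.disjoint_coe.mpr hXY) ha hb).eq, sub_self, norm_zero]
        exact mul_nonneg (by positivity) (decayPair_nonneg X Y)
      · obtain ⟨x, hx, hy⟩ := Finset.not_disjoint_iff.mp hXY
        refine (norm_commutator_le a b).trans (le_mul_of_one_le_right (by positivity) ?_)
        have e1 : decay (x - x) ≤ ∑ y ∈ Y, decay (x - y) :=
          Finset.single_le_sum (f := fun y => decay (x - y)) (fun y _ => decay_nonneg _) hy
        have e2 := Finset.single_le_sum (f := fun x => ∑ y ∈ Y, decay (x - y))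
          (fun x _ => Finset.sum_nonneg fun y _ => decay_nonneg _) hx
        rw [sub_self, decay_zero] at e1
        exact e1.trans e2
    refine (add_le_add_left hab _).trans (le_of_eq ?_)
    rw [hP0]
    simp only [hP]
    rw [show (fun x => 2 * Real.exp (2 * c * t) * ∑ y ∈ Y, decay (x - y) +
      2 * ((2 * c * t) ^ (k + 1) / ((k + 1).factorial : ℝ))) = fun x => 2 *
        (Real.exp (2 * c * t) * ∑ y ∈ Y, decay (x - y) +
          (2 * c * t) ^ (k + 1) / ((k + 1).factorial : ℝ)) from by funext x; ring,
      ← Finset.mul_sum]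
    ring

/-- The constant in the Lieb-Robinson bound for times in `[0,1]`. -/
def lrConst (C : ℝ) : ℝ := 2 * Real.exp (2 * lrRate C)

/-- The Lieb-Robinson bound. -/
theorem IsRegular.lieb_robinson (h : IsRegular C Φ) (𝒵 : Finset (Finset ℤ)) {X Y : Finset ℤ}
    {a b : ChainAlgebra n} (ha : a ∈ supp n (X : Set ℤ)) (hb : b ∈ supp n (Y : Set ℤ))
    {t : ℝ} (ht : t ∈ Set.Icc (0 : ℝ) 1) :
    ‖prop (ham Φ 𝒵) t * a * star (prop (ham Φ 𝒵) t) * b -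
        b * (prop (ham Φ 𝒵) t * a * star (prop (ham Φ 𝒵) t))‖ ≤
      lrConst C * ‖a‖ * ‖b‖ * decayPair X Y := by
  have hC := h.nonneg
  have hS := one_le_decaySum
  have hc : 0 ≤ lrRate C := by unfold lrRate; positivity
  have hlim : Tendsto (fun k : ℕ => ‖a‖ * ‖b‖ * ∑ x ∈ X,
      (2 * Real.exp (2 * lrRate C * t) * ∑ y ∈ Y, decay (x - y) +
        2 * ((2 * lrRate C * t) ^ k / (k.factorial : ℝ)))) atTop
      (𝓝 (‖a‖ * ‖b‖ * ∑ x ∈ X,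
        (2 * Real.exp (2 * lrRate C * t) * ∑ y ∈ Y, decay (x - y) + 2 * 0))) := by
    refine Tendsto.const_mul _ (tendsto_finsetSum _ fun x _ => ?_)
    exact tendsto_const_nhds.add
      ((FloorSemiring.tendsto_pow_div_factorial_atTop _).const_mul 2)
  refine (ge_of_tendsto' hlim fun k => h.lieb_robinson_aux 𝒵 hb k t ht X a ha).trans ?_
  simp only [mul_zero, add_zero]
  rw [← Finset.mul_sum]
  have h1 : Real.exp (2 * lrRate C * t) ≤ Real.exp (2 * lrRate C) :=
    Real.exp_le_exp.mpr (mul_le_of_le_one_right (by positivity) ht.2)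
  have h2 := decayPair_nonneg X Y
  change ‖a‖ * ‖b‖ * (2 * Real.exp (2 * lrRate C * t) * decayPair X Y) ≤ _
  calc _ ≤ ‖a‖ * ‖b‖ * (2 * Real.exp (2 * lrRate C) * decayPair X Y) := by gcongr
    _ = _ := by rw [lrConst]; ring

theorem lrConst_pos (C : ℝ) : 0 < lrConst C := by unfold lrConst; positivity

end LiebRobinson

/-! ### Cutting interactions at the boundary of a set of sites -/

section Cutting

attribute [local irreducible] instCStarAlgebraChainAlgebra

variable {n : ℤ → ℕ} {C : ℝ} {Φ : Finset ℤ → ℝ → ChainAlgebra n}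

/-- The finite set `B` separates `Γ` from its complement: between a site in `Γ` and a site outside
there is a point of `B`. -/
def IsBoundary (Γ : Set ℤ) (B : Finset ℤ) : Prop :=
  ∀ x ∈ Γ, ∀ y ∉ Γ, ∃ c ∈ B, |x - c| ≤ |x - y| ∧ |y - c| ≤ |x - y|

/-- `Z` contains sites in `Γ` and sites outside of `Γ`. -/
def Crosses (Γ : Set ℤ) (Z : Finset ℤ) : Prop := ¬(Z : Set ℤ) ⊆ Γ ∧ ¬(Z : Set ℤ) ⊆ Γᶜ

theorem Crosses.exists_boundary {Γ : Set ℤ} {B Z : Finset ℤ} (hB : IsBoundary Γ B)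
    (hZ : Crosses Γ Z) {x : ℤ} (hx : x ∈ Z) : ∃ c ∈ B, (x - c).natAbs ≤ diam Z := by
  have key : ∀ y ∈ Z, ∀ c, |x - c| ≤ |x - y| → (x - c).natAbs ≤ diam Z := fun y hy c h => by
    refine le_trans ?_ (natAbs_sub_le_diam hx hy)
    zify
    exact h
  by_cases hxΓ : x ∈ Γ
  · obtain ⟨y, hy, hyΓ⟩ := Set.not_subset.mp hZ.1
    obtain ⟨c, hc, h1, -⟩ := hB x hxΓ y hyΓ
    exact ⟨c, hc, key y hy c h1⟩
  · obtain ⟨y, hy, hyΓ⟩ := Set.not_subset.mp hZ.2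
    obtain ⟨c, hc, -, h1⟩ := hB y (not_not.mp hyΓ) x hxΓ
    exact ⟨c, hc, key y hy c (by rwa [abs_sub_comm x y])⟩

theorem IsRegular.sum_crosses_le (h : IsRegular C Φ) {Γ : Set ℤ} {B : Finset ℤ}
    (hB : IsBoundary Γ B) (u : ℝ) (x : ℤ) (𝒵 : Finset (Finset ℤ))
    (h𝒵 : ∀ Z ∈ 𝒵, Crosses Γ Z ∧ x ∈ Z) : ∑ Z ∈ 𝒵, ‖Φ Z u‖ ≤ C * ∑ c ∈ B, decay (x - c) := by
  calc ∑ Z ∈ 𝒵, ‖Φ Z u‖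
      ≤ ∑ Z ∈ 𝒵, ∑ c ∈ B with (x - c).natAbs ≤ diam Z, ‖Φ Z u‖ := by
        refine Finset.sum_le_sum fun Z hZ => ?_
        obtain ⟨c, hc, hd⟩ := (h𝒵 Z hZ).1.exists_boundary hB (h𝒵 Z hZ).2
        exact Finset.single_le_sum (f := fun _ => ‖Φ Z u‖) (fun _ _ => norm_nonneg _)
          (Finset.mem_filter.mpr ⟨hc, hd⟩)
    _ = ∑ c ∈ B, ∑ Z ∈ 𝒵 with (x - c).natAbs ≤ diam Z, ‖Φ Z u‖ := by
        refine Finset.sum_comm' fun Z c => ?_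
        simp only [Finset.mem_filter]
        tauto
    _ ≤ C * ∑ c ∈ B, decay (x - c) := by
        rw [Finset.mul_sum]
        refine Finset.sum_le_sum fun c _ => ?_
        rw [← decay_natAbs]
        refine h.bound u x _ _ fun Z hZ => ?_
        rw [Finset.mem_filter] at hZ
        exact ⟨(h𝒵 Z hZ.1).2, hZ.2⟩

/-- The constant in the estimates of the effect of cutting an interaction. -/
def cutConst (C : ℝ) : ℝ := lrConst C * C * (4 * decaySum)

theorem IsRegular.cutConst_nonneg (h : IsRegular C Φ) : 0 ≤ cutConst C := by
  have := h.nonneg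
  have := lrConst_pos C
  have := decaySum_nonneg
  unfold cutConst
  positivity

theorem IsRegular.sum_crosses_decayPair_le (h : IsRegular C Φ) {Γ : Set ℤ} {B : Finset ℤ}
    (hB : IsBoundary Γ B) (u : ℝ) (𝒵 : Finset (Finset ℤ)) (h𝒵 : ∀ Z ∈ 𝒵, Crosses Γ Z)
    (X : Finset ℤ) :
    ∑ Z ∈ 𝒵, ‖Φ Z u‖ * decayPair Z X ≤ C * (4 * decaySum) * decayPair B X := by
  unfold decayPair
  rw [sum_mul_sum_comm]
  have h1 : ∀ x, (∑ y ∈ X, decay (x - y)) * ∑ Z ∈ 𝒵 with x ∈ Z, ‖Φ Z u‖ ≤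
      (∑ y ∈ X, decay (x - y)) * (C * ∑ c ∈ B, decay (x - c)) := fun x => by
    refine mul_le_mul_of_nonneg_left ?_ (Finset.sum_nonneg fun _ _ => decay_nonneg _)
    refine h.sum_crosses_le hB u x _ fun Z hZ => ?_
    rw [Finset.mem_filter] at hZ
    exact ⟨h𝒵 Z hZ.1, hZ.2⟩
  refine (Finset.sum_le_sum fun x _ => h1 x).trans ?_
  calc ∑ x ∈ 𝒵.sup id, (∑ y ∈ X, decay (x - y)) * (C * ∑ c ∈ B, decay (x - c))
      = C * ∑ c ∈ B, ∑ y ∈ X, ∑ x ∈ 𝒵.sup id, decay (c - x) * decay (x - y) := by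
        simp only [Finset.mul_sum, Finset.sum_mul]
        rw [Finset.sum_comm]
        refine Finset.sum_congr rfl fun c _ => ?_
        rw [Finset.sum_comm]
        refine Finset.sum_congr rfl fun y _ => Finset.sum_congr rfl fun x _ => ?_
        rw [decay_sub_comm c x]
        ring
    _ ≤ C * ∑ c ∈ B, ∑ y ∈ X, 4 * decaySum * decay (c - y) := by
        refine mul_le_mul_of_nonneg_left ?_ h.nonneg
        exact Finset.sum_le_sum fun c _ => Finset.sum_le_sum fun y _ =>
          sum_decay_mul_decay_le _ c y
    _ = _ := by
        simp only [← Finset.mul_sum]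
        ring

/-- The terms which cross the boundary of `Γ`, evolved, almost commute with observables far from the
boundary. -/
theorem IsRegular.norm_crosses_commutator_le (h : IsRegular C Φ) {Γ : Set ℤ} {B : Finset ℤ}
    (hB : IsBoundary Γ B) (𝒵₀ 𝒵 : Finset (Finset ℤ)) (h𝒵 : ∀ Z ∈ 𝒵, Crosses Γ Z)
    {X : Finset ℤ} {a : ChainAlgebra n} (ha : a ∈ supp n (X : Set ℤ)) {u s : ℝ}
    (hs : s ∈ Set.Icc (0 : ℝ) 1) :
    ‖prop (ham Φ 𝒵₀) s * ham Φ 𝒵 u * star (prop (ham Φ 𝒵₀) s) * a -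
      a * (prop (ham Φ 𝒵₀) s * ham Φ 𝒵 u * star (prop (ham Φ 𝒵₀) s))‖ ≤
      cutConst C * ‖a‖ * decayPair B X := by
  rw [ham, Finset.mul_sum, Finset.sum_mul, Finset.sum_mul, Finset.mul_sum,
    ← Finset.sum_sub_distrib]
  refine (norm_sum_le_of_le _ fun Z _ => h.lieb_robinson 𝒵₀ (h.mem Z u) ha hs).trans ?_
  have h1 := h.sum_crosses_decayPair_le hB u 𝒵 h𝒵 X
  have h2 := lrConst_pos C
  calc _ = lrConst C * ‖a‖ * ∑ Z ∈ 𝒵, ‖Φ Z u‖ * decayPair Z X := by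
        rw [Finset.mul_sum]
        exact Finset.sum_congr rfl fun Z _ => by ring
    _ ≤ lrConst C * ‖a‖ * (C * (4 * decaySum) * decayPair B X) := by gcongr
    _ = _ := by rw [cutConst]; ring

/-- The same estimate with the roles exchanged: the observable is evolved. -/
theorem IsRegular.norm_crosses_commutator_le' (h : IsRegular C Φ) {Γ : Set ℤ} {B : Finset ℤ}
    (hB : IsBoundary Γ B) (𝒵₀ 𝒵 : Finset (Finset ℤ)) (h𝒵 : ∀ Z ∈ 𝒵, Crosses Γ Z)
    {X : Finset ℤ} {a : ChainAlgebra n} (ha : a ∈ supp n (X : Set ℤ)) {u s : ℝ}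
    (hs : s ∈ Set.Icc (0 : ℝ) 1) :
    ‖prop (ham Φ 𝒵₀) s * a * star (prop (ham Φ 𝒵₀) s) * ham Φ 𝒵 u -
      ham Φ 𝒵 u * (prop (ham Φ 𝒵₀) s * a * star (prop (ham Φ 𝒵₀) s))‖ ≤
      cutConst C * ‖a‖ * decayPair B X := by
  rw [ham, Finset.mul_sum, Finset.sum_mul, ← Finset.sum_sub_distrib]
  refine (norm_sum_le_of_le _ fun Z _ => h.lieb_robinson 𝒵₀ ha (h.mem Z u) hs).trans ?_
  have h1 := h.sum_crosses_decayPair_le hB u 𝒵 h𝒵 X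
  have h2 := lrConst_pos C
  calc _ = lrConst C * ‖a‖ * ∑ Z ∈ 𝒵, ‖Φ Z u‖ * decayPair Z X := by
        rw [Finset.mul_sum]
        exact Finset.sum_congr rfl fun Z _ => by rw [decayPair_comm]; ring
    _ ≤ lrConst C * ‖a‖ * (C * (4 * decaySum) * decayPair B X) := by gcongr
    _ = _ := by rw [cutConst]; ring

/-- Conjugation by a unitary (the identity for elements which are not unitary). -/
def innerAut {A : Type*} [CStarAlgebra A] (u : A) : A ≃⋆ₐ[ℂ] A :=
  open Classical in if h : u ∈ unitary A then Unitary.conjStarAlgAut ℂ A ⟨u, h⟩ else 1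

theorem innerAut_apply {A : Type*} [CStarAlgebra A] {u : A} (h : u ∈ unitary A) (a : A) :
    innerAut u a = u * a * star u := by
  rw [innerAut, dif_pos h]; rfl

theorem innerAut_inv_apply {A : Type*} [CStarAlgebra A] {u : A} (h : u ∈ unitary A) (a : A) :
    (innerAut u)⁻¹ a = star u * a * u := by
  rw [innerAut, dif_pos h]; rfl

/-- The finite-volume evolution with the terms of a finite family of sets. -/
def finEv (Φ : Finset ℤ → ℝ → ChainAlgebra n) (𝒵 : Finset (Finset ℤ)) (s : ℝ) :
    ChainAlgebra n ≃⋆ₐ[ℂ] ChainAlgebra n := innerAut (prop (ham Φ 𝒵) s)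

theorem IsRegular.prop_mem_unitary (h : IsRegular C Φ) (𝒵 : Finset (Finset ℤ)) (s : ℝ) :
    prop (ham Φ 𝒵) s ∈ unitary (ChainAlgebra n) := SpinChain.prop_mem_unitary (h.isDriver 𝒵) s

theorem IsRegular.finEv_apply (h : IsRegular C Φ) (𝒵 : Finset (Finset ℤ)) (s : ℝ)
    (a : ChainAlgebra n) : finEv Φ 𝒵 s a = prop (ham Φ 𝒵) s * a * star (prop (ham Φ 𝒵) s) :=
  innerAut_apply (h.prop_mem_unitary 𝒵 s) a

theorem IsRegular.finEv_inv_apply (h : IsRegular C Φ) (𝒵 : Finset (Finset ℤ)) (s : ℝ)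
    (a : ChainAlgebra n) : (finEv Φ 𝒵 s)⁻¹ a =
      star (prop (ham Φ 𝒵) s) * a * prop (ham Φ 𝒵) s :=
  innerAut_inv_apply (h.prop_mem_unitary 𝒵 s) a

/-- The propagators of terms inside and outside of `Γ` factorize. -/
theorem IsRegular.prop_union (h : IsRegular C Φ) {Γ : Set ℤ} {𝒵₁ 𝒵₂ : Finset (Finset ℤ)}
    (hd : Disjoint 𝒵₁ 𝒵₂) (h₁ : ∀ Z ∈ 𝒵₁, (Z : Set ℤ) ⊆ Γ) (h₂ : ∀ Z ∈ 𝒵₂, (Z : Set ℤ) ⊆ Γᶜ)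
    (s : ℝ) : prop (ham Φ (𝒵₁ ∪ 𝒵₂)) s = prop (ham Φ 𝒵₁) s * prop (ham Φ 𝒵₂) s := by
  rw [← prop_add (h.isDriver 𝒵₁) (h.isDriver 𝒵₂)]
  · congr 1
    funext u
    exact Finset.sum_union hd
  · intro s u
    refine commute_of_disjoint (X := Γᶜ) (Y := Γ) disjoint_compl_left (prop_ham_mem h 𝒵₂ h₂ s) ?_
    exact sum_mem fun Z hZ => supp_mono (h₁ Z hZ) (h.mem Z u)

open Classical in
/-- The effect of cutting a finite family of terms at the boundary of `Γ` on observables in `Γ`. -/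
theorem IsRegular.finEv_cut (h : IsRegular C Φ) {Γ : Set ℤ} {B : Finset ℤ}
    (hB : IsBoundary Γ B) (𝒵 : Finset (Finset ℤ)) {X : Finset ℤ} (hX : (X : Set ℤ) ⊆ Γ)
    {a : ChainAlgebra n} (ha : a ∈ supp n (X : Set ℤ)) {s : ℝ} (hs : s ∈ Set.Icc (0 : ℝ) 1) :
    ‖finEv Φ 𝒵 s a - finEv Φ (𝒵.filter fun Z : Finset ℤ => (Z : Set ℤ) ⊆ Γ) s a‖ ≤
        cutConst C * ‖a‖ * decayPair B X ∧
      ‖(finEv Φ 𝒵 s)⁻¹ a - (finEv Φ (𝒵.filter fun Z : Finset ℤ => (Z : Set ℤ) ⊆ Γ) s)⁻¹ a‖ ≤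
        cutConst C * ‖a‖ * decayPair B X := by
  -- the terms inside `Γ`, outside of `Γ`, and across the boundary; without the last ones the
  -- propagator factorizes, and its outer factor commutes with `a`
  set 𝒵₁ := 𝒵.filter fun Z : Finset ℤ => (Z : Set ℤ) ⊆ Γ with h𝒵₁
  set 𝒵₂ := 𝒵.filter fun Z : Finset ℤ => ¬(Z : Set ℤ) ⊆ Γ ∧ (Z : Set ℤ) ⊆ Γᶜ with h𝒵₂
  set 𝒵₃ := 𝒵.filter fun Z : Finset ℤ => Crosses Γ Z with h𝒵₃
  have hd : Disjoint 𝒵₁ 𝒵₂ := Finset.disjoint_filter.mpr fun Z _ h1 h2 => h2.1 h1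
  have hU := h.isDriver 𝒵
  have hU₀ := h.isDriver (𝒵₁ ∪ 𝒵₂)
  have hfac := h.prop_union hd (fun Z hZ => (Finset.mem_filter.mp hZ).2)
    (fun Z hZ => (Finset.mem_filter.mp hZ).2.2)
  have hdiff : ∀ u, ham Φ 𝒵 u - ham Φ (𝒵₁ ∪ 𝒵₂) u = ham Φ 𝒵₃ u := fun u => by
    rw [sub_eq_iff_eq_add, ham, ham, ham, ← Finset.sum_union]
    · congr 1
      ext Z
      rw [Finset.mem_union, Finset.mem_union, Finset.mem_filter, Finset.mem_filter,
        Finset.mem_filter, Crosses]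
      tauto
    · rw [Finset.disjoint_union_right]
      exact ⟨Finset.disjoint_filter.mpr fun Z _ h1 h2 => h1.1 h2,
        Finset.disjoint_filter.mpr fun Z _ h1 h2 => h1.2 h2.2⟩
  have hcr : ∀ Z ∈ 𝒵₃, Crosses Γ Z := fun Z hZ => (Finset.mem_filter.mp hZ).2
  set V := prop (ham Φ 𝒵₁) s with hV
  set V' := prop (ham Φ 𝒵₂) s with hV'
  have hV'u : V' ∈ unitary (ChainAlgebra n) := h.prop_mem_unitary 𝒵₂ s
  have hV'a : Commute V' a := commute_of_disjoint (X := Γᶜ) (Y := Γ) disjoint_compl_left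
    (prop_ham_mem h 𝒵₂ (fun Z hZ => (Finset.mem_filter.mp hZ).2.2) s) (supp_mono hX ha)
  have hVV' : Commute V' V := commute_of_disjoint (X := Γᶜ) (Y := Γ) disjoint_compl_left
    (prop_ham_mem h 𝒵₂ (fun Z hZ => (Finset.mem_filter.mp hZ).2.2) s)
    (prop_ham_mem h 𝒵₁ (fun Z hZ => (Finset.mem_filter.mp hZ).2) s)
  have e1 : finEv Φ 𝒵₁ s a = finEv Φ (𝒵₁ ∪ 𝒵₂) s a := by
    rw [h.finEv_apply, h.finEv_apply, hfac, star_mul]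
    change V * a * star V = V * V' * a * (star V' * star V)
    rw [mul_assoc V V' a, hV'a.eq, mul_assoc, mul_assoc, ← mul_assoc (a * V'), mul_assoc a V',
      hV'u.2, mul_one]
  have e2 : (finEv Φ 𝒵₁ s)⁻¹ a = (finEv Φ (𝒵₁ ∪ 𝒵₂) s)⁻¹ a := by
    rw [h.finEv_inv_apply, h.finEv_inv_apply, hfac, star_mul]
    change star V * a * V = star V' * star V * a * (V * V')
    have h1 : Commute V' (star V * a * V) := ((by
      have := (prop_ham_mem h 𝒵₁ (fun Z hZ => (Finset.mem_filter.mp hZ).2) s)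
      exact commute_of_disjoint (X := Γᶜ) (Y := Γ) disjoint_compl_left
        (prop_ham_mem h 𝒵₂ (fun Z hZ => (Finset.mem_filter.mp hZ).2.2) s)
        (star_mem this) : Commute V' (star V)).mul_right hV'a).mul_right hVV'
    calc star V * a * V = star V' * V' * (star V * a * V) := by rw [hV'u.1, one_mul]
      _ = star V' * (star V * a * V * V') := by rw [mul_assoc, h1.eq]
      _ = _ := by simp only [mul_assoc]
  rw [e1, e2, h.finEv_apply, h.finEv_apply, h.finEv_inv_apply, h.finEv_inv_apply]
  set U := prop (ham Φ 𝒵) with hUdef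
  set W := prop (ham Φ (𝒵₁ ∪ 𝒵₂)) with hWdef
  have hUu : ∀ s, U s ∈ unitary (ChainAlgebra n) := h.prop_mem_unitary 𝒵
  have hWu : ∀ s, W s ∈ unitary (ChainAlgebra n) := h.prop_mem_unitary (𝒵₁ ∪ 𝒵₂)
  have hnn : 0 ≤ cutConst C * ‖a‖ * decayPair B X :=
    mul_nonneg (mul_nonneg h.cutConst_nonneg (norm_nonneg _)) (decayPair_nonneg _ _)
  constructor
  · have key := norm_interaction_conj_sub_le hU hU₀ (b := W s * a * star (W s)) hs.1
      (g := cutConst C * ‖a‖ * decayPair B X) fun u hu => ?_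
    · refine (le_of_eq ?_).trans (key.trans (mul_le_of_le_one_right hnn hs.2))
      congr 2
      rw [star_mul, star_star]
      have h1 : ∀ x, star (W s) * (W s * x) = x := fun x => by
        rw [← mul_assoc, (hWu s).1, one_mul]
      simp only [← hUdef, ← hWdef, mul_assoc, h1]
    · rw [hdiff]
      have hsu : s - u ∈ Set.Icc (0 : ℝ) 1 :=
        ⟨by linarith [hu.2], by linarith [hu.1, hs.2]⟩
      -- the observable has evolved during the time from `u` to `s`, hence the shift of the origin
      have k1 := (h.shift u).norm_crosses_commutator_le' hB (𝒵₁ ∪ 𝒵₂) 𝒵₃ hcr ha (u := 0) hsu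
      have k2 : prop (ham (fun Z v => Φ Z (u + v)) (𝒵₁ ∪ 𝒵₂)) (s - u) =
          star (W u) * W s := by
        have := prop_shift hU₀ u (s - u)
        rw [add_sub_cancel] at this
        exact this
      have k3 : ham (fun Z v => Φ Z (u + v)) 𝒵₃ 0 = ham Φ 𝒵₃ u := by simp [ham]
      rw [k2, k3] at k1
      refine le_trans (le_of_eq ?_) k1
      rw [norm_sub_rev]
      conv_rhs => rw [← norm_unitary_conj (hWu u)]
      congr 1
      have h1 : ∀ x, W u * (star (W u) * x) = x := fun x => by
        rw [← mul_assoc, (hWu u).2, one_mul]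
      simp only [← hWdef, star_mul, star_star, mul_sub, sub_mul, mul_assoc, h1,
        (hWu u).2, mul_one]
  · have key := norm_interaction_conj_sub_le hU hU₀ (b := a) hs.1
      (g := cutConst C * ‖a‖ * decayPair B X) fun u hu => by
        rw [hdiff]
        exact h.norm_crosses_commutator_le hB (𝒵₁ ∪ 𝒵₂) 𝒵₃ hcr ha
          ⟨hu.1, hu.2.trans hs.2⟩
    refine (le_of_eq ?_).trans (key.trans (mul_le_of_le_one_right hnn hs.2))
    rw [← norm_unitary_conj (hUu s) (_ - _), norm_sub_rev]
    have h1 : ∀ x, U s * (star (U s) * x) = x := fun x => by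
      rw [← mul_assoc, (hUu s).2, one_mul]
    congr 1
    simp only [← hUdef, ← hWdef, star_mul, star_star, mul_sub, sub_mul, mul_assoc, h1,
      (hUu s).2, mul_one]

end Cutting

/-! ### Limits of automorphisms -/

section Limits

attribute [local irreducible] instCStarAlgebraChainAlgebra

variable {n : ℤ → ℕ}

/-- The automorphisms of the spin chain algebra. -/
abbrev ChainAut (n : ℤ → ℕ) : Type := ChainAlgebra n ≃⋆ₐ[ℂ] ChainAlgebra n

theorem aut_inv_apply (α : ChainAut n) (a : ChainAlgebra n) : α⁻¹ (α a) = a :=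
  α.symm_apply_apply a

theorem aut_apply_inv (α : ChainAut n) (a : ChainAlgebra n) : α (α⁻¹ a) = a :=
  α.apply_symm_apply a

theorem norm_aut (α : ChainAut n) (a : ChainAlgebra n) : ‖α a‖ = ‖a‖ := StarAlgEquiv.norm_map α a

theorem norm_aut_sub (α : ChainAut n) (a b : ChainAlgebra n) : ‖α a - α b‖ = ‖a - b‖ := by
  rw [← map_sub, norm_aut]

theorem continuous_aut (α : ChainAut n) : Continuous α := (StarAlgEquiv.isometry α).continuous

theorem aut_eq_of_eq_on_local {α β : ChainAut n}
    (h : ∀ S : Finset ℤ, ∀ a ∈ supp n (S : Set ℤ), α a = β a) : α = β :=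
  DFunLike.coe_injective (eq_of_eq_on_local (continuous_aut α) (continuous_aut β) h)

theorem tendsto_aut_apply {ι : Type*} {l : Filter ι} {β : ι → ChainAut n} {α : ChainAut n}
    (h : ∀ a, Tendsto (fun i => β i a) l (𝓝 (α a))) {x : ι → ChainAlgebra n} {a : ChainAlgebra n}
    (hx : Tendsto x l (𝓝 a)) : Tendsto (fun i => β i (x i)) l (𝓝 (α a)) := by
  have h1 : Tendsto (fun i => β i (x i) - β i a) l (𝓝 0) := by
    rw [tendsto_zero_iff_norm_tendsto_zero]
    simp_rw [norm_aut_sub]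
    rw [← tendsto_zero_iff_norm_tendsto_zero]
    simpa using hx.sub_const a
  simpa using h1.add (h a)

/-- A net of automorphisms which is pointwise Cauchy on local observables, together with the
inverses, converges to an automorphism. -/
theorem exists_aut_tendsto {β : Finset ℤ → ChainAut n}
    (h : ∀ S : Finset ℤ, ∀ a ∈ supp n (S : Set ℤ), CauchySeq fun Λ => β Λ a)
    (h' : ∀ S : Finset ℤ, ∀ a ∈ supp n (S : Set ℤ), CauchySeq fun Λ => (β Λ)⁻¹ a) :
    ∃ α : ChainAut n, ∀ a, Tendsto (fun Λ => β Λ a) atTop (𝓝 (α a)) ∧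
      Tendsto (fun Λ => (β Λ)⁻¹ a) atTop (𝓝 (α⁻¹ a)) := by
  have ext : ∀ β : Finset ℤ → ChainAut n,
      (∀ S : Finset ℤ, ∀ a ∈ supp n (S : Set ℤ), CauchySeq fun Λ => β Λ a) →
      ∀ a, ∃ b, Tendsto (fun Λ => β Λ a) atTop (𝓝 b) := by
    intro β h a
    refine cauchySeq_tendsto_of_complete (Metric.cauchySeq_iff'.mpr fun ε hε => ?_)
    obtain ⟨b, hb, hab⟩ := (Metric.mem_closure_iff.mp (dense_supp n a)) (ε / 3) (by positivity)
    obtain ⟨S, -, hS⟩ := exists_finset_of_mem_supp hb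
    obtain ⟨N, hN⟩ := Metric.cauchySeq_iff'.mp (h S b hS) (ε / 3) (by positivity)
    refine ⟨N, fun Λ hΛ => ?_⟩
    have h1 : ∀ Λ, dist (β Λ a) (β Λ b) < ε / 3 := fun Λ => by
      rwa [dist_eq_norm, norm_aut_sub, ← dist_eq_norm]
    have h2 := h1 N
    rw [dist_comm] at h2
    calc dist (β Λ a) (β N a) ≤ dist (β Λ a) (β Λ b) + dist (β Λ b) (β N b) +
          dist (β N b) (β N a) := dist_triangle4 _ _ _ _
      _ < ε / 3 + ε / 3 + ε / 3 := add_lt_add (add_lt_add (h1 Λ) (hN Λ hΛ)) h2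
      _ = ε := by ring
  choose f hf using ext β h
  choose g hg using ext (fun Λ => (β Λ)⁻¹) h'
  have key : ∀ (β : Finset ℤ → ChainAut n) (f g : ChainAlgebra n → ChainAlgebra n),
      (∀ a, Tendsto (fun Λ => β Λ a) atTop (𝓝 (f a))) →
      (∀ a, Tendsto (fun Λ => (β Λ)⁻¹ a) atTop (𝓝 (g a))) → ∀ a, g (f a) = a := by
    intro β f g hf hg a
    refine tendsto_nhds_unique (hg (f a)) ?_
    have h1 : Tendsto (fun Λ => (β Λ)⁻¹ (f a) - (β Λ)⁻¹ (β Λ a)) atTop (𝓝 0) := by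
      rw [tendsto_zero_iff_norm_tendsto_zero]
      simp_rw [norm_aut_sub, norm_sub_rev (f a)]
      exact tendsto_iff_norm_sub_tendsto_zero.mp (hf a)
    simpa [aut_inv_apply] using h1.add (tendsto_const_nhds (x := a))
  refine ⟨
    { toFun := f
      invFun := g
      left_inv := key β f g hf hg
      right_inv := key (fun Λ => (β Λ)⁻¹) g f hg (by simpa using hf)
      map_mul' := fun a b => tendsto_nhds_unique (hf _) (by simpa using (hf a).mul (hf b))
      map_add' := fun a b => tendsto_nhds_unique (hf _) (by simpa using (hf a).add (hf b))
      map_star' := fun a => tendsto_nhds_unique (hf _) (by simpa [map_star] using (hf a).star)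
      map_smul' := fun c a => tendsto_nhds_unique (hf _)
        (by simpa using (hf a).const_smul c) }, fun a => ⟨hf a, hg a⟩⟩

/-! ### Observables in infinite regions -/

/-- The C⋆-algebra of the observables in a possibly infinite set of sites. -/
def alg (n : ℤ → ℕ) (Γ : Set ℤ) : StarSubalgebra ℂ (ChainAlgebra n) :=
  (supp n Γ).topologicalClosure

theorem isClosed_alg (Γ : Set ℤ) : IsClosed (alg n Γ : Set (ChainAlgebra n)) :=
  StarSubalgebra.isClosed_topologicalClosure _

theorem supp_le_alg (Γ : Set ℤ) : supp n Γ ≤ alg n Γ := StarSubalgebra.le_topologicalClosure _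

theorem alg_mono {Γ Γ' : Set ℤ} (h : Γ ⊆ Γ') : alg n Γ ≤ alg n Γ' :=
  StarSubalgebra.topologicalClosure_mono (supp_mono h)

/-- A closed property of observables in `Γ` holds if it holds for finite subsets of `Γ`. -/
theorem alg_induction {Γ : Set ℤ} {p : ChainAlgebra n → Prop} (hp : IsClosed {a | p a})
    (h : ∀ X : Finset ℤ, (X : Set ℤ) ⊆ Γ → ∀ a ∈ supp n (X : Set ℤ), p a) {a : ChainAlgebra n}
    (ha : a ∈ alg n Γ) : p a := by
  refine closure_minimal (s := (supp n Γ : Set (ChainAlgebra n))) (fun b hb => ?_) hp ha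
  obtain ⟨S, hS, hb⟩ := exists_finset_of_mem_supp hb
  exact h S hS b hb

theorem commute_of_disjoint_alg {Γ Γ' : Set ℤ} (hd : Disjoint Γ Γ') {a b : ChainAlgebra n}
    (ha : a ∈ alg n Γ) (hb : b ∈ alg n Γ') : Commute a b := by
  refine alg_induction (p := fun a => Commute a b)
    (isClosed_eq (continuous_mul_const b) (continuous_const_mul b)) (fun X hX a ha => ?_) ha
  refine alg_induction (p := fun b => Commute a b)
    (isClosed_eq (continuous_const_mul a) (continuous_mul_const a)) (fun Y hY b hb => ?_) hb
  exact commute_of_disjoint (hd.mono hX hY) ha hb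

theorem mem_alg_of_tendsto {ι : Type*} {l : Filter ι} [l.NeBot] {Γ : Set ℤ}
    {x : ι → ChainAlgebra n} {a : ChainAlgebra n} (hx : Tendsto x l (𝓝 a))
    (h : ∀ i, x i ∈ alg n Γ) : a ∈ alg n Γ :=
  (isClosed_alg Γ).mem_of_tendsto hx (.of_forall h)

end Limits

/-! ### The evolution in infinite volume -/

section Evolution

attribute [local irreducible] instCStarAlgebraChainAlgebra

variable {n : ℤ → ℕ} {C : ℝ} {Φ : Finset ℤ → ℝ → ChainAlgebra n}

open Classical in
/-- Keep only the terms on the sets with the property `P`. -/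
def restrictTerms (P : Finset ℤ → Prop) (Φ : Finset ℤ → ℝ → ChainAlgebra n) (Z : Finset ℤ) (u : ℝ) :
    ChainAlgebra n :=
  if P Z then Φ Z u else 0

theorem restrictTerms_of_not {P : Finset ℤ → Prop} {Z : Finset ℤ} (h : ¬P Z) (u : ℝ) :
    restrictTerms P Φ Z u = 0 := if_neg h

theorem restrictTerms_of {P : Finset ℤ → Prop} {Z : Finset ℤ} (h : P Z) (u : ℝ) :
    restrictTerms P Φ Z u = Φ Z u := if_pos h

theorem IsRegular.restrict (h : IsRegular C Φ) (P : Finset ℤ → Prop) :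
    IsRegular C (restrictTerms P Φ) where
  sa Z u := by
    unfold restrictTerms
    split_ifs
    exacts [h.sa Z u, star_zero _]
  mem Z u := by
    unfold restrictTerms
    split_ifs
    exacts [h.mem Z u, zero_mem _]
  meas Z := by
    unfold restrictTerms
    split_ifs
    exacts [h.meas Z, aestronglyMeasurable_const]
  empty u := by
    unfold restrictTerms
    split_ifs
    exacts [h.empty u, rfl]
  bound u x d 𝒵 h𝒵 := by
    refine (Finset.sum_le_sum fun Z _ => ?_).trans (h.bound u x d 𝒵 h𝒵)
    unfold restrictTerms
    split_ifs
    exacts [le_rfl, by simp]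

open Classical in
theorem ham_restrictTerms (P : Finset ℤ → Prop) (𝒵 : Finset (Finset ℤ)) :
    ham (restrictTerms P Φ) 𝒵 = ham Φ (𝒵.filter P) := by
  funext u
  simp only [ham, restrictTerms, Finset.sum_filter]

/-- The symmetric interval of sites. -/
def box (R : ℕ) : Finset ℤ := Finset.Icc (-(R : ℤ)) R

theorem mem_box {R : ℕ} {x : ℤ} : x ∈ box R ↔ |x| ≤ R := by
  rw [box, Finset.mem_Icc, abs_le]

theorem tendsto_box : Tendsto box atTop atTop := by
  refine tendsto_atTop_finset_of_monotone (fun R S h x hx => ?_) fun x => ⟨x.natAbs, ?_⟩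
  · rw [mem_box] at hx ⊢; exact hx.trans (by exact_mod_cast h)
  · rw [mem_box]; simp

theorem isBoundary_box (R : ℕ) : IsBoundary (box R : Set ℤ) {-(R : ℤ), (R : ℤ)} := by
  intro x hx y hy
  rw [Finset.mem_coe, mem_box, abs_le] at hx
  rw [Finset.mem_coe, mem_box, abs_le, not_and_or] at hy
  rcases hy with hy | hy
  · refine ⟨-R, by simp, ?_, ?_⟩ <;> rw [abs_le, abs_eq_max_neg, le_max_iff, neg_le,
      le_max_iff] <;> omega
  · refine ⟨R, by simp, ?_, ?_⟩ <;> rw [abs_le, abs_eq_max_neg, le_max_iff, neg_le,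
      le_max_iff] <;> omega

theorem isBoundary_Iic (r : ℤ) : IsBoundary (Set.Iic r) {r} := by
  intro x hx y hy
  rw [Set.mem_Iic] at hx hy
  refine ⟨r, by simp, ?_, ?_⟩ <;> rw [abs_le, abs_eq_max_neg, le_max_iff, neg_le,
      le_max_iff] <;> omega

theorem isBoundary_Ioi (r : ℤ) : IsBoundary (Set.Ioi r) {r} := by
  intro x hx y hy
  rw [Set.mem_Ioi] at hx hy
  refine ⟨r, by simp, ?_, ?_⟩ <;> rw [abs_le, abs_eq_max_neg, le_max_iff, neg_le,
      le_max_iff] <;> omega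

theorem tendsto_decayPair_box (X : Finset ℤ) :
    Tendsto (fun R : ℕ => decayPair {-(R : ℤ), (R : ℤ)} X) atTop (𝓝 0) := by
  have h0 : Tendsto decay cofinite (𝓝 0) := summable_decay.tendsto_cofinite_zero
  have h1 : ∀ y : ℤ, Tendsto (fun R : ℕ => decay (-(R : ℤ) - y)) atTop (𝓝 0) := fun y => by
    refine h0.comp ?_
    rw [← Nat.cofinite_eq_atTop]
    exact Function.Injective.tendsto_cofinite fun a b hab => by simpa using hab
  have h2 : ∀ y : ℤ, Tendsto (fun R : ℕ => decay ((R : ℤ) - y)) atTop (𝓝 0) := fun y => by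
    refine h0.comp ?_
    rw [← Nat.cofinite_eq_atTop]
    exact Function.Injective.tendsto_cofinite fun a b hab => by simpa using hab
  have h3 := (tendsto_finsetSum X fun y _ => h1 y).add (tendsto_finsetSum X fun y _ => h2 y)
  simp only [Finset.sum_const_zero, add_zero] at h3
  refine squeeze_zero (fun R => decayPair_nonneg _ _) (fun R => ?_) h3
  unfold decayPair
  have h4 : ∀ (a b : ℤ) (f : ℤ → ℝ), (∀ x, 0 ≤ f x) → ∑ x ∈ {a, b}, f x ≤ f a + f b := by
    intro a b f hf
    by_cases hab : a = b
    · subst hab; simpa using hf a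
    · rw [Finset.sum_pair hab]
  exact h4 _ _ _ fun x => Finset.sum_nonneg fun y _ => decay_nonneg _

theorem exists_subset_box (X : Finset ℤ) : ∀ᶠ R in atTop, X ⊆ box R :=
  tendsto_box.eventually_ge_atTop X

theorem IsRegular.finEv_box_sub_le (h : IsRegular C Φ) {R : ℕ} {Λ : Finset ℤ} (hΛ : box R ⊆ Λ)
    {X : Finset ℤ} (hX : X ⊆ box R) {a : ChainAlgebra n} (ha : a ∈ supp n (X : Set ℤ)) {s : ℝ}
    (hs : s ∈ Set.Icc (0 : ℝ) 1) :
    ‖finEv Φ Λ.powerset s a - finEv Φ (box R).powerset s a‖ ≤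
        cutConst C * ‖a‖ * decayPair {-(R : ℤ), (R : ℤ)} X ∧
      ‖(finEv Φ Λ.powerset s)⁻¹ a - (finEv Φ (box R).powerset s)⁻¹ a‖ ≤
        cutConst C * ‖a‖ * decayPair {-(R : ℤ), (R : ℤ)} X := by
  classical
  have e : ∀ inst : DecidablePred fun Z : Finset ℤ => (Z : Set ℤ) ⊆ (box R : Set ℤ),
      @Finset.filter _ _ inst Λ.powerset = (box R).powerset := fun inst => by
    ext Z
    simp only [Finset.mem_filter, Finset.mem_powerset, Finset.coe_subset]
    exact ⟨fun h => h.2, fun h => ⟨h.trans hΛ, h⟩⟩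
  have := h.finEv_cut (isBoundary_box R) Λ.powerset (Finset.coe_subset.mpr hX) ha hs
  rw [e] at this
  exact this

theorem IsRegular.exists_ev (h : IsRegular C Φ) {s : ℝ} (hs : s ∈ Set.Icc (0 : ℝ) 1) :
    ∃ α : ChainAut n, ∀ a, Tendsto (fun Λ => finEv Φ (Finset.powerset Λ) s a) atTop (𝓝 (α a)) ∧
      Tendsto (fun Λ => (finEv Φ (Finset.powerset Λ) s)⁻¹ a) atTop (𝓝 (α⁻¹ a)) := by
  have small : ∀ (X : Finset ℤ) (a : ChainAlgebra n) (ε : ℝ), 0 < ε → ∃ R : ℕ, X ⊆ box R ∧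
      cutConst C * ‖a‖ * decayPair {-(R : ℤ), (R : ℤ)} X < ε := by
    intro X a ε hε
    have h1 := (tendsto_decayPair_box X).const_mul (cutConst C * ‖a‖)
    rw [mul_zero] at h1
    exact ((exists_subset_box X).and (h1.eventually_lt_const hε)).exists
  refine exists_aut_tendsto (fun X a ha => Metric.cauchySeq_iff'.mpr fun ε hε => ?_)
    fun X a ha => Metric.cauchySeq_iff'.mpr fun ε hε => ?_
  all_goals
    obtain ⟨R, hR, hlt⟩ := small X a ε hε
    refine ⟨box R, fun Λ hΛ => ?_⟩
    rw [dist_eq_norm]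
  exacts [(h.finEv_box_sub_le hΛ hR ha hs).1.trans_lt hlt,
    (h.finEv_box_sub_le hΛ hR ha hs).2.trans_lt hlt]

open Classical in
/-- The evolution generated by the terms `Φ`: the limit of the finite-volume evolutions (the
identity if there is no limit). -/
def ev (Φ : Finset ℤ → ℝ → ChainAlgebra n) (s : ℝ) : ChainAut n :=
  if h : ∃ α : ChainAut n, ∀ a, Tendsto (fun Λ => finEv Φ (Finset.powerset Λ) s a) atTop (𝓝 (α a)) ∧
      Tendsto (fun Λ => (finEv Φ (Finset.powerset Λ) s)⁻¹ a) atTop (𝓝 (α⁻¹ a)) then h.choose else 1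

theorem IsRegular.tendsto_ev (h : IsRegular C Φ) {s : ℝ} (hs : s ∈ Set.Icc (0 : ℝ) 1)
    (a : ChainAlgebra n) :
    Tendsto (fun Λ => finEv Φ (Finset.powerset Λ) s a) atTop (𝓝 (ev Φ s a)) := by
  rw [ev, dif_pos (h.exists_ev hs)]
  exact ((h.exists_ev hs).choose_spec a).1

theorem IsRegular.tendsto_ev_inv (h : IsRegular C Φ) {s : ℝ} (hs : s ∈ Set.Icc (0 : ℝ) 1)
    (a : ChainAlgebra n) :
    Tendsto (fun Λ => (finEv Φ (Finset.powerset Λ) s)⁻¹ a) atTop (𝓝 ((ev Φ s)⁻¹ a)) := by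
  rw [ev, dif_pos (h.exists_ev hs)]
  exact ((h.exists_ev hs).choose_spec a).2

theorem finEv_restrict_congr {Ψ : Finset ℤ → ℝ → ChainAlgebra n} {𝒵 𝒵' : Finset (Finset ℤ)}
    (h : ham Φ 𝒵 = ham Ψ 𝒵') (s : ℝ) : finEv Φ 𝒵 s = finEv Ψ 𝒵' s := by
  rw [finEv, finEv, h]

theorem IsRegular.ev_cut (h : IsRegular C Φ) {Γ : Set ℤ} {B : Finset ℤ} (hB : IsBoundary Γ B)
    {X : Finset ℤ} (hX : (X : Set ℤ) ⊆ Γ) {a : ChainAlgebra n} (ha : a ∈ supp n (X : Set ℤ))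
    {s : ℝ} (hs : s ∈ Set.Icc (0 : ℝ) 1) :
    ‖ev Φ s a - ev (restrictTerms (fun Z : Finset ℤ => (Z : Set ℤ) ⊆ Γ) Φ) s a‖ ≤
        cutConst C * ‖a‖ * decayPair B X ∧
      ‖(ev Φ s)⁻¹ a - (ev (restrictTerms (fun Z : Finset ℤ => (Z : Set ℤ) ⊆ Γ) Φ) s)⁻¹ a‖ ≤
        cutConst C * ‖a‖ * decayPair B X := by
  have hr := h.restrict fun Z : Finset ℤ => (Z : Set ℤ) ⊆ Γ
  constructor
  · refine le_of_tendsto' ((h.tendsto_ev hs a).sub (hr.tendsto_ev hs a)).norm fun Λ => ?_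
    rw [finEv_restrict_congr (ham_restrictTerms _ _)]
    exact (h.finEv_cut hB _ hX ha hs).1
  · refine le_of_tendsto' ((h.tendsto_ev_inv hs a).sub (hr.tendsto_ev_inv hs a)).norm fun Λ => ?_
    rw [finEv_restrict_congr (ham_restrictTerms _ _)]
    exact (h.finEv_cut hB _ hX ha hs).2

/-- The evolution generated by terms in `Γ` preserves the observables in `Γ`. -/
theorem IsRegular.ev_mem_alg (h : IsRegular C Φ) {Γ : Set ℤ}
    (hΓ : ∀ Z : Finset ℤ, ¬(Z : Set ℤ) ⊆ Γ → ∀ u, Φ Z u = 0) {s : ℝ} (hs : s ∈ Set.Icc (0 : ℝ) 1)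
    {a : ChainAlgebra n} (ha : a ∈ alg n Γ) : ev Φ s a ∈ alg n Γ ∧ (ev Φ s)⁻¹ a ∈ alg n Γ := by
  classical
  have hU : ∀ Λ : Finset ℤ, prop (ham Φ Λ.powerset) s ∈ alg n Γ := fun Λ => by
    have e : ham Φ Λ.powerset = ham Φ (Λ.powerset.filter fun Z => (Z : Set ℤ) ⊆ Γ) := by
      funext u
      rw [ham, ham, Finset.sum_filter]
      refine Finset.sum_congr rfl fun Z _ => ?_
      split_ifs with hZ
      exacts [rfl, hΓ Z hZ u]
    rw [e]
    exact supp_le_alg Γ (prop_ham_mem h _ (fun Z hZ => (Finset.mem_filter.mp hZ).2) s)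
  refine ⟨mem_alg_of_tendsto (h.tendsto_ev hs a) fun Λ => ?_,
    mem_alg_of_tendsto (h.tendsto_ev_inv hs a) fun Λ => ?_⟩
  · rw [h.finEv_apply]
    exact mul_mem (mul_mem (hU Λ) ha) (star_mem (hU Λ))
  · rw [h.finEv_inv_apply]
    exact mul_mem (mul_mem (star_mem (hU Λ)) ha) (hU Λ)

/-- The evolution generated by terms outside of `Γ` fixes the observables in `Γ`. -/
theorem IsRegular.ev_fix (h : IsRegular C Φ) {Γ : Set ℤ}
    (hΓ : ∀ Z : Finset ℤ, ¬(Z : Set ℤ) ⊆ Γᶜ → ∀ u, Φ Z u = 0) {s : ℝ} (hs : s ∈ Set.Icc (0 : ℝ) 1)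
    {a : ChainAlgebra n} (ha : a ∈ alg n Γ) : ev Φ s a = a := by
  classical
  refine tendsto_nhds_unique (h.tendsto_ev hs a) (tendsto_const_nhds.congr fun Λ => ?_)
  have e : ham Φ Λ.powerset = ham Φ (Λ.powerset.filter fun Z => (Z : Set ℤ) ⊆ Γᶜ) := by
    funext u
    rw [ham, ham, Finset.sum_filter]
    refine Finset.sum_congr rfl fun Z _ => ?_
    split_ifs with hZ
    exacts [rfl, hΓ Z hZ u]
  have hU : prop (ham Φ Λ.powerset) s ∈ alg n Γᶜ := by
    rw [e]
    exact supp_le_alg _ (prop_ham_mem h _ (fun Z hZ => (Finset.mem_filter.mp hZ).2) s)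
  rw [h.finEv_apply, (commute_of_disjoint_alg disjoint_compl_left hU ha).eq, mul_assoc,
    (h.prop_mem_unitary _ s).2, mul_one]

theorem aut_prop {K : ℝ → ChainAlgebra n} {M : ℝ} (hK : IsDriver K M) (τ : ChainAut n)
    (hτ : ∀ u, τ (K u) = K u) (s : ℝ) : τ (prop K s) = prop K s := by
  let B : Subalgebra ℂ (ChainAlgebra n) :=
    AlgHom.equalizer (τ : ChainAlgebra n →ₐ[ℂ] ChainAlgebra n) (AlgHom.id ℂ _)
  have hB : IsClosed (B : Set (ChainAlgebra n)) := isClosed_eq (continuous_aut τ) continuous_id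
  exact prop_mem hB hK hτ s

theorem IsRegular.aut_prop (h : IsRegular C Φ) (τ : ChainAut n)
    (hτ : ∀ Z u, τ (Φ Z u) = Φ Z u) (𝒵 : Finset (Finset ℤ)) (s : ℝ) :
    τ (prop (ham Φ 𝒵) s) = prop (ham Φ 𝒵) s :=
  SpinChain.aut_prop (h.isDriver 𝒵) τ (fun u => by simp [ham, map_sum, hτ]) s

/-- Symmetries of the terms commute with the evolution. -/
theorem IsRegular.ev_comm (h : IsRegular C Φ) (τ : ChainAut n) (hτ : ∀ Z u, τ (Φ Z u) = Φ Z u)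
    {s : ℝ} (hs : s ∈ Set.Icc (0 : ℝ) 1) (a : ChainAlgebra n) :
    τ (ev Φ s a) = ev Φ s (τ a) := by
  refine tendsto_nhds_unique (((continuous_aut τ).tendsto _).comp (h.tendsto_ev hs a))
    ((h.tendsto_ev hs (τ a)).congr fun Λ => ?_)
  rw [Function.comp_apply, h.finEv_apply, h.finEv_apply, map_mul, map_mul, map_star,
    h.aut_prop τ hτ]

theorem IsRegular.ev_zero (h : IsRegular C Φ) : ev Φ 0 = 1 := by
  refine DFunLike.ext _ _ fun a => ?_
  refine tendsto_nhds_unique (h.tendsto_ev ⟨le_rfl, zero_le_one⟩ a)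
    (tendsto_const_nhds.congr fun Λ => ?_)
  rw [h.finEv_apply, prop_zero (h.isDriver _)]
  simp

/-- The evolution is Lipschitz on local observables at time `0`. -/
theorem IsRegular.norm_ev_sub_le (h : IsRegular C Φ) {s : ℝ} (hs : s ∈ Set.Icc (0 : ℝ) 1)
    {X : Finset ℤ} {a : ChainAlgebra n} (ha : a ∈ supp n (X : Set ℤ)) :
    ‖ev Φ s a - a‖ ≤ 2 * (X.card * C) * ‖a‖ * s := by
  classical
  refine le_of_tendsto' ((h.tendsto_ev hs a).sub_const a).norm fun Λ => ?_
  set 𝒵 := Λ.powerset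
  -- the terms disjoint from `X` do not move `a`
  set 𝒵₀ := 𝒵.filter fun Z => Disjoint Z X with h𝒵₀
  have hcomm : Commute (prop (ham Φ 𝒵₀) s) a := by
    refine commute_of_disjoint (X := (X : Set ℤ)ᶜ) disjoint_compl_left
      (prop_ham_mem h _ (fun Z hZ => ?_) s) ha
    exact Set.subset_compl_iff_disjoint_right.mpr
      (Finset.disjoint_coe.mpr (Finset.mem_filter.mp hZ).2)
  have hdiff : ∀ u, ‖ham Φ 𝒵 u - ham Φ 𝒵₀ u‖ ≤ X.card * C := fun u => by
    have e : ham Φ 𝒵 u - ham Φ 𝒵₀ u = ∑ Z ∈ 𝒵 with ¬Disjoint Z X, Φ Z u := by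
      rw [ham, ham, ← Finset.sum_filter_add_sum_filter_not 𝒵 fun Z => Disjoint Z X]
      abel
    rw [e]
    calc _ ≤ ∑ Z ∈ 𝒵 with ¬Disjoint Z X, ‖Φ Z u‖ := norm_sum_le _ _
      _ ≤ ∑ Z ∈ 𝒵 with ¬Disjoint Z X, ∑ x ∈ X with x ∈ Z, ‖Φ Z u‖ := by
          refine Finset.sum_le_sum fun Z hZ => ?_
          obtain ⟨x, hxZ, hxX⟩ := Finset.not_disjoint_iff.mp (Finset.mem_filter.mp hZ).2
          exact Finset.single_le_sum (f := fun _ => ‖Φ Z u‖) (fun _ _ => norm_nonneg _)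
            (Finset.mem_filter.mpr ⟨hxX, hxZ⟩)
      _ = ∑ x ∈ X, ∑ Z ∈ 𝒵 with ¬Disjoint Z X ∧ x ∈ Z, ‖Φ Z u‖ := by
          refine Finset.sum_comm' fun Z x => ?_
          simp only [Finset.mem_filter]
          tauto
      _ ≤ ∑ _x ∈ X, C := Finset.sum_le_sum fun x _ => h.sum_le u x _ fun Z hZ =>
          (Finset.mem_filter.mp hZ).2.2
      _ = X.card * C := by simp
  have key := norm_interaction_conj_sub_le (h.isDriver 𝒵) (h.isDriver 𝒵₀) (b := a) hs.1
    (g := 2 * (X.card * C) * ‖a‖) fun u _ => by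
      refine (norm_commutator_le _ _).trans ?_
      rw [norm_unitary_conj (h.prop_mem_unitary _ u)]
      have := hdiff u
      gcongr
  refine (le_of_eq ?_).trans key
  rw [h.finEv_apply, star_mul, star_star]
  have h1 : star (prop (ham Φ 𝒵₀) s) * a * prop (ham Φ 𝒵₀) s = a := by
    rw [mul_assoc, ← hcomm.eq, ← mul_assoc, (h.prop_mem_unitary _ s).1, one_mul]
  have h2 : prop (ham Φ 𝒵) s * star (prop (ham Φ 𝒵₀) s) * a *
      (prop (ham Φ 𝒵₀) s * star (prop (ham Φ 𝒵) s)) = prop (ham Φ 𝒵) s *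
        (star (prop (ham Φ 𝒵₀) s) * a * prop (ham Φ 𝒵₀) s) * star (prop (ham Φ 𝒵) s) := by
    simp only [mul_assoc]
  rw [h2, h1]

/-- The evolution of time-shifted terms. -/
theorem IsRegular.ev_shift (h : IsRegular C Φ) {r s : ℝ} (hr : r ∈ Set.Icc (0 : ℝ) 1)
    (hs : s ∈ Set.Icc (0 : ℝ) 1) (hrs : r + s ≤ 1) :
    ev (fun Z u => Φ Z (r + u)) s = (ev Φ r)⁻¹ * ev Φ (r + s) := by
  refine DFunLike.ext _ _ fun a => ?_
  refine tendsto_nhds_unique ((h.shift r).tendsto_ev hs a) ?_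
  have h1 := h.tendsto_ev (s := r + s) ⟨add_nonneg hr.1 hs.1, hrs⟩ a
  refine (tendsto_aut_apply (h.tendsto_ev_inv hr) h1).congr fun Λ => ?_
  have e := prop_shift (h.isDriver Λ.powerset) r s
  rw [h.finEv_inv_apply, h.finEv_apply, (h.shift r).finEv_apply]
  change _ = prop (fun u => ham Φ Λ.powerset (r + u)) s * a *
    star (prop (fun u => ham Φ Λ.powerset (r + u)) s)
  rw [e, star_mul, star_star]
  simp only [mul_assoc]

theorem IsRegular.norm_ev_sub_ev_le (h : IsRegular C Φ) {s t : ℝ} (hs : s ∈ Set.Icc (0 : ℝ) 1)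
    (ht : t ∈ Set.Icc (0 : ℝ) 1) (hst : s ≤ t) {X : Finset ℤ} {a : ChainAlgebra n}
    (ha : a ∈ supp n (X : Set ℤ)) : ‖ev Φ t a - ev Φ s a‖ ≤ 2 * (X.card * C) * ‖a‖ * (t - s) := by
  have hts : t - s ∈ Set.Icc (0 : ℝ) 1 := ⟨by linarith, by linarith [hs.1, ht.2]⟩
  have e := h.ev_shift hs hts (by linarith [ht.2])
  rw [add_sub_cancel] at e
  have h1 := (h.shift s).norm_ev_sub_le hts ha
  rw [e, ← norm_aut_sub (ev Φ s), StarAlgEquiv.mul_apply, aut_apply_inv] at h1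
  exact h1

theorem IsRegular.continuousOn_ev (h : IsRegular C Φ) (a : ChainAlgebra n) :
    ContinuousOn (fun s => ev Φ s a) (Set.Icc 0 1) := by
  refine alg_induction (Γ := Set.univ)
    (p := fun a => ContinuousOn (fun s => ev Φ s a) (Set.Icc 0 1)) ?_ ?_ (dense_supp n a)
  · refine isClosed_of_closure_subset fun b hb => ?_
    rw [mem_closure_iff_seq_limit] at hb
    obtain ⟨x, hx, hxb⟩ := hb
    refine TendstoUniformlyOn.continuousOn (F := fun k s => ev Φ s (x k)) (p := atTop) ?_
      (.of_forall hx)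
    rw [Metric.tendstoUniformlyOn_iff]
    intro ε hε
    filter_upwards [Metric.tendsto_nhds.mp hxb ε hε] with k hk s _
    rwa [dist_eq_norm, norm_aut_sub, ← dist_eq_norm, dist_comm]
  · intro X _ a ha
    have hC := h.nonneg
    refine LipschitzOnWith.continuousOn (K := (2 * (X.card * C) * ‖a‖).toNNReal)
      (LipschitzOnWith.of_dist_le_mul fun s hs t ht => ?_)
    rw [Real.coe_toNNReal _ (by positivity), dist_eq_norm, Real.dist_eq]
    rcases le_total s t with hst | hst
    · rw [norm_sub_rev, abs_sub_comm, abs_of_nonneg (sub_nonneg.mpr hst)]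
      exact h.norm_ev_sub_ev_le hs ht hst ha
    · rw [abs_of_nonneg (sub_nonneg.mpr hst)]
      exact h.norm_ev_sub_ev_le ht hs hst ha

end Evolution

/-! ### Cutting an evolution into two halves -/

section Halves

attribute [local irreducible] instCStarAlgebraChainAlgebra

variable {n : ℤ → ℕ} {C : ℝ} {Φ : Finset ℤ → ℝ → ChainAlgebra n}

/-- The terms on the left half-line `{…, -1, 0}`. -/
def leftTerms (Φ : Finset ℤ → ℝ → ChainAlgebra n) : Finset ℤ → ℝ → ChainAlgebra n :=
  restrictTerms (fun Z : Finset ℤ => (Z : Set ℤ) ⊆ Set.Iic 0) Φ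

/-- The terms on the right half-line `{1, 2, …}`. -/
def rightTerms (Φ : Finset ℤ → ℝ → ChainAlgebra n) : Finset ℤ → ℝ → ChainAlgebra n :=
  restrictTerms (fun Z : Finset ℤ => (Z : Set ℤ) ⊆ (Set.Iic 0)ᶜ) Φ

/-- The terms on sets which contain sites of both half-lines. -/
def crossTerms (Φ : Finset ℤ → ℝ → ChainAlgebra n) : Finset ℤ → ℝ → ChainAlgebra n :=
  restrictTerms (Crosses (Set.Iic 0)) Φ

/-- The terms on sets which are contained in one of the half-lines. -/
def decoupledTerms (Φ : Finset ℤ → ℝ → ChainAlgebra n) : Finset ℤ → ℝ → ChainAlgebra n :=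
  restrictTerms (fun Z => ¬Crosses (Set.Iic 0) Z) Φ

theorem IsRegular.sum_crossTerms_le (h : IsRegular C Φ) (u : ℝ) (𝒵 : Finset (Finset ℤ)) :
    ∑ Z ∈ 𝒵, ‖crossTerms Φ Z u‖ ≤ C * decaySum := by
  classical
  have e : ∑ Z ∈ 𝒵, ‖crossTerms Φ Z u‖ = ∑ Z ∈ 𝒵 with Crosses (Set.Iic 0) Z, ‖Φ Z u‖ := by
    rw [Finset.sum_filter]
    refine Finset.sum_congr rfl fun Z _ => ?_
    rw [crossTerms, restrictTerms]
    split_ifs <;> simp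
  rw [e]
  set 𝒵' := 𝒵.filter (Crosses (Set.Iic 0))
  have h1 : ∀ Z ∈ 𝒵', ‖Φ Z u‖ ≤ ‖Φ Z u‖ * ∑ _x ∈ Z, (1 : ℝ) := fun Z hZ => by
    obtain ⟨x, hx, -⟩ := Set.not_subset.mp (Finset.mem_filter.mp hZ).2.1
    refine le_mul_of_one_le_right (norm_nonneg _) ?_
    simpa using Finset.card_pos.mpr ⟨x, Finset.mem_coe.mp hx⟩
  refine (Finset.sum_le_sum h1).trans ?_
  rw [sum_mul_sum_comm]
  calc _ ≤ ∑ x ∈ 𝒵'.sup id, C * decay (0 - x) := by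
        refine Finset.sum_le_sum fun x _ => ?_
        rw [one_mul, decay_sub_comm]
        simpa using h.sum_crosses_le (isBoundary_Iic 0) u x (𝒵'.filter (x ∈ ·)) fun Z hZ => by
          rw [Finset.mem_filter] at hZ
          exact ⟨(Finset.mem_filter.mp hZ.1).2, hZ.2⟩
    _ ≤ C * decaySum := by
        rw [← Finset.mul_sum]
        exact mul_le_mul_of_nonneg_left (SpinChain.sum_decay_le _ 0) h.nonneg

theorem IsRegular.summable_crossTerms (h : IsRegular C Φ) (u : ℝ) :
    Summable fun Z => crossTerms Φ Z u :=
  .of_norm (summable_of_sum_le (fun _ => norm_nonneg _) (h.sum_crossTerms_le u))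

theorem tendsto_powerset_box :
    Tendsto (fun R => (box R).powerset) atTop (atTop : Filter (Finset (Finset ℤ))) := by
  refine tendsto_atTop_finset_of_monotone (fun R S h => ?_) fun Z => ?_
  · refine Finset.powerset_mono.mpr fun x hx => ?_
    rw [mem_box] at hx ⊢
    exact hx.trans (by exact_mod_cast h)
  · obtain ⟨R, hR⟩ := (exists_subset_box Z).exists
    exact ⟨R, Finset.mem_powerset.mpr hR⟩

theorem ham_eq_decoupled_add_cross (Φ : Finset ℤ → ℝ → ChainAlgebra n)
    (𝒵 : Finset (Finset ℤ)) (u : ℝ) :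
    ham Φ 𝒵 u = ham (decoupledTerms Φ) 𝒵 u + ham (crossTerms Φ) 𝒵 u := by
  rw [ham, ham, ham, ← Finset.sum_add_distrib]
  refine Finset.sum_congr rfl fun Z _ => ?_
  rw [decoupledTerms, crossTerms, restrictTerms, restrictTerms]
  by_cases hZ : Crosses (Set.Iic 0) Z <;> simp [hZ]

theorem IsRegular.ham_decoupledTerms (h : IsRegular C Φ) (𝒵 : Finset (Finset ℤ)) (u : ℝ) :
    ham (decoupledTerms Φ) 𝒵 u = ham (leftTerms Φ) 𝒵 u + ham (rightTerms Φ) 𝒵 u := by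
  rw [ham, ham, ham, ← Finset.sum_add_distrib]
  refine Finset.sum_congr rfl fun Z _ => ?_
  rw [decoupledTerms, leftTerms, rightTerms, restrictTerms, restrictTerms, restrictTerms]
  rcases Z.eq_empty_or_nonempty with rfl | ⟨x, hx⟩
  · simp [h.empty]
  · have h1 : ¬((Z : Set ℤ) ⊆ Set.Iic 0 ∧ (Z : Set ℤ) ⊆ (Set.Iic 0)ᶜ) := fun h => h.2 hx (h.1 hx)
    by_cases h2 : (Z : Set ℤ) ⊆ Set.Iic 0 <;> by_cases h3 : (Z : Set ℤ) ⊆ (Set.Iic 0)ᶜ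
    · exact absurd ⟨h2, h3⟩ h1
    all_goals simp only [Crosses, h2, h3, if_true, if_false, not_true, not_false_eq_true, add_zero,
      zero_add, and_true, and_false, and_self]

theorem prop_ham_mem_of_restrict (h : IsRegular C Φ) (Γ : Set ℤ) (𝒵 : Finset (Finset ℤ)) (s : ℝ) :
    prop (ham (restrictTerms (fun Z : Finset ℤ => (Z : Set ℤ) ⊆ Γ) Φ) 𝒵) s ∈ supp n Γ := by
  classical
  rw [ham_restrictTerms]
  exact prop_ham_mem h _ (fun Z hZ => (Finset.mem_filter.mp hZ).2) s

theorem IsRegular.ev_decoupledTerms (h : IsRegular C Φ) {s : ℝ} (hs : s ∈ Set.Icc (0 : ℝ) 1) :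
    ev (decoupledTerms Φ) s = ev (leftTerms Φ) s * ev (rightTerms Φ) s := by
  have hl : IsRegular C (leftTerms Φ) := h.restrict _
  have hr : IsRegular C (rightTerms Φ) := h.restrict _
  have hd : IsRegular C (decoupledTerms Φ) := h.restrict _
  refine DFunLike.ext _ _ fun a => tendsto_nhds_unique (hd.tendsto_ev hs a) ?_
  refine (tendsto_aut_apply (hl.tendsto_ev hs) (hr.tendsto_ev hs a)).congr fun Λ => ?_
  have e : prop (ham (decoupledTerms Φ) Λ.powerset) s =
      prop (ham (leftTerms Φ) Λ.powerset) s * prop (ham (rightTerms Φ) Λ.powerset) s := by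
    rw [← prop_add (hl.isDriver _) (hr.isDriver _)]
    · congr 1
      funext u
      exact h.ham_decoupledTerms _ u
    · intro s u
      refine commute_of_disjoint (X := (Set.Iic 0)ᶜ) (Y := Set.Iic 0) disjoint_compl_left
        (prop_ham_mem_of_restrict h _ _ s) (sum_mem fun Z _ => ?_)
      rw [leftTerms, restrictTerms]
      split_ifs with hZ
      exacts [supp_mono hZ (h.mem Z u), zero_mem _]
  rw [hl.finEv_apply, hr.finEv_apply, hd.finEv_apply, e, star_mul]
  simp only [mul_assoc]

/-- The terms across the cut in the interaction picture, in finite volume. -/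
def cutDriver (Φ : Finset ℤ → ℝ → ChainAlgebra n) (R : ℕ) (u : ℝ) : ChainAlgebra n :=
  prop (ham (decoupledTerms Φ) (box R).powerset) u * ham (crossTerms Φ) (box R).powerset u *
    star (prop (ham (decoupledTerms Φ) (box R).powerset) u)

open Classical in
/-- The terms across the cut in the interaction picture. -/
def cutDriverLim (Φ : Finset ℤ → ℝ → ChainAlgebra n) (u : ℝ) : ChainAlgebra n :=
  if u ∈ Set.Icc (0 : ℝ) 1 then ev (decoupledTerms Φ) u (∑' Z, crossTerms Φ Z u) else 0

theorem IsRegular.isDriver_cutDriver (h : IsRegular C Φ) (R : ℕ) :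
    IsDriver (cutDriver Φ R) (C * decaySum) := by
  have hd : IsRegular C (decoupledTerms Φ) := h.restrict _
  have hc : IsRegular C (crossTerms Φ) := h.restrict _
  refine ⟨?_, fun u => ?_, fun u => ?_⟩
  · have := (continuous_prop (hd.isDriver (box R).powerset)).aestronglyMeasurable (μ := volume)
    exact (this.mul (hc.isDriver _).meas).mul this.star
  · rw [cutDriver, norm_unitary_conj (hd.prop_mem_unitary _ u)]
    exact (norm_sum_le _ _).trans (h.sum_crossTerms_le u _)
  · simp only [cutDriver, star_mul, star_star, (hc.isDriver _).sa, mul_assoc]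

theorem IsRegular.tendsto_cutDriver (h : IsRegular C Φ) {u : ℝ} (hu : u ∈ Set.Icc (0 : ℝ) 1) :
    Tendsto (fun R => cutDriver Φ R u) atTop (𝓝 (cutDriverLim Φ u)) := by
  have hd : IsRegular C (decoupledTerms Φ) := h.restrict _
  rw [cutDriverLim, if_pos hu]
  refine (tendsto_aut_apply (fun a => (hd.tendsto_ev hu a).comp tendsto_box)
    ((h.summable_crossTerms u).hasSum.comp tendsto_powerset_box)).congr fun R => ?_
  exact hd.finEv_apply _ _ _

theorem IsRegular.isDriver_cutDriverLim (h : IsRegular C Φ) :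
    IsDriver (cutDriverLim Φ) (C * decaySum) := by
  classical
  have hlim : ∀ u, Tendsto (fun R => (Set.Icc (0 : ℝ) 1).indicator (cutDriver Φ R) u) atTop
      (𝓝 (cutDriverLim Φ u)) := fun u => by
    by_cases hu : u ∈ Set.Icc (0 : ℝ) 1
    · simpa only [Set.indicator_of_mem hu] using h.tendsto_cutDriver hu
    · simpa only [Set.indicator_of_notMem hu, cutDriverLim, if_neg hu] using tendsto_const_nhds
  refine ⟨?_, fun u => ?_, fun u => ?_⟩
  · exact aestronglyMeasurable_of_tendsto_ae atTop
      (fun R => (h.isDriver_cutDriver R).meas.indicator measurableSet_Icc) (.of_forall hlim)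
  · refine le_of_tendsto' (hlim u).norm fun R => ?_
    exact (norm_indicator_le_norm_self _ _).trans ((h.isDriver_cutDriver R).bound u)
  · refine tendsto_nhds_unique (hlim u).star ((hlim u).congr fun R => ?_)
    by_cases hu : u ∈ Set.Icc (0 : ℝ) 1
    · simp only [Set.indicator_of_mem hu, (h.isDriver_cutDriver R).sa]
    · simp only [Set.indicator_of_notMem hu, star_zero]

/-- The unitary which relates an evolution to the decoupled one. -/
def cutUnitary (Φ : Finset ℤ → ℝ → ChainAlgebra n) (s : ℝ) : ChainAlgebra n :=
  prop (cutDriverLim Φ) s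

theorem IsRegular.tendsto_prop_cutDriver (h : IsRegular C Φ) {s : ℝ}
    (hs : s ∈ Set.Icc (0 : ℝ) 1) :
    Tendsto (fun R => prop (cutDriver Φ R) s) atTop (𝓝 (cutUnitary Φ s)) := by
  rw [tendsto_iff_norm_sub_tendsto_zero]
  have hK := h.isDriver_cutDriver
  have hK' := h.isDriver_cutDriverLim
  refine squeeze_zero (fun _ => norm_nonneg _)
    (fun R => norm_prop_sub_prop_le (hK R) hK' hs.1) ?_
  have h0 : ∫ _u in (0 : ℝ)..s, (0 : ℝ) = 0 := by simp
  suffices Tendsto (fun R => ∫ u in (0 : ℝ)..s, ‖cutDriver Φ R u - cutDriverLim Φ u‖) atTop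
      (𝓝 (∫ _u in (0 : ℝ)..s, (0 : ℝ))) by rwa [h0] at this
  refine intervalIntegral.tendsto_integral_filter_of_dominated_convergence (l := (atTop : Filter ℕ))
    (F := fun R u => ‖cutDriver Φ R u - cutDriverLim Φ u‖) (fun _ => C * decaySum + C * decaySum)
    (.of_forall fun R => ?_) (.of_forall fun R => ?_)
    (intervalIntegrable_const (μ := volume)) ?_
  · exact ((hK R).meas.sub hK'.meas).norm.restrict
  · refine .of_forall fun u _ => ?_
    rw [norm_norm]
    exact (norm_sub_le _ _).trans (add_le_add ((hK R).bound u) (hK'.bound u))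
  · refine .of_forall fun u hu => ?_
    rw [Set.uIoc_of_le hs.1] at hu
    have := h.tendsto_cutDriver (u := u) ⟨hu.1.le, hu.2.trans hs.2⟩
    exact tendsto_iff_norm_sub_tendsto_zero.mp this

theorem IsRegular.prop_cutDriver (h : IsRegular C Φ) (R : ℕ) (s : ℝ) :
    prop (cutDriver Φ R) s = prop (ham Φ (box R).powerset) s *
      star (prop (ham (decoupledTerms Φ) (box R).powerset) s) := by
  have hd : IsRegular C (decoupledTerms Φ) := h.restrict _
  have hU := h.isDriver (box R).powerset
  have hW := hd.isDriver (box R).powerset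
  set U := prop (ham Φ (box R).powerset)
  set W := prop (ham (decoupledTerms Φ) (box R).powerset) with hWdef
  have h1 : ∀ u x, star (W u) * (W u * x) = x := fun u x => by
    rw [← mul_assoc, star_prop_mul hW, one_mul]
  have hac : IsACPath (fun s => U s * star (W s)) fun s =>
      Complex.I • (U s * star (W s) * cutDriver Φ R s) := by
    refine ((isACPath_prop hU).mul (isACPath_prop hW).star).congr fun s => ?_
    have e : ham (crossTerms Φ) (box R).powerset s =
        ham Φ (box R).powerset s - ham (decoupledTerms Φ) (box R).powerset s := by
      rw [ham_eq_decoupled_add_cross Φ, add_sub_cancel_left]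
    rw [cutDriver, e]
    change Complex.I • (U s * _) * star (W s) + U s * star (Complex.I • (W s * _)) =
      Complex.I • (U s * star (W s) * (W s * _ * star (W s)))
    simp only [star_smul, star_mul, hW.sa, mul_sub, sub_mul, smul_sub, mul_assoc, h1,
      smul_mul_assoc, mul_smul_comm, Complex.star_def, Complex.conj_I, neg_smul, mul_neg]
    abel
  have := eq_mul_prop (h.isDriver_cutDriver R) hac s
  rw [this]
  simp [U, W, prop_zero hU, prop_zero hW]

theorem IsRegular.cutUnitary_mem_unitary (h : IsRegular C Φ) (s : ℝ) :
    cutUnitary Φ s ∈ unitary (ChainAlgebra n) :=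
  SpinChain.prop_mem_unitary h.isDriver_cutDriverLim s

theorem IsRegular.norm_cutUnitary_sub_one_le (h : IsRegular C Φ) {s : ℝ} (hs : 0 ≤ s) :
    ‖cutUnitary Φ s - 1‖ ≤ C * decaySum * s := by
  have := norm_prop_sub_le h.isDriver_cutDriverLim hs
  rwa [prop_zero h.isDriver_cutDriverLim, sub_zero] at this

/-- An evolution is the evolution of the two decoupled half-lines, followed by an inner
automorphism. -/
theorem IsRegular.ev_eq_cut (h : IsRegular C Φ) {s : ℝ} (hs : s ∈ Set.Icc (0 : ℝ) 1) :
    ev Φ s = innerAut (cutUnitary Φ s) * (ev (leftTerms Φ) s * ev (rightTerms Φ) s) := by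
  have hd : IsRegular C (decoupledTerms Φ) := h.restrict _
  rw [← h.ev_decoupledTerms hs]
  refine DFunLike.ext _ _ fun a => tendsto_nhds_unique
    ((h.tendsto_ev hs a).comp tendsto_box) ?_
  rw [StarAlgEquiv.mul_apply, innerAut_apply (h.cutUnitary_mem_unitary s)]
  have hX := h.tendsto_prop_cutDriver hs
  refine ((hX.mul ((hd.tendsto_ev hs a).comp tendsto_box)).mul hX.star).congr fun R => ?_
  rw [Function.comp_apply, Function.comp_apply, h.finEv_apply, hd.finEv_apply, h.prop_cutDriver,
    star_mul, star_star]
  have h1 : ∀ x, star (prop (ham (decoupledTerms Φ) (box R).powerset) s) *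
      (prop (ham (decoupledTerms Φ) (box R).powerset) s * x) = x := fun x => by
    rw [← mul_assoc, (hd.prop_mem_unitary _ s).1, one_mul]
  simp only [mul_assoc, h1]

theorem aut_restrictTerms {τ : ChainAut n} (hτ : ∀ Z u, τ (Φ Z u) = Φ Z u)
    (P : Finset ℤ → Prop) (Z : Finset ℤ) (u : ℝ) :
    τ (restrictTerms P Φ Z u) = restrictTerms P Φ Z u := by
  unfold restrictTerms
  split_ifs
  exacts [hτ Z u, map_zero τ]

theorem IsRegular.aut_cutUnitary (h : IsRegular C Φ) (τ : ChainAut n)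
    (hτ : ∀ Z u, τ (Φ Z u) = Φ Z u) {s : ℝ} (hs : s ∈ Set.Icc (0 : ℝ) 1) :
    τ (cutUnitary Φ s) = cutUnitary Φ s := by
  have hd : IsRegular C (decoupledTerms Φ) := h.restrict _
  have hX := h.tendsto_prop_cutDriver hs
  refine tendsto_nhds_unique (((continuous_aut τ).tendsto _).comp hX) (hX.congr fun R => ?_)
  rw [Function.comp_apply, h.prop_cutDriver, map_mul, map_star, h.aut_prop τ hτ,
    hd.aut_prop τ (aut_restrictTerms hτ _)]

theorem innerAut_mul (α : ChainAut n) {u : ChainAlgebra n} (hu : u ∈ unitary (ChainAlgebra n)) :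
    α * innerAut u = innerAut (α u) * α := by
  refine DFunLike.ext _ _ fun a => ?_
  have hu' : α u ∈ unitary (ChainAlgebra n) := by
    constructor <;> rw [← map_star, ← map_mul]
    · rw [hu.1, map_one]
    · rw [hu.2, map_one]
  rw [StarAlgEquiv.mul_apply, StarAlgEquiv.mul_apply, innerAut_apply hu, innerAut_apply hu',
    map_mul, map_mul, map_star]

end Halves

/-! ### Automorphisms which can be cut at the origin -/

section CutAut

attribute [local irreducible] instCStarAlgebraChainAlgebra

variable {n : ℤ → ℕ} {𝒮 : Set (ChainAut n)} {δ δ₁ δ₂ : ℝ}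
  {θ θ' θ'' θ₁ θ₁' θ₁'' θ₂ θ₂' θ₂'' : ChainAut n} {X X₁ X₂ : ChainAlgebra n}

theorem innerAut_mul_innerAut {u v : ChainAlgebra n} (hu : u ∈ unitary (ChainAlgebra n))
    (hv : v ∈ unitary (ChainAlgebra n)) : innerAut u * innerAut v = innerAut (u * v) := by
  refine DFunLike.ext _ _ fun a => ?_
  rw [StarAlgEquiv.mul_apply, innerAut_apply hu, innerAut_apply hv, innerAut_apply (mul_mem hu hv),
    star_mul]
  simp only [mul_assoc]

theorem innerAut_inv {u : ChainAlgebra n} (hu : u ∈ unitary (ChainAlgebra n)) :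
    (innerAut u)⁻¹ = innerAut (star u) := by
  refine DFunLike.ext _ _ fun a => ?_
  rw [innerAut_inv_apply hu, innerAut_apply (Unitary.star_mem hu), star_star]

theorem aut_mem_unitary (α : ChainAut n) {u : ChainAlgebra n} (hu : u ∈ unitary (ChainAlgebra n)) :
    α u ∈ unitary (ChainAlgebra n) := by
  constructor <;> rw [← map_star, ← map_mul]
  · rw [hu.1, map_one]
  · rw [hu.2, map_one]

/-- Automorphisms which agree on both half-lines are equal. -/
theorem aut_eq_of_eq_on_halves {α β : ChainAut n} (hl : ∀ a ∈ alg n (Set.Iic 0), α a = β a)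
    (hr : ∀ a ∈ alg n (Set.Ioi 0), α a = β a) : α = β := by
  refine aut_eq_of_eq_on_local fun S a ha => ?_
  refine supp_induction (p := fun a => α a = β a) (fun j _ M => ?_) (fun c => ?_)
    (fun a b _ _ h1 h2 => ?_) (fun a b _ _ h1 h2 => ?_) ha
  · rcases le_or_gt j 0 with hj | hj
    · exact hl _ (supp_le_alg _ (site_mem_supp (X := Set.Iic 0) hj M))
    · exact hr _ (supp_le_alg _ (site_mem_supp (X := Set.Ioi 0) hj M))
  · rw [Algebra.algebraMap_eq_smul_one, map_smul, map_smul, map_one, map_one]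
  · rw [map_add, map_add, h1, h2]
  · rw [map_mul, map_mul, h1, h2]

/-- The automorphism `θ` only affects the observables on `Γ`. -/
structure IsLocalizedOn (Γ : Set ℤ) (θ : ChainAut n) : Prop where
  mem : ∀ a ∈ alg n Γ, θ a ∈ alg n Γ
  mem_inv : ∀ a ∈ alg n Γ, θ⁻¹ a ∈ alg n Γ
  fix : ∀ a ∈ alg n Γᶜ, θ a = a

theorem IsLocalizedOn.fix_inv {Γ : Set ℤ} (h : IsLocalizedOn Γ θ) {a : ChainAlgebra n}
    (ha : a ∈ alg n Γᶜ) : θ⁻¹ a = a := by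
  conv_lhs => rw [← h.fix a ha]
  exact aut_inv_apply θ a

theorem IsLocalizedOn.inv {Γ : Set ℤ} (h : IsLocalizedOn Γ θ) : IsLocalizedOn Γ θ⁻¹ where
  mem := h.mem_inv
  mem_inv := by simpa using h.mem
  fix _ ha := h.fix_inv ha

theorem IsLocalizedOn.mul {Γ : Set ℤ} (h₁ : IsLocalizedOn Γ θ₁) (h₂ : IsLocalizedOn Γ θ₂) :
    IsLocalizedOn Γ (θ₁ * θ₂) where
  mem a ha := h₁.mem _ (h₂.mem a ha)
  mem_inv a ha := by
    rw [mul_inv_rev]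
    exact h₂.mem_inv _ (h₁.mem_inv a ha)
  fix a ha := by rw [StarAlgEquiv.mul_apply, h₂.fix a ha, h₁.fix a ha]

theorem compl_Iic_zero : (Set.Iic (0 : ℤ))ᶜ = Set.Ioi 0 := Set.compl_Iic

theorem IsLocalizedOn.commute (h : IsLocalizedOn (Set.Iic 0) θ')
    (h' : IsLocalizedOn (Set.Ioi 0) θ'') : Commute θ' θ'' := by
  refine aut_eq_of_eq_on_halves (fun a ha => ?_) fun a ha => ?_
  · have e : ∀ a ∈ alg n (Set.Iic 0), θ'' a = a := fun a ha =>
      h'.fix a (by rwa [Set.compl_Ioi])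
    rw [StarAlgEquiv.mul_apply, StarAlgEquiv.mul_apply, e _ ha, e _ (h.mem a ha)]
  · have e : ∀ a ∈ alg n (Set.Ioi 0), θ' a = a := fun a ha =>
      h.fix a (by rwa [Set.compl_Iic])
    rw [StarAlgEquiv.mul_apply, StarAlgEquiv.mul_apply, e _ ha, e _ (h'.mem a ha)]

/-- The automorphism `θ` factorizes, up to conjugation by the unitary `X`, into the automorphisms
`θ'` and `θ''` of the left and of the right half-line; everything commutes with the symmetries `𝒮`,
and `X` is `δ`-close to the identity. -/
structure IsCut (𝒮 : Set (ChainAut n)) (θ θ' θ'' : ChainAut n) (X : ChainAlgebra n) (δ : ℝ) :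
    Prop where
  unitary : X ∈ unitary (ChainAlgebra n)
  eq : θ = innerAut X * (θ' * θ'')
  left : IsLocalizedOn (Set.Iic 0) θ'
  right : IsLocalizedOn (Set.Ioi 0) θ''
  aut_eq : ∀ τ ∈ 𝒮, τ X = X
  comm_left : ∀ τ ∈ 𝒮, Commute τ θ'
  comm_right : ∀ τ ∈ 𝒮, Commute τ θ''
  norm_le : ‖X - 1‖ ≤ δ

theorem aut_apply_eq_of_commute {τ : ChainAut n} (h : Commute τ θ) (hX : τ X = X) :
    τ (θ X) = θ X := by
  have := DFunLike.congr_fun h.eq X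
  rwa [StarAlgEquiv.mul_apply, StarAlgEquiv.mul_apply, hX] at this

theorem IsCut.mul (h₁ : IsCut 𝒮 θ₁ θ₁' θ₁'' X₁ δ₁) (h₂ : IsCut 𝒮 θ₂ θ₂' θ₂'' X₂ δ₂) :
    IsCut 𝒮 (θ₁ * θ₂) (θ₁' * θ₂') (θ₁'' * θ₂'') (X₁ * (θ₁' * θ₁'') X₂) (δ₁ + δ₂) where
  unitary := mul_mem h₁.unitary (aut_mem_unitary _ h₂.unitary)
  eq := by
    rw [← innerAut_mul_innerAut h₁.unitary (aut_mem_unitary _ h₂.unitary), h₁.eq, h₂.eq]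
    have e := innerAut_mul (θ₁' * θ₁'') h₂.unitary
    have c := (h₂.left.commute h₁.right).eq
    calc innerAut X₁ * (θ₁' * θ₁'') * (innerAut X₂ * (θ₂' * θ₂''))
        = innerAut X₁ * ((θ₁' * θ₁'') * innerAut X₂) * (θ₂' * θ₂'') := by group
      _ = innerAut X₁ * innerAut ((θ₁' * θ₁'') X₂) * (θ₁' * (θ₁'' * θ₂') * θ₂'') := by
          rw [e]; group
      _ = _ := by rw [← c]; group
  left := h₁.left.mul h₂.left
  right := h₁.right.mul h₂.right
  aut_eq τ hτ := by
    rw [map_mul, h₁.aut_eq τ hτ, aut_apply_eq_of_commute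
      ((h₁.comm_left τ hτ).mul_right (h₁.comm_right τ hτ)) (h₂.aut_eq τ hτ)]
  comm_left τ hτ := (h₁.comm_left τ hτ).mul_right (h₂.comm_left τ hτ)
  comm_right τ hτ := (h₁.comm_right τ hτ).mul_right (h₂.comm_right τ hτ)
  norm_le := by
    have e : X₁ * (θ₁' * θ₁'') X₂ - 1 =
        X₁ * ((θ₁' * θ₁'') (X₂ - 1)) + (X₁ - 1) := by
      rw [map_sub, map_one]; noncomm_ring
    rw [e]
    refine (norm_add_le _ _).trans ?_
    rw [CStarRing.norm_mem_unitary_mul _ h₁.unitary, norm_aut, add_comm δ₁]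
    exact add_le_add h₂.norm_le h₁.norm_le

theorem IsCut.inv (h : IsCut 𝒮 θ θ' θ'' X δ) :
    IsCut 𝒮 θ⁻¹ θ'⁻¹ θ''⁻¹ ((θ' * θ'')⁻¹ (star X)) δ where
  unitary := aut_mem_unitary _ (Unitary.star_mem h.unitary)
  eq := by
    rw [h.eq, mul_inv_rev, innerAut_inv h.unitary, innerAut_mul _ (Unitary.star_mem h.unitary),
      (h.left.commute h.right).eq, mul_inv_rev]
  left := h.left.inv
  right := h.right.inv
  aut_eq τ hτ := aut_apply_eq_of_commute
    ((h.comm_left τ hτ).mul_right (h.comm_right τ hτ)).inv_right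
    (by rw [map_star, h.aut_eq τ hτ])
  comm_left τ hτ := (h.comm_left τ hτ).inv_right
  comm_right τ hτ := (h.comm_right τ hτ).inv_right
  norm_le := by
    have e : (θ' * θ'')⁻¹ (star X) - 1 = (θ' * θ'')⁻¹ (star (X - 1)) := by
      rw [star_sub, map_sub, star_one, map_one]
    rw [e, norm_aut, norm_star]
    exact h.norm_le

variable {C : ℝ} {Φ : Finset ℤ → ℝ → ChainAlgebra n}

theorem IsRegular.isLocalizedOn_ev (h : IsRegular C Φ) (Γ : Set ℤ) {s : ℝ}
    (hs : s ∈ Set.Icc (0 : ℝ) 1) :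
    IsLocalizedOn Γ (ev (restrictTerms (fun Z : Finset ℤ => (Z : Set ℤ) ⊆ Γ) Φ) s) := by
  have hr := h.restrict fun Z : Finset ℤ => (Z : Set ℤ) ⊆ Γ
  have h0 : ∀ Z : Finset ℤ, ¬(Z : Set ℤ) ⊆ Γ → ∀ u,
      restrictTerms (fun Z : Finset ℤ => (Z : Set ℤ) ⊆ Γ) Φ Z u = 0 :=
    fun Z hZ u => restrictTerms_of_not hZ u
  refine ⟨fun a ha => (hr.ev_mem_alg h0 hs ha).1, fun a ha => (hr.ev_mem_alg h0 hs ha).2,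
    fun a ha => hr.ev_fix (by rwa [compl_compl]) hs ha⟩

/-- The evolution generated by invariant local terms can be cut at the origin. -/
theorem IsRegular.isCut (h : IsRegular C Φ) (hS : ∀ τ ∈ 𝒮, ∀ Z u, τ (Φ Z u) = Φ Z u) {s : ℝ}
    (hs : s ∈ Set.Icc (0 : ℝ) 1) :
    IsCut 𝒮 (ev Φ s) (ev (leftTerms Φ) s) (ev (rightTerms Φ) s) (cutUnitary Φ s)
      (C * decaySum * s) where
  unitary := h.cutUnitary_mem_unitary s
  eq := h.ev_eq_cut hs
  left := h.isLocalizedOn_ev _ hs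
  right := by
    rw [← compl_Iic_zero]
    exact h.isLocalizedOn_ev _ hs
  aut_eq τ hτ := h.aut_cutUnitary τ (hS τ hτ) hs
  comm_left τ hτ := DFunLike.ext _ _ fun a =>
    (h.restrict _).ev_comm τ (aut_restrictTerms (hS τ hτ) _) hs a
  comm_right τ hτ := DFunLike.ext _ _ fun a =>
    (h.restrict _).ev_comm τ (aut_restrictTerms (hS τ hτ) _) hs a
  norm_le := h.norm_cutUnitary_sub_one_le hs.1

/-! ### Quasi-locality of the evolution -/

/-- The sum of the kernel over the distances at least `d`. -/
def decayTail (d : ℕ) : ℝ := ∑' y : ℤ, {y : ℤ | (d : ℤ) ≤ |y|}.indicator decay y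

theorem indicator_decay_le (s : Set ℤ) (y : ℤ) : s.indicator decay y ≤ decay y :=
  Set.indicator_le_self' (fun _ _ => decay_nonneg _) y

theorem decayTail_nonneg (d : ℕ) : 0 ≤ decayTail d :=
  tsum_nonneg fun _ => Set.indicator_nonneg (fun _ _ => decay_nonneg _) _

theorem tendsto_decayTail : Tendsto decayTail atTop (𝓝 0) := by
  suffices Tendsto decayTail atTop (𝓝 (∑' _y : ℤ, (0 : ℝ))) by rwa [tsum_zero] at this
  refine tendsto_tsum_of_dominated_convergence summable_decay (fun y => ?_)
    (.of_forall fun d y => ?_)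
  · refine tendsto_const_nhds.congr' ?_
    filter_upwards [eventually_gt_atTop y.natAbs] with d hd
    rw [Set.indicator_of_notMem]
    rw [Set.mem_ofPred_eq, Int.abs_eq_natAbs]
    omega
  · rw [Real.norm_of_nonneg (Set.indicator_nonneg (fun _ _ => decay_nonneg _) _)]
    exact indicator_decay_le _ y

theorem sum_decay_le_decayTail {d : ℕ} {c : ℤ} {X : Finset ℤ} (hX : ∀ y ∈ X, (d : ℤ) ≤ |c - y|) :
    ∑ y ∈ X, decay (c - y) ≤ decayTail d := by
  have hs : Summable ({y : ℤ | (d : ℤ) ≤ |y|}.indicator decay) := summable_decay.indicator _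
  have e : ∑ y ∈ X, decay (c - y) =
      ∑ y ∈ X.map (Equiv.subLeft c).toEmbedding, {y : ℤ | (d : ℤ) ≤ |y|}.indicator decay y := by
    rw [Finset.sum_map]
    exact Finset.sum_congr rfl fun y hy =>
      (Set.indicator_of_mem (s := {y : ℤ | (d : ℤ) ≤ |y|}) (hX y hy) decay).symm
  rw [e]
  exact hs.sum_le_tsum _ fun _ _ => Set.indicator_nonneg (fun _ _ => decay_nonneg _) _

/-- The backward evolution maps observables in `Γ'` to observables which are approximately in a
larger region `Γ`. -/
theorem IsRegular.exists_quasilocal (h : IsRegular C Φ) {Γ Γ' : Set ℤ} {B : Finset ℤ}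
    (hB : IsBoundary Γ B) (hΓ : Γ' ⊆ Γ) {d : ℕ} (hd : ∀ y ∈ Γ', ∀ c ∈ B, (d : ℤ) ≤ |c - y|)
    {s : ℝ} (hs : s ∈ Set.Icc (0 : ℝ) 1) {a : ChainAlgebra n} (ha : a ∈ alg n Γ') :
    ∃ b ∈ alg n Γ, ‖b‖ = ‖a‖ ∧
      ‖(ev Φ s)⁻¹ a - b‖ ≤ cutConst C * ‖a‖ * (B.card * decayTail d) := by
  refine ⟨(ev (restrictTerms (fun Z : Finset ℤ => (Z : Set ℤ) ⊆ Γ) Φ) s)⁻¹ a,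
    (h.isLocalizedOn_ev Γ hs).mem_inv a (alg_mono hΓ ha), norm_aut _ _, ?_⟩
  refine alg_induction (p := fun a => ‖(ev Φ s)⁻¹ a -
    (ev (restrictTerms (fun Z : Finset ℤ => (Z : Set ℤ) ⊆ Γ) Φ) s)⁻¹ a‖ ≤
      cutConst C * ‖a‖ * (B.card * decayTail d)) ?_ (fun X hX a ha => ?_) ha
  · refine isClosed_le ?_ ?_
    · exact ((continuous_aut _).sub (continuous_aut _)).norm
    · fun_prop
  · refine (h.ev_cut hB (hX.trans hΓ) ha hs).2.trans ?_
    have h1 := h.cutConst_nonneg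
    refine mul_le_mul_of_nonneg_left ?_ (by positivity)
    rw [← nsmul_eq_mul]
    exact Finset.sum_le_card_nsmul _ _ _ fun c hc => sum_decay_le_decayTail fun y hy =>
      hd y (hX hy) c hc

end CutAut

/-! ### The GNS representation -/

section GNS

variable {n : ℤ → ℕ} {φ : ChainAlgebra n →L[ℂ] ℂ}

open scoped ComplexOrder in
/-- The GNS construction, for functionals which are nonnegative on the elements `a⋆ a`. -/
theorem exists_cyclic_representation {A : Type} [CStarAlgebra A] (φ : A →ₗ[ℂ] ℂ)
    (hφ : ∀ a : A, ∃ r : ℝ, 0 ≤ r ∧ φ (star a * a) = r) :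
    ∃ (𝓗 : Type) (_ : NormedAddCommGroup 𝓗) (_ : InnerProductSpace ℂ 𝓗) (_ : CompleteSpace 𝓗)
      (π : A →⋆ₐ[ℂ] (𝓗 →L[ℂ] 𝓗)) (Ω : 𝓗),
      (∀ a, φ a = ⟪Ω, π a Ω⟫_ℂ) ∧ Dense (Set.range fun a => π a Ω) := by
  let _ := CStarAlgebra.spectralOrder A
  have := CStarAlgebra.spectralOrderedRing A
  have hpos : ∀ x : A, 0 ≤ x → 0 ≤ φ x := fun x hx => by
    obtain ⟨b, hb⟩ := CStarAlgebra.nonneg_iff_eq_star_mul_self.mp hx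
    obtain ⟨r, hr, e⟩ := hφ b
    rw [hb, e]
    exact_mod_cast hr
  let f : A →ₚ[ℂ] ℂ := PositiveLinearMap.mk₀ φ hpos
  have hf : ∀ a, f a = φ a := fun a => rfl
  have happ : ∀ a : A, f.gnsStarAlgHom a ((f.toPreGNS 1 : f.PreGNS) : f.GNS) =
      ((f.toPreGNS a : f.PreGNS) : f.GNS) := fun a => by
    change f.gnsNonUnitalStarAlgHom a ((f.toPreGNS 1 : f.PreGNS) : f.GNS) = _
    rw [PositiveLinearMap.gnsNonUnitalStarAlgHom_apply_coe]
    simp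
  refine ⟨f.GNS, inferInstance, inferInstance, inferInstance, f.gnsStarAlgHom,
    ((f.toPreGNS 1 : f.PreGNS) : f.GNS), fun a => ?_, ?_⟩
  · rw [happ, UniformSpace.Completion.inner_coe, PositiveLinearMap.preGNS_inner_def]
    rw [PositiveLinearMap.ofPreGNS_toPreGNS, PositiveLinearMap.ofPreGNS_toPreGNS, star_one,
      one_mul, hf]
  · have hd : DenseRange ((↑) : f.PreGNS → f.GNS) := UniformSpace.Completion.denseRange_coe
    refine Dense.mono ?_ hd
    rintro _ ⟨x, rfl⟩
    exact ⟨f.ofPreGNS x, (happ _).trans (by rw [PositiveLinearMap.toPreGNS_ofPreGNS])⟩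

theorem exists_gnsTriple (hφ : φ ∈ stateSet n) :
    ∃ (𝓗 : Type) (_ : NormedAddCommGroup 𝓗) (_ : InnerProductSpace ℂ 𝓗) (_ : CompleteSpace 𝓗)
      (π : ChainAlgebra n →⋆ₐ[ℂ] (𝓗 →L[ℂ] 𝓗)) (Ω : 𝓗), IsGNSTriple φ π Ω := by
  obtain ⟨𝓗, i₁, i₂, i₃, π, Ω, h₁, h₂⟩ :=
    exists_cyclic_representation (φ : ChainAlgebra n →ₗ[ℂ] ℂ) hφ.2
  exact ⟨𝓗, i₁, i₂, i₃, π, Ω, h₁, h₂⟩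

variable {𝓗 : Type*} [NormedAddCommGroup 𝓗] [InnerProductSpace ℂ 𝓗] [CompleteSpace 𝓗]
  {π : ChainAlgebra n →⋆ₐ[ℂ] (𝓗 →L[ℂ] 𝓗)} {Ω : 𝓗}

theorem inner_rep_left (π : ChainAlgebra n →⋆ₐ[ℂ] (𝓗 →L[ℂ] 𝓗)) (a : ChainAlgebra n) (x y : 𝓗) :
    ⟪π a x, y⟫_ℂ = ⟪x, π (star a) y⟫_ℂ := by
  rw [map_star, ContinuousLinearMap.star_eq_adjoint, ContinuousLinearMap.adjoint_inner_right]

theorem rep_mul_apply (π : ChainAlgebra n →⋆ₐ[ℂ] (𝓗 →L[ℂ] 𝓗)) (a b : ChainAlgebra n) (x : 𝓗) :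
    π (a * b) x = π a (π b x) := by rw [map_mul]; rfl

theorem rep_one_apply (π : ChainAlgebra n →⋆ₐ[ℂ] (𝓗 →L[ℂ] 𝓗)) (x : 𝓗) : π 1 x = x := by
  rw [map_one]; rfl

theorem norm_rep_apply_le (π : ChainAlgebra n →⋆ₐ[ℂ] (𝓗 →L[ℂ] 𝓗)) (a : ChainAlgebra n) (x : 𝓗) :
    ‖π a x‖ ≤ ‖a‖ * ‖x‖ :=
  ((π a).le_opNorm x).trans (mul_le_mul_of_nonneg_right (NonUnitalStarAlgHom.norm_apply_le π a)
    (norm_nonneg _))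

theorem continuous_rep_apply (π : ChainAlgebra n →⋆ₐ[ℂ] (𝓗 →L[ℂ] 𝓗)) (x : 𝓗) :
    Continuous fun a => π a x := by
  have h : Continuous (π : ChainAlgebra n → (𝓗 →L[ℂ] 𝓗)) :=
    AddMonoidHomClass.continuous_of_bound π 1 fun a => by
      rw [one_mul]; exact NonUnitalStarAlgHom.norm_apply_le π a
  exact h.clm_apply continuous_const

theorem norm_sq_rep_apply (π : ChainAlgebra n →⋆ₐ[ℂ] (𝓗 →L[ℂ] 𝓗)) (a : ChainAlgebra n) (x : 𝓗) :
    (‖π a x‖ : ℂ) ^ 2 = ⟪x, π (star a * a) x⟫_ℂ := by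
  rw [rep_mul_apply, ← inner_rep_left, inner_self_eq_norm_sq_to_K]
  rfl

/-- Vectors with the same state have the same norms under the representation. -/
theorem norm_rep_apply_eq {𝓗' : Type*} [NormedAddCommGroup 𝓗'] [InnerProductSpace ℂ 𝓗']
    [CompleteSpace 𝓗'] {π' : ChainAlgebra n →⋆ₐ[ℂ] (𝓗' →L[ℂ] 𝓗')} {a b : ChainAlgebra n} {x : 𝓗}
    {y : 𝓗'} (h : ⟪x, π (star a * a) x⟫_ℂ = ⟪y, π' (star b * b) y⟫_ℂ) :
    ‖π a x‖ = ‖π' b y‖ := by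
  rw [← norm_sq_rep_apply, ← norm_sq_rep_apply] at h
  have h2 : ‖π a x‖ ^ 2 = ‖π' b y‖ ^ 2 := by exact_mod_cast h
  exact (sq_eq_sq₀ (norm_nonneg _) (norm_nonneg _)).mp h2

namespace IsGNSTriple

variable (h : IsGNSTriple φ π Ω)
include h

theorem inner_apply (a b : ChainAlgebra n) : ⟪π a Ω, π b Ω⟫_ℂ = φ (star a * b) := by
  rw [inner_rep_left, ← rep_mul_apply, h.vector]

theorem ext {x y : 𝓗} (hxy : ∀ a, ⟪π a Ω, x⟫_ℂ = ⟪π a Ω, y⟫_ℂ) : x = y := by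
  refine ext_inner_left ℂ fun z => ?_
  refine congrFun (Continuous.ext_on h.cyclic (f := fun z => ⟪z, x⟫_ℂ) (g := fun z => ⟪z, y⟫_ℂ)
    (by fun_prop) (by fun_prop) ?_) z
  rintro _ ⟨a, rfl⟩
  exact hxy a

theorem norm_vector (hφ : φ ∈ stateSet n) : ‖Ω‖ = 1 := by
  have h1 := norm_sq_rep_apply π 1 Ω
  rw [star_one, one_mul, ← h.vector, hφ.1, rep_one_apply] at h1
  have h2 : ‖Ω‖ ^ 2 = 1 := by exact_mod_cast h1
  nlinarith [norm_nonneg Ω]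

/-- An isometry can be defined on the vectors `π(a)Ω`. -/
theorem exists_isometry {𝓗' : Type*} [NormedAddCommGroup 𝓗'] [InnerProductSpace ℂ 𝓗']
    [CompleteSpace 𝓗'] (T : ChainAlgebra n →ₗ[ℂ] 𝓗') (hT : ∀ a, ‖T a‖ = ‖π a Ω‖) :
    ∃ W : 𝓗 →ₗᵢ[ℂ] 𝓗', ∀ a, W (π a Ω) = T a := by
  let e : ChainAlgebra n →ₗ[ℂ] 𝓗 :=
    { toFun := fun a => π a Ω
      map_add' := fun a b => by rw [map_add]; rfl
      map_smul' := fun c a => by rw [map_smul]; rfl }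
  have hW : ∀ a, T.extendOfNorm e (e a) = T a :=
    LinearMap.extendOfNorm_eq h.cyclic ⟨1, fun a => by rw [one_mul]; exact (hT a).le⟩
  refine ⟨⟨(T.extendOfNorm e : 𝓗 →ₗ[ℂ] 𝓗'), fun x => ?_⟩, hW⟩
  refine congrFun (Continuous.ext_on h.cyclic (f := fun x => ‖T.extendOfNorm e x‖)
    (g := fun x => ‖x‖) (by fun_prop) (by fun_prop) ?_) x
  rintro _ ⟨a, rfl⟩
  change ‖T.extendOfNorm e (e a)‖ = _
  rw [hW, hT]

/-- Continuous maps which agree on the vectors `π(a)Ω` are equal. -/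
theorem eq_of_eq_on {Y : Type*} [TopologicalSpace Y] [T2Space Y] {f g : 𝓗 → Y}
    (hf : Continuous f) (hg : Continuous g) (hfg : ∀ a, f (π a Ω) = g (π a Ω)) (x : 𝓗) :
    f x = g x := by
  refine congrFun (Continuous.ext_on h.cyclic hf hg ?_) x
  rintro _ ⟨a, rfl⟩
  exact hfg a

end IsGNSTriple

/-! ### Covariant representations -/

variable {G : Type*} [Group G] [TopologicalSpace G] {γ : OnSiteAction G n}
  {U : G →* unitary (𝓗 →L[ℂ] 𝓗)}

/-- A GNS triple with a strongly continuous unitary representation of the symmetry group which fixes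
the cyclic vector and implements the action. -/
structure IsCovariant (γ : OnSiteAction G n) (φ : ChainAlgebra n →L[ℂ] ℂ)
    (π : ChainAlgebra n →⋆ₐ[ℂ] (𝓗 →L[ℂ] 𝓗)) (Ω : 𝓗) (U : G →* unitary (𝓗 →L[ℂ] 𝓗)) : Prop
    extends IsGNSTriple φ π Ω where
  cont : ∀ x, Continuous fun g => (U g : 𝓗 →L[ℂ] 𝓗) x
  fix : ∀ g, (U g : 𝓗 →L[ℂ] 𝓗) Ω = Ω
  cov : ∀ g a, π (γ.aut g a) = (U g : 𝓗 →L[ℂ] 𝓗) * π a * star (U g : 𝓗 →L[ℂ] 𝓗)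

theorem IsCovariant.apply_rep (h : IsCovariant γ φ π Ω U) (g : G) (a : ChainAlgebra n) (x : 𝓗) :
    (U g : 𝓗 →L[ℂ] 𝓗) (π a x) = π (γ.aut g a) ((U g : 𝓗 →L[ℂ] 𝓗) x) := by
  rw [h.cov]
  have h1 : star (U g : 𝓗 →L[ℂ] 𝓗) ((U g : 𝓗 →L[ℂ] 𝓗) x) = x :=
    DFunLike.congr_fun (U g).2.1 x
  change _ = (U g : 𝓗 →L[ℂ] 𝓗) (π a (star (U g : 𝓗 →L[ℂ] 𝓗) ((U g : 𝓗 →L[ℂ] 𝓗) x)))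
  rw [h1]

theorem inner_unitary_apply (u : unitary (𝓗 →L[ℂ] 𝓗)) (x y : 𝓗) :
    ⟪(u : 𝓗 →L[ℂ] 𝓗) x, (u : 𝓗 →L[ℂ] 𝓗) y⟫_ℂ = ⟪x, y⟫_ℂ := by
  rw [← ContinuousLinearMap.adjoint_inner_right, ← ContinuousLinearMap.star_eq_adjoint]
  congr 1
  exact DFunLike.congr_fun u.2.1 y

theorem norm_unitary_apply (u : unitary (𝓗 →L[ℂ] 𝓗)) (x : 𝓗) : ‖(u : 𝓗 →L[ℂ] 𝓗) x‖ = ‖x‖ := by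
  have h := inner_unitary_apply u x x
  rw [inner_self_eq_norm_sq_to_K, inner_self_eq_norm_sq_to_K] at h
  have h2 : ‖(u : 𝓗 →L[ℂ] 𝓗) x‖ ^ 2 = ‖x‖ ^ 2 := by exact_mod_cast h
  exact (sq_eq_sq₀ (norm_nonneg _) (norm_nonneg _)).mp h2

/-- In the GNS representation of an invariant state, `π(a)Ω ↦ π(γ(g)[a])Ω` defines a strongly
continuous unitary representation which implements the action. -/
theorem IsGNSTriple.exists_isCovariant (h : IsGNSTriple φ π Ω) (hinv : IsInvariantState γ φ) :
    ∃ U : G →* unitary (𝓗 →L[ℂ] 𝓗), IsCovariant γ φ π Ω U := by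
  let T : G → ChainAlgebra n →ₗ[ℂ] 𝓗 := fun g =>
    { toFun := fun a => π (γ.aut g a) Ω
      map_add' := fun a b => by rw [map_add, map_add]; rfl
      map_smul' := fun c a => by rw [map_smul, map_smul]; rfl }
  have hT : ∀ g a, ‖T g a‖ = ‖π a Ω‖ := fun g a => norm_rep_apply_eq (by
    rw [← h.vector, ← h.vector, ← map_star, ← map_mul, hinv])
  choose V hV using fun g => h.exists_isometry (T g) (hT g)
  let W : G → 𝓗 →L[ℂ] 𝓗 := fun g => (V g).toContinuousLinearMap
  have hW : ∀ g a, W g (π a Ω) = π (γ.aut g a) Ω := hV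
  have hWn : ∀ g x, ‖W g x‖ = ‖x‖ := fun g => (V g).norm_map
  have hmul : ∀ g k, W (g * k) = W g * W k := fun g k => by
    refine DFunLike.coe_injective (Continuous.ext_on h.cyclic (W (g * k)).continuous
      (W g * W k).continuous ?_)
    rintro _ ⟨a, rfl⟩
    change _ = W g (W k (π a Ω))
    rw [hW, hW, hW, map_mul]
    rfl
  have hone : W 1 = 1 := by
    refine DFunLike.coe_injective (Continuous.ext_on h.cyclic (W 1).continuous
      (1 : 𝓗 →L[ℂ] 𝓗).continuous ?_)
    rintro _ ⟨a, rfl⟩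
    rw [hW, map_one]
    rfl
  have hiso : ∀ g, star (W g) * W g = 1 := fun g => by
    rw [ContinuousLinearMap.star_eq_adjoint]
    exact (ContinuousLinearMap.norm_map_iff_adjoint_comp_self (W g)).mp (hWn g)
  have hinv' : ∀ g, star (W g) = W g⁻¹ := fun g => by
    calc star (W g) = star (W g) * (W g * W g⁻¹) := by
          rw [← hmul, mul_inv_cancel, hone, mul_one]
      _ = W g⁻¹ := by rw [← mul_assoc, hiso, one_mul]
  have hu : ∀ g, W g ∈ unitary (𝓗 →L[ℂ] 𝓗) := fun g =>
    ⟨hiso g, by rw [hinv', ← hmul, mul_inv_cancel, hone]⟩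
  refine ⟨{ toFun := fun g => ⟨W g, hu g⟩, map_one' := Subtype.ext hone,
            map_mul' := fun g k => Subtype.ext (hmul g k) }, ⟨h, fun x => ?_, fun g => ?_,
            fun g a => ?_⟩⟩
  · change Continuous fun g => W g x
    refine h.cyclic.induction (P := fun x => Continuous fun g => W g x) ?_ ?_ x
    · rintro _ ⟨a, rfl⟩
      simp_rw [hW]
      exact (continuous_rep_apply π Ω).comp (γ.continuous a)
    · refine isClosed_of_closure_subset fun y hy => ?_
      obtain ⟨z, hz, hzy⟩ := mem_closure_iff_seq_limit.mp hy
      refine TendstoUniformly.continuous (F := fun k g => W g (z k)) (p := atTop) ?_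
        (Frequently.of_forall hz)
      rw [Metric.tendstoUniformly_iff]
      intro ε hε
      filter_upwards [Metric.tendsto_nhds.mp hzy ε hε] with k hk g
      rwa [dist_eq_norm, ← map_sub, hWn, ← dist_eq_norm, dist_comm]
  · have := hW g 1
    rw [map_one (γ.aut g), rep_one_apply] at this
    exact this
  · change π (γ.aut g a) = W g * π a * star (W g)
    rw [hinv']
    refine DFunLike.coe_injective (Continuous.ext_on h.cyclic (π (γ.aut g a)).continuous
      (W g * π a * W g⁻¹).continuous ?_)
    rintro _ ⟨b, rfl⟩
    change _ = W g (π a (W g⁻¹ (π b Ω)))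
    rw [hW, ← rep_mul_apply π a, hW, map_mul (γ.aut g), map_inv, aut_apply_inv, rep_mul_apply]

end GNS

/-! ### The ground state projections of a pure product state -/

open Matrix in
/-- A hermitian normalized functional on a matrix algebra commutes with a minimal projection of
nonzero weight, namely with an eigenprojection of its density matrix. -/
theorem exists_minimal_projection {d : ℕ} (ω : Matrix (Fin d) (Fin d) ℂ →ₗ[ℂ] ℂ)
    (hω : ∀ M, ω Mᴴ = star (ω M)) (h1 : ω 1 = 1) :
    ∃ p : Matrix (Fin d) (Fin d) ℂ, pᴴ = p ∧ p * p = p ∧ (∀ M, ∃ c : ℂ, p * M * p = c • p) ∧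
      (∀ M, ω (p * M) = ω (M * p)) ∧ ω p ≠ 0 := by
  -- the density matrix of `ω`
  let ρ : Matrix (Fin d) (Fin d) ℂ := Matrix.of fun a b => ω (Matrix.single b a 1)
  have hρω : ∀ M, ω M = (ρ * M).trace := fun M => by
    conv_lhs => rw [matrix_eq_sum_single M]
    simp only [map_sum, Matrix.trace, Matrix.diag_apply, Matrix.mul_apply]
    rw [Finset.sum_comm]
    refine Finset.sum_congr rfl fun j _ => Finset.sum_congr rfl fun i _ => ?_
    have e : Matrix.single i j (M i j) = M i j • Matrix.single i j (1 : ℂ) := by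
      rw [Matrix.smul_single, smul_eq_mul, mul_one]
    rw [e, map_smul, smul_eq_mul, mul_comm]
    rfl
  have hρ : ρ.IsHermitian := by
    ext a b
    rw [conjTranspose_apply]
    change star (ω (Matrix.single a b 1)) = ω (Matrix.single b a 1)
    rw [← hω, conjTranspose_single, star_one]
  have htr : ρ.trace = 1 := by rw [← mul_one ρ, ← hρω, h1]
  -- the sum of the eigenvalues is one
  obtain ⟨i, hi⟩ : ∃ i, hρ.eigenvalues i ≠ 0 := by
    by_contra! hall
    rw [hρ.trace_eq_sum_eigenvalues] at htr
    simp [hall] at htr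
  set ξ : Fin d → ℂ := (hρ.eigenvectorBasis i).ofLp with hξ
  have hev : ρ.mulVec ξ = hρ.eigenvalues i • ξ := hρ.mulVec_eigenvectorBasis i
  have hnorm : star ξ ⬝ᵥ ξ = 1 := by
    have h2 : ⟪hρ.eigenvectorBasis i, hρ.eigenvectorBasis i⟫_ℂ = 1 := by
      rw [inner_self_eq_norm_sq_to_K, hρ.eigenvectorBasis.orthonormal.1 i]
      simp
    rw [EuclideanSpace.inner_eq_star_dotProduct, dotProduct_comm] at h2
    exact h2
  set p := vecMulVec ξ (star ξ) with hp
  have hps : pᴴ = p := by rw [hp, conjTranspose_vecMulVec, star_star]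
  have hρp : ρ * p = (hρ.eigenvalues i : ℂ) • p := by
    rw [hp, mul_vecMulVec, hev]
    ext a b
    simp [vecMulVec_apply, mul_assoc]
  have hpρ : p * ρ = (hρ.eigenvalues i : ℂ) • p := by
    have h2 := congrArg Matrix.conjTranspose hρp
    rw [conjTranspose_mul, conjTranspose_smul, hps, hρ.eq, Complex.star_def,
      Complex.conj_ofReal] at h2
    exact h2
  refine ⟨p, hps, ?_, fun M => ⟨star ξ ⬝ᵥ M.mulVec ξ, ?_⟩, fun M => ?_, ?_⟩
  · rw [hp, vecMulVec_mul_vecMulVec, hnorm, one_smul]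
  · rw [hp, mul_assoc, mul_vecMulVec, vecMulVec_mul_vecMulVec]
    ext a b
    simp only [vecMulVec_apply, Pi.smul_apply, smul_eq_mul, Matrix.smul_apply]
    ring
  · rw [hρω, hρω, ← mul_assoc, hρp, ← mul_assoc, Matrix.trace_mul_comm (ρ * M) p, ← mul_assoc, hpρ]
  · rw [hρω, hρp, Matrix.trace_smul, hp, trace_vecMulVec, dotProduct_comm, hnorm]
    simpa using hi

section Ground

attribute [local irreducible] instCStarAlgebraChainAlgebra

variable {n : ℤ → ℕ} {φ : ChainAlgebra n →L[ℂ] ℂ}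

/-- Every observable is a sum of products of observables in `Γ` and in its complement. -/
theorem split_induction (Γ : Set ℤ) {p : ChainAlgebra n → Prop}
    (hadd : ∀ a b, p a → p b → p (a + b))
    (hmul : ∀ L R : Finset ℤ, (L : Set ℤ) ⊆ Γ → (R : Set ℤ) ⊆ Γᶜ → ∀ l ∈ supp n (L : Set ℤ),
      ∀ r ∈ supp n (R : Set ℤ), p (l * r)) {S : Finset ℤ} {a : ChainAlgebra n}
    (ha : a ∈ supp n (S : Set ℤ)) : p a := by
  classical
  set L := S.filter (· ∈ Γ) with hL
  set R := S.filter (· ∉ Γ) with hR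
  have e : (S : Set ℤ) = (L : Set ℤ) ∪ (R : Set ℤ) := by
    rw [← Finset.coe_union, hL, hR, Finset.filter_union_filter_not_eq]
  have hd : Disjoint (L : Set ℤ) (R : Set ℤ) :=
    Finset.disjoint_coe.mpr (Finset.disjoint_filter_filter_not S S (· ∈ Γ))
  rw [e, ← mem_suppSubmodule, suppSubmodule_union _ _ hd] at ha
  refine Submodule.mul_induction_on ha (fun l hl r hr => ?_) hadd
  exact hmul L R (fun x hx => (Finset.mem_filter.mp hx).2) (fun x hx => (Finset.mem_filter.mp hx).2)
    l hl r hr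

theorem IsProduct.map_mul (h : IsProduct φ) {S T : Finset ℤ} (hd : Disjoint S T)
    {a b : ChainAlgebra n} (ha : a ∈ supp n (S : Set ℤ)) (hb : b ∈ supp n (T : Set ℤ)) :
    φ (a * b) = φ a * φ b :=
  h S T hd a b (isSupportedOn_iff.mpr ha) (isSupportedOn_iff.mpr hb)

theorem IsProduct.map_mul_alg (h : IsProduct φ) {Γ Γ' : Set ℤ} (hd : Disjoint Γ Γ')
    {a b : ChainAlgebra n} (ha : a ∈ alg n Γ) (hb : b ∈ alg n Γ') : φ (a * b) = φ a * φ b := by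
  refine alg_induction (p := fun a => φ (a * b) = φ a * φ b)
    (isClosed_eq (by fun_prop) (by fun_prop)) (fun X hX a ha => ?_) ha
  refine alg_induction (p := fun b => φ (a * b) = φ a * φ b)
    (isClosed_eq (by fun_prop) (by fun_prop)) (fun Y hY b hb => ?_) hb
  exact h.map_mul (Finset.disjoint_coe.mp (hd.mono hX hY)) ha hb

theorem state_star (hφ : φ ∈ stateSet n) (a : ChainAlgebra n) : φ (star a) = star (φ a) := by
  obtain ⟨𝓗, _, _, _, π, Ω, h⟩ := exists_gnsTriple hφ
  rw [h.vector, h.vector, ← inner_rep_left]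
  exact (inner_conj_symm _ _).symm

/-- A projection of expectation one drops out of expectations. -/
theorem state_mul_proj (hφ : φ ∈ stateSet n) {p : ChainAlgebra n} (hs : star p = p)
    (hp : p * p = p) (h1 : φ p = 1) (a : ChainAlgebra n) : φ (p * a) = φ a ∧ φ (a * p) = φ a := by
  obtain ⟨𝓗, _, _, _, π, Ω, h⟩ := exists_gnsTriple hφ
  have h0 : π (1 - p) Ω = 0 := by
    have h2 := norm_sq_rep_apply π (1 - p) Ω
    have e : star (1 - p) * (1 - p) = 1 - p := by
      rw [star_sub, star_one, hs, mul_sub, sub_mul, sub_mul, hp]; simp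
    rw [e, ← h.vector, map_sub φ, hφ.1, h1, sub_self] at h2
    simpa using h2
  have h3 : π p Ω = Ω := by
    rw [map_sub, map_one] at h0
    exact (sub_eq_zero.mp h0).symm
  constructor
  · rw [h.vector, h.vector, rep_mul_apply, ← hs, ← inner_rep_left, h3]
  · rw [h.vector, h.vector, rep_mul_apply, h3]

/-- `p` is the projection of `Λ` onto the pure product state `φ`. -/
structure IsGround (φ : ChainAlgebra n →L[ℂ] ℂ) (Λ : Finset ℤ) (p : ChainAlgebra n) : Prop where
  mem : p ∈ supp n (Λ : Set ℤ)
  star_eq : star p = p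
  mul_self : p * p = p
  state : φ p = 1
  compress : ∀ a ∈ supp n (Λ : Set ℤ), p * a * p = φ a • p

theorem isGround_empty (hφ : φ ∈ stateSet n) : IsGround φ ∅ 1 where
  mem := one_mem _
  star_eq := star_one _
  mul_self := one_mul 1
  state := hφ.1
  compress a ha := by
    rw [Finset.coe_empty] at ha
    obtain ⟨c, rfl⟩ := exists_smul_one_of_mem_supp_empty ha
    rw [one_mul, mul_one, map_smul, hφ.1, smul_eq_mul, mul_one]

theorem IsGround.union (hprod : IsProduct φ) {Λ Λ' : Finset ℤ} (hd : Disjoint Λ Λ')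
    {p p' : ChainAlgebra n} (h : IsGround φ Λ p) (h' : IsGround φ Λ' p') :
    IsGround φ (Λ ∪ Λ') (p * p') := by
  have hdc : Disjoint (Λ : Set ℤ) (Λ' : Set ℤ) := Finset.disjoint_coe.mpr hd
  have hc := (commute_of_disjoint hdc h.mem h'.mem).eq
  refine ⟨?_, ?_, ?_, ?_, fun a ha => ?_⟩
  · rw [Finset.coe_union]
    exact mul_mem (supp_mono Set.subset_union_left h.mem)
      (supp_mono Set.subset_union_right h'.mem)
  · rw [star_mul, h.star_eq, h'.star_eq, hc]
  · rw [mul_assoc, ← mul_assoc p', ← hc, mul_assoc, h'.mul_self, ← mul_assoc, h.mul_self]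
  · rw [hprod.map_mul hd h.mem h'.mem, h.state, h'.state, mul_one]
  · rw [Finset.coe_union, ← mem_suppSubmodule, suppSubmodule_union _ _ hdc] at ha
    refine Submodule.mul_induction_on ha (fun x hx y hy => ?_) fun x y hx hy => ?_
    · have c1 := (commute_of_disjoint hdc hx h'.mem).eq
      have c2 := (commute_of_disjoint hdc h.mem hy).eq
      calc p * p' * (x * y) * (p * p') = p * (p' * x) * (y * p) * p' := by simp only [mul_assoc]
        _ = p * x * (p' * p) * y * p' := by rw [← c1, ← c2]; simp only [mul_assoc]
        _ = (p * x * p) * (p' * y * p') := by rw [← hc]; simp only [mul_assoc]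
        _ = _ := by
          rw [h.compress x hx, h'.compress y hy, hprod.map_mul hd hx hy, smul_mul_smul_comm]
    · rw [mul_add, add_mul, hx, hy, map_add, add_smul]

theorem IsGround.unique {Λ : Finset ℤ} {p q : ChainAlgebra n} (h : IsGround φ Λ p)
    (h' : IsGround φ Λ q) : p = q := by
  have key : ∀ {p q : ChainAlgebra n}, IsGround φ Λ p → IsGround φ Λ q → p = q * p := by
    intro p q h h'
    have e : star (p - q * p) * (p - q * p) = 0 := by
      have h1 : p * q * p = p := by rw [h.compress q h'.mem, h'.state, one_smul]
      rw [star_sub, star_mul, h.star_eq, h'.star_eq, mul_sub, sub_mul, sub_mul, h.mul_self, h1,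
        ← mul_assoc p q, h1, mul_assoc p q, ← mul_assoc q q, h'.mul_self, ← mul_assoc, h1]
      simp
    exact sub_eq_zero.mp (CStarRing.star_mul_self_eq_zero_iff _ |>.mp e)
  have h1 := key h h'
  have h2 := congrArg star (key h' h)
  rw [star_mul, h.star_eq, h'.star_eq] at h2
  rw [h2, ← h1]

/-- The purity of `φ` makes its restriction to every site pure. -/
theorem exists_isGround_singleton (hφ : IsPureState φ) (hprod : IsProduct φ) (j : ℤ) :
    ∃ p, IsGround φ {j} p := by
  have hst : φ ∈ stateSet n := hφ.1
  obtain ⟨p, hps, hpp, hpM, hcomm, hp0⟩ := exists_minimal_projection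
    ((φ : ChainAlgebra n →ₗ[ℂ] ℂ) ∘ₗ siteₗ j)
    (fun M => by
      change φ (site j M.conjTranspose) = star (φ (site j M))
      rw [← star_site, state_star hst])
    (by change φ (site j 1) = 1; rw [site_one, hst.1])
  set P : ChainAlgebra n := site j p
  have hP : P ∈ supp n ((({j} : Finset ℤ) : Set ℤ)) := site_mem_supp (by simp) p
  have hPs : star P = P := by rw [star_site, hps]
  have hPP : P * P = P := (site_mul j p p).trans (by rw [hpp])
  -- `P` belongs to the centralizer of `φ`, because `φ` factorizes between `j` and the other sites
  have hPc : ∀ x, φ (P * x) = φ (x * P) := fun x => by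
    refine congrFun (eq_of_eq_on_local (f := fun x => φ (P * x)) (g := fun x => φ (x * P))
      (by fun_prop) (by fun_prop) fun S a ha => ?_) x
    refine split_induction {j} (p := fun a => φ (P * a) = φ (a * P))
      (fun a b h1 h2 => by rw [mul_add, add_mul, map_add, map_add, h1, h2])
      (fun L R hL hR l hl r hr => ?_) ha
    have hd : Disjoint ({j} : Finset ℤ) R := by
      rw [Finset.disjoint_singleton_left]
      exact fun h => hR h rfl
    have hl' : l ∈ supp n (({j} : Finset ℤ) : Set ℤ) := by
      rw [Finset.coe_singleton]; exact supp_mono hL hl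
    have hc := (commute_of_disjoint (Finset.disjoint_coe.mpr hd) hP hr).eq
    obtain ⟨M, rfl⟩ := exists_site_of_mem_supp_singleton (by rwa [Finset.coe_singleton] at hl')
    change φ (P * (site j M * r)) = φ (site j M * r * P)
    rw [mul_assoc (site j M), ← hc, ← mul_assoc, ← mul_assoc,
      hprod.map_mul hd (mul_mem hP hl') hr, hprod.map_mul hd (mul_mem hl' hP) hr]
    congr 1
    have := hcomm M
    change φ (site j (p * M)) = φ (site j (M * p)) at this
    rw [← site_mul, ← site_mul] at this
    exact this
  -- `φ` is a mixture of its compressions to `P` and to `1 - P`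
  obtain ⟨t, ht0, ht⟩ := hst.2 P
  rw [hPs, hPP] at ht
  have htne : t ≠ 0 := fun h => hp0 (by
    change φ P = 0
    rw [ht, h, Complex.ofReal_zero])
  have htpos : 0 < t := lt_of_le_of_ne ht0 (Ne.symm htne)
  have hQ : ∀ x, φ ((1 - P) * x * (1 - P)) = φ x - φ (P * x * P) := fun x => by
    have h1 : φ (x * P) = φ (P * x * P) := by rw [mul_assoc, hPc, mul_assoc, hPP]
    have h2 : φ (P * x) = φ (P * x * P) := by rw [hPc (x), h1]
    have e : (1 - P) * x * (1 - P) = x - P * x - x * P + P * x * P := by noncomm_ring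
    rw [e, map_add, map_sub, map_sub, h2, h1]
    ring
  obtain ⟨r, hr0, hr⟩ := hst.2 (1 - P)
  have hQs : star (1 - P) = 1 - P := by rw [star_sub, star_one, hPs]
  have hQQ : (1 - P) * (1 - P) = 1 - P := by
    rw [mul_sub, sub_mul, sub_mul, hPP]; simp
  rw [hQs, hQQ, map_sub, hst.1, ht] at hr
  have hrt : r = 1 - t := by exact_mod_cast hr.symm
  -- normalized compressions to projections of positive weight are states
  have hcompr : ∀ (E : ChainAlgebra n) (s : ℝ), star E = E → E * E = E → 0 < s → φ E = s →
      (s : ℂ)⁻¹ • φ.comp (ContinuousLinearMap.mulLeftRight ℂ (ChainAlgebra n) E E) ∈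
        stateSet n := by
    intro E s hE hEE hs hsE
    constructor
    · rw [smul_apply, ContinuousLinearMap.comp_apply, ContinuousLinearMap.mulLeftRight_apply,
        mul_one, hEE, hsE, smul_eq_mul, inv_mul_cancel₀]
      exact_mod_cast hs.ne'
    · intro a
      obtain ⟨q, hq0, hq⟩ := hst.2 (a * E)
      refine ⟨s⁻¹ * q, by positivity, ?_⟩
      rw [smul_apply, ContinuousLinearMap.comp_apply, ContinuousLinearMap.mulLeftRight_apply,
        smul_eq_mul]
      rw [star_mul, hE] at hq
      rw [show E * (star a * a) * E = E * star a * (a * E) by simp only [mul_assoc], hq]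
      push_cast
      rfl
  -- by extremality, `φ` equals its normalized compression to `P`
  have htone : φ P = 1 := by
    rcases eq_or_lt_of_le (show t ≤ 1 by linarith) with h1 | h1
    · rw [ht, h1, Complex.ofReal_one]
    have hr' : 0 < r := by linarith
    have hφQ : φ (1 - P) = r := by rw [map_sub, hst.1, ht, hr]
    have := (mem_extremePoints_iff_left.mp hφ).2 _ (hcompr P t hPs hPP htpos ht) _
      (hcompr (1 - P) r hQs hQQ hr' hφQ) ⟨t, r, htpos, hr', by linarith, ?_⟩
    · have h2 := DFunLike.congr_fun this P
      rw [smul_apply, ContinuousLinearMap.comp_apply, ContinuousLinearMap.mulLeftRight_apply,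
        hPP, hPP, ht, smul_eq_mul, inv_mul_cancel₀ (by exact_mod_cast htne)] at h2
      rw [ht, ← h2]
    · ext x
      have ht' : (t : ℂ) ≠ 0 := by exact_mod_cast htne
      have hr'' : (r : ℂ) ≠ 0 := by exact_mod_cast hr'.ne'
      simp only [add_apply, smul_apply, ContinuousLinearMap.comp_apply,
        ContinuousLinearMap.mulLeftRight_apply, smul_eq_mul, Complex.real_smul, hQ]
      field_simp
      ring
  refine ⟨P, hP, hPs, hPP, htone, fun a ha => ?_⟩
  rw [Finset.coe_singleton] at ha
  obtain ⟨M, rfl⟩ := exists_site_of_mem_supp_singleton ha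
  obtain ⟨c, hc⟩ := hpM M
  have h1 : P * site j M * P = c • P := by
    change site j p * site j M * site j p = c • site j p
    rw [site_mul, site_mul, hc, site_smul]
  have h2 := congrArg φ h1
  rw [mul_assoc, (state_mul_proj hst hPs hPP htone _).1, (state_mul_proj hst hPs hPP htone _).2,
    map_smul, htone, smul_eq_mul, mul_one] at h2
  rw [h1, h2]

theorem exists_isGround (hφ : IsPureState φ) (hprod : IsProduct φ) (Λ : Finset ℤ) :
    ∃ p, IsGround φ Λ p := by
  classical
  induction Λ using Finset.induction_on with
  | empty => exact ⟨1, isGround_empty hφ.1⟩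
  | insert j Λ hj ih =>
    obtain ⟨p, hp⟩ := exists_isGround_singleton hφ hprod j
    obtain ⟨q, hq⟩ := ih
    exact ⟨p * q, hp.union hprod (Finset.disjoint_singleton_left.mpr hj) hq⟩

open Classical in
/-- The projection of `Λ` onto the pure product state `φ` (the identity if there is none). -/
def ground (φ : ChainAlgebra n →L[ℂ] ℂ) (Λ : Finset ℤ) : ChainAlgebra n :=
  if h : ∃ p, IsGround φ Λ p then h.choose else 1

theorem isGround_ground (hφ : IsPureState φ) (hprod : IsProduct φ) (Λ : Finset ℤ) :
    IsGround φ Λ (ground φ Λ) := by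
  rw [ground, dif_pos (exists_isGround hφ hprod Λ)]
  exact (exists_isGround hφ hprod Λ).choose_spec

theorem ground_union (hφ : IsPureState φ) (hprod : IsProduct φ) {Λ Λ' : Finset ℤ}
    (hd : Disjoint Λ Λ') : ground φ (Λ ∪ Λ') = ground φ Λ * ground φ Λ' :=
  (isGround_ground hφ hprod _).unique
    ((isGround_ground hφ hprod Λ).union hprod hd (isGround_ground hφ hprod Λ'))

theorem IsGround.norm_le_one {Λ : Finset ℤ} {p : ChainAlgebra n} (h : IsGround φ Λ p) :
    ‖p‖ ≤ 1 := by
  have h1 := CStarRing.norm_star_mul_self (x := p)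
  rw [h.star_eq, h.mul_self] at h1
  nlinarith [norm_nonneg p]

end Ground

/-! ### Vector states -/

section Charges

attribute [local irreducible] instCStarAlgebraChainAlgebra

variable {n : ℤ → ℕ} {φ : ChainAlgebra n →L[ℂ] ℂ} {𝓗 : Type*} [NormedAddCommGroup 𝓗]
  [InnerProductSpace ℂ 𝓗] [CompleteSpace 𝓗] {π : ChainAlgebra n →⋆ₐ[ℂ] (𝓗 →L[ℂ] 𝓗)} {Ω : 𝓗}

theorem IsGNSTriple.induction_local (h : IsGNSTriple φ π Ω) {p : 𝓗 → Prop}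
    (hp : IsClosed {x | p x})
    (hl : ∀ S : Finset ℤ, ∀ a ∈ supp n (S : Set ℤ), p (π a Ω)) (x : 𝓗) : p x := by
  refine h.cyclic.induction (P := p) ?_ hp x
  rintro _ ⟨a, rfl⟩
  exact alg_induction (Γ := Set.univ) (p := fun a => p (π a Ω))
    (hp.preimage (continuous_rep_apply π Ω)) (fun X _ a ha => hl X a ha) (dense_supp n a)

theorem IsGround.rep_vector (h : IsGNSTriple φ π Ω) (hφ : φ ∈ stateSet n) {Λ : Finset ℤ}
    {p : ChainAlgebra n} (hp : IsGround φ Λ p) : π p Ω = Ω := by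
  refine h.ext fun a => ?_
  rw [h.inner_apply, (state_mul_proj hφ hp.star_eq hp.mul_self hp.state _).2]
  have := h.inner_apply a 1
  rw [mul_one, rep_one_apply] at this
  exact this.symm

theorem IsGround.norm_rep_le {Λ : Finset ℤ} {p : ChainAlgebra n} (hp : IsGround φ Λ p) (x : 𝓗) :
    ‖π p x‖ ≤ ‖x‖ :=
  (norm_rep_apply_le π p x).trans (mul_le_of_le_one_left (norm_nonneg _) hp.norm_le_one)

/-- A sequence of contractions which is eventually constant on the vectors of local observables
converges strongly. -/
theorem IsGNSTriple.exists_tendsto (h : IsGNSTriple φ π Ω) (T : ℕ → 𝓗 →L[ℂ] 𝓗)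
    (hT : ∀ k x, ‖T k x‖ ≤ ‖x‖) (hc : ∀ S : Finset ℤ, ∀ a ∈ supp n (S : Set ℤ),
      ∃ y, ∀ᶠ k in atTop, T k (π a Ω) = y) (x : 𝓗) :
    ∃ y, Tendsto (fun k => T k x) atTop (𝓝 y) := by
  refine cauchySeq_tendsto_of_complete (h.induction_local (p := fun x => CauchySeq fun k => T k x)
    ?_ (fun S a ha => ?_) x)
  · refine isClosed_of_closure_subset fun z hz => ?_
    change CauchySeq fun k => T k z
    refine Metric.cauchySeq_iff'.mpr fun ε hε => ?_
    obtain ⟨y, hy, hzy⟩ := Metric.mem_closure_iff.mp hz (ε / 3) (by positivity)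
    obtain ⟨N, hN⟩ := Metric.cauchySeq_iff'.mp hy (ε / 3) (by positivity)
    have h1 : ∀ k, dist (T k z) (T k y) < ε / 3 := fun k => by
      rw [dist_eq_norm, ← map_sub]
      exact (hT k _).trans_lt (by rwa [← dist_eq_norm])
    refine ⟨N, fun k hk => ?_⟩
    have h2 := h1 N
    rw [dist_comm] at h2
    calc dist (T k z) (T N z) ≤ dist (T k z) (T k y) + dist (T k y) (T N y) +
          dist (T N y) (T N z) := dist_triangle4 _ _ _ _
      _ < ε / 3 + ε / 3 + ε / 3 := add_lt_add (add_lt_add (h1 k) (hN k hk)) h2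
      _ = ε := by ring
  · obtain ⟨y, hy⟩ := hc S a ha
    exact ((tendsto_const_nhds (x := y)).congr'
      (hy.mono fun _ hk => hk.symm)).cauchySeq

/-- The projections onto `φ` in large boxes converge to the projection onto the cyclic vector. -/
theorem tendsto_rep_ground_box (h : IsGNSTriple φ π Ω) (hφ : IsPureState φ) (hprod : IsProduct φ)
    (x : 𝓗) : Tendsto (fun k => π (ground φ (box k)) x) atTop (𝓝 (⟪Ω, x⟫_ℂ • Ω)) := by
  have hg := isGround_ground hφ hprod
  have hloc : ∀ S : Finset ℤ, ∀ a ∈ supp n (S : Set ℤ),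
      ∀ᶠ k in atTop, π (ground φ (box k)) (π a Ω) = φ a • Ω := fun S a ha => by
    filter_upwards [exists_subset_box S] with k hk
    have e : π (ground φ (box k)) (π a Ω) =
        π (ground φ (box k) * a * ground φ (box k)) Ω := by
      rw [rep_mul_apply, rep_mul_apply, (hg _).rep_vector h hφ.1]
    rw [e, (hg _).compress a (supp_mono (Finset.coe_subset.mpr hk) ha), map_smul]
    change φ a • π (ground φ (box k)) Ω = _
    rw [(hg _).rep_vector h hφ.1]
  obtain ⟨y, hy⟩ := h.exists_tendsto (fun k => π (ground φ (box k)))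
    (fun k x => (hg _).norm_rep_le x) (fun S a ha => ⟨_, hloc S a ha⟩) x
  have key : y = ⟪Ω, x⟫_ℂ • Ω := by
    refine ext_inner_left ℂ fun z => h.induction_local
      (p := fun z => ⟪z, y⟫_ℂ = ⟪z, ⟪Ω, x⟫_ℂ • Ω⟫_ℂ) (isClosed_eq (by fun_prop) (by fun_prop))
      (fun S a ha => ?_) z
    have h1 : Tendsto (fun k => ⟪π a Ω, π (ground φ (box k)) x⟫_ℂ) atTop (𝓝 ⟪π a Ω, y⟫_ℂ) :=
      tendsto_const_nhds.inner hy
    refine tendsto_nhds_unique h1 (tendsto_const_nhds.congr' ?_)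
    filter_upwards [hloc S a ha] with k hk
    rw [← (hg (box k)).star_eq, ← inner_rep_left, hk, inner_smul_left, inner_smul_right,
      h.vector, ← inner_conj_symm (π a Ω) Ω, mul_comm]
  rwa [← key]

/-- Vectors which represent the same state are proportional. -/
theorem exists_smul_of_same_state (h : IsGNSTriple φ π Ω) (hφ : IsPureState φ)
    (hprod : IsProduct φ) {v w : 𝓗} (hw : w ≠ 0) (hvw : ∀ a, ⟪v, π a v⟫_ℂ = ⟪w, π a w⟫_ℂ) :
    ∃ c : ℂ, w = c • v := by
  have hlim : ∀ (v : 𝓗) (a b : ChainAlgebra n),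
      Tendsto (fun k => ⟪v, π (a * ground φ (box k) * b) v⟫_ℂ) atTop
        (𝓝 (⟪v, π a Ω⟫_ℂ * ⟪Ω, π b v⟫_ℂ)) := fun v a b => by
    have h1 := ((π a).continuous.tendsto _).comp (tendsto_rep_ground_box h hφ hprod (π b v))
    have h2 : Tendsto (fun k => ⟪v, π a (π (ground φ (box k)) (π b v))⟫_ℂ) atTop
      (𝓝 ⟪v, π a (⟪Ω, π b v⟫_ℂ • Ω)⟫_ℂ) := tendsto_const_nhds.inner h1
    rw [map_smul, inner_smul_right, mul_comm] at h2
    refine h2.congr fun k => ?_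
    rw [rep_mul_apply, rep_mul_apply]
  have heq : ∀ a b, ⟪v, π a Ω⟫_ℂ * ⟪Ω, π b v⟫_ℂ = ⟪w, π a Ω⟫_ℂ * ⟪Ω, π b w⟫_ℂ := fun a b =>
    tendsto_nhds_unique (hlim v a b) ((hlim w a b).congr fun k => (hvw _).symm)
  obtain ⟨b, hb⟩ : ∃ b, ⟪Ω, π b w⟫_ℂ ≠ 0 := by
    by_contra! hall
    refine hw (h.ext fun a => ?_)
    rw [inner_rep_left, hall, inner_zero_right]
  refine ⟨starRingEnd ℂ (⟪Ω, π b v⟫_ℂ / ⟪Ω, π b w⟫_ℂ), h.ext fun a => ?_⟩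
  rw [inner_smul_right, ← inner_conj_symm (π a Ω) w, ← inner_conj_symm (π a Ω) v, ← map_mul]
  congr 1
  rw [div_mul_eq_mul_div, eq_div_iff hb, ← heq, mul_comm]

/-! ### Charges -/

variable {G : Type*} [Group G] [TopologicalSpace G] {γ : OnSiteAction G n}
  {U : G →* unitary (𝓗 →L[ℂ] 𝓗)} {θ θ₁ θ₂ : ChainAut n} {χ χ₁ χ₂ : G →ₜ* Circle}

/-- The state `φ ∘ θ` has the charge `χ` in the covariant representation `(π, U)`. -/
def HasCharge (φ : ChainAlgebra n →L[ℂ] ℂ) (π : ChainAlgebra n →⋆ₐ[ℂ] (𝓗 →L[ℂ] 𝓗))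
    (U : G →* unitary (𝓗 →L[ℂ] 𝓗)) (θ : ChainAut n) (χ : G →ₜ* Circle) : Prop :=
  ∃ v, ‖v‖ = 1 ∧ (∀ a, φ (θ a) = ⟪v, π a v⟫_ℂ) ∧ ∀ g, (U g : 𝓗 →L[ℂ] 𝓗) v = (χ g : ℂ) • v

theorem HasCharge.unique (h : IsGNSTriple φ π Ω) (hφ : IsPureState φ) (hprod : IsProduct φ)
    (h₁ : HasCharge φ π U θ χ₁) (h₂ : HasCharge φ π U θ χ₂) : χ₁ = χ₂ := by
  obtain ⟨v, hv, hv1, hv2⟩ := h₁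
  obtain ⟨w, hw, hw1, hw2⟩ := h₂
  have hw0 : w ≠ 0 := fun h => by simp [h] at hw
  obtain ⟨c, rfl⟩ := exists_smul_of_same_state h hφ hprod hw0 fun a => by rw [← hv1, ← hw1]
  ext g
  have e := hw2 g
  rw [map_smul, hv2, smul_smul, smul_smul, mul_comm c] at e
  have hc : c ≠ 0 := fun h => hw0 (by rw [h, zero_smul])
  have hv0 : v ≠ 0 := fun h => by simp [h] at hv
  exact mul_right_cancel₀ hc (smul_left_injective ℂ hv0 e)

theorem HasCharge.one (h : IsCovariant γ φ π Ω U) (hφ : φ ∈ stateSet n) :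
    HasCharge φ π U 1 1 :=
  ⟨Ω, h.norm_vector hφ, h.vector, fun g => by
    rw [h.fix]
    change _ = ((1 : Circle) : ℂ) • Ω
    rw [Circle.coe_one, one_smul]⟩

/-- An automorphism which commutes with the symmetries and carries a charge can be implemented by an
isometry which intertwines the unitary representation up to the charge. -/
theorem HasCharge.exists_intertwiner (h : IsCovariant γ φ π Ω U)
    (hc : HasCharge φ π U θ χ) (hθ : ∀ g, Commute (γ.aut g) θ) :
    ∃ W : 𝓗 →ₗᵢ[ℂ] 𝓗, (∀ a x, W (π (θ a) x) = π a (W x)) ∧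
      ∀ g x, (U g : 𝓗 →L[ℂ] 𝓗) (W x) = (χ g : ℂ) • W ((U g : 𝓗 →L[ℂ] 𝓗) x) := by
  obtain ⟨v, hv, hv1, hv2⟩ := hc
  let T : ChainAlgebra n →ₗ[ℂ] 𝓗 :=
    { toFun := fun a => π (θ⁻¹ a) v
      map_add' := fun a b => by rw [map_add, map_add]; rfl
      map_smul' := fun c a => by rw [map_smul, map_smul]; rfl }
  obtain ⟨W, hW⟩ := h.exists_isometry T fun a => norm_rep_apply_eq (π := π) (π' := π) (by
    rw [← h.vector, ← hv1, ← map_star, ← map_mul, aut_apply_inv])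
  replace hW : ∀ a, W (π a Ω) = π (θ⁻¹ a) v := hW
  refine ⟨W, fun a => ?_, fun g => ?_⟩
  · refine h.eq_of_eq_on ?_ ?_ fun b => ?_
    · exact W.continuous.comp (π (θ a)).continuous
    · exact (π a).continuous.comp W.continuous
    · rw [← rep_mul_apply, hW, hW, map_mul, aut_inv_apply, rep_mul_apply]
  · refine h.eq_of_eq_on ?_ ?_ fun b => ?_
    · exact (U g : 𝓗 →L[ℂ] 𝓗).continuous.comp W.continuous
    · exact (W.continuous.comp (U g : 𝓗 →L[ℂ] 𝓗).continuous).const_smul _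
    · rw [hW, h.apply_rep, hv2, map_smul, h.apply_rep, h.fix, hW]
      have e := DFunLike.congr_fun (hθ g).inv_right.eq b
      rw [StarAlgEquiv.mul_apply, StarAlgEquiv.mul_apply] at e
      rw [e]

/-- Charges are multiplicative: the isometry which implements `θ₂` adds its charge to that of a
vector. -/
theorem HasCharge.mul (h : IsCovariant γ φ π Ω U) (h₁ : HasCharge φ π U θ₁ χ₁)
    (h₂ : HasCharge φ π U θ₂ χ₂) (hθ₂ : ∀ g, Commute (γ.aut g) θ₂) :
    HasCharge φ π U (θ₁ * θ₂) (χ₁ * χ₂) := by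
  obtain ⟨W, hW, hWU⟩ := h₂.exists_intertwiner h hθ₂
  obtain ⟨v, hv, hv1, hv2⟩ := h₁
  refine ⟨W v, by rw [W.norm_map, hv], fun a => ?_, fun g => ?_⟩
  · rw [StarAlgEquiv.mul_apply, hv1, ← hW, W.inner_map_map]
  · rw [hWU, hv2, map_smul, smul_smul]
    congr 1
    change _ = ((χ₁ g * χ₂ g : Circle) : ℂ)
    rw [Circle.coe_mul, mul_comm]

/-- Invariant inner perturbations do not change the charge. -/
theorem HasCharge.innerAut_mul (h : IsCovariant γ φ π Ω U) (hφ : φ ∈ stateSet n)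
    {u : ChainAlgebra n}
    (hu : u ∈ unitary (ChainAlgebra n)) (hug : ∀ g, γ.aut g u = u) (hc : HasCharge φ π U θ χ)
    (hθ : ∀ g, Commute (γ.aut g) θ) : HasCharge φ π U (innerAut u * θ) χ := by
  have h1 : HasCharge φ π U (innerAut u) (1 : G →ₜ* Circle) := by
    refine ⟨π (star u) Ω, ?_, fun a => ?_, fun g => ?_⟩
    · have e := norm_sq_rep_apply π (star u) Ω
      rw [star_star, hu.2, ← h.vector, hφ.1] at e
      have e2 : ‖π (star u) Ω‖ ^ 2 = 1 := by exact_mod_cast e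
      nlinarith [norm_nonneg (π (star u) Ω)]
    · rw [innerAut_apply hu, ← rep_mul_apply, h.inner_apply, star_star, mul_assoc]
    · rw [h.apply_rep, h.fix, map_star, hug]
      change _ = ((1 : Circle) : ℂ) • _
      rw [Circle.coe_one, one_smul]
  simpa using h1.mul h hc hθ

/-- If the pumped state has an overlap with `φ` that is uniform in the volume, then its vector is
not orthogonal to the cyclic vector, and therefore it has trivial charge. -/
theorem HasCharge.eq_one (h : IsCovariant γ φ π Ω U) (hφ : IsPureState φ) (hprod : IsProduct φ)
    (hc : HasCharge φ π U θ χ) {r : ℝ} (hr : 0 < r)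
    (hθ : ∀ᶠ k in atTop, r ≤ ‖φ (θ (ground φ (box k)))‖) : χ = 1 := by
  obtain ⟨v, hv, hv1, hv2⟩ := hc
  have h1 : Tendsto (fun k => ⟪v, π (ground φ (box k)) v⟫_ℂ) atTop (𝓝 ⟪v, ⟪Ω, v⟫_ℂ • Ω⟫_ℂ) :=
    tendsto_const_nhds.inner (tendsto_rep_ground_box h.toIsGNSTriple hφ hprod v)
  have h2 : r ≤ ‖⟪v, ⟪Ω, v⟫_ℂ • Ω⟫_ℂ‖ := by
    refine ge_of_tendsto h1.norm (hθ.mono fun k hk => ?_)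
    rwa [hv1] at hk
  have h3 : ⟪Ω, v⟫_ℂ ≠ 0 := fun h0 => by
    rw [h0, zero_smul, inner_zero_right, norm_zero] at h2
    exact absurd h2 (not_le.mpr hr)
  ext g
  have e := inner_unitary_apply (U g) Ω v
  rw [h.fix, hv2, inner_smul_right] at e
  exact mul_right_cancel₀ h3 (e.trans (one_mul _).symm)

/-- If `φ ∘ θ` is represented by a vector and `θ` commutes with the symmetries, then it has a
charge. -/
theorem exists_hasCharge_of_vector (h : IsCovariant γ φ π Ω U) (hφ : IsPureState φ)
    (hprod : IsProduct φ) (hinv : IsInvariantState γ φ) (hθ : ∀ g, Commute (γ.aut g) θ) {v : 𝓗}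
    (hv : ‖v‖ = 1) (hv1 : ∀ a, φ (θ a) = ⟪v, π a v⟫_ℂ) : ∃ χ, HasCharge φ π U θ χ := by
  have hU : ∀ g, (U g : 𝓗 →L[ℂ] 𝓗) v ≠ 0 := fun g h0 => by
    have := norm_unitary_apply (U g) v
    rw [h0, hv, norm_zero] at this
    exact zero_ne_one this
  have hv0 : v ≠ 0 := fun h => by simp [h] at hv
  -- `v` and `U(g)v` represent the same state, hence they are proportional
  have hsame : ∀ g a, ⟪v, π a v⟫_ℂ =
      ⟪(U g : 𝓗 →L[ℂ] 𝓗) v, π a ((U g : 𝓗 →L[ℂ] 𝓗) v)⟫_ℂ := fun g a => by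
    have e1 : γ.aut g (γ.aut g⁻¹ a) = a := by rw [map_inv, aut_apply_inv]
    have e2 : π a ((U g : 𝓗 →L[ℂ] 𝓗) v) = (U g : 𝓗 →L[ℂ] 𝓗) (π (γ.aut g⁻¹ a) v) := by
      rw [h.apply_rep, e1]
    rw [e2, inner_unitary_apply, ← hv1, ← hv1]
    have e3 := DFunLike.congr_fun (hθ g⁻¹).eq a
    rw [StarAlgEquiv.mul_apply, StarAlgEquiv.mul_apply] at e3
    rw [← e3, hinv]
  choose c hc using fun g => exists_smul_of_same_state h.toIsGNSTriple hφ hprod (hU g) (hsame g)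
  have hcn : ∀ g, ‖c g‖ = 1 := fun g => by
    have := norm_unitary_apply (U g) v
    rwa [hc, norm_smul, hv, mul_one] at this
  have hmul : ∀ g k, c (g * k) = c g * c k := fun g k => by
    refine smul_left_injective ℂ hv0 ?_
    change c (g * k) • v = (c g * c k) • v
    rw [← hc, map_mul, Submonoid.coe_mul, mul_comm (c g), mul_smul, ← hc g, ← map_smul, ← hc k]
    rfl
  have hcont : Continuous c := by
    have e : c = fun g => ⟪v, (U g : 𝓗 →L[ℂ] 𝓗) v⟫_ℂ := by
      funext g
      rw [hc, inner_smul_right, inner_self_eq_norm_sq_to_K, hv]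
      simp
    rw [e]
    exact continuous_const.inner (h.cont v)
  have hmem : ∀ g, c g ∈ Submonoid.unitSphere ℂ := fun g => mem_sphere_zero_iff_norm.mpr (hcn g)
  have hone : c 1 = 1 := by
    have := hmul 1 1
    rw [mul_one] at this
    have hc1 : c 1 ≠ 0 := fun h => by simpa [h] using hcn 1
    exact (mul_right_cancel₀ hc1 (by rw [one_mul, ← this])).symm
  exact ⟨⟨⟨⟨fun g => ⟨c g, hmem g⟩, Circle.ext hone⟩, fun g k => Circle.ext (hmul g k)⟩,
    hcont.subtype_mk _⟩, v, hv, hv1, hc⟩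

/-- The interval `{1, …, k}` of the right half-line. -/
def rightBox (k : ℕ) : Finset ℤ := Finset.Icc 1 k

theorem eventually_subset_rightBox {R : Finset ℤ} (hR : (R : Set ℤ) ⊆ (Set.Iic 0)ᶜ) :
    ∀ᶠ k in atTop, R ⊆ rightBox k := by
  filter_upwards [exists_subset_box R] with k hk x hx
  have h1 := hk hx
  have h2 : ¬x ≤ 0 := hR hx
  rw [mem_box, abs_le] at h1
  rw [rightBox, Finset.mem_Icc]
  omega

theorem rightBox_subset (k : ℕ) : (rightBox k : Set ℤ) ⊆ Set.Ioi 0 := fun x hx => by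
  rw [rightBox, Finset.coe_Icc] at hx
  exact lt_of_lt_of_le zero_lt_one hx.1

/-- A `φ`-preserving automorphism which can be cut at the origin maps, after the cut, `φ` to a
vector state. -/
theorem exists_vector_of_isCut (h : IsGNSTriple φ π Ω) (hφ : IsPureState φ) (hprod : IsProduct φ)
    {𝒮 : Set (ChainAut n)} {θ' θ'' : ChainAut n} {X : ChainAlgebra n} {δ : ℝ}
    (hcut : IsCut 𝒮 θ θ' θ'' X δ) (hθ : ∀ a, φ (θ a) = φ a) :
    ∃ v : 𝓗, ‖v‖ = 1 ∧ ∀ a, φ (θ' a) = ⟪v, π a v⟫_ℂ := by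
  have hg := isGround_ground hφ hprod
  set β := θ' * θ'' with hβ
  -- the state `φ ∘ θ' ∘ θ''` is a vector state since it differs from `φ` by a unitary
  set w := π (θ⁻¹ X) Ω with hwdef
  have hw : ∀ a, ⟪w, π a w⟫_ℂ = φ (β a) := fun a => by
    have hθa : θ a = X * β a * star X := by
      rw [hcut.eq, StarAlgEquiv.mul_apply, innerAut_apply hcut.unitary]
    have e1 : ∀ x, star X * (X * x) = x := fun x => by rw [← mul_assoc, hcut.unitary.1, one_mul]
    rw [hwdef, ← rep_mul_apply, h.inner_apply, ← hθ, map_mul θ, map_star θ, map_mul θ,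
      aut_apply_inv, hθa]
    simp only [mul_assoc, hcut.unitary.1, mul_one, e1]
  have hw0 : w ≠ 0 := fun h0 => by
    have := hw 1
    rw [map_one β, hφ.1.1, h0, inner_zero_left] at this
    exact zero_ne_one this
  have hβl : ∀ a ∈ alg n (Set.Iic 0), β a = θ' a := fun a ha => by
    rw [hβ, StarAlgEquiv.mul_apply, hcut.right.fix a (by rwa [Set.compl_Ioi])]
  have hβr : ∀ a ∈ alg n (Set.Ioi 0), β a = θ'' a := fun a ha => by
    rw [hβ, StarAlgEquiv.mul_apply]
    exact hcut.left.fix _ (by rw [Set.compl_Iic]; exact hcut.right.mem a ha)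
  have hgr : ∀ k, ground φ (rightBox k) ∈ alg n (Set.Ioi 0) := fun k =>
    supp_le_alg _ (supp_mono (rightBox_subset k) (hg _).mem)
  have hlr : ∀ {l r : ChainAlgebra n}, l ∈ alg n (Set.Iic 0) → r ∈ alg n (Set.Ioi 0) →
      Commute l r := fun hl hr =>
    commute_of_disjoint_alg (by rw [← Set.compl_Iic]; exact disjoint_compl_right) hl hr
  have hmemL : ∀ {L : Finset ℤ}, (L : Set ℤ) ⊆ Set.Iic 0 → ∀ l ∈ supp n (L : Set ℤ),
      l ∈ alg n (Set.Iic 0) := fun hL l hl => supp_le_alg _ (supp_mono hL hl)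
  have hmemR : ∀ {R : Finset ℤ}, (R : Set ℤ) ⊆ (Set.Iic 0)ᶜ → ∀ r ∈ supp n (R : Set ℤ),
      r ∈ alg n (Set.Ioi 0) := fun hR r hr =>
    supp_le_alg _ (supp_mono (by rwa [Set.compl_Iic] at hR) hr)
  -- the projections onto `φ` in the right half-line converge strongly
  have hlim : ∀ x, ∃ y, Tendsto (fun k => π (ground φ (rightBox k)) x) atTop (𝓝 y) := by
    refine h.exists_tendsto _ (fun k x => (hg _).norm_rep_le x) fun S a ha => ?_
    refine split_induction (Set.Iic 0)
      (p := fun a => ∃ y, ∀ᶠ k in atTop, π (ground φ (rightBox k)) (π a Ω) = y) ?_ ?_ ha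
    · rintro a b ⟨y, hy⟩ ⟨z, hz⟩
      refine ⟨y + z, ?_⟩
      filter_upwards [hy, hz] with k hky hkz
      rw [map_add, add_apply, map_add, hky, hkz]
    · intro L R hL hR l hl r hr
      refine ⟨φ r • π l Ω, ?_⟩
      filter_upwards [eventually_subset_rightBox hR] with k hk
      have e : π (ground φ (rightBox k)) (π (l * r) Ω) =
          π (l * (ground φ (rightBox k) * r * ground φ (rightBox k))) Ω := by
        conv_lhs => rw [← (hg (rightBox k)).rep_vector h hφ.1, ← rep_mul_apply, ← rep_mul_apply]
        rw [← mul_assoc, ← mul_assoc, ← mul_assoc, ← (hlr (hmemL hL l hl) (hgr k)).eq]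
      rw [e, (hg _).compress r (supp_mono (Finset.coe_subset.mpr hk) hr), rep_mul_apply, map_smul,
        smul_apply, (hg _).rep_vector h hφ.1, map_smul]
  choose f hf using hlim
  -- the limit does not annihilate all vectors `π(b)w`
  obtain ⟨R, hR, b, hb, hv0⟩ : ∃ R : Finset ℤ, (R : Set ℤ) ⊆ (Set.Iic 0)ᶜ ∧
      ∃ b ∈ supp n (R : Set ℤ), f (π b w) ≠ 0 := by
    by_contra! hall
    refine hw0 (ext_inner_left ℂ fun z => ?_)
    refine h.induction_local (p := fun z => ⟪z, w⟫_ℂ = ⟪z, (0 : 𝓗)⟫_ℂ)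
      (isClosed_eq (by fun_prop) (by fun_prop)) (fun S a ha => ?_) z
    rw [inner_zero_right]
    refine split_induction (Set.Iic 0) (p := fun a => ⟪π a Ω, w⟫_ℂ = 0)
      (fun a b ha hb => ?_) (fun L R hL hR l hl r hr => ?_) ha
    · rw [map_add, add_apply, inner_add_left, ha, hb, add_zero]
    · rw [(hlr (hmemL hL l hl) (hmemR hR r hr)).eq, rep_mul_apply, inner_rep_left]
      have h1 : Tendsto (fun k => ⟪π l Ω, π (ground φ (rightBox k)) (π (star r) w)⟫_ℂ) atTop
          (𝓝 ⟪π l Ω, (0 : 𝓗)⟫_ℂ) := by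
        rw [← hall R hR (star r) (star_mem hr)]
        exact tendsto_const_nhds.inner (hf _)
      rw [inner_zero_right] at h1
      refine tendsto_nhds_unique (tendsto_const_nhds.congr fun k => ?_) h1
      conv_rhs => rw [← (hg (rightBox k)).star_eq, ← inner_rep_left, ← rep_mul_apply,
        ← (hlr (hmemL hL l hl) (hgr k)).eq, rep_mul_apply, (hg _).rep_vector h hφ.1]
  set v₀ := f (π b w) with hv₀
  have hbm := hmemR hR b hb
  have hinner : ∀ a, Tendsto (fun k => φ (β (star b * (ground φ (rightBox k) * a *
      ground φ (rightBox k)) * b))) atTop (𝓝 ⟪v₀, π a v₀⟫_ℂ) := fun a => by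
    refine ((hf (π b w)).inner (((π a).continuous.tendsto _).comp (hf (π b w)))).congr fun k => ?_
    rw [← hw, Function.comp_apply, inner_rep_left, inner_rep_left, (hg _).star_eq,
      ← rep_mul_apply, ← rep_mul_apply, ← rep_mul_apply, ← rep_mul_apply]
    simp only [mul_assoc]
  -- on the right the projections turn the state of `v₀` into `φ`, and on the left it remains the
  -- state `φ ∘ θ'` of `w`; this holds up to the normalization of `v₀`
  have hstate : ∀ a, ⟪v₀, π a v₀⟫_ℂ = ⟪v₀, v₀⟫_ℂ * φ (θ' a) := by
    refine congrFun (eq_of_eq_on_local ?_ ?_ fun S a ha => ?_)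
    · exact continuous_const.inner (continuous_rep_apply π v₀)
    · exact continuous_const.mul (φ.continuous.comp (continuous_aut θ'))
    refine split_induction (Set.Iic 0) (p := fun a => ⟪v₀, π a v₀⟫_ℂ = ⟪v₀, v₀⟫_ℂ * φ (θ' a))
      (fun a b ha hb => ?_) (fun L R' hL hR' l hl r hr => ?_) ha
    · rw [map_add, add_apply, inner_add_right, ha, hb, map_add, map_add, mul_add]
    · have hlm := hmemL hL l hl
      have hrm := hmemR hR' r hr
      have hdisj : Disjoint (Set.Iic (0 : ℤ)) (Set.Ioi 0) := by
        rw [← Set.compl_Iic]; exact disjoint_compl_right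
      have h1 := (hinner 1).const_mul (φ r * φ (θ' l))
      rw [rep_one_apply] at h1
      have e : φ (θ' (l * r)) = φ r * φ (θ' l) := by
        rw [map_mul, hcut.left.fix r (by rwa [Set.compl_Iic]),
          hprod.map_mul_alg hdisj (hcut.left.mem l hlm) hrm, mul_comm]
      rw [e, mul_comm]
      refine tendsto_nhds_unique (hinner (l * r)) (h1.congr' ?_)
      filter_upwards [eventually_subset_rightBox hR'] with k hk
      set p := ground φ (rightBox k)
      have hp : p ∈ alg n (Set.Ioi 0) := hgr k
      have hc : star b * p * b ∈ alg n (Set.Ioi 0) := mul_mem (mul_mem (star_mem hbm) hp) hbm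
      have e1 : star b * (p * (l * r) * p) * b = φ r • (l * (star b * p * b)) := by
        calc star b * (p * (l * r) * p) * b = (star b * (p * l)) * (r * p * b) := by
              simp only [mul_assoc]
          _ = (star b * l) * (p * r * p * b) := by
              rw [← (hlr hlm hp).eq]
              simp only [mul_assoc]
          _ = l * (star b * (p * r * p) * b) := by
              rw [← (hlr hlm (star_mem hbm)).eq]
              simp only [mul_assoc]
          _ = _ := by
              rw [(hg (rightBox k)).compress r (supp_mono (Finset.coe_subset.mpr hk) hr),
                mul_smul_comm, smul_mul_assoc, mul_smul_comm]
      have e2 : star b * (p * 1 * p) * b = star b * p * b := by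
        rw [mul_one, (hg (rightBox k)).mul_self]
      rw [e1, e2, map_smul, map_smul, map_mul β l, hβl l hlm, hβr _ hc,
        hprod.map_mul_alg hdisj (hcut.left.mem l hlm) (hcut.right.mem _ hc), smul_eq_mul,
        mul_assoc]
  have hN : (‖v₀‖ : ℂ) ≠ 0 := by exact_mod_cast norm_ne_zero_iff.mpr hv0
  refine ⟨((‖v₀‖ : ℂ)⁻¹) • v₀, ?_, fun a => ?_⟩
  · rw [norm_smul, norm_inv, Complex.norm_real, norm_norm, inv_mul_cancel₀]
    exact norm_ne_zero_iff.mpr hv0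
  · rw [map_smul, inner_smul_left, inner_smul_right, hstate, inner_self_eq_norm_sq_to_K, map_inv₀,
      Complex.conj_ofReal]
    change _ = (‖v₀‖ : ℂ)⁻¹ * ((‖v₀‖ : ℂ)⁻¹ * ((‖v₀‖ : ℂ) ^ 2 * φ (θ' a)))
    field_simp

/-- A `φ`-preserving symmetric automorphism which can be cut at the origin pumps a charge. -/
theorem exists_hasCharge_of_isCut (h : IsCovariant γ φ π Ω U) (hφ : IsPureState φ)
    (hprod : IsProduct φ) (hinv : IsInvariantState γ φ) {θ' θ'' : ChainAut n}
    {X : ChainAlgebra n} {δ : ℝ} (hcut : IsCut (Set.range γ.aut) θ θ' θ'' X δ)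
    (hθ : ∀ a, φ (θ a) = φ a) : ∃ χ, HasCharge φ π U θ' χ := by
  obtain ⟨v, hv, hv1⟩ := exists_vector_of_isCut h.toIsGNSTriple hφ hprod hcut hθ
  exact exists_hasCharge_of_vector h hφ hprod hinv (fun g => hcut.comm_left _ ⟨g, rfl⟩) hv hv1

/-- Relative charges can be computed in any covariant representation. -/
theorem IsRelativeCharge.hasCharge (h : IsCovariant γ φ π Ω U) {ψ : ChainAlgebra n →L[ℂ] ℂ}
    (hψ : ∀ a, ψ a = φ (θ a)) (hc : IsRelativeCharge γ φ ψ χ) : HasCharge φ π U θ χ := by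
  obtain ⟨𝓗', _, _, _, π', Ω', U', v, hG, hcont, hfix, hcov, hv, hv1, hv2⟩ := hc
  have h' : IsCovariant γ φ π' Ω' U' := ⟨hG, hcont, hfix, hcov⟩
  let T : ChainAlgebra n →ₗ[ℂ] 𝓗 :=
    { toFun := fun a => π a Ω
      map_add' := fun a b => by rw [map_add]; rfl
      map_smul' := fun c a => by rw [map_smul]; rfl }
  obtain ⟨W, hW⟩ := h'.exists_isometry T fun a =>
    norm_rep_apply_eq (π := π) (π' := π') (by rw [← h.vector, ← h'.vector])
  replace hW : ∀ a, W (π' a Ω') = π a Ω := hW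
  have hWπ : ∀ a x, W (π' a x) = π a (W x) := fun a => by
    refine h'.eq_of_eq_on (W.continuous.comp (π' a).continuous)
      ((π a).continuous.comp W.continuous) fun b => ?_
    rw [← rep_mul_apply, hW, hW, rep_mul_apply]
  have hWU : ∀ g x, W ((U' g : 𝓗' →L[ℂ] 𝓗') x) = (U g : 𝓗 →L[ℂ] 𝓗) (W x) := fun g => by
    refine h'.eq_of_eq_on (W.continuous.comp (U' g : 𝓗' →L[ℂ] 𝓗').continuous)
      ((U g : 𝓗 →L[ℂ] 𝓗).continuous.comp W.continuous) fun b => ?_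
    rw [h'.apply_rep, h'.fix, hW, hW, h.apply_rep, h.fix]
  refine ⟨W v, by rw [W.norm_map, hv], fun a => ?_, fun g => ?_⟩
  · rw [← hWπ, W.inner_map_map, ← hv1, hψ]
  · rw [← hWU, hv2, map_smul]

end Charges

/-! ### Small plaquettes carry no charge -/

section Plaquette

attribute [local irreducible] instCStarAlgebraChainAlgebra

variable {n : ℤ → ℕ} {C : ℝ} {Φ Ψ : Finset ℤ → ℝ → ChainAlgebra n}

theorem norm_conj_sub_conj_le {T K L : ChainAut n} {a b : ChainAlgebra n} {ε κ : ℝ}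
    (hb : ‖T⁻¹ a - b‖ ≤ ε) (hK : ‖K b - L b‖ ≤ κ) :
    ‖(T * K * T⁻¹) a - (T * L * T⁻¹) a‖ ≤ 2 * ε + κ := by
  have e : (T * K * T⁻¹) a - (T * L * T⁻¹) a = T (K (T⁻¹ a) - L (T⁻¹ a)) := by
    rw [map_sub]
    rfl
  have e2 : K (T⁻¹ a) - L (T⁻¹ a) = K (T⁻¹ a - b) + (K b - L b) - L (T⁻¹ a - b) := by
    rw [map_sub, map_sub]
    abel
  rw [e, norm_aut, e2]
  refine (norm_sub_le _ _).trans ?_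
  have h1 := norm_add_le (K (T⁻¹ a - b)) (K b - L b)
  rw [norm_aut] at h1 ⊢
  linarith

/-- The inverse of `T` spreads observables far to the left, far to the right, and in the middle, by
a distance of order `d`, up to a relative error `ε`. -/
structure IsQuasilocal (T : ChainAut n) (d : ℕ) (ε : ℝ) : Prop where
  left : ∀ a ∈ alg n (Set.Iic (-(2 * d : ℤ) - 1)), ∃ b ∈ alg n (Set.Iic 0),
    ‖b‖ = ‖a‖ ∧ ‖T⁻¹ a - b‖ ≤ ε * ‖a‖
  right : ∀ a ∈ alg n (Set.Ioi (2 * d : ℤ)), ∃ b ∈ alg n (Set.Ioi 0),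
    ‖b‖ = ‖a‖ ∧ ‖T⁻¹ a - b‖ ≤ ε * ‖a‖
  middle : ∀ a ∈ alg n (box (2 * d)), ∃ b ∈ alg n (box (4 * d)),
    ‖b‖ = ‖a‖ ∧ ‖T⁻¹ a - b‖ ≤ ε * ‖a‖

/-- A composition of two evolutions spreads observables little. -/
theorem isQuasilocal_mul (hΨ : IsRegular C Ψ) (hΦ : IsRegular C Φ) {s t : ℝ}
    (hs : s ∈ Set.Icc (0 : ℝ) 1) (ht : t ∈ Set.Icc (0 : ℝ) 1) (d : ℕ) :
    IsQuasilocal (ev Ψ t * ev Φ s) d (cutConst C * (4 * decayTail d)) := by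
  have hc := hΦ.cutConst_nonneg
  -- each of the two evolutions spreads observables by the distance `d`, from `Γ₁` to `Γ₂` and from
  -- `Γ₂` to `Γ₃`
  have key : ∀ {Γ₁ Γ₂ Γ₃ : Set ℤ} {B₂ B₃ : Finset ℤ}, IsBoundary Γ₂ B₂ → IsBoundary Γ₃ B₃ →
      Γ₁ ⊆ Γ₂ → Γ₂ ⊆ Γ₃ → (∀ y ∈ Γ₁, ∀ c ∈ B₂, (d : ℤ) ≤ |c - y|) →
      (∀ y ∈ Γ₂, ∀ c ∈ B₃, (d : ℤ) ≤ |c - y|) → B₂.card ≤ 2 → B₃.card ≤ 2 →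
      ∀ a ∈ alg n Γ₁, ∃ b ∈ alg n Γ₃, ‖b‖ = ‖a‖ ∧
        ‖(ev Ψ t * ev Φ s)⁻¹ a - b‖ ≤ cutConst C * (4 * decayTail d) * ‖a‖ := by
    intro Γ₁ Γ₂ Γ₃ B₂ B₃ hB₂ hB₃ h12 h23 hd₂ hd₃ hc₂ hc₃ a ha
    obtain ⟨b, hb, hbn, hba⟩ := hΨ.exists_quasilocal hB₂ h12 hd₂ ht ha
    obtain ⟨c, hcm, hcn, hcb⟩ := hΦ.exists_quasilocal hB₃ h23 hd₃ hs hb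
    refine ⟨c, hcm, hcn.trans hbn, ?_⟩
    have e : (ev Ψ t * ev Φ s)⁻¹ a - c =
        (ev Φ s)⁻¹ ((ev Ψ t)⁻¹ a - b) + ((ev Φ s)⁻¹ b - c) := by
      rw [map_sub, mul_inv_rev, StarAlgEquiv.mul_apply]
      abel
    rw [e]
    refine (norm_add_le _ _).trans ?_
    rw [norm_aut]
    have hbound : ∀ B : Finset ℤ, B.card ≤ 2 → cutConst C * ‖a‖ * (B.card * decayTail d) ≤
        cutConst C * ‖a‖ * (2 * decayTail d) := fun B hB => by
      have h2 : (B.card : ℝ) ≤ 2 := by exact_mod_cast hB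
      have := decayTail_nonneg d
      gcongr
    rw [hbn] at hcb
    have := hbound B₂ hc₂
    have := hbound B₃ hc₃
    linarith
  refine ⟨?_, ?_, ?_⟩
  · refine key (isBoundary_Iic (-(d : ℤ))) (isBoundary_Iic 0) ?_ ?_ ?_ ?_ (by simp) (by simp)
    · intro x hx; rw [Set.mem_Iic] at hx ⊢; omega
    · intro x hx; rw [Set.mem_Iic] at hx ⊢; omega
    · intro y hy c hc
      rw [Set.mem_Iic] at hy
      rw [Finset.mem_singleton] at hc
      exact le_trans (by omega) (le_abs_self _)
    · intro y hy c hc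
      rw [Set.mem_Iic] at hy
      rw [Finset.mem_singleton] at hc
      exact le_trans (by omega) (le_abs_self _)
  · refine key (isBoundary_Ioi (d : ℤ)) (isBoundary_Ioi 0) ?_ ?_ ?_ ?_ (by simp) (by simp)
    · intro x hx; rw [Set.mem_Ioi] at hx ⊢; omega
    · intro x hx; rw [Set.mem_Ioi] at hx ⊢; omega
    · intro y hy c hc
      rw [Set.mem_Ioi] at hy
      rw [Finset.mem_singleton] at hc
      exact le_trans (by omega) (neg_le_abs _)
    · intro y hy c hc
      rw [Set.mem_Ioi] at hy
      rw [Finset.mem_singleton] at hc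
      exact le_trans (by omega) (neg_le_abs _)
  · refine key (isBoundary_box (3 * d)) (isBoundary_box (4 * d)) ?_ ?_ ?_ ?_ Finset.card_le_two
      Finset.card_le_two
    · intro x hx
      rw [Finset.mem_coe, mem_box, abs_le] at hx ⊢; push_cast at hx ⊢; omega
    · intro x hx
      rw [Finset.mem_coe, mem_box, abs_le] at hx ⊢; push_cast at hx ⊢; omega
    · intro y hy c hc
      rw [Finset.mem_coe, mem_box, abs_le] at hy
      push_cast at hy
      rw [Finset.mem_insert, Finset.mem_singleton] at hc
      push_cast at hc
      rcases hc with hc | hc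
      · exact le_trans (by omega) (neg_le_abs _)
      · exact le_trans (by omega) (le_abs_self _)
    · intro y hy c hc
      rw [Finset.mem_coe, mem_box, abs_le] at hy
      push_cast at hy
      rw [Finset.mem_insert, Finset.mem_singleton] at hc
      push_cast at hc
      rcases hc with hc | hc
      · exact le_trans (by omega) (neg_le_abs _)
      · exact le_trans (by omega) (le_abs_self _)

variable {φ : ChainAlgebra n →L[ℂ] ℂ} {G : Type*} [Group G] [TopologicalSpace G]
  {γ : OnSiteAction G n}
  {𝓗 : Type*} [NormedAddCommGroup 𝓗] [InnerProductSpace ℂ 𝓗] [CompleteSpace 𝓗]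
  {π : ChainAlgebra n →⋆ₐ[ℂ] (𝓗 →L[ℂ] 𝓗)} {Ω : 𝓗} {U : G →* unitary (𝓗 →L[ℂ] 𝓗)}

theorem norm_state_le (hφ : φ ∈ stateSet n) (a : ChainAlgebra n) : ‖φ a‖ ≤ ‖a‖ := by
  obtain ⟨𝓗, _, _, _, π, Ω, h⟩ := exists_gnsTriple hφ
  rw [h.vector]
  refine (norm_inner_le_norm _ _).trans ?_
  rw [h.norm_vector hφ, one_mul]
  refine (norm_rep_apply_le π a Ω).trans ?_
  rw [h.norm_vector hφ, mul_one]

theorem norm_mul_mul_sub_le {A : Type*} [NormedRing A] {x y z x' y' z' : A} {a b c : ℝ}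
    (hx : ‖x - x'‖ ≤ a) (hy : ‖y - y'‖ ≤ b) (hz : ‖z - z'‖ ≤ c) (hxn : ‖x'‖ ≤ 1) (hyn : ‖y‖ ≤ 1)
    (hyn' : ‖y'‖ ≤ 1) (hzn : ‖z‖ ≤ 1) : ‖x * y * z - x' * (y' * z')‖ ≤ a + b + c := by
  have e : x * y * z - x' * (y' * z') =
      (x - x') * y * z + x' * (y - y') * z + x' * y' * (z - z') := by noncomm_ring
  have ha := (norm_nonneg _).trans hx
  have hb := (norm_nonneg _).trans hy
  have hc := (norm_nonneg _).trans hz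
  rw [e]
  refine (norm_add₃_le).trans ?_
  refine add_le_add (add_le_add ?_ ?_) ?_
  · calc ‖(x - x') * y * z‖ ≤ ‖x - x'‖ * ‖y‖ * ‖z‖ := norm_mul₃_le
      _ ≤ a * 1 * 1 := by gcongr
      _ = a := by ring
  · calc ‖x' * (y - y') * z‖ ≤ ‖x'‖ * ‖y - y'‖ * ‖z‖ := norm_mul₃_le
      _ ≤ 1 * b * 1 := by gcongr
      _ = b := by ring
  · calc ‖x' * y' * (z - z')‖ ≤ ‖x'‖ * ‖y'‖ * ‖z - z'‖ := norm_mul₃_le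
      _ ≤ 1 * 1 * c := by gcongr
      _ = c := by ring

/-- If `T K T⁻¹` preserves `φ` and the cut of `K` is close to the identity, then `T K T⁻¹` pumps no
charge: the projection onto `φ` in a large interval is a product of projections on the left, in
the middle and on the right, and the cut automorphism acts on them almost as `T K T⁻¹`, almost
trivially, and almost trivially, respectively. The pumped state therefore overlaps with `φ`. -/
theorem hasCharge_one_of_near (h : IsCovariant γ φ π Ω U) (hφ : IsPureState φ)
    (hprod : IsProduct φ) (hinv : IsInvariantState γ φ)
    {T T' T'' K K' K'' : ChainAut n} {XT X : ChainAlgebra n} {d : ℕ} {δT δ ε η : ℝ}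
    (hT : IsCut (Set.range γ.aut) T T' T'' XT δT) (hK : IsCut (Set.range γ.aut) K K' K'' X δ)
    (hE : ∀ a, φ ((T * K * T⁻¹) a) = φ a) (hloc : IsQuasilocal T d ε) (hε : 0 ≤ ε)
    (hη : 0 ≤ η) (hnear : ∀ m ∈ alg n (box (4 * d)), ‖K' m - m‖ ≤ η * ‖m‖)
    (hsmall : 6 * ε + 2 * δ + η ≤ 1 / 2) : HasCharge φ π U (T' * K' * T'⁻¹) 1 := by
  have hg := isGround_ground hφ hprod
  obtain ⟨χ, hχ⟩ := exists_hasCharge_of_isCut h hφ hprod hinv ((hT.mul hK).mul hT.inv) hE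
  set θ := T' * K' * T'⁻¹ with hθ
  have hθc : ∀ g, Commute (γ.aut g) θ := fun g =>
    ((hT.comm_left _ ⟨g, rfl⟩).mul_right (hK.comm_left _ ⟨g, rfl⟩)).mul_right
      (hT.comm_left _ ⟨g, rfl⟩).inv_right
  -- `T K' T⁻¹` differs from the cut of `T K T⁻¹` by an invariant inner automorphism
  have hXm : θ (star XT) ∈ unitary (ChainAlgebra n) :=
    SpinChain.aut_mem_unitary θ (Unitary.star_mem hT.unitary)
  have hconj : T * K' * T⁻¹ = innerAut (XT * θ (star XT)) * θ := by
    have c1 := (hK.left.commute hT.right).eq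
    have c2 : innerAut XT * (T' * T'') = T := hT.eq.symm
    rw [← innerAut_mul_innerAut hT.unitary hXm, mul_assoc (innerAut XT), ← innerAut_mul θ
      (Unitary.star_mem hT.unitary), ← innerAut_inv hT.unitary]
    have e1 : T' * T'' * K' * (T' * T'')⁻¹ = θ := by
      rw [mul_assoc T', ← c1, hθ, mul_inv_rev]
      group
    rw [← e1]
    calc T * K' * T⁻¹ = innerAut XT * (T' * T'') * K' * (innerAut XT * (T' * T''))⁻¹ := by rw [c2]
      _ = _ := by group
  have hcharge : HasCharge φ π U (T * K' * T⁻¹) χ := by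
    rw [hconj]
    refine hχ.innerAut_mul h hφ.1 (mul_mem hT.unitary hXm) (fun g => ?_) hθc
    rw [map_mul, hT.aut_eq _ ⟨g, rfl⟩]
    congr 1
    exact aut_apply_eq_of_commute (hθc g) (by rw [map_star, hT.aut_eq _ ⟨g, rfl⟩])
  suffices hχ1 : χ = 1 by rwa [hχ1] at hχ
  refine hcharge.eq_one h hφ hprod (r := 1 / 2) (by norm_num) ?_
  filter_upwards [eventually_ge_atTop (2 * d)] with k hk
  set L : Finset ℤ := Finset.Icc (-(k : ℤ)) (-(2 * d : ℤ) - 1)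
  set R : Finset ℤ := Finset.Icc ((2 * d : ℤ) + 1) k
  have hbox : box k = (L ∪ box (2 * d)) ∪ R := by
    ext x
    simp only [Finset.mem_union, mem_box, L, R, Finset.mem_Icc, abs_le]
    push_cast
    omega
  have hd1 : Disjoint (L ∪ box (2 * d)) R := by
    rw [Finset.disjoint_left]
    intro x hx hx2
    simp only [Finset.mem_union, mem_box, L, R, Finset.mem_Icc, abs_le] at hx hx2
    push_cast at hx
    omega
  have hd2 : Disjoint L (box (2 * d)) := by
    rw [Finset.disjoint_left]
    intro x hx hx2
    simp only [mem_box, L, Finset.mem_Icc, abs_le] at hx hx2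
    push_cast at hx2
    omega
  have hd3 : Disjoint (box (2 * d)) R := hd1.mono_left Finset.subset_union_right
  rw [hbox, ground_union hφ hprod hd1, ground_union hφ hprod hd2, map_mul (T * K' * T⁻¹),
    map_mul (T * K' * T⁻¹)]
  have hn : ∀ S : Finset ℤ, ‖ground φ S‖ ≤ 1 := fun S => (hg S).norm_le_one
  have hone : T * 1 * T⁻¹ = 1 := by group
  -- on the left `K` and `K'` differ by conjugation with the unitary of the cut only; in the middle
  -- `K'` is almost trivial by hypothesis, and on the right it is trivial
  have hL : ‖(T * K' * T⁻¹) (ground φ L) - (T * K * T⁻¹) (ground φ L)‖ ≤ 2 * ε + 2 * δ := by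
    obtain ⟨b, hb, hbn, hb2⟩ := hloc.left (ground φ L) (supp_le_alg _ (supp_mono (fun x hx => by
      simp only [L, Finset.coe_Icc] at hx
      exact hx.2) (hg L).mem))
    refine norm_conj_sub_conj_le (hb2.trans (mul_le_of_le_one_right hε (hn L))) ?_
    have e : K b = X * K' b * star X := by
      rw [hK.eq, StarAlgEquiv.mul_apply, StarAlgEquiv.mul_apply, innerAut_apply hK.unitary,
        hK.right.fix b (by rwa [Set.compl_Ioi])]
    have hbn' : ‖K' b‖ ≤ 1 := by rw [norm_aut, hbn]; exact hn L
    have e2 : K' b - X * K' b * star X = (K' b * (X - 1) - (X - 1) * K' b) * star X := by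
      calc K' b - X * K' b * star X = K' b * (X * star X) - X * K' b * star X := by
            rw [hK.unitary.2, mul_one]
        _ = _ := by noncomm_ring
    rw [e, e2, CStarRing.norm_mul_mem_unitary _ (Unitary.star_mem hK.unitary)]
    refine (norm_commutator_le _ _).trans ?_
    have := hK.norm_le
    have := norm_nonneg (X - 1)
    nlinarith [norm_nonneg (K' b)]
  have hM : ‖(T * K' * T⁻¹) (ground φ (box (2 * d))) - ground φ (box (2 * d))‖ ≤ 2 * ε + η := by
    obtain ⟨b, hb, hbn, hb2⟩ := hloc.middle _ (supp_le_alg _ (hg (box (2 * d))).mem)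
    have := norm_conj_sub_conj_le (T := T) (K := K') (L := 1) (κ := η)
      (hb2.trans (mul_le_of_le_one_right hε (hn _)))
      ((hnear b hb).trans (mul_le_of_le_one_right hη (hbn.le.trans (hn _))))
    rwa [hone] at this
  have hR : ‖(T * K' * T⁻¹) (ground φ R) - ground φ R‖ ≤ 2 * ε := by
    obtain ⟨b, hb, hbn, hb2⟩ := hloc.right (ground φ R) (supp_le_alg _ (supp_mono (fun x hx => by
      simp only [R, Finset.coe_Icc] at hx
      exact lt_of_lt_of_le (lt_add_one _) hx.1) (hg R).mem))
    have := norm_conj_sub_conj_le (T := T) (K := K') (L := 1) (κ := 0)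
      (hb2.trans (mul_le_of_le_one_right hε (hn R))) (by
        rw [hK.left.fix b (by rwa [Set.compl_Iic])]
        change ‖b - b‖ ≤ 0
        rw [sub_self, norm_zero])
    rwa [hone, add_zero] at this
  -- projections of expectation one drop out, and `T K T⁻¹` preserves `φ`
  have hval : φ ((T * K * T⁻¹) (ground φ L) * (ground φ (box (2 * d)) * ground φ R)) = 1 := by
    rw [← ground_union hφ hprod hd3, (state_mul_proj hφ.1 (hg _).star_eq (hg _).mul_self
      (hg _).state _).2, hE, (hg L).state]
  have hsum := norm_mul_mul_sub_le hL hM hR (by rw [norm_aut]; exact hn L)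
    (by rw [norm_aut]; exact hn _) (hn _) (by rw [norm_aut]; exact hn R)
  have h1 := (norm_state_le hφ.1 _).trans hsum
  rw [map_sub φ, hval] at h1
  have h2 := norm_sub_norm_le (1 : ℂ) (1 - φ ((T * K' * T⁻¹) (ground φ L) *
    (T * K' * T⁻¹) (ground φ (box (2 * d))) * (T * K' * T⁻¹) (ground φ R)))
  rw [sub_sub_cancel, norm_one, ← norm_neg, neg_sub] at h2
  linarith

end Plaquette

/-! ### Homotopies do not change the pumped charge -/

section Homotopy

attribute [local irreducible] instCStarAlgebraChainAlgebra

variable {n : ℤ → ℕ} {C : ℝ} {Φ : Finset ℤ → ℝ → ChainAlgebra n} {𝒮 : Set (ChainAut n)}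
  {p q : ChainAut n × ChainAut n} {X : Finset ℤ} {δ δ₁ δ₂ η η₁ η₂ : ℝ}

/-- The first automorphism can be cut at the origin, and its left part is the second one. -/
def IsCuttable (𝒮 : Set (ChainAut n)) (q : ChainAut n × ChainAut n) : Prop :=
  ∃ θ'' X δ, IsCut 𝒮 q.1 q.2 θ'' X δ

theorem IsCuttable.mul (hp : IsCuttable 𝒮 p) (hq : IsCuttable 𝒮 q) : IsCuttable 𝒮 (p * q) := by
  obtain ⟨_, _, _, hp⟩ := hp
  obtain ⟨_, _, _, hq⟩ := hq
  exact ⟨_, _, _, hp.mul hq⟩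

theorem IsCuttable.inv (hp : IsCuttable 𝒮 p) : IsCuttable 𝒮 p⁻¹ := by
  obtain ⟨_, _, _, hp⟩ := hp
  exact ⟨_, _, _, hp.inv⟩

theorem IsCuttable.commute (hp : IsCuttable 𝒮 p) {τ : ChainAut n} (hτ : τ ∈ 𝒮) :
    Commute τ p.2 := by
  obtain ⟨_, _, _, hp⟩ := hp
  exact hp.comm_left τ hτ

/-- A cut by a unitary `δ`-close to the identity, such that the left part moves the observables
in `X` by at most a fraction `η` of their norm. -/
def IsSmallCut (𝒮 : Set (ChainAut n)) (X : Finset ℤ) (δ η : ℝ) (q : ChainAut n × ChainAut n) :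
    Prop :=
  (∃ θ'' Y, IsCut 𝒮 q.1 q.2 θ'' Y δ) ∧ ∀ m ∈ alg n X, ‖q.2 m - m‖ ≤ η * ‖m‖

theorem IsSmallCut.mul (hp : IsSmallCut 𝒮 X δ₁ η₁ p) (hq : IsSmallCut 𝒮 X δ₂ η₂ q) :
    IsSmallCut 𝒮 X (δ₁ + δ₂) (η₁ + η₂) (p * q) := by
  obtain ⟨⟨_, _, hp⟩, hp2⟩ := hp
  obtain ⟨⟨_, _, hq⟩, hq2⟩ := hq
  refine ⟨⟨_, _, hp.mul hq⟩, fun m hm => ?_⟩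
  have e : (p * q).2 m - m = (p.2 m - m) + p.2 (q.2 m - m) := by
    rw [map_sub, Prod.snd_mul, StarAlgEquiv.mul_apply]
    abel
  rw [e, add_mul]
  refine (norm_add_le _ _).trans (add_le_add (hp2 m hm) ?_)
  rw [norm_aut]
  exact hq2 m hm

theorem IsSmallCut.inv (hp : IsSmallCut 𝒮 X δ η p) : IsSmallCut 𝒮 X δ η p⁻¹ := by
  obtain ⟨⟨_, _, hp⟩, hp2⟩ := hp
  refine ⟨⟨_, _, hp.inv⟩, fun m hm => ?_⟩
  rw [← norm_aut p.2, map_sub, Prod.snd_inv, aut_apply_inv, norm_sub_rev]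
  exact hp2 m hm

/-- The evolution and its left part at the time `s`. -/
def evPair (Φ : Finset ℤ → ℝ → ChainAlgebra n) (s : ℝ) : ChainAut n × ChainAut n :=
  (ev Φ s, ev (leftTerms Φ) s)

theorem IsRegular.leftTerms (h : IsRegular C Φ) : IsRegular C (leftTerms Φ) := h.restrict _

theorem IsRegular.isCuttable (h : IsRegular C Φ) (hS : ∀ τ ∈ 𝒮, ∀ Z u, τ (Φ Z u) = Φ Z u) {s : ℝ}
    (hs : s ∈ Set.Icc (0 : ℝ) 1) : IsCuttable 𝒮 (evPair Φ s) :=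
  ⟨_, _, _, h.isCut hS hs⟩

theorem IsRegular.isSmallCut_step (h : IsRegular C Φ) (hS : ∀ τ ∈ 𝒮, ∀ Z u, τ (Φ Z u) = Φ Z u)
    {r s : ℝ} (hr : r ∈ Set.Icc (0 : ℝ) 1) (hs : s ∈ Set.Icc (0 : ℝ) 1) (hrs : r + s ≤ 1) :
    IsSmallCut 𝒮 X (C * decaySum * s) (2 * (X.card * C) * s)
      ((evPair Φ r)⁻¹ * evPair Φ (r + s)) := by
  have e : (evPair Φ r)⁻¹ * evPair Φ (r + s) = evPair (fun Z u => Φ Z (r + u)) s :=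
    Prod.ext (h.ev_shift hr hs hrs).symm (h.leftTerms.ev_shift hr hs hrs).symm
  rw [e]
  refine ⟨⟨_, _, (h.shift r).isCut (fun τ hτ Z u => hS τ hτ Z (r + u)) hs⟩, fun m hm => ?_⟩
  have hC := h.nonneg
  refine alg_induction (p := fun m => ‖(evPair (fun Z u => Φ Z (r + u)) s).2 m - m‖ ≤
    2 * (X.card * C) * s * ‖m‖) (isClosed_le ((continuous_aut _).sub continuous_id).norm
      (by fun_prop)) (fun Y hY a ha => ?_) hm
  refine ((h.shift r).leftTerms.norm_ev_sub_le hs ha).trans ?_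
  have : (Y.card : ℝ) ≤ X.card := by
    exact_mod_cast Finset.card_le_card (Finset.coe_subset.mp hY)
  calc 2 * (Y.card * C) * ‖a‖ * s ≤ 2 * (X.card * C) * ‖a‖ * s := by
        have := hs.1
        gcongr
    _ = _ := by ring

variable {φ : ChainAlgebra n →L[ℂ] ℂ} {G : Type*} [Group G] [TopologicalSpace G]
  {γ : OnSiteAction G n}
  {𝓗 : Type*} [NormedAddCommGroup 𝓗] [InnerProductSpace ℂ 𝓗] [CompleteSpace 𝓗]
  {π : ChainAlgebra n →⋆ₐ[ℂ] (𝓗 →L[ℂ] 𝓗)} {Ω : 𝓗} {U : G →* unitary (𝓗 →L[ℂ] 𝓗)}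
  {Ψ : ℝ → Finset ℤ → ℝ → ChainAlgebra n} {Φ' : ℝ → Finset ℤ → ℝ → ChainAlgebra n}
  {ψ : ℝ → ℝ → (ChainAlgebra n →L[ℂ] ℂ)}

/-- A homotopy of loops of states, the loop with the parameter `l` being generated by the invariant
local terms `Φ l`, and the family of states at the time `s` by `Ψ s`. Its first and its last loop
are based at `φ`. -/
structure IsRegularHomotopy (γ : OnSiteAction G n) (φ : ChainAlgebra n →L[ℂ] ℂ) (C : ℝ)
    (Φ Ψ : ℝ → Finset ℤ → ℝ → ChainAlgebra n) (ψ : ℝ → ℝ → (ChainAlgebra n →L[ℂ] ℂ)) :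
    Prop where
  regular : ∀ l ∈ Set.Icc (0 : ℝ) 1, IsRegular C (Φ l)
  regular' : ∀ s ∈ Set.Icc (0 : ℝ) 1, IsRegular C (Ψ s)
  invariant : ∀ l ∈ Set.Icc (0 : ℝ) 1, ∀ τ ∈ Set.range γ.aut, ∀ Z u, τ (Φ l Z u) = Φ l Z u
  invariant' : ∀ s ∈ Set.Icc (0 : ℝ) 1, ∀ τ ∈ Set.range γ.aut, ∀ Z u, τ (Ψ s Z u) = Ψ s Z u
  base_zero : ψ 0 0 = φ
  base_one : ψ 1 0 = φ
  loop : ∀ l ∈ Set.Icc (0 : ℝ) 1, ψ l 1 = ψ l 0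
  time : ∀ l ∈ Set.Icc (0 : ℝ) 1, ∀ s ∈ Set.Icc (0 : ℝ) 1, ∀ a,
    ψ l s a = ψ l 0 (ev (Φ l) s a)
  param : ∀ l ∈ Set.Icc (0 : ℝ) 1, ∀ s ∈ Set.Icc (0 : ℝ) 1, ∀ a,
    ψ l s a = ψ 0 s (ev (Ψ s) l a)

theorem IsCuttable.exists_hasCharge (h : IsCovariant γ φ π Ω U) (hφ : IsPureState φ)
    (hprod : IsProduct φ) (hinv : IsInvariantState γ φ) (hq : IsCuttable (Set.range γ.aut) q)
    (hqφ : ∀ a, φ (q.1 a) = φ a) : ∃ χ, HasCharge φ π U q.2 χ := by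
  obtain ⟨_, _, _, hq⟩ := hq
  exact exists_hasCharge_of_isCut h hφ hprod hinv hq hqφ

theorem state_inv_apply {θ : ChainAut n} (hθ : ∀ a, φ (θ a) = φ a) (a : ChainAlgebra n) :
    φ (θ⁻¹ a) = φ a := by
  rw [← hθ, aut_apply_inv]

/-- The transport around a strip of length zero is trivial. -/
theorem strip_zero {𝒢 : Type*} [Group 𝒢] {A B : ℕ → ℕ → 𝒢} {k : ℕ} (h : A k 0 = 1)
    (h' : A (k + 1) 0 = 1) :
    B 0 k * A k 0 * ((B 0 k)⁻¹ * B 0 (k + 1)) * (B 0 (k + 1) * A (k + 1) 0)⁻¹ = 1 := by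
  rw [h, h']; group

/-- A plaquette added to a strip multiplies the transport around it by a conjugate of the transport
around the plaquette. -/
theorem strip_succ {𝒢 : Type*} [Group 𝒢] (A B : ℕ → ℕ → 𝒢) (k j : ℕ) :
    B 0 k * A k (j + 1) * ((B (j + 1) k)⁻¹ * B (j + 1) (k + 1)) *
        (B 0 (k + 1) * A (k + 1) (j + 1))⁻¹ =
      B 0 k * A k j * (((A k j)⁻¹ * A k (j + 1)) * ((B (j + 1) k)⁻¹ * B (j + 1) (k + 1)) *
        ((A (k + 1) j)⁻¹ * A (k + 1) (j + 1))⁻¹ * ((B j k)⁻¹ * B j (k + 1))⁻¹) *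
        (B 0 k * A k j)⁻¹ *
      (B 0 k * A k j * ((B j k)⁻¹ * B j (k + 1)) * (B 0 (k + 1) * A (k + 1) j)⁻¹) := by
  group

/-- If the start and the end of the loops are transported in the same way, then neighbouring loops
agree, after transport to the base point of the first one, up to the transport around a full
strip. -/
theorem strip_last {𝒢 : Type*} [Group 𝒢] {A B : ℕ → ℕ → 𝒢} {N : ℕ} (h : B N = B 0) (k : ℕ) :
    B 0 k * A k N * (B 0 k)⁻¹ =
      B 0 k * A k N * ((B N k)⁻¹ * B N (k + 1)) * (B 0 (k + 1) * A (k + 1) N)⁻¹ *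
        (B 0 (k + 1) * A (k + 1) N * (B 0 (k + 1))⁻¹) := by
  rw [h]; group

/-- A grid of transports between the states of a homotopy: `A k j` transports along the loop with
the number `k` up to the time with the number `j`, and `B j k` in the direction of the homotopy
parameter. The steps are so small that a plaquette pumps no charge. -/
structure IsFineGrid (γ : OnSiteAction G n) (φ : ChainAlgebra n →L[ℂ] ℂ) (N d : ℕ) (δ ε η : ℝ)
    (ω : ℕ → ℕ → (ChainAlgebra n →L[ℂ] ℂ)) (A B : ℕ → ℕ → ChainAut n × ChainAut n) : Prop where
  zero_left : ∀ k ≤ N, A k 0 = 1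
  zero_right : B 0 0 = 1
  last : B N = B 0
  cut_left : ∀ k ≤ N, ∀ j ≤ N, IsCuttable (Set.range γ.aut) (A k j)
  cut_right : ∀ j ≤ N, ∀ k ≤ N, IsCuttable (Set.range γ.aut) (B j k)
  step_left : ∀ k ≤ N, ∀ j, j + 1 ≤ N →
    IsSmallCut (Set.range γ.aut) (box (4 * d)) δ η ((A k j)⁻¹ * A k (j + 1))
  step_right : ∀ j ≤ N, ∀ k, k + 1 ≤ N →
    IsSmallCut (Set.range γ.aut) (box (4 * d)) δ η ((B j k)⁻¹ * B j (k + 1))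
  state : ∀ k ≤ N, ∀ j ≤ N, ∀ a, φ ((B 0 k * A k j).1 a) = ω k j a
  param : ∀ k ≤ N, ∀ j ≤ N, ∀ a, ω k j a = ω 0 j ((B j k).1 a)
  quasilocal : ∀ k ≤ N, ∀ j ≤ N, IsQuasilocal (B 0 k * A k j).1 d ε
  left_nonneg : 0 ≤ ε
  right_nonneg : 0 ≤ η
  small : 6 * ε + 8 * δ + 4 * η ≤ 1 / 2

section Grid

variable {N d : ℕ} {ε : ℝ} {ω : ℕ → ℕ → (ChainAlgebra n →L[ℂ] ℂ)}
  {A B : ℕ → ℕ → ChainAut n × ChainAut n}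

/-- The transport around a strip preserves `φ`, as both ways along it lead to the same state of the
homotopy. -/
theorem IsFineGrid.state_strip (hg : IsFineGrid γ φ N d δ ε η ω A B) {k j : ℕ} (hk : k + 1 ≤ N)
    (hj : j ≤ N) (a : ChainAlgebra n) :
    φ ((B 0 k * A k j * ((B j k)⁻¹ * B j (k + 1)) * (B 0 (k + 1) * A (k + 1) j)⁻¹).1 a) = φ a := by
  set t := B 0 (k + 1) * A (k + 1) j with ht
  have hk' := Nat.le_of_succ_le hk
  conv_rhs => rw [← aut_apply_inv t.1 a]
  rw [ht, hg.state _ hk _ hj, ← ht, hg.param _ hk _ hj]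
  have e : (B 0 k * A k j * ((B j k)⁻¹ * B j (k + 1)) * t⁻¹).1 a =
      (B 0 k * A k j).1 ((B j k).1⁻¹ ((B j (k + 1)).1 (t.1⁻¹ a))) := rfl
  rw [e, hg.state _ hk' _ hj, hg.param _ hk' _ hj, aut_apply_inv]

/-- The transport around a plaquette pumps no charge, even after conjugation with the transport from
the base point. -/
theorem IsFineGrid.hasCharge_plaquette (hg : IsFineGrid γ φ N d δ ε η ω A B)
    (h : IsCovariant γ φ π Ω U) (hφ : IsPureState φ) (hprod : IsProduct φ)
    (hinv : IsInvariantState γ φ) {k j : ℕ} (hk : k + 1 ≤ N) (hj : j + 1 ≤ N)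
    {K : ChainAut n × ChainAut n}
    (hK : K = ((A k j)⁻¹ * A k (j + 1)) * ((B (j + 1) k)⁻¹ * B (j + 1) (k + 1)) *
        ((A (k + 1) j)⁻¹ * A (k + 1) (j + 1))⁻¹ * ((B j k)⁻¹ * B j (k + 1))⁻¹)
    (hE : ∀ a, φ ((B 0 k * A k j * K * (B 0 k * A k j)⁻¹).1 a) = φ a) :
    HasCharge φ π U (B 0 k * A k j * K * (B 0 k * A k j)⁻¹).2 1 := by
  have hk' := Nat.le_of_succ_le hk
  have hj' := Nat.le_of_succ_le hj
  obtain ⟨_, _, _, hTk⟩ := (hg.cut_right 0 (Nat.zero_le _) k hk').mul (hg.cut_left k hk' j hj')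
  have hKs := (((hg.step_left k hk' j hj).mul (hg.step_right (j + 1) hj k hk)).mul
    (hg.step_left (k + 1) hk j hj).inv).mul (hg.step_right j hj' k hk).inv
  rw [← hK] at hKs
  obtain ⟨⟨_, _, hKc⟩, hKn⟩ := hKs
  have h1 := hg.left_nonneg
  have h2 := hg.right_nonneg
  have h3 := hg.small
  exact hasCharge_one_of_near h hφ hprod hinv hTk hKc hE (hg.quasilocal k hk' j hj') h1
    (by positivity) hKn (by linarith)

/-- A strip of plaquettes pumps no charge. -/
theorem IsFineGrid.hasCharge_strip (hg : IsFineGrid γ φ N d δ ε η ω A B)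
    (h : IsCovariant γ φ π Ω U) (hφ : IsPureState φ) (hprod : IsProduct φ)
    (hinv : IsInvariantState γ φ) {k : ℕ} (hk : k + 1 ≤ N) (j : ℕ) (hj : j ≤ N) :
    HasCharge φ π U
      (B 0 k * A k j * ((B j k)⁻¹ * B j (k + 1)) * (B 0 (k + 1) * A (k + 1) j)⁻¹).2 1 := by
  have hk' := Nat.le_of_succ_le hk
  induction j with
  | zero =>
    rw [strip_zero (hg.zero_left k hk') (hg.zero_left _ hk)]
    exact .one h hφ.1
  | succ j ih =>
    have hj' := Nat.le_of_succ_le hj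
    have hs := hg.state_strip hk hj
    have hs' := hg.state_strip hk hj'
    have hc : IsCuttable (Set.range γ.aut)
        (B 0 k * A k j * ((B j k)⁻¹ * B j (k + 1)) * (B 0 (k + 1) * A (k + 1) j)⁻¹) :=
      (((hg.cut_right 0 (Nat.zero_le _) k hk').mul (hg.cut_left k hk' j hj')).mul
        ((hg.cut_right j hj' k hk').inv.mul (hg.cut_right j hj' _ hk))).mul
        ((hg.cut_right 0 (Nat.zero_le _) _ hk).mul (hg.cut_left _ hk j hj')).inv
    have ih' := ih hj'
    have e := strip_succ A B k j
    generalize B 0 k * A k j * ((B j k)⁻¹ * B j (k + 1)) * (B 0 (k + 1) * A (k + 1) j)⁻¹ = q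
      at hs' ih' e hc
    have hp := hg.hasCharge_plaquette h hφ hprod hinv hk hj rfl fun a => by
      refine Eq.trans ?_ ((hs (q.1⁻¹ a)).trans (state_inv_apply hs' a))
      rw [e, Prod.fst_mul _ q, StarAlgEquiv.mul_apply, aut_apply_inv]
    have := hp.mul h ih' fun g => hc.commute ⟨g, rfl⟩
    rw [one_mul, ← Prod.snd_mul, ← e] at this
    exact this

/-- The first and the last loop of a fine grid pump the same charge. -/
theorem IsFineGrid.exists_hasCharge (hg : IsFineGrid γ φ N d δ ε η ω A B)
    (h : IsCovariant γ φ π Ω U) (hφ : IsPureState φ) (hprod : IsProduct φ)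
    (hinv : IsInvariantState γ φ) (hA : ∀ a, φ ((A N N).1 a) = φ a)
    (hB : ∀ a, φ ((B 0 N).1 a) = φ a) :
    ∃ χ, HasCharge φ π U (A 0 N).2 χ ∧ HasCharge φ π U (A N N).2 χ := by
  have hSc : ∀ k ≤ N, IsCuttable (Set.range γ.aut) (B 0 k * A k N * (B 0 k)⁻¹) := fun k hk =>
    ((hg.cut_right 0 (Nat.zero_le _) k hk).mul (hg.cut_left k hk N le_rfl)).mul
      (hg.cut_right 0 (Nat.zero_le _) k hk).inv
  -- neighbouring loops differ by a strip
  have hS1 : ∀ χ, ∀ k ≤ N, HasCharge φ π U (B 0 k * A k N * (B 0 k)⁻¹).2 χ →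
      HasCharge φ π U (B 0 0 * A 0 N * (B 0 0)⁻¹).2 χ := by
    intro χ k
    induction k with
    | zero => exact fun _ => id
    | succ k ih =>
      intro hk hc
      refine ih (Nat.le_of_succ_le hk) ?_
      have := (hg.hasCharge_strip h hφ hprod hinv hk N le_rfl).mul h hc
        fun g => (hSc _ hk).commute ⟨g, rfl⟩
      rw [one_mul, ← Prod.snd_mul, ← strip_last hg.last] at this
      exact this
  have hBc := hg.cut_right 0 (Nat.zero_le _) N le_rfl
  have hAc := hg.cut_left N le_rfl N le_rfl
  obtain ⟨χ, hχ⟩ := hAc.exists_hasCharge h hφ hprod hinv hA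
  obtain ⟨χ₁, hχ₁⟩ := hBc.exists_hasCharge h hφ hprod hinv hB
  obtain ⟨χ₂, hχ₂⟩ := hBc.inv.exists_hasCharge h hφ hprod hinv (state_inv_apply hB)
  have hcomm := fun g => hBc.inv.commute (τ := γ.aut g) ⟨g, rfl⟩
  -- conjugation by the transport of the base points does not change the charge
  have h12 : χ₁ * χ₂ = 1 := by
    have := hχ₁.mul h hχ₂ hcomm
    rw [Prod.snd_inv, mul_inv_cancel] at this
    exact this.unique h.toIsGNSTriple hφ hprod (.one h hφ.1)
  have hSN := (hχ₁.mul h hχ fun g => hAc.commute ⟨g, rfl⟩).mul h hχ₂ hcomm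
  rw [mul_right_comm, h12, one_mul] at hSN
  have := hS1 χ N le_rfl hSN
  rw [hg.zero_right, one_mul, inv_one, mul_one] at this
  exact ⟨χ, this, hχ⟩

end Grid

/-- A sufficiently fine subdivision of the parameter square is a fine grid, if the base points and
the end points of the loops are transported in the same way. -/
theorem IsRegularHomotopy.exists_isFineGrid (hh : IsRegularHomotopy γ φ C Φ' Ψ ψ)
    (hΨ : Ψ 1 = Ψ 0) : ∃ (N d : ℕ) (δ ε η : ℝ), (0 : ℝ) < N ∧ IsFineGrid γ φ N d δ ε η
      (fun k j => ψ (k / N) (j / N)) (fun k j => evPair (Φ' (k / N)) (j / N))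
      (fun j k => evPair (Ψ (j / N)) (k / N)) := by
  have h0 : (0 : ℝ) ∈ Set.Icc (0 : ℝ) 1 := ⟨le_rfl, zero_le_one⟩
  have hC := (hh.regular 0 h0).nonneg
  have hcut := (hh.regular 0 h0).cutConst_nonneg
  -- `d` makes the quasi-locality error small; the number `N` of steps comes after `d`, because the
  -- effect `η` of a unit of time on the observables in a box depends on the size of the box
  obtain ⟨d, hd⟩ : ∃ d, cutConst C * (4 * decayTail d) < 1 / 24 := by
    have ht : Tendsto (fun d => cutConst C * (4 * decayTail d)) atTop (𝓝 (cutConst C * (4 * 0))) :=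
      (tendsto_decayTail.const_mul 4).const_mul _
    rw [mul_zero, mul_zero] at ht
    exact (ht.eventually_lt_const (by norm_num)).exists
  set δ : ℝ := C * decaySum with hδ
  set η : ℝ := 2 * ((box (4 * d)).card * C) with hη
  obtain ⟨N, hN⟩ := exists_nat_gt (max 1 (4 * (8 * δ + 4 * η)))
  have hN0 : (0 : ℝ) < N := (lt_of_lt_of_le one_pos (le_max_left _ _)).trans hN
  have hsmall : (8 * δ + 4 * η) * (1 / N) ≤ 1 / 4 := by
    rw [mul_one_div, div_le_iff₀ hN0]
    linarith [(le_max_right 1 (4 * (8 * δ + 4 * η))).trans hN.le]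
  have hI : ∀ k : ℕ, k ≤ N → (k : ℝ) / N ∈ Set.Icc (0 : ℝ) 1 := fun k hk =>
    ⟨by positivity, (div_le_one hN0).mpr (by exact_mod_cast hk)⟩
  have hstep : (1 : ℝ) / N ∈ Set.Icc (0 : ℝ) 1 := by
    simpa using hI 1 (by exact_mod_cast ((le_max_left 1 (4 * (8 * δ + 4 * η))).trans hN.le))
  have hsucc : ∀ k : ℕ, ((k + 1 : ℕ) : ℝ) / N = (k : ℝ) / N + 1 / N := fun k => by
    push_cast; ring
  have hN1 : (N : ℝ) / N = 1 := div_self hN0.ne'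
  have hz : ((0 : ℕ) : ℝ) / N = 0 := by simp
  have hle1 : ∀ k : ℕ, k + 1 ≤ N → (k : ℝ) / N + 1 / N ≤ 1 := fun k hk => by
    rw [← hsucc]; exact (hI _ hk).2
  have hev : ∀ {Φ : Finset ℤ → ℝ → ChainAlgebra n}, IsRegular C Φ →
      evPair Φ (((0 : ℕ) : ℝ) / N) = 1 := fun {Φ} hΦ => by
    rw [hz, evPair, hΦ.ev_zero, hΦ.leftTerms.ev_zero]
    rfl
  have hηn : 0 ≤ η := by positivity
  have hdt := decayTail_nonneg d
  refine ⟨N, d, δ * (1 / N), cutConst C * (4 * decayTail d), η * (1 / N), hN0, ?_⟩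
  exact
    { zero_left := fun k hk => hev (hh.regular _ (hI k hk))
      zero_right := hev (hh.regular' _ (hI 0 (Nat.zero_le _)))
      last := by
        funext k
        rw [hN1, hz, hΨ]
      cut_left := fun k hk j hj =>
        (hh.regular _ (hI k hk)).isCuttable (hh.invariant _ (hI k hk)) (hI j hj)
      cut_right := fun j hj k hk =>
        (hh.regular' _ (hI j hj)).isCuttable (hh.invariant' _ (hI j hj)) (hI k hk)
      step_left := fun k hk j hj => by
        rw [hsucc]
        exact (hh.regular _ (hI k hk)).isSmallCut_step (hh.invariant _ (hI k hk))
          (hI j (Nat.le_of_succ_le hj)) hstep (hle1 j hj)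
      step_right := fun j hj k hk => by
        rw [hsucc]
        exact (hh.regular' _ (hI j hj)).isSmallCut_step (hh.invariant' _ (hI j hj))
          (hI k (Nat.le_of_succ_le hk)) hstep (hle1 k hk)
      state := fun k hk j hj a => by
        rw [hh.time _ (hI k hk) _ (hI j hj), hh.param _ (hI k hk) _ h0, hh.base_zero]
        conv_rhs => rw [← hz]
        rfl
      param := fun k hk j hj a => by
        rw [hh.param _ (hI k hk) _ (hI j hj)]
        conv_lhs => rw [← hz]
        rfl
      quasilocal := fun k hk j hj =>
        isQuasilocal_mul (hh.regular' _ (hI 0 (Nat.zero_le _))) (hh.regular _ (hI k hk))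
          (hI j hj) (hI k hk) d
      left_nonneg := by positivity
      right_nonneg := by positivity
      small := by linarith }

/-- The pumped charge does not change under homotopies for which the base points and the end points
of the loops are transported in the same way: transport around a strip of plaquettes pumps no
charge, hence neighbouring loops pump the same charge. -/
theorem IsRegularHomotopy.exists_hasCharge_aux (hh : IsRegularHomotopy γ φ C Φ' Ψ ψ)
    (hΨ : Ψ 1 = Ψ 0) (h : IsCovariant γ φ π Ω U) (hφ : IsPureState φ) (hprod : IsProduct φ)
    (hinv : IsInvariantState γ φ) : ∃ χ, HasCharge φ π U (ev (leftTerms (Φ' 0)) 1) χ ∧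
      HasCharge φ π U (ev (leftTerms (Φ' 1)) 1) χ := by
  have h0 : (0 : ℝ) ∈ Set.Icc (0 : ℝ) 1 := ⟨le_rfl, zero_le_one⟩
  have h1 : (1 : ℝ) ∈ Set.Icc (0 : ℝ) 1 := ⟨zero_le_one, le_rfl⟩
  obtain ⟨N, d, δ, ε, η, hN0, hg⟩ := hh.exists_isFineGrid hΨ
  have hN1 : (N : ℝ) / N = 1 := div_self hN0.ne'
  have hz : ((0 : ℕ) : ℝ) / N = 0 := by simp
  have key := hg.exists_hasCharge h hφ hprod hinv
  simp only [hN1, hz] at key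
  refine key (fun a => ?_) fun a => ?_
  · have := hh.time 1 h1 1 h1 a
    rw [hh.loop 1 h1, hh.base_one] at this
    exact this.symm
  · have := hh.param 1 h1 0 h0 a
    rw [hh.base_zero, hh.base_one] at this
    exact this.symm

/-- The pumped charge is invariant under homotopies. -/
theorem IsRegularHomotopy.exists_hasCharge (hh : IsRegularHomotopy γ φ C Φ' Ψ ψ)
    (h : IsCovariant γ φ π Ω U) (hφ : IsPureState φ) (hprod : IsProduct φ)
    (hinv : IsInvariantState γ φ) : ∃ χ, HasCharge φ π U (ev (leftTerms (Φ' 0)) 1) χ ∧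
      HasCharge φ π U (ev (leftTerms (Φ' 1)) 1) χ := by
  have h0 : (0 : ℝ) ∈ Set.Icc (0 : ℝ) 1 := ⟨le_rfl, zero_le_one⟩
  have h1 : (1 : ℝ) ∈ Set.Icc (0 : ℝ) 1 := ⟨zero_le_one, le_rfl⟩
  -- the base points may be transported by `Ψ 0` at the time `1` as well
  have key : ∀ s ∈ Set.Icc (0 : ℝ) 1, (s ≠ 1 ∧ Function.update Ψ 1 (Ψ 0) s = Ψ s) ∨
      (s = 1 ∧ Function.update Ψ 1 (Ψ 0) s = Ψ 0) := fun s _ => by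
    by_cases hs : s = 1
    · exact .inr ⟨hs, by rw [hs, Function.update_self]⟩
    · exact .inl ⟨hs, Function.update_of_ne hs _ _⟩
  refine IsRegularHomotopy.exists_hasCharge_aux (C := C) (Ψ := Function.update Ψ 1 (Ψ 0)) (ψ := ψ)
    { hh with
      regular' := fun s hs => ?_
      invariant' := fun s hs => ?_
      param := fun l hl s hs a => ?_ } ?_ h hφ hprod hinv
  · obtain ⟨_, e⟩ | ⟨_, e⟩ := key s hs <;> rw [e]
    exacts [hh.regular' s hs, hh.regular' 0 h0]
  · obtain ⟨_, e⟩ | ⟨_, e⟩ := key s hs <;> rw [e]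
    exacts [hh.invariant' s hs, hh.invariant' 0 h0]
  · obtain ⟨_, e⟩ | ⟨rfl, e⟩ := key s hs <;> rw [e]
    · exact hh.param l hl s hs a
    · rw [hh.loop l hl, hh.loop 0 h0, hh.param l hl 0 h0]
  · rw [Function.update_self, Function.update_of_ne zero_ne_one]

end Homotopy

/-! ### Regularity of time-dependent interactions -/

section Regularity

variable {n : ℤ → ℕ} {f : ℕ+ → ℝ}

theorem IsDecayFunction.exists_le_decay (hf : IsDecayFunction f) :
    ∃ M : ℝ, 0 ≤ M ∧ ∀ d : ℕ, f d.succPNat ≤ M * decay d := by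
  have hs : Tendsto Nat.succPNat atTop atTop := OrderIso.pnatIsoNat.symm.tendsto_atTop
  have h1 : Tendsto (fun k : ℕ => ((k.succPNat : ℕ) : ℝ) ^ (2 : ℝ) * f k.succPNat) atTop (𝓝 0) :=
    (hf.fast 2 two_pos).comp hs
  obtain ⟨M, hM⟩ := h1.bddAbove_range
  have hM' : ∀ d : ℕ, ((d : ℝ) + 1) ^ 2 * f d.succPNat ≤ M := fun d => by
    have := hM ⟨d, rfl⟩
    simpa using this
  refine ⟨M, le_trans (by have := hf.pos (Nat.succPNat 0); positivity) (hM' 0), fun d => ?_⟩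
  have e : decay d = (((d : ℝ) + 1) ^ 2)⁻¹ := by
    simp [decay, add_comm]
  rw [e, ← div_eq_mul_inv, le_div_iff₀ (by positivity), mul_comm]
  exact hM' d

theorem enorm_term_le (hf : IsDecayFunction f) (K : Finset ℤ → ChainAlgebra n) {x : ℤ}
    {Z : Finset ℤ} (hx : x ∈ Z) : ‖K Z‖ₑ ≤ ENNReal.ofReal (f (diam Z).succPNat) * fNorm f K := by
  have hp := ENNReal.ofReal_pos.mpr (hf.pos (diam Z).succPNat)
  rw [mul_comm, ← ENNReal.div_le_iff hp.ne' ENNReal.ofReal_ne_top]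
  exact (ENNReal.le_tsum (f := fun S : {S : Finset ℤ // x ∈ S} =>
    ‖K S‖ₑ / ENNReal.ofReal (f (diam S).succPNat)) ⟨Z, hx⟩).trans
      (le_iSup (fun j : ℤ => ∑' S : {S : Finset ℤ // j ∈ S},
        ‖K S‖ₑ / ENNReal.ofReal (f (diam S).succPNat)) x)

theorem sum_norm_le_of_fNorm_le (hf : IsDecayFunction f) {K : Finset ℤ → ChainAlgebra n} {C₀ : ℝ≥0}
    (hK : fNorm f K ≤ C₀) {x : ℤ} {d : ℕ} {𝒵 : Finset (Finset ℤ)}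
    (h𝒵 : ∀ Z ∈ 𝒵, x ∈ Z ∧ d ≤ diam Z) : ∑ Z ∈ 𝒵, ‖K Z‖ ≤ C₀ * f d.succPNat := by
  have h1 : ∑ Z ∈ 𝒵, ‖K Z‖ₑ / ENNReal.ofReal (f (diam Z).succPNat) ≤ C₀ := by
    refine le_trans ?_ ((le_iSup (fun j : ℤ => ∑' S : {S : Finset ℤ // j ∈ S},
        ‖K S‖ₑ / ENNReal.ofReal (f (diam S).succPNat)) x).trans hK)
    rw [← Finset.sum_subtype_of_mem (p := fun Z => x ∈ Z)
      (fun Z => ‖K Z‖ₑ / ENNReal.ofReal (f (diam Z).succPNat)) fun Z hZ => (h𝒵 Z hZ).1]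
    exact ENNReal.sum_le_tsum _
  have h2 : ∑ Z ∈ 𝒵, ‖K Z‖ₑ ≤ C₀ * ENNReal.ofReal (f d.succPNat) := by
    refine le_trans ?_ (mul_le_mul_left h1 _)
    rw [Finset.sum_mul]
    refine Finset.sum_le_sum fun Z hZ => ?_
    have hp := ENNReal.ofReal_pos.mpr (hf.pos (diam Z).succPNat)
    have hle : ENNReal.ofReal (f (diam Z).succPNat) ≤ ENNReal.ofReal (f d.succPNat) :=
      ENNReal.ofReal_le_ofReal (hf.antitone (Nat.succPNat_le_succPNat.mpr (h𝒵 Z hZ).2))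
    calc ‖K Z‖ₑ = ‖K Z‖ₑ / ENNReal.ofReal (f (diam Z).succPNat) *
          ENNReal.ofReal (f (diam Z).succPNat) :=
          (ENNReal.div_mul_cancel hp.ne' ENNReal.ofReal_ne_top).symm
      _ ≤ _ := by gcongr
  have h3 : ENNReal.ofReal (∑ Z ∈ 𝒵, ‖K Z‖) ≤ ENNReal.ofReal (C₀ * f d.succPNat) := by
    rw [ENNReal.ofReal_sum_of_nonneg fun _ _ => norm_nonneg _,
      ENNReal.ofReal_mul C₀.coe_nonneg, ENNReal.ofReal_coe_nnreal]
    simpa only [ofReal_norm] using h2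
  exact (ENNReal.ofReal_le_ofReal_iff (mul_nonneg C₀.coe_nonneg (hf.pos _).le)).mp h3

/-- The terms of a time-dependent interaction on nonempty sets, extended by zero to all times. The
term on the empty set is a multiple of the identity and does not contribute to the evolution. -/
def regTerms (H : ℝ → LocalTerms n) (Z : Finset ℤ) (u : ℝ) : ChainAlgebra n :=
  open Classical in if Z.Nonempty ∧ u ∈ Set.Icc (0 : ℝ) 1 then (H u).term Z else 0

theorem regTerms_of_mem (H : ℝ → LocalTerms n) {Z : Finset ℤ} (hZ : Z.Nonempty) {u : ℝ}
    (hu : u ∈ Set.Icc (0 : ℝ) 1) : regTerms H Z u = (H u).term Z := if_pos ⟨hZ, hu⟩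

theorem regTerms_of_notMem (H : ℝ → LocalTerms n) {Z : Finset ℤ} {u : ℝ}
    (hu : u ∉ Set.Icc (0 : ℝ) 1) : regTerms H Z u = 0 := if_neg fun h => hu h.2

theorem regTerms_empty (H : ℝ → LocalTerms n) (u : ℝ) : regTerms H ∅ u = 0 :=
  if_neg fun h => Finset.not_nonempty_empty h.1

theorem StronglyMeasurableFor.aestronglyMeasurable (hf : IsDecayFunction f)
    {H : ℝ → LocalTerms n} (hH : StronglyMeasurableFor f H) (Z : Finset ℤ) :
    AEStronglyMeasurable (regTerms H Z) := by
  rcases Z.eq_empty_or_nonempty with rfl | ⟨x, hx⟩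
  · rw [show regTerms H ∅ = fun _ => 0 from funext (regTerms_empty H)]
    exact aestronglyMeasurable_const
  obtain ⟨K, -, hK⟩ := hH
  have h1 : AEStronglyMeasurable (fun u => (H u).term Z)
      (volume.restrict (Set.Icc (0 : ℝ) 1)) := by
    refine aestronglyMeasurable_of_tendsto_ae atTop (f := fun k u => (K k u).term Z)
      (fun k => ((K k).map fun H : LocalTerms n => H.term Z).aestronglyMeasurable) ?_
    filter_upwards [hK] with u hu
    rw [tendsto_iff_edist_tendsto_0]
    refine tendsto_of_tendsto_of_tendsto_of_le_of_le tendsto_const_nhds (h :=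
      fun k => ENNReal.ofReal (f (diam Z).succPNat) * fNorm f ((K k u).term - (H u).term)) ?_
      (fun _ => zero_le) fun k => ?_
    · simpa using ENNReal.Tendsto.const_mul hu (.inr ENNReal.ofReal_ne_top)
    · change edist ((K k u).term Z) ((H u).term Z) ≤ _
      rw [edist_eq_enorm_sub]
      exact enorm_term_le hf ((K k u).term - (H u).term) hx
  have e : regTerms H Z = (Set.Icc (0 : ℝ) 1).indicator fun u => (H u).term Z := by
    funext u
    by_cases hu : u ∈ Set.Icc (0 : ℝ) 1
    · rw [regTerms_of_mem H ⟨x, hx⟩ hu, Set.indicator_of_mem hu]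
    · rw [regTerms_of_notMem H hu, Set.indicator_of_notMem hu]
  rw [e]
  exact (aestronglyMeasurable_indicator_iff measurableSet_Icc).mpr h1

/-- A bound on time-dependent interactions makes them regular, with a constant which depends on the
bound only. -/
theorem exists_isRegular (hf : IsDecayFunction f) (C₀ : ℝ≥0) :
    ∃ C, ∀ H : ℝ → LocalTerms n, UnifBound f H C₀ → IsTDI H → IsRegular C (regTerms H) := by
  obtain ⟨M, hM, hfM⟩ := hf.exists_le_decay
  refine ⟨C₀ * M, fun H hH hH' => ?_⟩
  obtain ⟨f', hf', -, hmeas⟩ := hH'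
  refine ⟨fun Z u => ?_, fun Z u => ?_,
    hmeas.aestronglyMeasurable hf', regTerms_empty H, fun u x d 𝒵 h𝒵 => ?_⟩
  · unfold regTerms
    split_ifs
    exacts [(H u).selfAdjoint Z, star_zero _]
  · unfold regTerms
    split_ifs
    exacts [isSupportedOn_iff.mp ((H u).supported Z), zero_mem _]
  · by_cases hu : u ∈ Set.Icc (0 : ℝ) 1
    · calc ∑ Z ∈ 𝒵, ‖regTerms H Z u‖ = ∑ Z ∈ 𝒵, ‖(H u).term Z‖ :=
          Finset.sum_congr rfl fun Z hZ => by rw [regTerms_of_mem H ⟨x, (h𝒵 Z hZ).1⟩ hu]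
        _ ≤ C₀ * f d.succPNat := sum_norm_le_of_fNorm_le hf (hH u hu) h𝒵
        _ ≤ C₀ * (M * decay d) := by
          have := hfM d
          gcongr
        _ = _ := by ring
    · rw [Finset.sum_eq_zero fun Z _ => by rw [regTerms_of_notMem H hu, norm_zero]]
      have := decay_nonneg d
      positivity

theorem IsTDI.exists_isRegular {H : ℝ → LocalTerms n} (hH : IsTDI H) :
    ∃ C, IsRegular C (regTerms H) := by
  obtain ⟨f, hf, ⟨C₀, hC₀⟩, hm⟩ := hH
  obtain ⟨C, hC⟩ := SpinChain.exists_isRegular (n := n) hf C₀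
  exact ⟨C, hC H hC₀ ⟨f, hf, ⟨C₀, hC₀⟩, hm⟩⟩

theorem regTerms_truncate (H : ℝ → LocalTerms n) :
    regTerms (fun s => truncate (H s)) = leftTerms (regTerms H) := by
  funext Z u
  have e : (∀ j ∈ Z, j ≤ 0) ↔ (Z : Set ℤ) ⊆ Set.Iic 0 := Iff.rfl
  unfold leftTerms
  by_cases hZ : (Z : Set ℤ) ⊆ Set.Iic 0
  · rw [restrictTerms_of hZ]
    unfold regTerms truncate
    dsimp only
    rw [if_pos (e.mpr hZ)]
  · rw [restrictTerms_of_not hZ]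
    unfold regTerms truncate
    dsimp only
    rw [if_neg fun h => hZ (e.mp h), ite_self]

theorem fNorm_mono {K L : Finset ℤ → ChainAlgebra n} (h : ∀ Z, ‖K Z‖ ≤ ‖L Z‖) :
    fNorm f K ≤ fNorm f L :=
  iSup_mono fun _ => ENNReal.tsum_le_tsum fun S =>
    ENNReal.div_le_div_right (enorm_le_iff_norm_le.mpr (h S)) _

/-- A contraction of the terms which is compatible with differences maps time-dependent interactions
to time-dependent interactions. -/
theorem IsTDI.map {H : ℝ → LocalTerms n} (hH : IsTDI H) (T : LocalTerms n → LocalTerms n)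
    (hT : ∀ K Z, ‖(T K).term Z‖ ≤ ‖K.term Z‖)
    (hT' : ∀ K L Z, ‖(T K).term Z - (T L).term Z‖ ≤ ‖K.term Z - L.term Z‖) :
    IsTDI fun s => T (H s) := by
  obtain ⟨f, hf, ⟨C₀, hC₀⟩, K, hK, hlim⟩ := hH
  refine ⟨f, hf, ⟨C₀, fun s hs => (fNorm_mono (hT _)).trans (hC₀ s hs)⟩,
    fun k => (K k).map T, fun k s => (fNorm_mono (hT _)).trans_lt (hK k s), ?_⟩
  filter_upwards [hlim] with s hs
  exact tendsto_of_tendsto_of_tendsto_of_le_of_le tendsto_const_nhds hs (fun _ => zero_le)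
    fun k => fNorm_mono fun Z => hT' _ _ Z

theorem IsTDI.truncate {H : ℝ → LocalTerms n} (hH : IsTDI H) :
    IsTDI fun s => truncate (H s) := by
  refine hH.map SpinChain.truncate (fun K Z => ?_) fun K L Z => ?_ <;>
  · unfold SpinChain.truncate
    dsimp only
    split_ifs <;> simp

end Regularity

/-! ### The Heisenberg equation -/

section ProductRule

variable {E : Type*} [NormedAddCommGroup E]

theorem IsLocBdd.add {x y : ℝ → E} (hx : IsLocBdd x) (hy : IsLocBdd y) :
    IsLocBdd fun s => x s + y s := fun R => by
  obtain ⟨M, hM⟩ := hx R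
  obtain ⟨N, hN⟩ := hy R
  refine ⟨M + N, ?_⟩
  filter_upwards [hM, hN] with u h1 h2 hu
  exact (norm_add_le _ _).trans (add_le_add (h1 hu) (h2 hu))

theorem IsLocBdd.mul {x y : ℝ → ℂ} (hx : IsLocBdd x) (hy : IsLocBdd y) :
    IsLocBdd fun s => x s * y s := fun R => by
  obtain ⟨M, hM⟩ := hx R
  obtain ⟨N, hN⟩ := hy R
  refine ⟨M * N, ?_⟩
  filter_upwards [hM, hN] with u h1 h2 hu
  rw [norm_mul]
  exact mul_le_mul (h1 hu) (h2 hu) (norm_nonneg _) ((norm_nonneg _).trans (h1 hu))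

theorem IsLocBdd.of_continuous {x : ℝ → E} (hx : Continuous x) : IsLocBdd x := fun R => by
  obtain ⟨M, hM⟩ := (isCompact_Icc (a := -R) (b := R)).exists_bound_of_continuousOn hx.continuousOn
  exact ⟨M, .of_forall fun u hu => hM u (abs_le.mp hu)⟩

theorem IsLocBdd.clm {F : Type*} [NormedSpace ℝ E] [NormedAddCommGroup F] [NormedSpace ℝ F]
    {x : ℝ → E} (T : E →L[ℝ] F) (hx : IsLocBdd x) : IsLocBdd fun s => T (x s) := fun R => by
  obtain ⟨M, hM⟩ := hx R
  refine ⟨‖T‖ * M, ?_⟩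
  filter_upwards [hM] with u h1 hu
  exact (T.le_opNorm _).trans (mul_le_mul_of_nonneg_left (h1 hu) (norm_nonneg _))

theorem IsACPath.sum {ι : Type*} [NormedSpace ℝ E] (t : Finset ι) {X x : ι → ℝ → E}
    (h : ∀ i, IsACPath (X i) (x i)) :
    IsACPath (fun s => ∑ i ∈ t, X i s) fun s => ∑ i ∈ t, x i s := by
  classical
  induction t using Finset.induction_on with
  | empty => simpa using IsACPath.const (0 : E)
  | insert i t hi ih => simpa only [Finset.sum_insert hi] using (h i).add ih

theorem IsLocBdd.sum {ι : Type*} (t : Finset ι) {x : ι → ℝ → E} (h : ∀ i, IsLocBdd (x i)) :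
    IsLocBdd fun s => ∑ i ∈ t, x i s := by
  classical
  induction t using Finset.induction_on with
  | empty => exact .of_le (M := 0) fun u => by simp
  | insert i t hi ih => simpa only [Finset.sum_insert hi] using (h i).add ih

/-- The product rule for functionals on a finite-dimensional space, evaluated along a path: if the
derivative of `s ↦ ω s (Y s)` is bounded by `ε`, then this function changes by at most `ε t` up to
the time `t`. -/
theorem norm_apply_path_sub_le {V : Type*} [NormedAddCommGroup V] [NormedSpace ℂ V]
    [FiniteDimensional ℂ V] {ω d : ℝ → V →ₗ[ℂ] ℂ}
    (hm : ∀ b, AEStronglyMeasurable ((Set.Icc (0 : ℝ) 1).indicator fun u => d u b))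
    (hb : ∀ b, ∃ M, ∀ u ∈ Set.Icc (0 : ℝ) 1, ‖d u b‖ ≤ M)
    (hω : ∀ b, ∀ s ∈ Set.Icc (0 : ℝ) 1, ω s b = ω 0 b + ∫ u in (0 : ℝ)..s, d u b)
    {Y y : ℝ → V} (hY : IsACPath Y y) (hy : IsLocBdd y) {ε : ℝ}
    (hε : ∀ u ∈ Set.Icc (0 : ℝ) 1, ‖ω u (y u) + d u (Y u)‖ ≤ ε) {t : ℝ}
    (ht : t ∈ Set.Icc (0 : ℝ) 1) : ‖ω t (Y t) - ω 0 (Y 0)‖ ≤ ε * t := by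
  set b := Module.finBasis ℂ V
  have hsum : ∀ (l : V →ₗ[ℂ] ℂ) v, l v = ∑ i, b.repr v i * l (b i) := fun l v => by
    conv_lhs => rw [← b.sum_repr v, map_sum]
    simp
  -- the product rule is applied to the coordinates of `Y` and to the values `P i` of `ω` on a basis
  set c : Fin (Module.finrank ℂ V) → V →L[ℝ] ℂ := fun i =>
    (LinearMap.toContinuousLinearMap (b.coord i)).restrictScalars ℝ with hc
  have hcb : ∀ i v, c i v = b.repr v i := fun i v => rfl
  set D := fun i => (Set.Icc (0 : ℝ) 1).indicator fun u => d u (b i) with hD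
  have hDb : ∀ i, IsLocBdd (D i) := fun i => by
    obtain ⟨M, hM⟩ := hb (b i)
    refine .of_le (M := M) fun u => ?_
    by_cases hu : u ∈ Set.Icc (0 : ℝ) 1
    · rw [hD]; simp only [Set.indicator_of_mem hu]; exact hM u hu
    · rw [hD]
      simp only [Set.indicator_of_notMem hu, norm_zero]
      exact (norm_nonneg _).trans (hM 0 ⟨le_rfl, zero_le_one⟩)
  set P := fun i s => ω 0 (b i) + ∫ u in (0 : ℝ)..s, D i u with hP
  have hPac : ∀ i, IsACPath (P i) (D i) := fun i =>
    ((IsACPath.const (ω 0 (b i))).add (IsACPath.primitive (hm (b i)) (hDb i) 0)).congr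
      fun s => zero_add _
  have hPω : ∀ i, ∀ s ∈ Set.Icc (0 : ℝ) 1, P i s = ω s (b i) := fun i s hs => by
    rw [hω (b i) s hs, hP]
    refine congrArg (ω 0 (b i) + ·) ?_
    refine intervalIntegral.integral_congr fun u hu => ?_
    rw [Set.uIcc_of_le hs.1] at hu
    have hu' : u ∈ Set.Icc (0 : ℝ) 1 := ⟨hu.1, hu.2.trans hs.2⟩
    simp only [hD, Set.indicator_of_mem hu']
  have hF : IsACPath (fun s => ∑ i, c i (Y s) * P i s) fun s =>
      ∑ i, (c i (y s) * P i s + c i (Y s) * D i s) :=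
    IsACPath.sum (E := ℂ) _ fun i => (hY.clm (F := ℂ) (c i)).mul (hPac i)
  have hFb : IsLocBdd fun s => ∑ i, (c i (y s) * P i s + c i (Y s) * D i s) :=
    IsLocBdd.sum _ fun i => ((hy.clm (c i)).mul (.of_continuous (hPac i).continuous)).add
      ((IsLocBdd.of_continuous ((c i).continuous.comp hY.continuous)).mul (hDb i))
  have hFω : ∀ s ∈ Set.Icc (0 : ℝ) 1, ∑ i, c i (Y s) * P i s = ω s (Y s) := fun s hs => by
    rw [hsum (ω s)]
    exact Finset.sum_congr rfl fun i _ => by rw [hPω i s hs, hcb]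
  have key := hF.norm_sub_le hFb ht.1 (g := fun _ => ε) intervalIntegrable_const fun u hu => by
    have hu' : u ∈ Set.Icc (0 : ℝ) 1 := ⟨hu.1, hu.2.trans ht.2⟩
    refine (le_of_eq ?_).trans (hε u hu')
    rw [hsum (ω u), hsum (d u), ← Finset.sum_add_distrib]
    congr 1
    refine Finset.sum_congr rfl fun i _ => ?_
    rw [hPω i u hu', hcb, hcb, hD]
    simp only [Set.indicator_of_mem hu']
  rw [intervalIntegral.integral_const, sub_zero, smul_eq_mul, mul_comm] at key
  rwa [hFω t ht, hFω 0 ⟨le_rfl, zero_le_one⟩] at key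

end ProductRule

section Conjugation

variable {A : Type*} [CStarAlgebra A] {K : ℝ → A} {M : ℝ}

theorem isACPath_conj (hK : IsDriver K M) (b : A) :
    IsACPath (fun s => prop K s * b * star (prop K s)) fun s =>
      prop K s * (Complex.I • (K s * b - b * K s)) * star (prop K s) := by
  have h := ((isACPath_prop hK).mul (.const b)).mul (isACPath_prop hK).star
  refine h.congr fun s => ?_
  rw [star_smul, star_mul, hK.sa, Complex.star_def, Complex.conj_I]
  simp only [sub_eq_add_neg, mul_add, add_mul, smul_add, smul_neg, smul_mul_assoc, mul_smul_comm,
    mul_zero, add_zero, neg_smul, mul_neg, neg_mul, mul_assoc]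

theorem isACPath_star_conj (hK : IsDriver K M) (b : A) :
    IsACPath (fun s => star (prop K s) * b * prop K s) fun s =>
      -(Complex.I • (K s * (star (prop K s) * b * prop K s) -
        star (prop K s) * b * prop K s * K s)) := by
  have h := ((isACPath_prop hK).star.mul (.const b)).mul (isACPath_prop hK)
  refine h.congr fun s => ?_
  rw [star_smul, star_mul, hK.sa, Complex.star_def, Complex.conj_I]
  simp only [smul_sub, smul_mul_assoc, mul_smul_comm, mul_zero, add_zero,
    neg_smul, neg_mul, mul_assoc, neg_sub]
  abel

theorem norm_I_smul_commutator_le (hK : IsDriver K M) (u : ℝ) (b : A) :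
    ‖Complex.I • (K u * b - b * K u)‖ ≤ 2 * M * ‖b‖ := by
  rw [norm_smul, Complex.norm_I, one_mul]
  refine (norm_commutator_le _ _).trans ?_
  have := hK.bound u
  gcongr

end Conjugation

/-! ### Uniqueness of the evolution -/

section Uniqueness

attribute [local irreducible] instCStarAlgebraChainAlgebra

variable {n : ℤ → ℕ}

theorem IsACPath.codRestrict {V : Submodule ℂ (ChainAlgebra n)} [FiniteDimensional ℂ V]
    {Y y : ℝ → ChainAlgebra n} (h : IsACPath Y y) (hY : ∀ s, Y s ∈ V) (hy : ∀ s, y s ∈ V) :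
    IsACPath (fun s => (⟨Y s, hY s⟩ : V)) fun s => ⟨y s, hy s⟩ := by
  obtain ⟨p, hp⟩ := Submodule.ClosedComplemented.of_finiteDimensional V
  have h1 := h.clm (p.restrictScalars ℝ)
  have e1 : (fun s => (p.restrictScalars ℝ) (Y s)) = fun s => (⟨Y s, hY s⟩ : V) :=
    funext fun s => hp ⟨Y s, hY s⟩
  have e2 : (fun s => (p.restrictScalars ℝ) (y s)) = fun s => (⟨y s, hy s⟩ : V) :=
    funext fun s => hp ⟨y s, hy s⟩
  rwa [e1, e2] at h1

instance finiteDimensional_suppSubmodule (S : Finset ℤ) :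
    FiniteDimensional ℂ (suppSubmodule n (S : Set ℤ)) :=
  Module.Finite.iff_fg.mpr (fg_suppSubmodule S)

theorem commutator_mem_supp {X : Set ℤ} {a b : ChainAlgebra n} (ha : a ∈ supp n X)
    (hb : b ∈ supp n X) : Complex.I • (a * b - b * a) ∈ supp n X :=
  SMulMemClass.smul_mem _ (sub_mem (mul_mem ha hb) (mul_mem hb ha))

/-- The product rule for functionals on a local algebra, evaluated along a path which moves by the
finite-volume Heisenberg dynamics of `K`. -/
theorem norm_apply_star_conj_sub_le {K : ℝ → ChainAlgebra n} {M : ℝ} (hK : IsDriver K M)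
    {S : Finset ℤ} (hKS : ∀ u, K u ∈ supp n (S : Set ℤ))
    (hUS : ∀ u, prop K u ∈ supp n (S : Set ℤ))
    {ω d : ℝ → suppSubmodule n (S : Set ℤ) →ₗ[ℂ] ℂ}
    (hm : ∀ b, AEStronglyMeasurable ((Set.Icc (0 : ℝ) 1).indicator fun u => d u b))
    (hb : ∀ b, ∃ M, ∀ u ∈ Set.Icc (0 : ℝ) 1, ‖d u b‖ ≤ M)
    (hω : ∀ b, ∀ s ∈ Set.Icc (0 : ℝ) 1, ω s b = ω 0 b + ∫ u in (0 : ℝ)..s, d u b)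
    {a : ChainAlgebra n} (ha : a ∈ supp n (S : Set ℤ)) {ε : ℝ}
    (hε : ∀ u ∈ Set.Icc (0 : ℝ) 1, ∀ y : suppSubmodule n (S : Set ℤ),
      (y : ChainAlgebra n) = star (prop K u) * a * prop K u →
      ‖d u y - ω u ⟨Complex.I • (K u * y - y * K u), commutator_mem_supp (hKS u) y.2⟩‖ ≤ ε)
    {t : ℝ} (ht : t ∈ Set.Icc (0 : ℝ) 1) (y : suppSubmodule n (S : Set ℤ))
    (hy : (y : ChainAlgebra n) = star (prop K t) * a * prop K t) :
    ‖ω t y - ω 0 ⟨a, ha⟩‖ ≤ ε * t := by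
  have hY : ∀ s, star (prop K s) * a * prop K s ∈ suppSubmodule n (S : Set ℤ) := fun s =>
    mem_suppSubmodule.mpr (mul_mem (mul_mem (star_mem (hUS s)) ha) (hUS s))
  have hac := (isACPath_star_conj hK a).codRestrict hY
    fun s => Submodule.neg_mem _ (commutator_mem_supp (hKS s) (hY s))
  have hlb : IsLocBdd fun s => (⟨-(Complex.I • (K s * (star (prop K s) * a * prop K s) -
        star (prop K s) * a * prop K s * K s)),
      Submodule.neg_mem _ (commutator_mem_supp (hKS s) (hY s))⟩ : suppSubmodule n (S : Set ℤ)) := by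
    refine .of_le (M := 2 * M * ‖a‖) fun s => ?_
    rw [Submodule.coe_norm]
    dsimp only
    rw [norm_neg, ← norm_star_unitary_conj (prop_mem_unitary hK s) a]
    exact norm_I_smul_commutator_le hK s _
  have key := norm_apply_path_sub_le hm hb hω hac hlb (ε := ε) (fun u hu => ?_) ht
  · have e0 : (⟨star (prop K 0) * a * prop K 0, hY 0⟩ : suppSubmodule n (S : Set ℤ)) = ⟨a, ha⟩ := by
      refine Subtype.ext ?_
      dsimp only
      rw [prop_zero hK, star_one, one_mul, mul_one]
    have e1 : (⟨star (prop K t) * a * prop K t, hY t⟩ : suppSubmodule n (S : Set ℤ)) = y :=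
      Subtype.ext hy.symm
    rwa [e0, e1] at key
  · refine (le_of_eq ?_).trans (hε u hu ⟨_, hY u⟩ rfl)
    have e : (⟨-(Complex.I • (K u * (star (prop K u) * a * prop K u) -
        star (prop K u) * a * prop K u * K u)),
      Submodule.neg_mem _ (commutator_mem_supp (hKS u) (hY u))⟩ : suppSubmodule n (S : Set ℤ)) =
      -⟨Complex.I • (K u * (star (prop K u) * a * prop K u) -
        star (prop K u) * a * prop K u * K u), commutator_mem_supp (hKS u) (hY u)⟩ := rfl
    rw [e, map_neg, neg_add_eq_sub]

/-- The solution of the Heisenberg equation in finite volume is unique. -/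
theorem SolvesHeisenberg.eq_innerAut {K K' : ℝ → ChainAlgebra n} {M : ℝ} (hK : IsDriver K M)
    {S : Finset ℤ} (hKS : ∀ u, K u ∈ supp n (S : Set ℤ))
    (hKK' : ∀ u ∈ Set.Icc (0 : ℝ) 1, ∀ a, K' u * a - a * K' u = K u * a - a * K u)
    {β : ℝ → ChainAut n} (hβ : SolvesHeisenberg K' β) {t : ℝ} (ht : t ∈ Set.Icc (0 : ℝ) 1) :
    β t = innerAut (prop K t) := by
  refine aut_eq_of_eq_on_local fun X a ha => ?_
  set T := S ∪ X with hT
  have hKT : ∀ u, K u ∈ supp n (T : Set ℤ) := fun u =>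
    supp_mono (Finset.coe_subset.mpr Finset.subset_union_left) (hKS u)
  have haT : a ∈ supp n (T : Set ℤ) :=
    supp_mono (Finset.coe_subset.mpr Finset.subset_union_right) ha
  have hUT : ∀ u, prop K u ∈ supp n (T : Set ℤ) := fun u =>
    prop_mem (B := (supp n (T : Set ℤ)).toSubalgebra) (isClosed_supp T) hK hKT u
  have hI : ∀ {u}, u ∈ Set.Icc (0 : ℝ) t → u ∈ Set.Icc (0 : ℝ) 1 := fun hu =>
    ⟨hu.1, hu.2.trans ht.2⟩
  have hU := prop_mem_unitary hK t
  rw [innerAut_apply hU]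
  set a' := prop K t * a * star (prop K t) with ha'
  have ha'T : a' ∈ supp n (T : Set ℤ) := mul_mem (mul_mem (hUT t) haT) (star_mem (hUT t))
  have hback : a = star (prop K t) * a' * prop K t := by
    have h1 : ∀ x, star (prop K t) * (prop K t * x) = x := fun x => by
      rw [← mul_assoc, hU.1, one_mul]
    rw [ha']
    simp only [mul_assoc, h1, hU.1, mul_one]
  have h00 : (0 : ℝ) ∈ Set.Icc (0 : ℝ) 1 := ⟨le_rfl, zero_le_one⟩
  have hβ0 : ∀ b, β 0 b = b := fun b => by
    rw [(hβ b).2.2 0 h00, intervalIntegral.integral_same, smul_zero, add_zero]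
  -- `β s` applied to the backward evolution of `a'` has the derivative zero
  refine (SeparatingDual.eq_iff_forall_dual_eq (R := ℂ)).mpr fun ℓ => ?_
  let ω : ℝ → suppSubmodule n (T : Set ℤ) →ₗ[ℂ] ℂ := fun s =>
    { toFun := fun b => ℓ (β s b)
      map_add' := fun b c => by rw [Submodule.coe_add, map_add, map_add]
      map_smul' := fun c b => by rw [Submodule.coe_smul, map_smul, map_smul, RingHom.id_apply] }
  let d : ℝ → suppSubmodule n (T : Set ℤ) →ₗ[ℂ] ℂ := fun u =>
    { toFun := fun b => ℓ (β u (Complex.I • (K u * b - b * K u)))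
      map_add' := fun b c => by
        rw [← map_add, ← map_add, ← smul_add, Submodule.coe_add, mul_add, add_mul]
        congr 3
        abel
      map_smul' := fun c b => by
        rw [Submodule.coe_smul, mul_smul_comm, smul_mul_assoc, ← smul_sub, smul_comm, map_smul,
          map_smul, RingHom.id_apply] }
  have hd : ∀ b : suppSubmodule n (T : Set ℤ), ∀ u ∈ Set.Icc (0 : ℝ) 1,
      d u b = ℓ (Complex.I • β u (K' u * b - b * K' u)) := fun b u hu => by
    change ℓ (β u (Complex.I • (K u * b - b * K u))) = _
    rw [hKK' u hu, map_smul (β u)]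
  have hint : ∀ b : ChainAlgebra n, IntervalIntegrable
      (fun u => ℓ (Complex.I • β u (K' u * b - b * K' u))) volume 0 1 := fun b =>
    intervalIntegrable_iff.mpr ((ℓ.comp (Complex.I • ContinuousLinearMap.id ℂ
      (ChainAlgebra n))).integrable_comp (intervalIntegrable_iff.mp (hβ b).2.1))
  have key := norm_apply_star_conj_sub_le hK hKT hUT (ω := ω) (d := d) (fun b => ?_) (fun b => ?_)
    (fun b s hs => ?_) ha'T (ε := 0) (fun u hu y hy => ?_) ht ⟨a, haT⟩ hback
  · rw [zero_mul, norm_le_zero_iff, sub_eq_zero] at key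
    have e : ω 0 ⟨a', ha'T⟩ = ℓ a' := congrArg ℓ (hβ0 a')
    rw [e] at key
    exact key
  · rw [aestronglyMeasurable_indicator_iff measurableSet_Icc]
    have h1 := ((intervalIntegrable_iff_integrableOn_Icc_of_le zero_le_one).mp
      (hint b)).aestronglyMeasurable
    refine h1.congr ?_
    filter_upwards [ae_restrict_mem measurableSet_Icc] with u hu using (hd b u hu).symm
  · refine ⟨‖ℓ‖ * (2 * M * ‖(b : ChainAlgebra n)‖), fun u _ => (ℓ.le_opNorm _).trans ?_⟩
    rw [norm_aut]
    exact mul_le_mul_of_nonneg_left (norm_I_smul_commutator_le hK u _) (norm_nonneg _)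
  · change ℓ (β s b) = ℓ (β 0 b) + _
    rw [hβ0, (hβ b).2.2 s hs, map_add]
    refine congrArg (ℓ (b : ChainAlgebra n) + ·) ?_
    have hsub : Set.uIcc (0 : ℝ) s ⊆ Set.uIcc 0 1 := by
      rw [Set.uIcc_of_le hs.1, Set.uIcc_of_le zero_le_one]
      exact Set.Icc_subset_Icc le_rfl hs.2
    have h1 := (ℓ.comp (Complex.I • ContinuousLinearMap.id ℂ
      (ChainAlgebra n))).intervalIntegral_comp_comm ((hβ b).2.1.mono_set hsub)
    refine h1.symm.trans (intervalIntegral.integral_congr fun u hu => ?_)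
    rw [Set.uIcc_of_le hs.1] at hu
    exact (hd b u ⟨hu.1, hu.2.trans hs.2⟩).symm
  · refine (norm_le_zero_iff).mpr (sub_eq_zero.mpr rfl)

variable {C : ℝ} {Φ : Finset ℤ → ℝ → ChainAlgebra n}

theorem ham_mem_supp (h : IsRegular C Φ) (Λ : Finset ℤ) (u : ℝ) :
    ham Φ Λ.powerset u ∈ supp n (Λ : Set ℤ) :=
  sum_mem fun Z hZ => supp_mono (Finset.coe_subset.mpr (Finset.mem_powerset.mp hZ)) (h.mem Z u)

theorem aestronglyMeasurable_conj {A : Type*} [CStarAlgebra A] {K : ℝ → A} {M : ℝ}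
    (hK : IsDriver K M) (b : A) : AEStronglyMeasurable fun s =>
      prop K s * (Complex.I • (K s * b - b * K s)) * star (prop K s) :=
  ((continuous_prop hK).aestronglyMeasurable.mul (((hK.meas.mul_const b).sub
    (hK.meas.const_mul b)).const_smul _)).mul (continuous_prop hK).star.aestronglyMeasurable

theorem norm_conj_commutator_le {A : Type*} [CStarAlgebra A] {K : ℝ → A} {M : ℝ}
    (hK : IsDriver K M) (b : A) (s : ℝ) :
    ‖prop K s * (Complex.I • (K s * b - b * K s)) * star (prop K s)‖ ≤ 2 * M * ‖b‖ := by
  rw [norm_unitary_conj (prop_mem_unitary hK s)]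
  exact norm_I_smul_commutator_le hK s b

/-- Conjugation by the propagator solves the Heisenberg equation. -/
theorem solvesHeisenberg_innerAut {K K' : ℝ → ChainAlgebra n} {M : ℝ} (hK : IsDriver K M)
    (hKK' : ∀ u ∈ Set.Icc (0 : ℝ) 1, ∀ a, K' u * a - a * K' u = K u * a - a * K u) :
    SolvesHeisenberg K' fun s => innerAut (prop K s) := fun a => by
  have happ : ∀ s b, innerAut (prop K s) b = prop K s * b * star (prop K s) := fun s b =>
    innerAut_apply (prop_mem_unitary hK s) b
  have hac := isACPath_conj hK a
  have hlb : IsLocBdd fun s => prop K s * (Complex.I • (K s * a - a * K s)) * star (prop K s) :=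
    .of_le (norm_conj_commutator_le hK a)
  have hd : ∀ u ∈ Set.Icc (0 : ℝ) 1, Complex.I • innerAut (prop K u) (K' u * a - a * K' u) =
      prop K u * (Complex.I • (K u * a - a * K u)) * star (prop K u) := fun u hu => by
    rw [hKK' u hu, ← map_smul, happ]
  have hint : IntervalIntegrable (fun u => innerAut (prop K u) (K' u * a - a * K' u))
      volume 0 1 := by
    have h1 := (hlb.intervalIntegrable (aestronglyMeasurable_conj hK a) 0 1).smul (-Complex.I)
    refine h1.congr fun u hu => ?_
    rw [Set.uIoc_of_le zero_le_one] at hu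
    rw [Pi.smul_apply, ← hd u (Set.Ioc_subset_Icc_self hu), smul_smul]
    simp
  refine ⟨?_, hint, fun s hs => ?_⟩
  · simp_rw [happ]
    exact hac.continuous.continuousOn
  · rw [happ, hac.eq_add_integral hlb 0 s, prop_zero hK, star_one, one_mul, mul_one,
      ← intervalIntegral.integral_smul]
    congr 1
    refine intervalIntegral.integral_congr fun u hu => ?_
    rw [Set.uIcc_of_le hs.1] at hu
    exact (hd u ⟨hu.1, hu.2.trans hs.2⟩).symm

theorem hamiltonian_commutator (H : ℝ → LocalTerms n) (Λ : Finset ℤ) {u : ℝ}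
    (hu : u ∈ Set.Icc (0 : ℝ) 1) (a : ChainAlgebra n) :
    hamiltonian Λ (H u) * a - a * hamiltonian Λ (H u) =
      ham (regTerms H) Λ.powerset u * a - a * ham (regTerms H) Λ.powerset u := by
  rw [hamiltonian, ham, Finset.sum_mul, Finset.sum_mul, Finset.mul_sum, Finset.mul_sum,
    ← Finset.sum_sub_distrib, ← Finset.sum_sub_distrib]
  refine Finset.sum_congr rfl fun Z _ => ?_
  rcases Z.eq_empty_or_nonempty with rfl | hZ
  · obtain ⟨c, hc⟩ := exists_smul_one_of_mem_supp_empty (a := (H u).term ∅) (by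
      have := isSupportedOn_iff.mp ((H u).supported ∅)
      rwa [Finset.coe_empty] at this)
    rw [hc, regTerms_empty]
    simp
  · rw [regTerms_of_mem H hZ hu]

/-- The evolution of a time-dependent interaction is unique. -/
theorem IsEvolution.eq_ev {H : ℝ → LocalTerms n} (hH : IsRegular C (regTerms H))
    {α : ℝ → ChainAut n} (hα : IsEvolution H α) {s : ℝ} (hs : s ∈ Set.Icc (0 : ℝ) 1) :
    α s = ev (regTerms H) s := by
  obtain ⟨-, β, hβ, hlim⟩ := hα
  refine DFunLike.ext _ _ fun a => ?_
  refine tendsto_nhds_unique (hlim s hs a) ((hH.tendsto_ev hs a).congr fun Λ => ?_)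
  rw [(hβ Λ).eq_innerAut (hH.isDriver Λ.powerset) (ham_mem_supp hH Λ)
    (fun u hu a => hamiltonian_commutator H Λ hu a) hs]
  rfl

theorem isEvolution_ev {H : ℝ → LocalTerms n} (hH : IsRegular C (regTerms H)) :
    IsEvolution H (ev (regTerms H)) :=
  ⟨hH.continuousOn_ev, fun Λ => finEv (regTerms H) Λ.powerset,
    fun Λ => solvesHeisenberg_innerAut (hH.isDriver _)
      fun _ hu a => hamiltonian_commutator H Λ hu a, fun _ hs a => hH.tendsto_ev hs a⟩

theorem generates_iff {H : ℝ → LocalTerms n} (hH : IsTDI H) (hr : IsRegular C (regTerms H))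
    {ψ : ℝ → (ChainAlgebra n →L[ℂ] ℂ)} :
    Generates H ψ ↔ ∀ s ∈ Set.Icc (0 : ℝ) 1, ∀ a, ψ s a = ψ 0 (ev (regTerms H) s a) := by
  constructor
  · rintro ⟨-, α, hα, hψ⟩ s hs a
    rw [hψ s hs, hα.eq_ev hr hs]
  · exact fun hψ => ⟨hH, _, isEvolution_ev hr, hψ⟩

end Uniqueness

/-! ### The weak form of the evolution equation -/

section Weak

attribute [local irreducible] instCStarAlgebraChainAlgebra

variable {n : ℤ → ℕ} {C : ℝ} {Φ : Finset ℤ → ℝ → ChainAlgebra n} {X : Finset ℤ}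
  {b : ChainAlgebra n}

/-- The derivation `b ↦ i ∑_Z [Φ_Z(u), b]`, on local observables. -/
def derivation (Φ : Finset ℤ → ℝ → ChainAlgebra n) (u : ℝ) (b : ChainAlgebra n) : ChainAlgebra n :=
  ∑' Z, Complex.I • (Φ Z u * b - b * Φ Z u)

theorem IsRegular.sum_norm_commutator_le (h : IsRegular C Φ) (hb : b ∈ supp n (X : Set ℤ)) (u : ℝ)
    (𝒵 : Finset (Finset ℤ)) :
    ∑ Z ∈ 𝒵, ‖Complex.I • (Φ Z u * b - b * Φ Z u)‖ ≤ 2 * (X.card * C) * ‖b‖ := by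
  classical
  have h1 : ∀ Z ∈ 𝒵, ‖Complex.I • (Φ Z u * b - b * Φ Z u)‖ ≤
      2 * ‖b‖ * ∑ x ∈ X with x ∈ Z, ‖Φ Z u‖ := fun Z _ => by
    rw [norm_smul, Complex.norm_I, one_mul]
    by_cases hd : Disjoint Z X
    · rw [(commute_of_disjoint (Finset.disjoint_coe.mpr hd) (h.mem Z u) hb).eq, sub_self, norm_zero]
      exact mul_nonneg (by positivity) (Finset.sum_nonneg fun _ _ => norm_nonneg _)
    · obtain ⟨x, hxZ, hxX⟩ := Finset.not_disjoint_iff.mp hd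
      have h2 : ‖Φ Z u‖ ≤ ∑ x ∈ X with x ∈ Z, ‖Φ Z u‖ :=
        Finset.single_le_sum (f := fun _ => ‖Φ Z u‖) (fun _ _ => norm_nonneg _)
          (Finset.mem_filter.mpr ⟨hxX, hxZ⟩)
      calc _ ≤ 2 * ‖Φ Z u‖ * ‖b‖ := norm_commutator_le _ _
        _ = 2 * ‖b‖ * ‖Φ Z u‖ := by ring
        _ ≤ _ := by gcongr
  refine (Finset.sum_le_sum h1).trans ?_
  rw [← Finset.mul_sum]
  have h3 : ∑ Z ∈ 𝒵, ∑ x ∈ X with x ∈ Z, ‖Φ Z u‖ = ∑ x ∈ X, ∑ Z ∈ 𝒵 with x ∈ Z, ‖Φ Z u‖ := by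
    refine Finset.sum_comm' fun Z x => ?_
    simp only [Finset.mem_filter]
    tauto
  have h4 : ∑ x ∈ X, ∑ Z ∈ 𝒵 with x ∈ Z, ‖Φ Z u‖ ≤ X.card * C := by
    rw [← nsmul_eq_mul]
    exact Finset.sum_le_card_nsmul _ _ _ fun x _ =>
      h.sum_le u x _ fun Z hZ => (Finset.mem_filter.mp hZ).2
  rw [h3]
  calc _ ≤ 2 * ‖b‖ * (X.card * C) := by gcongr
    _ = _ := by ring

theorem IsRegular.summable_commutator (h : IsRegular C Φ) (hb : b ∈ supp n (X : Set ℤ)) (u : ℝ) :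
    Summable fun Z => Complex.I • (Φ Z u * b - b * Φ Z u) :=
  .of_norm (summable_of_sum_le (fun _ => norm_nonneg _) (h.sum_norm_commutator_le hb u))

theorem monotone_box : Monotone box := fun _ _ h x hx => by
  rw [mem_box] at hx ⊢
  omega

theorem I_smul_ham_commutator (𝒵 : Finset (Finset ℤ)) (u : ℝ) (b : ChainAlgebra n) :
    Complex.I • (ham Φ 𝒵 u * b - b * ham Φ 𝒵 u) =
      ∑ Z ∈ 𝒵, Complex.I • (Φ Z u * b - b * Φ Z u) := by
  rw [ham, Finset.sum_mul, Finset.mul_sum, ← Finset.sum_sub_distrib, Finset.smul_sum]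

theorem IsRegular.tendsto_derivation (h : IsRegular C Φ) (hb : b ∈ supp n (X : Set ℤ)) (u : ℝ) :
    Tendsto (fun k => Complex.I • (ham Φ (box k).powerset u * b - b * ham Φ (box k).powerset u))
      atTop (𝓝 (derivation Φ u b)) := by
  simp_rw [I_smul_ham_commutator]
  exact (h.summable_commutator hb u).hasSum.comp tendsto_powerset_box

theorem IsRegular.norm_ham_commutator_le (h : IsRegular C Φ) (hb : b ∈ supp n (X : Set ℤ)) (u : ℝ)
    (𝒵 : Finset (Finset ℤ)) :
    ‖Complex.I • (ham Φ 𝒵 u * b - b * ham Φ 𝒵 u)‖ ≤ 2 * (X.card * C) * ‖b‖ := by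
  rw [I_smul_ham_commutator]
  exact (norm_sum_le _ _).trans (h.sum_norm_commutator_le hb u _)

theorem IsRegular.norm_derivation_le (h : IsRegular C Φ) (hb : b ∈ supp n (X : Set ℤ)) (u : ℝ) :
    ‖derivation Φ u b‖ ≤ 2 * (X.card * C) * ‖b‖ :=
  le_of_tendsto' (h.tendsto_derivation hb u).norm fun _ => h.norm_ham_commutator_le hb u _

/-- The derivation as a linear map on a local algebra. -/
def IsRegular.derivationMap (h : IsRegular C Φ) (X : Finset ℤ) (u : ℝ) :
    suppSubmodule n (X : Set ℤ) →ₗ[ℂ] ChainAlgebra n where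
  toFun b := derivation Φ u b
  map_add' b c := by
    rw [derivation, derivation, derivation, ← (h.summable_commutator b.2 u).tsum_add
      (h.summable_commutator c.2 u)]
    refine tsum_congr fun Z => ?_
    rw [← smul_add, Submodule.coe_add, mul_add, add_mul]
    congr 1
    abel
  map_smul' c b := by
    rw [derivation, derivation, RingHom.id_apply, ← (h.summable_commutator b.2 u).tsum_const_smul]
    refine tsum_congr fun Z => ?_
    rw [Submodule.coe_smul, mul_smul_comm, smul_mul_assoc, ← smul_sub, smul_comm]

/-- The family of states `ψ` satisfies the integrated evolution equation for `Φ` on local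
observables. -/
structure IsWeakSolution (Φ : Finset ℤ → ℝ → ChainAlgebra n) (ψ : ℝ → (ChainAlgebra n →L[ℂ] ℂ)) :
    Prop where
  meas : ∀ X : Finset ℤ, ∀ b ∈ supp n (X : Set ℤ), AEStronglyMeasurable
    ((Set.Icc (0 : ℝ) 1).indicator fun u => ψ u (derivation Φ u b))
  eq : ∀ X : Finset ℤ, ∀ b ∈ supp n (X : Set ℤ), ∀ s ∈ Set.Icc (0 : ℝ) 1,
    ψ s b = ψ 0 b + ∫ u in (0 : ℝ)..s, ψ u (derivation Φ u b)

/-- The weak equation is the limit of the equations in finite volume. -/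
theorem IsRegular.isWeakSolution (h : IsRegular C Φ) {ψ : ℝ → (ChainAlgebra n →L[ℂ] ℂ)}
    (hψ : ∀ s ∈ Set.Icc (0 : ℝ) 1, ∀ a, ψ s a = ψ 0 (ev Φ s a)) : IsWeakSolution Φ ψ := by
  set F : ℕ → ChainAlgebra n → ℝ → ChainAlgebra n := fun k b u =>
    prop (ham Φ (box k).powerset) u * (Complex.I • (ham Φ (box k).powerset u * b -
      b * ham Φ (box k).powerset u)) * star (prop (ham Φ (box k).powerset) u) with hF
  have hFm : ∀ k b, AEStronglyMeasurable fun u => ψ 0 (F k b u) := fun k b =>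
    (ψ 0).continuous.comp_aestronglyMeasurable (aestronglyMeasurable_conj (h.isDriver _) b)
  have hlim : ∀ {X : Finset ℤ} {b}, b ∈ supp n (X : Set ℤ) → ∀ u ∈ Set.Icc (0 : ℝ) 1,
      Tendsto (fun k => ψ 0 (F k b u)) atTop (𝓝 (ψ u (derivation Φ u b))) := fun hb u hu => by
    rw [hψ u hu]
    refine ((ψ 0).continuous.tendsto _).comp ?_
    have h1 := tendsto_aut_apply (fun a => (h.tendsto_ev hu a).comp tendsto_box)
      (h.tendsto_derivation hb u)
    exact h1.congr fun k => h.finEv_apply _ u _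
  refine ⟨fun X b hb => ?_, fun X b hb s hs => ?_⟩
  · refine aestronglyMeasurable_of_tendsto_ae atTop
      (f := fun k => (Set.Icc (0 : ℝ) 1).indicator fun u => ψ 0 (F k b u))
      (fun k => (hFm k b).indicator measurableSet_Icc) (.of_forall fun u => ?_)
    by_cases hu : u ∈ Set.Icc (0 : ℝ) 1
    · simp only [Set.indicator_of_mem hu]
      exact hlim hb u hu
    · simp only [Set.indicator_of_notMem hu]
      exact tendsto_const_nhds
  · have h1 : ∀ k, ψ 0 (finEv Φ (box k).powerset s b) = ψ 0 b + ∫ u in (0 : ℝ)..s, ψ 0 (F k b u) :=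
      fun k => by
        have hd := h.isDriver (box k).powerset
        have e := (isACPath_conj hd b).eq_add_integral (.of_le (norm_conj_commutator_le hd b)) 0 s
        rw [prop_zero hd, star_one, one_mul, mul_one, ← h.finEv_apply] at e
        rw [e, map_add, ← (ψ 0).intervalIntegral_comp_comm]
        exact (IsLocBdd.of_le (norm_conj_commutator_le hd b)).intervalIntegrable
          (aestronglyMeasurable_conj hd b) 0 s
    have h2 : Tendsto (fun k => ∫ u in (0 : ℝ)..s, ψ 0 (F k b u)) atTop
        (𝓝 (∫ u in (0 : ℝ)..s, ψ u (derivation Φ u b))) := by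
      refine intervalIntegral.tendsto_integral_filter_of_dominated_convergence
        (fun _ => ‖ψ 0‖ * (2 * (X.card * C) * ‖b‖)) (.of_forall fun k => (hFm k b).restrict)
        (.of_forall fun k => .of_forall fun u _ => ?_) intervalIntegrable_const
        (.of_forall fun u hu => ?_)
      · refine ((ψ 0).le_opNorm _).trans (mul_le_mul_of_nonneg_left ?_ (norm_nonneg _))
        rw [hF]
        dsimp only
        rw [norm_unitary_conj (h.prop_mem_unitary _ u)]
        exact h.norm_ham_commutator_le hb u _
      · rw [Set.uIoc_of_le hs.1] at hu
        exact hlim hb u ⟨hu.1.le, hu.2.trans hs.2⟩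
    have h3 : Tendsto (fun k => ψ 0 (finEv Φ (box k).powerset s b)) atTop (𝓝 (ψ s b)) := by
      rw [hψ s hs]
      exact ((ψ 0).continuous.tendsto _).comp ((h.tendsto_ev hs b).comp tendsto_box)
    exact tendsto_nhds_unique h3 ((h2.const_add (ψ 0 b)).congr fun k => (h1 k).symm)

/-- A weak solution is the evolution of its initial state: along the backward evolution in a box,
only the terms which cross the boundary of the box contribute to the derivative of the
expectation. -/
theorem IsWeakSolution.eq_ev {ψ : ℝ → (ChainAlgebra n →L[ℂ] ℂ)} (hψ : IsWeakSolution Φ ψ)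
    (h : IsRegular C Φ) (hn : ∀ s ∈ Set.Icc (0 : ℝ) 1, ∀ a, ‖ψ s a‖ ≤ ‖a‖) {t : ℝ}
    (ht : t ∈ Set.Icc (0 : ℝ) 1) (a : ChainAlgebra n) : ψ t a = ψ 0 (ev Φ t a) := by
  suffices hs : ∀ a, ψ t ((ev Φ t)⁻¹ a) = ψ 0 a by
    rw [← hs, aut_inv_apply]
  refine congrFun (eq_of_eq_on_local ((ψ t).continuous.comp (continuous_aut _))
    (ψ 0).continuous fun X a ha => ?_)
  have hbound : ∀ᶠ R in atTop, ‖ψ t ((finEv Φ (box R).powerset t)⁻¹ a) - ψ 0 a‖ ≤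
      cutConst C * ‖a‖ * decayPair {-(R : ℤ), (R : ℤ)} X := by
    filter_upwards [exists_subset_box X] with R hR
    have hd := h.isDriver (box R).powerset
    have haR : a ∈ supp n (box R : Set ℤ) := supp_mono (Finset.coe_subset.mpr hR) ha
    have hUR : ∀ u, prop (ham Φ (box R).powerset) u ∈ supp n (box R : Set ℤ) :=
      prop_ham_mem h _ fun Z hZ => Finset.coe_subset.mpr (Finset.mem_powerset.mp hZ)
    have hyR : (finEv Φ (box R).powerset t)⁻¹ a ∈ suppSubmodule n (box R : Set ℤ) := by
      rw [h.finEv_inv_apply]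
      exact mem_suppSubmodule.mpr (mul_mem (mul_mem (star_mem (hUR t)) haR) (hUR t))
    have hnn : 0 ≤ cutConst C * ‖a‖ * decayPair {-(R : ℤ), (R : ℤ)} X :=
      mul_nonneg (mul_nonneg h.cutConst_nonneg (norm_nonneg _)) (decayPair_nonneg _ _)
    let d : ℝ → suppSubmodule n (box R : Set ℤ) →ₗ[ℂ] ℂ := fun u =>
      (ψ u : ChainAlgebra n →ₗ[ℂ] ℂ) ∘ₗ h.derivationMap (box R) u
    refine (norm_apply_star_conj_sub_le hd (ham_mem_supp h (box R)) hUR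
      (ω := fun s => (ψ s : ChainAlgebra n →ₗ[ℂ] ℂ) ∘ₗ (suppSubmodule n (box R : Set ℤ)).subtype)
      (d := d)
      (fun b => hψ.meas (box R) b b.2) (fun b => ?_) (fun b s hs => hψ.eq (box R) b b.2 s hs) haR
      (ε := cutConst C * ‖a‖ * decayPair {-(R : ℤ), (R : ℤ)} X) (fun u hu y hy => ?_) ht
      ⟨_, hyR⟩ (h.finEv_inv_apply _ _ _)).trans (mul_le_of_le_one_right hnn ht.2)
    · exact ⟨2 * ((box R).card * C) * ‖(b : ChainAlgebra n)‖, fun u hu =>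
        (hn u hu _).trans (h.norm_derivation_le b.2 u)⟩
    · -- only the terms which cross the boundary of the box contribute
      change ‖ψ u (derivation Φ u y) - ψ u (Complex.I • (ham Φ (box R).powerset u * y -
        y * ham Φ (box R).powerset u))‖ ≤ _
      rw [← map_sub]
      refine (hn u hu _).trans (le_of_tendsto ((h.tendsto_derivation y.2 u).sub_const _).norm ?_)
      filter_upwards [eventually_ge_atTop R] with k hk
      classical
      set 𝒵₃ := (box k).powerset.filter fun Z : Finset ℤ => Crosses (box R : Set ℤ) Z with h𝒵₃
      have hsplit : Complex.I • (ham Φ (box k).powerset u * (y : ChainAlgebra n) -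
          y * ham Φ (box k).powerset u) - Complex.I • (ham Φ (box R).powerset u * y -
          y * ham Φ (box R).powerset u) = Complex.I • (ham Φ 𝒵₃ u * y - y * ham Φ 𝒵₃ u) := by
        have hsub : (box R).powerset ⊆ (box k).powerset :=
          Finset.powerset_mono.mpr (monotone_box hk)
        rw [I_smul_ham_commutator, I_smul_ham_commutator, I_smul_ham_commutator,
          ← Finset.sum_sdiff hsub, add_sub_cancel_right]
        symm
        refine Finset.sum_subset (fun Z hZ => ?_) fun Z hZ hZ3 => ?_
        · rw [h𝒵₃, Finset.mem_filter] at hZ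
          rw [Finset.mem_sdiff]
          exact ⟨hZ.1, fun hZR => hZ.2.1 (Finset.coe_subset.mpr (Finset.mem_powerset.mp hZR))⟩
        · rw [Finset.mem_sdiff] at hZ
          have hc : (Z : Set ℤ) ⊆ (box R : Set ℤ)ᶜ := by
            by_contra hc
            refine hZ3 (Finset.mem_filter.mpr ⟨hZ.1, fun hZR => hZ.2 ?_, hc⟩)
            exact Finset.mem_powerset.mpr (Finset.coe_subset.mp hZR)
          rw [(commute_of_disjoint (X := (box R : Set ℤ)ᶜ) (Y := (box R : Set ℤ))
            disjoint_compl_left (supp_mono hc (h.mem Z u)) y.2).eq, sub_self, smul_zero]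
      rw [hsplit, norm_smul, Complex.norm_I, one_mul]
      have key := h.norm_crosses_commutator_le (isBoundary_box R) (box R).powerset 𝒵₃
        (fun Z hZ => (Finset.mem_filter.mp hZ).2) ha (u := u) hu
      refine (le_of_eq ?_).trans key
      have hU := h.prop_mem_unitary (box R).powerset u
      have h1 : ∀ x, prop (ham Φ (box R).powerset) u * (star (prop (ham Φ (box R).powerset) u) * x)
          = x := fun x => by rw [← mul_assoc, hU.2, one_mul]
      rw [← norm_unitary_conj hU, hy]
      congr 1
      simp only [mul_sub, sub_mul, mul_assoc, h1, hU.2, mul_one]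
  have hz : Tendsto (fun R : ℕ => cutConst C * ‖a‖ * decayPair {-(R : ℤ), (R : ℤ)} X) atTop
      (𝓝 0) := by
    simpa using (tendsto_decayPair_box X).const_mul (cutConst C * ‖a‖)
  have hlim : Tendsto (fun R => ψ t ((finEv Φ (box R).powerset t)⁻¹ a) - ψ 0 a) atTop
      (𝓝 (ψ t ((ev Φ t)⁻¹ a) - ψ 0 a)) :=
    (((ψ t).continuous.tendsto _).comp ((h.tendsto_ev_inv ht a).comp tendsto_box)).sub_const _
  have := le_of_tendsto_of_tendsto hlim.norm hz hbound
  exact sub_eq_zero.mp (norm_le_zero_iff.mp this)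

end Weak

/-! ### Averaging over the symmetry group -/

section Averaging

set_option linter.unusedSectionVars false

attribute [local irreducible] instCStarAlgebraChainAlgebra

variable {G : Type*} [Group G] [TopologicalSpace G] [IsTopologicalGroup G] [CompactSpace G]
  [MeasurableSpace G] [BorelSpace G] {n : ℤ → ℕ} (γ : OnSiteAction G n) (μ : Measure G)
  [IsProbabilityMeasure μ] {a b : ChainAlgebra n}

theorem OnSiteAction.aut_mem_supp (g : G) {X : Set ℤ} (ha : a ∈ supp n X) :
    γ.aut g a ∈ supp n X := by
  refine supp_induction (p := fun a => γ.aut g a ∈ supp n X) (fun j hj M => ?_) (fun c => ?_)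
    (fun a b _ _ ha hb => ?_) (fun a b _ _ ha hb => ?_) ha
  · have h1 : site j M ∈ supp n (({j} : Finset ℤ) : Set ℤ) := site_mem_supp (by simp) M
    have h2 := isSupportedOn_iff.mp (γ.onSite g j _ (isSupportedOn_iff.mpr h1))
    exact supp_mono (by simpa using hj) h2
  · rw [Algebra.algebraMap_eq_smul_one, map_smul, map_one]
    exact SMulMemClass.smul_mem _ (one_mem _)
  · rw [map_add]
    exact add_mem ha hb
  · rw [map_mul]
    exact mul_mem ha hb

theorem OnSiteAction.integrable (a : ChainAlgebra n) : Integrable (fun g => γ.aut g a) μ :=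
  (γ.continuous a).integrable_of_hasCompactSupport (.of_compactSpace _)

theorem OnSiteAction.integrable_inv (a : ChainAlgebra n) : Integrable (fun g => γ.aut g⁻¹ a) μ :=
  ((γ.continuous a).comp continuous_inv).integrable_of_hasCompactSupport (.of_compactSpace _)

/-- The average `∫ γ(g)[a] dμ(g)` of an observable over the group. -/
def OnSiteAction.average (a : ChainAlgebra n) : ChainAlgebra n := ∫ g, γ.aut g a ∂μ

/-- The average `∫ γ(g⁻¹)[a] dμ(g)`, which is the adjoint of `OnSiteAction.average` with respect to
invariant states. -/
def OnSiteAction.averageInv (a : ChainAlgebra n) : ChainAlgebra n := ∫ g, γ.aut g⁻¹ a ∂μ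

theorem OnSiteAction.norm_average_le (a : ChainAlgebra n) : ‖γ.average μ a‖ ≤ ‖a‖ := by
  refine (norm_integral_le_of_norm_le_const (C := ‖a‖) (.of_forall fun g => ?_)).trans ?_
  · rw [norm_aut]
  · simp

theorem OnSiteAction.average_sub (a b : ChainAlgebra n) :
    γ.average μ (a - b) = γ.average μ a - γ.average μ b := by
  simp only [OnSiteAction.average, map_sub]
  exact integral_sub (γ.integrable μ a) (γ.integrable μ b)

theorem OnSiteAction.star_average (a : ChainAlgebra n) :
    star (γ.average μ a) = γ.average μ (star a) := by
  have h := (starL' ℝ : ChainAlgebra n ≃L[ℝ] ChainAlgebra n).integral_comp_comm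
    (μ := μ) (fun g => γ.aut g a)
  simp only [OnSiteAction.average, map_star]
  exact h.symm

theorem OnSiteAction.aut_average [μ.IsMulLeftInvariant] (h : G) (a : ChainAlgebra n) :
    γ.aut h (γ.average μ a) = γ.average μ a := by
  have hc : Continuous (γ.aut h) := continuous_aut _
  let L : ChainAlgebra n →L[ℂ] ChainAlgebra n :=
    ⟨((γ.aut h : ChainAlgebra n ≃⋆ₐ[ℂ] ChainAlgebra n) :
      ChainAlgebra n →⋆ₐ[ℂ] ChainAlgebra n).toAlgHom.toLinearMap, hc⟩
  have h1 : γ.aut h (γ.average μ a) = ∫ g, γ.aut h (γ.aut g a) ∂μ :=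
    (L.integral_comp_comm (γ.integrable μ a)).symm
  rw [h1, OnSiteAction.average, ← integral_mul_left_eq_self (fun g => γ.aut g a) h]
  simp only [map_mul]
  rfl

theorem integral_mem_supp {X : Finset ℤ} {F : G → ChainAlgebra n} (hF : Integrable F μ)
    (h : ∀ g, F g ∈ supp n (X : Set ℤ)) : ∫ g, F g ∂μ ∈ supp n (X : Set ℤ) := by
  have hc : IsClosed (suppSubmodule n (X : Set ℤ) : Set (ChainAlgebra n)) :=
    Submodule.closed_of_finiteDimensional _
  exact ((suppSubmodule n (X : Set ℤ)).restrictScalars ℝ).convex.integral_mem hc (.of_forall h) hF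

theorem OnSiteAction.average_mem_supp {X : Finset ℤ} (ha : a ∈ supp n (X : Set ℤ)) :
    γ.average μ a ∈ supp n (X : Set ℤ) :=
  integral_mem_supp μ (γ.integrable μ a) fun g => γ.aut_mem_supp g ha

theorem OnSiteAction.averageInv_mem_supp {X : Finset ℤ} (ha : a ∈ supp n (X : Set ℤ)) :
    γ.averageInv μ a ∈ supp n (X : Set ℤ) :=
  integral_mem_supp μ (γ.integrable_inv μ a) fun g => γ.aut_mem_supp g⁻¹ ha

theorem IsInvariantState.apply_averageInv {ψ : ChainAlgebra n →L[ℂ] ℂ}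
    (hψ : IsInvariantState γ ψ) (b : ChainAlgebra n) : ψ (γ.averageInv μ b) = ψ b := by
  rw [OnSiteAction.averageInv, ← ψ.integral_comp_comm (γ.integrable_inv μ b)]
  have h : ∀ g, ψ (γ.aut g⁻¹ b) = ψ b := fun g => hψ g⁻¹ b
  simp only [h, integral_const, probReal_univ, one_smul]

/-- In an invariant state, averaging one factor of a commutator is the same as averaging the
other. -/
theorem IsInvariantState.apply_average_commutator {ψ : ChainAlgebra n →L[ℂ] ℂ}
    (hψ : IsInvariantState γ ψ) (a b : ChainAlgebra n) :
    ψ (Complex.I • (γ.average μ a * b - b * γ.average μ a)) =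
      ψ (Complex.I • (a * γ.averageInv μ b - γ.averageInv μ b * a)) := by
  let L : ChainAlgebra n →L[ℂ] ℂ := ψ ∘L (Complex.I •
    ((ContinuousLinearMap.mul ℂ (ChainAlgebra n)).flip b - ContinuousLinearMap.mul ℂ _ b))
  let R : ChainAlgebra n →L[ℂ] ℂ := ψ ∘L (Complex.I •
    (ContinuousLinearMap.mul ℂ (ChainAlgebra n) a - (ContinuousLinearMap.mul ℂ _).flip a))
  have h1 : ψ (Complex.I • (γ.average μ a * b - b * γ.average μ a)) = ∫ g, L (γ.aut g a) ∂μ :=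
    (L.integral_comp_comm (γ.integrable μ a)).symm
  have h2 : ψ (Complex.I • (a * γ.averageInv μ b - γ.averageInv μ b * a)) =
      ∫ g, R (γ.aut g⁻¹ b) ∂μ := (R.integral_comp_comm (γ.integrable_inv μ b)).symm
  rw [h1, h2]
  congr 1
  funext g
  change ψ (Complex.I • (γ.aut g a * b - b * γ.aut g a)) =
    ψ (Complex.I • (a * γ.aut g⁻¹ b - γ.aut g⁻¹ b * a))
  have h3 : γ.aut g (γ.aut g⁻¹ b) = b := by
    rw [map_inv]
    exact aut_apply_inv _ _
  rw [← hψ g (Complex.I • (a * γ.aut g⁻¹ b - γ.aut g⁻¹ b * a)), map_smul (γ.aut g),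
    map_sub (γ.aut g), map_mul (γ.aut g), map_mul (γ.aut g), h3]

/-- The average of the terms of an interaction. -/
def LocalTerms.average (K : LocalTerms n) : LocalTerms n where
  term Z := γ.average μ (K.term Z)
  selfAdjoint Z := by
    rw [isSelfAdjoint_iff, γ.star_average, (K.selfAdjoint Z).star_eq]
  supported Z := isSupportedOn_iff.mpr
    (γ.average_mem_supp μ (isSupportedOn_iff.mp (K.supported Z)))

variable {H : ℝ → LocalTerms n}

theorem IsTDI.average (hH : IsTDI H) : IsTDI fun s => (H s).average γ μ :=
  hH.map (LocalTerms.average γ μ) (fun _ _ => γ.norm_average_le μ _) fun K L Z => by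
    change ‖γ.average μ (K.term Z) - γ.average μ (L.term Z)‖ ≤ _
    rw [← γ.average_sub]
    exact γ.norm_average_le μ _

theorem UnifBound.average {f : ℕ+ → ℝ} {C₀ : ℝ≥0} (hH : UnifBound f H C₀) :
    UnifBound f (fun s => (H s).average γ μ) C₀ := fun s hs =>
  (fNorm_mono fun _ => γ.norm_average_le μ _).trans (hH s hs)

theorem isInvariantTDI_average [μ.IsMulLeftInvariant] (H : ℝ → LocalTerms n) :
    IsInvariantTDI γ fun s => (H s).average γ μ := fun _ _ _ g => γ.aut_average μ g _

theorem regTerms_average (H : ℝ → LocalTerms n) (Z : Finset ℤ) (u : ℝ) :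
    regTerms (fun s => (H s).average γ μ) Z u = γ.average μ (regTerms H Z u) := by
  unfold regTerms
  split_ifs
  · rfl
  · simp [OnSiteAction.average]

/-- A path of invariant states is also generated by the averaged interaction. -/
theorem Generates.average {ψ : ℝ → (ChainAlgebra n →L[ℂ] ℂ)} (hψ : Generates H ψ)
    (hst : ∀ s ∈ Set.Icc (0 : ℝ) 1, ψ s ∈ stateSet n)
    (hinv : ∀ s ∈ Set.Icc (0 : ℝ) 1, IsInvariantState γ (ψ s)) :
    Generates (fun s => (H s).average γ μ) ψ := by
  have hH := hψ.1
  obtain ⟨C, hC⟩ := hH.exists_isRegular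
  have hA := hH.average γ μ
  obtain ⟨C', hC'⟩ := hA.exists_isRegular
  rw [generates_iff hA hC']
  rw [generates_iff hH hC] at hψ
  have hw := hC.isWeakSolution hψ
  have hkey : ∀ {X : Finset ℤ} {b : ChainAlgebra n}, b ∈ supp n (X : Set ℤ) →
      ∀ u ∈ Set.Icc (0 : ℝ) 1, ψ u (derivation (regTerms fun s => (H s).average γ μ) u b) =
        ψ u (derivation (regTerms H) u (γ.averageInv μ b)) := fun {X b} hb u hu => by
    rw [derivation, derivation, (ψ u).map_tsum (hC'.summable_commutator hb u),
      (ψ u).map_tsum (hC.summable_commutator (γ.averageInv_mem_supp μ hb) u)]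
    refine tsum_congr fun Z => ?_
    rw [regTerms_average]
    exact (hinv u hu).apply_average_commutator γ μ _ _
  refine fun s hs a => IsWeakSolution.eq_ev ⟨fun X b hb => ?_, fun X b hb s hs => ?_⟩ hC'
    (fun s hs a => norm_state_le (hst s hs) a) hs a
  · refine (hw.meas X _ (γ.averageInv_mem_supp μ hb)).congr (.of_forall fun u => ?_)
    by_cases hu : u ∈ Set.Icc (0 : ℝ) 1
    · rw [Set.indicator_of_mem hu, Set.indicator_of_mem hu, hkey hb u hu]
    · rw [Set.indicator_of_notMem hu, Set.indicator_of_notMem hu]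
  · rw [← (hinv s hs).apply_averageInv γ μ b,
      ← (hinv 0 (Set.left_mem_Icc.mpr zero_le_one)).apply_averageInv γ μ b,
      hw.eq X _ (γ.averageInv_mem_supp μ hb) s hs]
    congr 1
    refine intervalIntegral.integral_congr fun u hu => ?_
    rw [Set.uIcc_of_le hs.1] at hu
    exact (hkey hb u ⟨hu.1, hu.2.trans hs.2⟩).symm

end Averaging

/-! ### The index of a loop -/

section Index

variable {n : ℤ → ℕ} {C C' : ℝ} {Φ : Finset ℤ → ℝ → ChainAlgebra n}

theorem IsRegular.mono (h : IsRegular C Φ) (hC : C ≤ C') : IsRegular C' Φ :=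
  { h with
    bound := fun u x d 𝒵 h𝒵 => (h.bound u x d 𝒵 h𝒵).trans
      (mul_le_mul_of_nonneg_right hC (decay_nonneg _)) }

theorem isRegular_zero : IsRegular 0 (fun _ _ => 0 : Finset ℤ → ℝ → ChainAlgebra n) where
  sa _ _ := star_zero _
  mem _ _ := zero_mem _
  meas _ := aestronglyMeasurable_const
  empty _ := rfl
  bound _ _ _ _ _ := by simp

theorem ev_zero_apply {s : ℝ} (hs : s ∈ Set.Icc (0 : ℝ) 1) (a : ChainAlgebra n) :
    ev (fun _ _ => 0) s a = a :=
  congrFun (eq_of_eq_on_local (continuous_aut _) continuous_id fun _ _ hb => by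
    have := isRegular_zero.norm_ev_sub_le hs hb
    simpa [sub_eq_zero] using this) a

variable {G : Type*} [Group G] [TopologicalSpace G] {γ : OnSiteAction G n}
  {φ : ChainAlgebra n →L[ℂ] ℂ} {ψ : ℝ → (ChainAlgebra n →L[ℂ] ℂ)} {H H' : ℝ → LocalTerms n}
  {𝓗 : Type*} [NormedAddCommGroup 𝓗] [InnerProductSpace ℂ 𝓗] [CompleteSpace 𝓗]
  {π : ChainAlgebra n →⋆ₐ[ℂ] (𝓗 →L[ℂ] 𝓗)} {Ω : 𝓗} {U : G →* unitary (𝓗 →L[ℂ] 𝓗)}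
  {χ : G →ₜ* Circle}

theorem IsInvariantTDI.aut_regTerms (hH : IsInvariantTDI γ H) :
    ∀ τ ∈ Set.range γ.aut, ∀ Z u, τ (regTerms H Z u) = regTerms H Z u := by
  rintro _ ⟨g, rfl⟩ Z u
  unfold regTerms
  split_ifs with h
  · exact hH u h.2 Z g
  · exact map_zero _

/-- Two invariant interactions which generate the same loop pump the same charge: the loop is
homotopic to itself by a homotopy which changes nothing but the interaction. -/
theorem exists_hasCharge_of_generates (h : IsCovariant γ φ π Ω U) (hφ : IsPureState φ)
    (hprod : IsProduct φ) (hinv : IsInvariantState γ φ) (h0 : ψ 0 = φ) (h1 : ψ 0 = ψ 1)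
    (hH : IsInvariantTDI γ H) (hHψ : Generates H ψ) (hH' : IsInvariantTDI γ H')
    (hHψ' : Generates H' ψ) : ∃ χ, HasCharge φ π U (ev (leftTerms (regTerms H)) 1) χ ∧
      HasCharge φ π U (ev (leftTerms (regTerms H')) 1) χ := by
  obtain ⟨C, hC⟩ := hHψ.1.exists_isRegular
  obtain ⟨C', hC'⟩ := hHψ'.1.exists_isRegular
  have e1 : (if (1 : ℝ) = 0 then regTerms H else regTerms H') = regTerms H' :=
    if_neg one_ne_zero
  have hh : IsRegularHomotopy γ φ (max C C') (fun l => if l = 0 then regTerms H else regTerms H')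
      (fun _ _ _ => 0) fun _ => ψ :=
    { regular := fun l _ => by
        split_ifs
        exacts [hC.mono (le_max_left _ _), hC'.mono (le_max_right _ _)]
      regular' := fun _ _ => isRegular_zero.mono (hC.nonneg.trans (le_max_left _ _))
      invariant := fun l _ => by
        split_ifs
        exacts [hH.aut_regTerms, hH'.aut_regTerms]
      invariant' := fun _ _ τ _ _ _ => map_zero τ
      base_zero := h0
      base_one := h0
      loop := fun _ _ => h1.symm
      time := fun l _ => by
        split_ifs
        exacts [(generates_iff hHψ.1 hC).mp hHψ, (generates_iff hHψ'.1 hC').mp hHψ']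
      param := fun l hl s _ a => by rw [ev_zero_apply hl] }
  have key := hh.exists_hasCharge h hφ hprod hinv
  simpa only [if_true, e1] using key

end Index

section LoopIndex

variable {n : ℤ → ℕ} {G : Type*} [Group G] [TopologicalSpace G] {γ : OnSiteAction G n}
  {φ : ChainAlgebra n →L[ℂ] ℂ} {ψ : ℝ → (ChainAlgebra n →L[ℂ] ℂ)} {H : ℝ → LocalTerms n}
  {𝓗 : Type} [NormedAddCommGroup 𝓗] [InnerProductSpace ℂ 𝓗] [CompleteSpace 𝓗]
  {π : ChainAlgebra n →⋆ₐ[ℂ] (𝓗 →L[ℂ] 𝓗)} {Ω : 𝓗} {U : G →* unitary (𝓗 →L[ℂ] 𝓗)}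
  {χ χ' : G →ₜ* Circle}

theorem isPumpedCharge_iff (h : IsCovariant γ φ π Ω U) (hH : IsTDI H) :
    IsPumpedCharge γ φ H χ ↔ HasCharge φ π U (ev (leftTerms (regTerms H)) 1) χ := by
  obtain ⟨C, hC⟩ := hH.truncate.exists_isRegular
  rw [← regTerms_truncate]
  constructor
  · rintro ⟨α, ψ', hα, hψ', hc⟩
    refine IsRelativeCharge.hasCharge h (fun a => ?_) hc
    rw [hψ', hα.eq_ev hC (Set.right_mem_Icc.mpr zero_le_one)]
  · rintro ⟨v, hv, hv1, hv2⟩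
    let θ := ev (regTerms fun s => truncate (H s)) 1
    let L : ChainAlgebra n →L[ℂ] ChainAlgebra n :=
      ⟨((θ : ChainAlgebra n ≃⋆ₐ[ℂ] ChainAlgebra n) :
        ChainAlgebra n →⋆ₐ[ℂ] ChainAlgebra n).toAlgHom.toLinearMap, continuous_aut θ⟩
    exact ⟨ev (regTerms fun s => truncate (H s)), φ ∘L L, isEvolution_ev hC, fun _ => rfl,
      𝓗, _, _, _, π, Ω, U, v, h.toIsGNSTriple, h.cont, h.fix, h.cov, hv, hv1, hv2⟩

theorem isLoopIndex_of_hasCharge (h : IsCovariant γ φ π Ω U) (hφ : IsPureState φ)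
    (hprod : IsProduct φ) (hinv : IsInvariantState γ φ) (h0 : ψ 0 = φ) (h1 : ψ 0 = ψ 1)
    (hH : IsInvariantTDI γ H) (hHψ : Generates H ψ)
    (hχ : HasCharge φ π U (ev (leftTerms (regTerms H)) 1) χ) : IsLoopIndex γ ψ χ := by
  refine ⟨⟨H, hH, hHψ⟩, fun K hK hKψ => ?_⟩
  obtain ⟨χ', h₁, h₂⟩ := exists_hasCharge_of_generates h hφ hprod hinv h0 h1 hH hHψ hK hKψ
  rw [h0, isPumpedCharge_iff h hKψ.1, hχ.unique h.toIsGNSTriple hφ hprod h₁]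
  exact h₂

theorem IsLoopIndex.unique (h : IsCovariant γ φ π Ω U) (hφ : IsPureState φ) (hprod : IsProduct φ)
    (h0 : ψ 0 = φ) (hχ : IsLoopIndex γ ψ χ) (hχ' : IsLoopIndex γ ψ χ') : χ = χ' := by
  obtain ⟨⟨H, hH, hHψ⟩, h1⟩ := hχ
  have e₁ := h1 H hH hHψ
  have e₂ := hχ'.2 H hH hHψ
  rw [h0, isPumpedCharge_iff h hHψ.1] at e₁ e₂
  exact e₁.unique h.toIsGNSTriple hφ hprod e₂

theorem IsLoopIndex.loopIndex (hχ : IsLoopIndex γ ψ χ) : IsLoopIndex γ ψ (loopIndex γ ψ) := by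
  have h : ∃ χ, IsLoopIndex γ ψ χ := ⟨χ, hχ⟩
  rw [SpinChain.loopIndex, dif_pos h]
  exact h.choose_spec

theorem Generates.congr {ψ' : ℝ → (ChainAlgebra n →L[ℂ] ℂ)} (h : Generates H ψ)
    (e : ∀ s ∈ Set.Icc (0 : ℝ) 1, ψ s = ψ' s) : Generates H ψ' := by
  obtain ⟨hH, α, hα, hψ⟩ := h
  exact ⟨hH, α, hα, fun s hs a => by
    rw [← e s hs, ← e 0 (Set.left_mem_Icc.mpr zero_le_one), hψ s hs]⟩

/-- The homotopy may be generated by invariant interactions, by averaging, so that the loops at its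
ends pump the same charge. -/
theorem IsGHomotopic.exists_isLoopIndex [IsTopologicalGroup G] [CompactSpace G]
    {ψ₀ ψ₁ : ℝ → (ChainAlgebra n →L[ℂ] ℂ)} (hhom : IsGHomotopic γ ψ₀ ψ₁)
    (h : IsCovariant γ φ π Ω U) (hφ : IsPureState φ)
    (hprod : IsProduct φ) (hinv : IsInvariantState γ φ)
    (h0 : ψ₀ 0 = φ) (h0' : ψ₀ 0 = ψ₀ 1) (h1 : ψ₁ 0 = φ) (h1' : ψ₁ 0 = ψ₁ 1) :
    ∃ χ, IsLoopIndex γ ψ₀ χ ∧ IsLoopIndex γ ψ₁ χ := by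
  let _ : MeasurableSpace G := borel G
  have : BorelSpace G := ⟨rfl⟩
  let μ : Measure G := Measure.haarMeasure ⊤
  have : IsProbabilityMeasure μ := ⟨by
    simpa using Measure.haarMeasure_self (K₀ := (⊤ : TopologicalSpace.PositiveCompacts G))⟩
  obtain ⟨Ψ, H, F, f, C₀, hloop, hH, hF, hf, hHb, hFb, hends⟩ := hhom
  obtain ⟨C, hC⟩ := exists_isRegular (n := n) hf C₀
  have m0 : (0 : ℝ) ∈ Set.Icc (0 : ℝ) 1 := Set.left_mem_Icc.mpr zero_le_one
  have m1 : (1 : ℝ) ∈ Set.Icc (0 : ℝ) 1 := Set.right_mem_Icc.mpr zero_le_one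
  have hst : ∀ l ∈ Set.Icc (0 : ℝ) 1, ∀ s ∈ Set.Icc (0 : ℝ) 1, Ψ l s ∈ stateSet n :=
    fun l hl s hs => ((hloop l hl).1.1.1 s hs).1
  have hHA : ∀ l ∈ Set.Icc (0 : ℝ) 1, Generates (fun s => (H l s).average γ μ) (Ψ l) :=
    fun l hl => (hH l hl).average γ μ (hst l hl) (hloop l hl).2
  have hFA : ∀ s ∈ Set.Icc (0 : ℝ) 1,
      Generates (fun l => (F s l).average γ μ) (fun l => Ψ l s) := fun s hs =>
    (hF s hs).average γ μ (fun l hl => hst l hl s hs) fun l hl => (hloop l hl).2 s hs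
  have hHr : ∀ l ∈ Set.Icc (0 : ℝ) 1, IsRegular C (regTerms fun s => (H l s).average γ μ) :=
    fun l hl => hC _ ((hHb l hl).average γ μ) (hHA l hl).1
  have hFr : ∀ s ∈ Set.Icc (0 : ℝ) 1, IsRegular C (regTerms fun l => (F s l).average γ μ) :=
    fun s hs => hC _ ((hFb s hs).average γ μ) (hFA s hs).1
  have hh : IsRegularHomotopy γ φ C (fun l => regTerms fun s => (H l s).average γ μ)
      (fun s => regTerms fun l => (F s l).average γ μ) Ψ :=
    { regular := hHr
      regular' := hFr
      invariant := fun l _ => (isInvariantTDI_average γ μ (H l)).aut_regTerms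
      invariant' := fun s _ => (isInvariantTDI_average γ μ (F s)).aut_regTerms
      base_zero := (hends 0 m0).1.trans h0
      base_one := (hends 0 m0).2.trans h1
      loop := fun l hl => (hloop l hl).1.2.symm
      time := fun l hl => (generates_iff (hHA l hl).1 (hHr l hl)).mp (hHA l hl)
      param := fun l hl s hs => (generates_iff (hFA s hs).1 (hFr s hs)).mp (hFA s hs) l hl }
  obtain ⟨χ, hχ₀, hχ₁⟩ := hh.exists_hasCharge h hφ hprod hinv
  exact ⟨χ, isLoopIndex_of_hasCharge h hφ hprod hinv h0 h0' (isInvariantTDI_average γ μ (H 0))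
      ((hHA 0 m0).congr fun s hs => (hends s hs).1) hχ₀,
    isLoopIndex_of_hasCharge h hφ hprod hinv h1 h1' (isInvariantTDI_average γ μ (H 1))
      ((hHA 1 m1).congr fun s hs => (hends s hs).2) hχ₁⟩

end LoopIndex

end SpinChain

end

theorem mainTheorem7 {G : Type*} [Group G] [TopologicalSpace G] [IsTopologicalGroup G]
    [CompactSpace G] (n : ℤ → ℕ) (hn : ∀ j, 0 < n j) (γ : SpinChain.OnSiteAction G n)
    (φ : SpinChain.ChainAlgebra n →L[ℂ] ℂ) (hφ : SpinChain.IsPureState φ)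
    (hφprod : SpinChain.IsProduct φ) (hφinv : SpinChain.IsInvariantState γ φ)
    (ψ₀ ψ₁ : ℝ → (SpinChain.ChainAlgebra n →L[ℂ] ℂ))
    (hψ₀ : SpinChain.IsInvariantLoop γ ψ₀) (hψ₁ : SpinChain.IsInvariantLoop γ ψ₁)
    (hbase₀ : ψ₀ 0 = φ) (hbase₁ : ψ₁ 0 = φ)
    (hhom : SpinChain.IsGHomotopic γ ψ₀ ψ₁) :
    SpinChain.IsLoopIndex γ ψ₀ (SpinChain.loopIndex γ ψ₀) ∧
      SpinChain.IsLoopIndex γ ψ₁ (SpinChain.loopIndex γ ψ₁) ∧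
      SpinChain.loopIndex γ ψ₁ = SpinChain.loopIndex γ ψ₀ := by
  obtain ⟨𝓗, _, _, _, π, Ω, hG⟩ := SpinChain.exists_gnsTriple hφ.1
  obtain ⟨U, h⟩ := hG.exists_isCovariant hφinv
  obtain ⟨χ, hχ₀, hχ₁⟩ := hhom.exists_isLoopIndex h hφ hφprod hφinv hbase₀ hψ₀.1.2 hbase₁ hψ₁.1.2
  refine ⟨hχ₀.loopIndex, hχ₁.loopIndex, ?_⟩
  rw [← hχ₁.unique h hφ hφprod hbase₁ hχ₁.loopIndex, hχ₀.unique h hφ hφprod hbase₀ hχ₀.loopIndex]
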